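/- Let $\theta\in\mathbb R$, $x_0>0$, and let $\mathcal R_\theta=\{x\in\mathbb C: e^{-i\theta}x>x_0\}$. Let $a,b\in L^1_{loc}(\mathcal R_\theta)$, and suppose that there are complex numbers $a_k,b_k$ $(k\ge 0)$, a constant $K$ and a number $0<\kappa<|a_0^2-4b_0|^{-1/2}$ such that, for all $n\in\mathbb N=\{0,1,2,\dots\}$ and all $x\in\mathcal R_\theta$, $$|a_n|,\ |b_n|\le K\kappa^n n!,\qquad \Big|a(x)-\sum_{k=0}^{n-1}\frac{a_k}{x^k}\Big|\le K\kappa^n n!\,|x|^{-n},\qquad \Big|b(x)-\sum_{k=0}^{n-1}\frac{b_k}{x^k}\Big|\le K\kappa^n n!\,|x|^{-n}.$$ Assume that the polynomial $\lambda^2+a_0\lambda+b_0$ has two distinct roots $\lambda_1,\lambda_2$. Put $$r_i=-\frac{a_1\lambda_i+b_1}{a_0+2\lambda_i}\quad(i=1,2),\qquad \rho=\Re(r_2-r_1),\qquad \Delta=\lambda_2-\lambda_1 .$$ Consider the equation $$y''+a(x)y'+b(x)y=0\quad\text{on }\mathcal R_\theta,\qquad(*)$$ where a solution is a continuously differentiable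 function $y$ on the ray whose derivative $y'$ (along the ray) is locally absolutely continuous and which satisfies the equation almost everywhere; functions are identified when they agree on $\mathcal R_\theta$. A formal solution of the form $e^{\lambda_i x}x^{r_i}F(1/x)$, with $F$ a formal power series, is one of the equation obtained from $(*)$ on replacing $a,b$ by $\sum a_kx^{-k}$, $\sum b_kx^{-k}$. (1) For $i=1,2$ there is a unique formal power series $\tilde S_i=\sum_{k\ge0}s_{i;k}x^{-k}$ with $s_{i;0}=1$ such that $e^{\lambda_ix}x^{r_i}\tilde S_i$ is a formal solution of $(*)$, and all formal solutions of the form $e^{\lambda_ix}x^{r_i}F(1/x)$ are its multiples $C e^{\lambda_ix}x^{r_i}\tilde S_i$, $C\in\mathbb C$. The limits $$R_1=\lim_{n\to\infty}\frac{s_{1;n}(\lambda_1-\lambda_2)^n}{\Gamma(n+r_2-r_1)},\qquad R_2=\lim_{n\to\infty}\frac{s_{2;n}(\lambda_2-\lambda_1)^n}{\Gamma(n+r_1-r_2)}$$ exist in $\mathbb C$. (2) Let $a_*=\sqrt2\,\max_{u\ge0}e^{-u^2}\int_0^ue^{t^2}dt$. Let $A_1=a_*|R_1|$ if $e^{i\theta}(\lambda_1-\lambda_2)$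 is a positive real number and $A_1=0$ otherwise; let $A_2=a_*|R_2|$ if $e^{i\theta}(\lambda_2-\lambda_1)$ is a positive real number and $A_2=0$ otherwise. Put $\Gamma_+(u)=\Gamma(u)$ for $u>0$ and $\Gamma_+(u)=1$ for $u\le0$. For $C_1,C_2\in\mathbb C$ and $B>0$ let $$w_i(k)=|C_i|\,(A_i\sqrt k+B)\,\Gamma_+\big(k-(-1)^i\rho\big)\,|\Delta|^{-k}\qquad(i=1,2,\ k\in\mathbb N).$$ There is a $B_0>0$, independent of $C_1,C_2$, such that for every $B\ge B_0$ the following holds. For all $C_1,C_2\in\mathbb C$ there is a unique solution $y$ of $(*)$ such that $$\Big|y(x)-C_1x^{r_1}e^{\lambda_1x}\sum_{j=0}^{k_1-1}\frac{s_{1;j}}{x^j}-C_2x^{r_2}e^{\lambda_2x}\sum_{j=0}^{k_2-1}\frac{s_{2;j}}{x^j}\Big|\le|x^{r_1}e^{\lambda_1x}|\,w_1(k_1)\,|x|^{-k_1}+|x^{r_2}e^{\lambda_2x}|\,w_2(k_2)\,|x|^{-k_2}$$ for all $x\in\mathcal R_\theta$ and all $k_1,k_2\in\mathbb N$ (with the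 principal branch of the powers $x^{r_i}$). Conversely, for every solution $y$ of $(*)$ there is exactly one pair $(C_1,C_2)\in\mathbb C^2$ for which these inequalities hold. Thus the inequalities establish a one-to-one correspondence between the formal solutions $C_1e^{\lambda_1x}x^{r_1}\tilde S_1+C_2e^{\lambda_2x}x^{r_2}\tilde S_2$ and the true solutions of $(*)$. -/

import Mathlib

open Filter Topology MeasureTheory

noncomputable section

namespace OptimalAsymptotics

/-- The point `t e^{iθ}` of the ray with direction `θ`. -/
def rayPoint (θ t : ℝ) : ℂ := (t : ℂ) * Complex.exp ((θ : ℂ) * Complex.I)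

/-- The ray `{x : e^{-iθ} x > x₀}`, that is `{t e^{iθ} : t > x₀}`. -/
def ray (θ x₀ : ℝ) : Set ℂ := {x | ∃ t : ℝ, x₀ < t ∧ x = rayPoint θ t}

/-- `f` belongs to `L¹_loc` of the open ray (with respect to arclength). -/
def LocIntegrableOnRay (f : ℂ → ℂ) (θ x₀ : ℝ) : Prop :=
  LocallyIntegrableOn (fun t : ℝ => f (rayPoint θ t)) (Set.Ioi x₀)

/-- `f` has the asymptotic power series `∑ c_k x^{-k}` on the set `S`, with coefficients and
remainders bounded by `K κ^n n!` and `K κ^n n! |x|^{-n}`, uniformly in `x` and `n`. -/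
def HasGevreySeries (f : ℂ → ℂ) (c : ℕ → ℂ) (S : Set ℂ) (κ : ℝ) : Prop :=
  ∃ K : ℝ, (∀ n : ℕ, ‖c n‖ ≤ K * κ ^ n * (n.factorial : ℝ)) ∧
    ∀ n : ℕ, ∀ x ∈ S,
      ‖f x - ∑ k ∈ Finset.range n, c k / x ^ k‖ ≤ K * κ ^ n * (n.factorial : ℝ) / ‖x‖ ^ n

/-- `y` solves `y'' + a(x) y' + b(x) y = 0` on the ray in the Carathéodory sense, the derivative
being taken along the ray: `y` is continuously differentiable with derivative `p = y'`, and `p` is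
the indefinite integral of the locally integrable function `-(a p + b y)`
(equivalently: `y'` is locally absolutely continuous and the equation holds almost everywhere). -/
def IsSolutionOnRay (a b : ℂ → ℂ) (θ x₀ : ℝ) (y : ℂ → ℂ) : Prop :=
  ∃ p : ℂ → ℂ,
    ContinuousOn (fun t : ℝ => p (rayPoint θ t)) (Set.Ioi x₀) ∧
    (∀ t : ℝ, x₀ < t →
      HasDerivAt (fun τ : ℝ => y (rayPoint θ τ))
        (p (rayPoint θ t) * Complex.exp ((θ : ℂ) * Complex.I)) t) ∧
    ∀ s t : ℝ, x₀ < s → x₀ < t →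
      p (rayPoint θ t) - p (rayPoint θ s) =
        ∫ τ in s..t,
          -(a (rayPoint θ τ) * p (rayPoint θ τ) + b (rayPoint θ τ) * y (rayPoint θ τ)) *
            Complex.exp ((θ : ℂ) * Complex.I)

/-- In the variable `X = 1/x`, the formal derivative `d/dx`, conjugated by `e^{lx} x^r`:
if `d/dx (e^{lx} x^r S(1/x)) = e^{lx} x^r T(1/x)` then `T = l S + r X S - X² dS/dX`. -/
def formalDeriv (l r : ℂ) (S : PowerSeries ℂ) : PowerSeries ℂ :=
  PowerSeries.C l * S + PowerSeries.C r * PowerSeries.X * S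
    - PowerSeries.X ^ 2 * PowerSeries.derivative ℂ S

/-- `e^{lx} x^r S(1/x)` is a formal solution of `y'' + a y' + b y = 0`, where `a` and `b` are
replaced by the formal series `∑ a_k x^{-k}` and `∑ b_k x^{-k}`. -/
def IsFormalSolution (ac bc : ℕ → ℂ) (l r : ℂ) (S : PowerSeries ℂ) : Prop :=
  formalDeriv l r (formalDeriv l r S) + PowerSeries.mk ac * formalDeriv l r S
    + PowerSeries.mk bc * S = 0

/-- The exponent `r = -(a₁ l + b₁) / (a₀ + 2 l)` attached to a characteristic root `l`. -/
def charExponent (ac bc : ℕ → ℂ) (l : ℂ) : ℂ := -(ac 1 * l + bc 1) / (ac 0 + 2 * l)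

/-- `x^r e^{lx} ∑_{j < k} s_j x^{-j}`; the principal power is a smooth branch on each ray. -/
def truncation (l r : ℂ) (S : PowerSeries ℂ) (k : ℕ) (x : ℂ) : ℂ :=
  x ^ r * Complex.exp (l * x) * ∑ j ∈ Finset.range k, PowerSeries.coeff j S / x ^ j

/-- `√2 max_{u ≥ 0} e^{-u²} ∫_0^u e^{t²} dt = 0.76515…`. -/
def aStar : ℝ :=
  √2 * sSup ((fun u : ℝ => Real.exp (-u ^ 2) * ∫ t in (0 : ℝ)..u, Real.exp (t ^ 2)) '' Set.Ici 0)

open Classical in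
/-- The constant `A` of the weight: `a_* |R|` if `e^{iθ} (l - l')` is a positive real number, and
`0` otherwise. -/
def stokesConst (θ : ℝ) (l l' R : ℂ) : ℝ :=
  if ∃ t : ℝ, 0 < t ∧ Complex.exp ((θ : ℂ) * Complex.I) * (l - l') = (t : ℂ) then aStar * ‖R‖
  else 0

/-- The Gamma function at positive arguments, and `1` at arguments that are not positive. -/
def gammaPos (u : ℝ) : ℝ := if 0 < u then Real.Gamma u else 1

/-- The weight `w(k) = |C| (A √k + B) Γ(k + σ) |Δ|^{-k}`. -/
def weight (C : ℂ) (A B σ : ℝ) (Δ : ℂ) (k : ℕ) : ℝ :=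
  ‖C‖ * (A * √(k : ℝ) + B) * gammaPos ((k : ℝ) + σ) / ‖Δ‖ ^ k

/-- On the set `S`, `y` is uniformly asymptotic to
`C₁ x^{r₁} e^{l₁ x} S₁(1/x) + C₂ x^{r₂} e^{l₂ x} S₂(1/x)` for the weight `(w₁, w₂)`. -/
def UniformlyAsymptotic (S : Set ℂ) (y : ℂ → ℂ) (C₁ C₂ l₁ l₂ r₁ r₂ : ℂ)
    (S₁ S₂ : PowerSeries ℂ) (w₁ w₂ : ℕ → ℝ) : Prop :=
  ∀ x ∈ S, ∀ k₁ k₂ : ℕ,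
    ‖y x - C₁ * truncation l₁ r₁ S₁ k₁ x - C₂ * truncation l₂ r₂ S₂ k₂ x‖ ≤
      ‖x ^ r₁ * Complex.exp (l₁ * x)‖ * (w₁ k₁ / ‖x‖ ^ k₁) +
        ‖x ^ r₂ * Complex.exp (l₂ * x)‖ * (w₂ k₂ / ‖x‖ ^ k₂)

end OptimalAsymptotics

end

noncomputable section

namespace OptimalAsymptotics

/-! In the coordinate `X = |Δ| |x|` the characteristic roots `L`, `L'` differ by a number `ω = L -
L'` of modulus one, and the Gevrey constant becomes `κ|Δ| < 1`. Put `ν = r' - r`, `Y = X^r e^{LX} u`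
and `G = u' + (ω - ν/X) u`. The equation becomes the system `u' = G - (ω - ν/X) u`, `G' = -(P G + H
u)`, and the choice of `L'` and `r'` makes `P` and `H` of order `X^{-2}`.

Large order. The recursion for the coefficients `s_n` of `u` is dominated by `ω s_{n+1} ≈ (n + ν)
s_n`. The convolution with the coefficients of `P` and `H`, which are bounded by `κ^j j!` with `κ <
1`, is a perturbation of relative size `n^{-2}`. Hence `s_n ω^n / Γ(n + ν)` converges
(`FormalSystem.exists_tendsto`).

Existence. The series cut near its least term, at an index close to `X`, solves the system up to an
error of the size `X^{Re ν - 1/2} e^{-X}` of that term. A Volterra equation, contracting in a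
weighted norm, corrects it to a true solution without enlarging the error
(`ScaledSystem.exists_solution`). Other truncations differ from this one by a sum of terms `s_j
X^{-j}`. If `ω ≠ 1`, summation by parts bounds the sum by a multiple of its outer term. If `ω = 1`,
the quotient of the sum by the outer term obeys a difference equation that discretizes the
differential equation of Dawson's function, whose scaled maximum is `a_* √X`; this is the origin of
`a_* |R| √n` (`FormalSystem.exists_approximation`).

Uniqueness. The bounds must fix the multiple of the recessive exponential although for `ω = 1` they
are as large as it. At two indices `k < X < l` where Dawson's function is maximal, the partial sums
are almost as far apart as the sum of the two permitted radii. A function within the bounds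
therefore lies in the intersection of two almost tangent disks, and is determined up to `o` of the
recessive exponential (`FormalSystem.rigid`). If both exponentials have the same size, the
oscillation of their quotient separates the constants. Thus a solution determines its constants
(`uniformExpansion_iff`); the two basic solutions are then independent, and by uniqueness for the
initial value problem they span all solutions. -/

/-! ### Growth of the Gamma function along shifted integers. -/

/-- This is Euler's limit formula for `Γ(s)`: the product `s (s + 1) ⋯ (s + n)` in its denominator
is `Γ(n + 1 + s) / Γ(s)`. -/
theorem tendsto_cpow_mul_factorial_div_Gamma_of_re_pos {s : ℂ} (hs : 0 < s.re) :
    Tendsto (fun n : ℕ => (n : ℂ) ^ s * (n.factorial : ℂ) / Complex.Gamma ((n : ℂ) + 1 + s))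
      atTop (𝓝 1) := by
  have hG : Complex.Gamma s ≠ 0 := Complex.Gamma_ne_zero_of_re_pos hs
  have h := (Complex.GammaSeq_tendsto_Gamma s).div_const (Complex.Gamma s)
  rw [div_self hG] at h
  refine h.congr fun n => ?_
  have hprod : ∀ n : ℕ, Complex.Gamma ((n : ℂ) + 1 + s)
      = Complex.Gamma s * ∏ j ∈ Finset.range (n + 1), (s + j) := by
    intro n
    induction n with
    | zero => simp [add_comm (1 : ℂ) s, Complex.Gamma_add_one s (by rintro rfl; simp at hs), mul_comm]
    | succ n ih =>
      rw [Finset.prod_range_succ, ← mul_assoc, ← ih]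
      have hne : (n : ℂ) + 1 + s ≠ 0 := by
        intro h0
        have := congrArg Complex.re h0
        simp at this
        have : (0 : ℝ) ≤ n := n.cast_nonneg
        linarith
      rw [show ((n + 1 : ℕ) : ℂ) + 1 + s = ((n : ℂ) + 1 + s) + 1 by push_cast; ring,
        Complex.Gamma_add_one _ hne]
      push_cast; ring
  rw [hprod, Complex.GammaSeq, div_div, mul_comm (Complex.Gamma s)]

/-- The functional equation carries the limit from `s + 1` to `s`, so it suffices to induct on the
number of shifts that make the real part positive. -/
theorem tendsto_cpow_mul_factorial_div_Gamma (s : ℂ) :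
    Tendsto (fun n : ℕ => (n : ℂ) ^ s * (n.factorial : ℂ) / Complex.Gamma ((n : ℂ) + 1 + s))
      atTop (𝓝 1) := by
  obtain ⟨k, hk⟩ := exists_nat_gt (-s.re)
  have hk' : 0 < (s + k).re := by simp; linarith
  induction k generalizing s with
  | zero => exact tendsto_cpow_mul_factorial_div_Gamma_of_re_pos (by simpa using hk')
  | succ k ih =>
    have h1 := ih (s + 1) (by simp; push_cast at hk; linarith) (by simp at hk' ⊢; linarith)
    have h2 : Tendsto (fun n : ℕ => 1 + (1 + s) / (n : ℂ)) atTop (𝓝 (1 + 0)) :=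
      tendsto_const_nhds.add (tendsto_const_div_atTop_nhds_zero_nat _)
    rw [add_zero] at h2
    have h3 := h1.mul h2
    rw [one_mul] at h3
    refine h3.congr' ?_
    obtain ⟨m, hm⟩ := exists_nat_gt (-s.re)
    filter_upwards [eventually_ge_atTop (m + 1)] with n hn
    have hn0 : (n : ℂ) ≠ 0 := by
      have : n ≠ 0 := by omega
      exact_mod_cast this
    have hne : (n : ℂ) + 1 + s ≠ 0 := by
      intro h0
      have := congrArg Complex.re h0
      simp at this
      have : (m : ℝ) + 1 ≤ n := by exact_mod_cast hn
      linarith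
    rw [show (n : ℂ) + 1 + (s + 1) = ((n : ℂ) + 1 + s) + 1 by ring, Complex.Gamma_add_one _ hne,
      Complex.cpow_add _ _ hn0, Complex.cpow_one]
    field_simp
    ring

theorem tendsto_norm_Gamma (s : ℂ) :
    Tendsto (fun n : ℕ => ‖Complex.Gamma ((n : ℂ) + 1 + s)‖ / ((n : ℝ) ^ s.re * n.factorial))
      atTop (𝓝 1) := by
  have h := (tendsto_cpow_mul_factorial_div_Gamma s).norm.inv₀ (by simp)
  simp only [norm_one, inv_one] at h
  refine h.congr' ?_
  filter_upwards [eventually_gt_atTop 0] with n hn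
  rw [norm_div, norm_mul, Complex.norm_natCast_cpow_of_pos hn, inv_div]
  simp

theorem tendsto_norm_Gamma_div_Gamma_re (s : ℂ) :
    Tendsto (fun n : ℕ => ‖Complex.Gamma ((n : ℂ) + s)‖ / |Real.Gamma ((n : ℝ) + s.re)|)
      atTop (𝓝 1) := by
  rw [← tendsto_add_atTop_iff_nat 1]
  have h := (tendsto_norm_Gamma s).div (tendsto_norm_Gamma (s.re : ℂ)) one_ne_zero
  rw [div_one] at h
  refine h.congr' ?_
  filter_upwards [eventually_gt_atTop 0] with n hn
  have hp : (0 : ℝ) < (n : ℝ) ^ s.re * n.factorial := by positivity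
  simp only [Pi.div_apply]
  rw [show (n : ℂ) + 1 + (s.re : ℂ) = (((n : ℝ) + 1 + s.re : ℝ) : ℂ) by push_cast; ring,
    Complex.Gamma_ofReal, Complex.norm_real, Real.norm_eq_abs]
  simp only [Complex.ofReal_re]
  rw [div_div_div_cancel_right₀ hp.ne']
  push_cast
  rfl

theorem tendsto_Gamma_stirling (ρ : ℝ) :
    Tendsto (fun n : ℕ => |Real.Gamma ((n : ℝ) + ρ)| /
      ((n : ℝ) ^ n * (n : ℝ) ^ (ρ - 1 / 2) * Real.exp (-n))) atTop (𝓝 (√2 * √Real.pi)) := by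
  have h1 := tendsto_norm_Gamma (ρ : ℂ)
  have h2 := Stirling.tendsto_stirlingSeq_sqrt_pi
  -- This factor converts `Γ(n + 1 + ρ)` into `n Γ(n + ρ)`.
  have h3 : Tendsto (fun n : ℕ => (1 + ρ / (n : ℝ))⁻¹) atTop (𝓝 ((1 + 0)⁻¹)) :=
    (tendsto_const_nhds.add (tendsto_const_div_atTop_nhds_zero_nat _)).inv₀ (by simp)
  have h := ((h1.mul h2).mul h3).const_mul √2
  simp only [one_mul, add_zero, inv_one, mul_one] at h
  refine h.congr' ?_
  obtain ⟨m, hm⟩ := exists_nat_gt (-ρ)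
  filter_upwards [eventually_ge_atTop (m + 1)] with n hn
  have hn1 : (m : ℝ) + 1 ≤ n := by exact_mod_cast hn
  have hm0 : (0 : ℝ) ≤ m := m.cast_nonneg
  have hn0 : (0 : ℝ) < n := by linarith
  have hpos : 0 < (n : ℝ) + ρ := by linarith
  rw [show (n : ℂ) + 1 + (ρ : ℂ) = (((n : ℝ) + ρ + 1 : ℝ) : ℂ) by push_cast; ring,
    Complex.Gamma_ofReal, Complex.norm_real, Real.norm_eq_abs, Real.Gamma_add_one hpos.ne',
    abs_mul, abs_of_pos hpos, Stirling.stirlingSeq, Complex.ofReal_re]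
  rw [Real.rpow_sub hn0, ← Real.sqrt_eq_rpow, Real.exp_neg,
    Real.sqrt_mul (by norm_num), div_pow, ← Real.exp_nat_mul, mul_one]
  have e1 : (0 : ℝ) < (n : ℝ) ^ ρ := Real.rpow_pos_of_pos hn0 _
  have e2 : (0 : ℝ) < √(n : ℝ) := Real.sqrt_pos.mpr hn0
  have e3 : (0 : ℝ) < Real.exp n := Real.exp_pos _
  have e4 : (0 : ℝ) < n.factorial := by positivity
  have e5 : (n : ℝ) = √(n : ℝ) * √(n : ℝ) := (Real.mul_self_sqrt hn0.le).symm
  have e6 : (1 : ℝ) + ρ / n = (n + ρ) / n := by field_simp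
  rw [e6]
  field_simp
  rw [Real.sq_sqrt hn0.le]

/-- An index beyond which the Gamma function is controlled by Stirling's formula. -/
structure BaseIndex (ν : ℂ) (n₀ : ℕ) : Prop where
  one_le : 1 ≤ n₀
  two_le : 2 ≤ (n₀ : ℝ) + ν.re
  norm_le : ∀ n : ℕ, n₀ ≤ n → ‖Complex.Gamma ((n : ℂ) + ν)‖ ≤ Real.Gamma ((n : ℝ) + ν.re)
  le_norm : ∀ n : ℕ, n₀ ≤ n → Real.Gamma ((n : ℝ) + ν.re) ≤ 2 * ‖Complex.Gamma ((n : ℂ) + ν)‖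
  le_stirling : ∀ n : ℕ, n₀ ≤ n → Real.Gamma ((n : ℝ) + ν.re) ≤
    3 * ((n : ℝ) ^ n * (n : ℝ) ^ (ν.re - 1 / 2) * Real.exp (-n))
  stirling_le : ∀ n : ℕ, n₀ ≤ n →
    (n : ℝ) ^ n * (n : ℝ) ^ (ν.re - 1 / 2) * Real.exp (-n) ≤ Real.Gamma ((n : ℝ) + ν.re)

/-- The Stirling constants `1` and `3` enclose `√(2π)`. The upper bound for `|Γ(n + ν)|` needs no
constant: its quotient by `Γ(n + Re ν)` increases, because `|n + ν| ≥ n + Re ν`, and its limit is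
`1`. -/
theorem exists_baseIndex (ν : ℂ) : ∃ n₀ : ℕ, ∀ n, n₀ ≤ n → BaseIndex ν n := by
  obtain ⟨m, hm⟩ := exists_nat_gt (2 - ν.re)
  have hsqrt : 1 < √2 * √Real.pi ∧ √2 * √Real.pi < 3 := by
    rw [← Real.sqrt_mul (by norm_num)]
    constructor
    · rw [Real.lt_sqrt (by norm_num)]; nlinarith [Real.pi_gt_three]
    · rw [Real.sqrt_lt' (by norm_num)]; nlinarith [Real.pi_lt_four]
  have hS := tendsto_Gamma_stirling ν.re
  have hR := tendsto_norm_Gamma_div_Gamma_re ν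
  obtain ⟨n₁, hn₁⟩ := eventually_atTop.mp
    ((hS.eventually (lt_mem_nhds hsqrt.1)).and ((hS.eventually (gt_mem_nhds hsqrt.2)).and
      (hR.eventually (lt_mem_nhds (show (1 / 2 : ℝ) < 1 by norm_num)))))
  have hpos : ∀ n : ℕ, m ≤ n → 2 < (n : ℝ) + ν.re := fun n hn => by
    have : (m : ℝ) ≤ n := by exact_mod_cast hn
    linarith
  have hG : ∀ n : ℕ, m ≤ n → 0 < Real.Gamma ((n : ℝ) + ν.re) := fun n hn =>
    Real.Gamma_pos_of_pos (by linarith [hpos n hn])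
  have hmono : ∀ n : ℕ, m ≤ n →
      ‖Complex.Gamma ((n : ℂ) + ν)‖ / |Real.Gamma ((n : ℝ) + ν.re)| ≤ 1 := by
    intro n hn
    have hm' : Monotone fun k : ℕ => ‖Complex.Gamma (((k + m : ℕ) : ℂ) + ν)‖ /
        |Real.Gamma (((k + m : ℕ) : ℝ) + ν.re)| := by
      refine monotone_nat_of_le_succ fun k => ?_
      have hk := hpos (k + m) (by omega)
      have hGk := hG (k + m) (by omega)
      have hne : ((k + m : ℕ) : ℂ) + ν ≠ 0 := by
        intro h0
        have := congrArg Complex.re h0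
        simp only [Complex.add_re, Complex.natCast_re, Complex.zero_re] at this
        linarith
      rw [show ((k + 1 + m : ℕ) : ℂ) + ν = (((k + m : ℕ) : ℂ) + ν) + 1 by push_cast; ring,
        show ((k + 1 + m : ℕ) : ℝ) + ν.re = (((k + m : ℕ) : ℝ) + ν.re) + 1 by push_cast; ring,
        Complex.Gamma_add_one _ hne, Real.Gamma_add_one (by linarith), norm_mul, abs_mul,
        mul_div_mul_comm]
      refine le_mul_of_one_le_left (by positivity) ?_
      rw [abs_of_pos (by linarith), one_le_div (by linarith)]
      have := Complex.re_le_norm (((k + m : ℕ) : ℂ) + ν)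
      simpa using this
    have h := hm'.ge_of_tendsto ((tendsto_add_atTop_iff_nat m).mpr hR) (n - m)
    simpa [Nat.sub_add_cancel hn] using h
  refine ⟨max (max m n₁) 1, fun n₀ hn₀ => ⟨by omega, (hpos n₀ (by omega)).le, fun n hn => ?_,
    fun n hn => ?_, fun n hn => ?_, fun n hn => ?_⟩⟩
  · have h := hmono n (by omega)
    have hg := hG n (by omega)
    rwa [abs_of_pos hg, div_le_one hg] at h
  · have h := (hn₁ n (by omega)).2.2
    have hg := hG n (by omega)
    rw [abs_of_pos hg, lt_div_iff₀ hg] at h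
    linarith
  · have h := (hn₁ n (by omega)).2.1
    have hg := hG n (by omega)
    have hn0 : (0 : ℝ) < n := by exact_mod_cast (by omega : 0 < n)
    rw [abs_of_pos hg, div_lt_iff₀ (by positivity)] at h
    exact h.le
  · have h := (hn₁ n (by omega)).1
    have hg := hG n (by omega)
    have hn0 : (0 : ℝ) < n := by exact_mod_cast (by omega : 0 < n)
    rw [abs_of_pos hg, lt_div_iff₀ (by positivity)] at h
    linarith

/-! ### Model terms and the least term. -/

/-- The model term `Γ(n + ρ) X^{-n}`. -/
def modelTerm (ρ : ℝ) (n : ℕ) (X : ℝ) : ℝ := Real.Gamma ((n : ℝ) + ρ) / X ^ n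

/-- The size `X^{ρ - 1/2} e^{-X}` of the smallest model term. -/
def leastTerm (ρ X : ℝ) : ℝ := X ^ (ρ - 1 / 2) * Real.exp (-X)

theorem leastTerm_pos (ρ : ℝ) {X : ℝ} (hX : 0 < X) : 0 < leastTerm ρ X :=
  mul_pos (Real.rpow_pos_of_pos hX _) (Real.exp_pos _)

theorem rpow_le_rpow_abs_mul {x y q : ℝ} (a : ℝ) (hx : 0 < x) (hy : 0 < y) (hq : 1 ≤ q)
    (hxy : x ≤ q * y) (hyx : y ≤ q * x) : x ^ a ≤ q ^ |a| * y ^ a := by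
  have hq0 : 0 < q := by linarith
  rcases le_total 0 a with ha | ha
  · rw [abs_of_nonneg ha, ← Real.mul_rpow hq0.le hy.le]
    exact Real.rpow_le_rpow hx.le hxy ha
  · have h1 : q * x ≥ y := hyx
    rw [abs_of_nonpos ha, Real.rpow_neg hq0.le, ← Real.inv_rpow hq0.le,
      ← Real.mul_rpow (by positivity) hy.le]
    refine Real.rpow_le_rpow_of_nonpos (by positivity) ?_ ha
    rw [inv_mul_le_iff₀ hq0]
    exact hyx

namespace BaseIndex

variable {ν : ℂ} {n₀ : ℕ}

theorem pos_arg (hn₀ : BaseIndex ν n₀) {n : ℕ} (hn : n₀ ≤ n) : 2 ≤ (n : ℝ) + ν.re := by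
  have : (n₀ : ℝ) ≤ n := by exact_mod_cast hn
  linarith [hn₀.two_le]

theorem natCast_one_le (hn₀ : BaseIndex ν n₀) {n : ℕ} (hn : n₀ ≤ n) : 1 ≤ (n : ℝ) := by
  exact_mod_cast hn₀.one_le.trans hn

theorem Gamma_pos (hn₀ : BaseIndex ν n₀) {n : ℕ} (hn : n₀ ≤ n) :
    0 < Real.Gamma ((n : ℝ) + ν.re) :=
  Real.Gamma_pos_of_pos (by linarith [hn₀.pos_arg hn])

theorem modelTerm_pos (hn₀ : BaseIndex ν n₀) {n : ℕ} (hn : n₀ ≤ n) {X : ℝ} (hX : 0 < X) :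
    0 < modelTerm ν.re n X :=
  div_pos (hn₀.Gamma_pos hn) (pow_pos hX _)

theorem modelTerm_succ (hn₀ : BaseIndex ν n₀) {n : ℕ} (hn : n₀ ≤ n) {X : ℝ} (hX : 0 < X) :
    modelTerm ν.re (n + 1) X = modelTerm ν.re n X * (((n : ℝ) + ν.re) / X) := by
  have h := hn₀.pos_arg hn
  rw [modelTerm, modelTerm, show ((n + 1 : ℕ) : ℝ) + ν.re = ((n : ℝ) + ν.re) + 1 by push_cast; ring,
    Real.Gamma_add_one (by linarith), pow_succ]
  field_simp

theorem modelTerm_mono (hn₀ : BaseIndex ν n₀) {n : ℕ} (hn : n₀ ≤ n) {X : ℝ} (hX : 0 < X)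
    (hnX : X ≤ (n : ℝ) + ν.re) {j : ℕ} (hj : n ≤ j) :
    modelTerm ν.re n X ≤ modelTerm ν.re j X := by
  induction j, hj using Nat.le_induction with
  | base => rfl
  | succ j hj ih =>
    rw [hn₀.modelTerm_succ (hn.trans hj) hX]
    refine ih.trans (le_mul_of_one_le_right (hn₀.modelTerm_pos (hn.trans hj) hX).le ?_)
    rw [one_le_div hX]
    have : (n : ℝ) ≤ j := by exact_mod_cast hj
    linarith

/-- Up to the index `X + M` a quotient of successive terms is at most `1 + (M + |Re ν|)/X`, and
there are at most `X + M` such quotients, so their product stays bounded. Up to a constant, the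
terms decrease until slightly beyond `X`. -/
theorem modelTerm_le_mul_of_le (hn₀ : BaseIndex ν n₀) {X₀ M : ℝ} (hX₀ : 0 < X₀) (hM : 0 ≤ M) :
    ∃ C : ℝ, 1 ≤ C ∧ ∀ X : ℝ, X₀ < X → ∀ n j : ℕ, n₀ ≤ n → n ≤ j → (j : ℝ) ≤ X + M →
      modelTerm ν.re j X ≤ C * modelTerm ν.re n X := by
  refine ⟨Real.exp ((1 + M / X₀) * (M + |ν.re|)), Real.one_le_exp (by positivity),
    fun X hX n j hn hnj hjX => ?_⟩
  have hXp : 0 < X := hX₀.trans hX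
  have hb : 0 ≤ M + |ν.re| := by positivity
  have key : ∀ j : ℕ, n ≤ j → (j : ℝ) ≤ X + M → modelTerm ν.re j X ≤
      Real.exp (((j : ℝ) - n) * ((M + |ν.re|) / X)) * modelTerm ν.re n X := by
    intro j hj
    induction j, hj using Nat.le_induction with
    | base => intro _; simp
    | succ j hj ih =>
      intro hjX
      have hjX' : (j : ℝ) + 1 ≤ X + M := by exact_mod_cast hjX
      have h1 := ih (by linarith)
      rw [hn₀.modelTerm_succ (hn.trans hj) hXp]
      have h2 : ((j : ℝ) + ν.re) / X ≤ Real.exp ((M + |ν.re|) / X) := by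
        have h3 : ((j : ℝ) + ν.re) / X ≤ (M + |ν.re|) / X + 1 := by
          rw [div_add_one hXp.ne']
          exact div_le_div_of_nonneg_right (by linarith [le_abs_self ν.re]) hXp.le
        exact h3.trans (Real.add_one_le_exp _)
      have h4 : 0 ≤ ((j : ℝ) + ν.re) / X := by
        have := hn₀.pos_arg (hn.trans hj)
        positivity
      calc _ ≤ (Real.exp (((j : ℝ) - n) * ((M + |ν.re|) / X)) * modelTerm ν.re n X) *
            Real.exp ((M + |ν.re|) / X) := by
            refine mul_le_mul h1 h2 h4 ?_
            exact mul_nonneg (Real.exp_pos _).le (hn₀.modelTerm_pos hn hXp).le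
        _ = _ := by
            rw [show (((j + 1 : ℕ) : ℝ) - n) * ((M + |ν.re|) / X) =
              ((j : ℝ) - n) * ((M + |ν.re|) / X) + (M + |ν.re|) / X by push_cast; ring, Real.exp_add]
            ring
  refine (key j hnj hjX).trans (mul_le_mul_of_nonneg_right (Real.exp_le_exp.mpr ?_)
    (hn₀.modelTerm_pos hn hXp).le)
  · rw [show ((j : ℝ) - n) * ((M + |ν.re|) / X) = ((j : ℝ) - n) / X * (M + |ν.re|) by ring]
    refine mul_le_mul_of_nonneg_right ?_ hb
    rw [div_le_iff₀ hXp]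
    have : M ≤ M / X₀ * X := by
      rw [div_mul_eq_mul_div, le_div_iff₀ hX₀]; gcongr
    have : (0 : ℝ) ≤ n := n.cast_nonneg
    nlinarith

/-- Within a distance of order `√X` from `X`, all terms have the size of the least one: by
Stirling's formula the decisive factor is `(N/X)^N e^{-N}`, which lies between `e^{-X}` and
`e^{(N-X)²/X} e^{-X}`; both bounds are instances of `1 + t ≤ e^t`. -/
theorem modelTerm_equiv_leastTerm (hn₀ : BaseIndex ν n₀) {X₀ M : ℝ} (hX₀ : 0 < X₀) (hM : 0 ≤ M) :
    ∃ C : ℝ, 1 ≤ C ∧ ∀ X : ℝ, X₀ < X → ∀ N : ℕ, n₀ ≤ N → ((N : ℝ) - X) ^ 2 ≤ M * X →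
      modelTerm ν.re N X ≤ C * leastTerm ν.re X ∧ leastTerm ν.re X ≤ C * modelTerm ν.re N X := by
  set a : ℝ := ν.re - 1 / 2 with ha
  -- `q` bounds both `N/X` and `X/N`. The last entry serves for `N/X`; for `X/N` the entry `4M`
  -- serves if `X ≤ 4M`, as `N ≥ 1`, and the entry `2` otherwise, as then `|N - X| ≤ X/2`.
  set q : ℝ := max (max 2 (4 * M)) (1 + √(M / X₀)) with hq
  have hq2 : 2 ≤ q := (le_max_left _ _).trans (le_max_left _ _)
  have hqM : 4 * M ≤ q := (le_max_right _ _).trans (le_max_left _ _)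
  have hqs : 1 + √(M / X₀) ≤ q := le_max_right _ _
  have hq1 : 1 ≤ q := by linarith
  have hqa : 1 ≤ q ^ |a| := Real.one_le_rpow hq1 (abs_nonneg _)
  have hCM : 1 ≤ Real.exp M := Real.one_le_exp hM
  refine ⟨3 * q ^ |a| * Real.exp M, by nlinarith, fun X hX N hN hNX => ?_⟩
  have hXp : 0 < X := hX₀.trans hX
  have hN1 : 1 ≤ (N : ℝ) := hn₀.natCast_one_le hN
  have hNp : 0 < (N : ℝ) := by linarith
  have r1 : (N : ℝ) ≤ q * X := by
    have h1 : (N : ℝ) - X ≤ √(M * X) := Real.le_sqrt_of_sq_le hNX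
    have h2 : √(M * X) ≤ √(M / X₀) * X := by
      rw [Real.sqrt_le_left (by positivity), mul_pow, Real.sq_sqrt (by positivity)]
      have : M * X * X₀ ≤ M * X * X := by gcongr
      rw [div_mul_eq_mul_div, le_div_iff₀ hX₀]
      nlinarith
    nlinarith
  have r2 : X ≤ q * N := by
    rcases le_total X (4 * M) with h | h
    · nlinarith
    · have : X ≤ 2 * N := by
        by_contra hcon
        push Not at hcon
        have : (X / 2) ^ 2 < ((N : ℝ) - X) ^ 2 := by
          rw [sq_lt_sq, abs_of_pos (by positivity), abs_of_neg (by linarith)]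
          linarith
        nlinarith
      nlinarith
  have ra := rpow_le_rpow_abs_mul a hNp hXp hq1 r1 r2
  have rb := rpow_le_rpow_abs_mul a hXp hNp hq1 r2 r1
  have hNa : 0 < (N : ℝ) ^ a := Real.rpow_pos_of_pos hNp _
  have hXa : 0 < X ^ a := Real.rpow_pos_of_pos hXp _
  have hpow : (N : ℝ) ^ N / X ^ N = ((N : ℝ) / X) ^ N := (div_pow _ _ _).symm
  have u1 : ((N : ℝ) / X) ^ N * Real.exp (-N) ≤ Real.exp M * Real.exp (-X) := by
    have h1 : (N : ℝ) / X ≤ Real.exp (((N : ℝ) - X) / X) := by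
      have := Real.add_one_le_exp (((N : ℝ) - X) / X)
      rwa [div_add_one hXp.ne', sub_add_cancel] at this
    have h2 : ((N : ℝ) / X) ^ N ≤ Real.exp (N * (((N : ℝ) - X) / X)) := by
      rw [Real.exp_nat_mul]
      gcongr
    calc _ ≤ Real.exp (N * (((N : ℝ) - X) / X)) * Real.exp (-N) := by gcongr
      _ = Real.exp (((N : ℝ) - X) ^ 2 / X + -X) := by
        rw [← Real.exp_add]; congr 1; field_simp; ring
      _ ≤ Real.exp (M + -X) := by
        gcongr
        rw [div_le_iff₀ hXp]; exact hNX
      _ = _ := Real.exp_add _ _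
  have u2 : Real.exp (-X) ≤ ((N : ℝ) / X) ^ N * Real.exp (-N) := by
    have h1 : X / N ≤ Real.exp ((X - N) / N) := by
      have := Real.add_one_le_exp ((X - (N : ℝ)) / N)
      rwa [div_add_one hNp.ne', sub_add_cancel] at this
    have h2 : (X / (N : ℝ)) ^ N ≤ Real.exp (N * ((X - N) / N)) := by
      rw [Real.exp_nat_mul]
      gcongr
    rw [mul_div_cancel₀ _ hNp.ne'] at h2
    have h3 : ((N : ℝ) / X) ^ N = ((X / (N : ℝ)) ^ N)⁻¹ := by rw [← inv_pow, inv_div]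
    rw [h3, inv_mul_eq_div, le_div_iff₀ (by positivity)]
    calc _ ≤ Real.exp (-X) * Real.exp (X - N) := by gcongr
      _ = _ := by rw [← Real.exp_add]; congr 1; ring
  have hstep : ∀ c : ℝ, c * ((N : ℝ) ^ N * (N : ℝ) ^ a * Real.exp (-N)) / X ^ N =
      c * (N : ℝ) ^ a * (((N : ℝ) / X) ^ N * Real.exp (-N)) := by
    intro c; rw [← hpow]; ring
  constructor
  · calc modelTerm ν.re N X ≤ 3 * ((N : ℝ) ^ N * (N : ℝ) ^ a * Real.exp (-N)) / X ^ N := by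
          unfold modelTerm; gcongr; exact hn₀.le_stirling N hN
      _ = 3 * (N : ℝ) ^ a * (((N : ℝ) / X) ^ N * Real.exp (-N)) := hstep 3
      _ ≤ 3 * (q ^ |a| * X ^ a) * (Real.exp M * Real.exp (-X)) := by gcongr
      _ = _ := by unfold leastTerm; ring
  · have hm : 1 * ((N : ℝ) ^ N * (N : ℝ) ^ a * Real.exp (-N)) / X ^ N ≤ modelTerm ν.re N X := by
      unfold modelTerm; rw [one_mul]; gcongr; exact hn₀.stirling_le N hN
    rw [hstep, one_mul] at hm
    calc leastTerm ν.re X = X ^ a * Real.exp (-X) := rfl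
      _ ≤ (q ^ |a| * (N : ℝ) ^ a) * (((N : ℝ) / X) ^ N * Real.exp (-N)) := by gcongr
      _ = q ^ |a| * ((N : ℝ) ^ a * (((N : ℝ) / X) ^ N * Real.exp (-N))) := by ring
      _ ≤ q ^ |a| * modelTerm ν.re N X := by gcongr
      _ ≤ _ := by
        gcongr
        · exact (hn₀.modelTerm_pos hN hXp).le
        · nlinarith

end BaseIndex

/-! ### Growth of the coefficients of a formal solution. -/

/-- `b` majorizes the tail of the series of increments, so that convergence and its rate follow by
telescoping. This serves for the large order of the coefficients and also for integrals put together
from unit intervals. -/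
theorem exists_tendsto_of_norm_sub_le_sub {E : Type*} [NormedAddCommGroup E] [CompleteSpace E]
    {f : ℕ → E} {b : ℕ → ℝ} {n₀ : ℕ} (hb : Tendsto b atTop (𝓝 0))
    (h : ∀ n, n₀ ≤ n → ‖f (n + 1) - f n‖ ≤ b n - b (n + 1)) :
    ∃ R : E, Tendsto f atTop (𝓝 R) ∧ ∀ n, n₀ ≤ n → ‖f n - R‖ ≤ b n := by
  have key : ∀ n, n₀ ≤ n → ∀ m, n ≤ m → ‖f m - f n‖ ≤ b n - b m := by
    intro n hn m hm
    induction m, hm using Nat.le_induction with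
    | base => simp
    | succ m hm ih =>
      have h1 := h m (hn.trans hm)
      calc ‖f (m + 1) - f n‖ = ‖(f (m + 1) - f m) + (f m - f n)‖ := by congr 1; abel
        _ ≤ ‖f (m + 1) - f m‖ + ‖f m - f n‖ := norm_add_le _ _
        _ ≤ _ := by linarith
  have hb0 : ∀ n, n₀ ≤ n → ∀ m, n ≤ m → b m ≤ b n := fun n hn m hm => by
    have := (norm_nonneg _).trans (key n hn m hm); linarith
  have hbn : ∀ n, n₀ ≤ n → 0 ≤ b n := fun n hn =>
    le_of_tendsto hb (eventually_atTop.mpr ⟨n, fun m hm => hb0 n hn m hm⟩)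
  have hc : CauchySeq fun n => f (n + n₀) := by
    refine cauchySeq_of_le_tendsto_0 (fun n => b (n + n₀)) (fun p q N hp hq => ?_)
      ((tendsto_add_atTop_iff_nat n₀).mpr hb)
    wlog hpq : p ≤ q generalizing p q
    · rw [dist_comm]; exact this q p hq hp (by omega)
    rw [dist_comm, dist_eq_norm]
    have h1 := key (p + n₀) (by omega) (q + n₀) (by omega)
    have h2 := hbn (q + n₀) (by omega)
    have h3 := hb0 (N + n₀) (by omega) (p + n₀) (by omega)
    linarith
  obtain ⟨R, hR⟩ := cauchySeq_tendsto_of_complete hc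
  rw [tendsto_add_atTop_iff_nat] at hR
  refine ⟨R, hR, fun n hn => ?_⟩
  rw [norm_sub_rev]
  refine le_of_tendsto (hR.sub_const (f n)).norm (eventually_atTop.mpr ⟨n, fun m hm => ?_⟩)
  have h1 := key n hn m hm
  have h2 := hbn m (hn.trans hm)
  linarith

/-- Coefficients of a formal solution of `u' = G - (ω - ν/X) u`, `G' = -(P G + H u)`. -/
structure FormalSystem (ω ν : ℂ) (Pc Hc s g : ℕ → ℂ) (K κ : ℝ) : Prop where
  norm_eq : ‖ω‖ = 1
  κ_pos : 0 < κ
  κ_lt : κ < 1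
  K_nonneg : 0 ≤ K
  P_zero : Pc 0 = 0
  P_one : Pc 1 = 0
  H_zero : Hc 0 = 0
  H_one : Hc 1 = 0
  P_le : ∀ n : ℕ, ‖Pc n‖ ≤ K * κ ^ n * n.factorial
  H_le : ∀ n : ℕ, ‖Hc n‖ ≤ K * κ ^ n * n.factorial
  s_zero : s 0 = 1
  g_zero : g 0 = ω * s 0
  s_succ : ∀ n : ℕ, ω * s (n + 1) = g (n + 1) + (n + ν) * s n
  g_eq : ∀ n : ℕ, (n : ℂ) * g n =
    ∑ j ∈ Finset.range (n + 2), (Pc j * g (n + 1 - j) + Hc j * s (n + 1 - j))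

/-- The weight `Γ(max n n₀ + ρ)`. -/
def gammaWeight (ρ : ℝ) (n₀ n : ℕ) : ℝ := Real.Gamma (((max n n₀ : ℕ) : ℝ) + ρ)

theorem factorial_mul_Gamma_le {x : ℝ} (hx : 1 ≤ x) (k : ℕ) :
    (k.factorial : ℝ) * Real.Gamma x ≤ Real.Gamma (x + k) := by
  induction k with
  | zero => simp
  | succ k ih =>
    have hk : (0 : ℝ) ≤ k := k.cast_nonneg
    have hpos : 0 < Real.Gamma (x + k) := Real.Gamma_pos_of_pos (by linarith)
    rw [show x + ((k + 1 : ℕ) : ℝ) = (x + k) + 1 by push_cast; ring,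
      Real.Gamma_add_one (by linarith), Nat.factorial_succ]
    push_cast
    calc ((k : ℝ) + 1) * k.factorial * Real.Gamma x
        = ((k : ℝ) + 1) * (k.factorial * Real.Gamma x) := by ring
      _ ≤ ((k : ℝ) + 1) * Real.Gamma (x + k) := by gcongr
      _ ≤ _ := mul_le_mul_of_nonneg_right (by linarith) hpos.le

namespace BaseIndex

variable {ν : ℂ} {n₀ : ℕ}

theorem gammaWeight_pos (hn₀ : BaseIndex ν n₀) (n : ℕ) : 0 < gammaWeight ν.re n₀ n :=
  hn₀.Gamma_pos (le_max_right _ _)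

theorem gammaWeight_eq (n₀ : ℕ) {n : ℕ} (hn : n₀ ≤ n) :
    gammaWeight ν.re n₀ n = Real.Gamma ((n : ℝ) + ν.re) := by
  rw [gammaWeight, max_eq_left hn]

/-- Since the weight is frozen below `n₀`, raising the index by `i` is only sure to gain the factor
`(i - n₀)!` (truncated subtraction). The factors missing from `(i + 2)!` cost a polynomial of degree
`n₀ + 2` in `i`. -/
theorem factorial_mul_gammaWeight_le (hn₀ : BaseIndex ν n₀) (m i : ℕ) :
    ((i + 2).factorial : ℝ) * gammaWeight ν.re n₀ m ≤
      ((n₀ + 2).factorial * ((i + 2 : ℕ) : ℝ) ^ (n₀ + 2)) * gammaWeight ν.re n₀ (m + i) := by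
  obtain ⟨r, hr⟩ : ∃ r, max (m + i) n₀ = max m n₀ + ((i - n₀) + r) :=
    ⟨max (m + i) n₀ - (max m n₀ + (i - n₀)), by omega⟩
  have h1 : ((i - n₀).factorial : ℝ) * gammaWeight ν.re n₀ m ≤ gammaWeight ν.re n₀ (m + i) := by
    have h2 := factorial_mul_Gamma_le (x := ((max m n₀ : ℕ) : ℝ) + ν.re)
      (by linarith [hn₀.pos_arg (le_max_right m n₀)]) ((i - n₀) + r)
    have h3 : gammaWeight ν.re n₀ (m + i) =
        Real.Gamma (((max m n₀ : ℕ) : ℝ) + ν.re + ((i - n₀ + r : ℕ) : ℝ)) := by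
      rw [gammaWeight, hr]; congr 1; push_cast; ring
    rw [h3]
    refine le_trans ?_ h2
    refine mul_le_mul_of_nonneg_right ?_ (hn₀.gammaWeight_pos m).le
    exact_mod_cast Nat.factorial_le (by omega)
  have h2 : ((i + 2).factorial : ℝ) ≤
      ((n₀ + 2).factorial * ((i + 2 : ℕ) : ℝ) ^ (n₀ + 2)) * (i - n₀).factorial := by
    norm_cast
    rcases le_total n₀ i with h | h
    · have h3 := Nat.factorial_mul_ascFactorial (i - n₀) (n₀ + 2)
      rw [show i - n₀ + (n₀ + 2) = i + 2 by omega] at h3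
      have h4 := Nat.ascFactorial_le_pow_add (i - n₀) (n₀ + 2)
      rw [show i - n₀ + (n₀ + 2) = i + 2 by omega] at h4
      rw [← h3]
      calc (i - n₀).factorial * (i - n₀ + 1).ascFactorial (n₀ + 2)
          ≤ (i - n₀).factorial * (i + 2) ^ (n₀ + 2) := by gcongr
        _ = 1 * (i + 2) ^ (n₀ + 2) * (i - n₀).factorial := by ring
        _ ≤ _ := by gcongr; exact Nat.factorial_pos _
    · calc (i + 2).factorial ≤ (n₀ + 2).factorial := Nat.factorial_le (by omega)
        _ = (n₀ + 2).factorial * 1 * 1 := by ring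
        _ ≤ _ := by
          gcongr
          · exact Nat.one_le_pow _ _ (by omega)
          · exact Nat.factorial_pos _
  calc ((i + 2).factorial : ℝ) * gammaWeight ν.re n₀ m
      ≤ ((n₀ + 2).factorial * ((i + 2 : ℕ) : ℝ) ^ (n₀ + 2)) * (i - n₀).factorial *
        gammaWeight ν.re n₀ m := by
        gcongr; exact (hn₀.gammaWeight_pos m).le
    _ = ((n₀ + 2).factorial * ((i + 2 : ℕ) : ℝ) ^ (n₀ + 2)) *
        ((i - n₀).factorial * gammaWeight ν.re n₀ m) := by ring
    _ ≤ _ := by gcongr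

/-- The condition `κ < 1` enters here: it makes `κ^i` beat the polynomial loss, so that the
convolution with `κ^j j!` preserves the weight. -/
theorem exists_convolution_le (hn₀ : BaseIndex ν n₀) {κ : ℝ} (hκ : 0 < κ) (hκ1 : κ < 1) :
    ∃ S : ℝ, 0 ≤ S ∧ ∀ n : ℕ, ∑ i ∈ Finset.range (n + 1),
      κ ^ (i + 2) * ((i + 2).factorial : ℝ) * gammaWeight ν.re n₀ (n - i) ≤
        S * gammaWeight ν.re n₀ n := by
  have hs : Summable fun i : ℕ => ((i : ℝ) ^ (n₀ + 2) * κ ^ i) :=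
    summable_pow_mul_geometric_of_norm_lt_one _ (by rw [Real.norm_of_nonneg hκ.le]; exact hκ1)
  have hs2 : Summable fun i : ℕ => (((i + 2 : ℕ) : ℝ) ^ (n₀ + 2) * κ ^ (i + 2)) :=
    (summable_nat_add_iff 2).mpr hs
  refine ⟨(n₀ + 2).factorial * ∑' i : ℕ, (((i + 2 : ℕ) : ℝ) ^ (n₀ + 2) * κ ^ (i + 2)),
    by positivity, fun n => ?_⟩
  calc _ ≤ ∑ i ∈ Finset.range (n + 1), ((n₀ + 2).factorial *
        (((i + 2 : ℕ) : ℝ) ^ (n₀ + 2) * κ ^ (i + 2))) * gammaWeight ν.re n₀ n := by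
        refine Finset.sum_le_sum fun i hi => ?_
        have hi' : i ≤ n := by simpa [Nat.lt_succ_iff] using hi
        have h := hn₀.factorial_mul_gammaWeight_le (n - i) i
        rw [Nat.sub_add_cancel hi'] at h
        have hk : 0 ≤ κ ^ (i + 2) := by positivity
        have := mul_le_mul_of_nonneg_left h hk
        nlinarith
    _ ≤ _ := by
        rw [← Finset.sum_mul, ← Finset.mul_sum]
        refine mul_le_mul_of_nonneg_right ?_ (hn₀.gammaWeight_pos n).le
        gcongr
        exact hs2.sum_le_tsum _ fun i _ => by positivity

theorem exists_mul_gammaWeight_le (hn₀ : BaseIndex ν n₀) :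
    ∃ c : ℝ, 1 ≤ c ∧ ∀ n : ℕ, ((n : ℝ) + 2) * gammaWeight ν.re n₀ n ≤
      c * gammaWeight ν.re n₀ (n + 1) := by
  refine ⟨n₀ + 2 + (2 + |ν.re|), by linarith [(Nat.cast_nonneg n₀ : (0 : ℝ) ≤ n₀), abs_nonneg ν.re],
    fun n => ?_⟩
  rcases lt_or_ge n n₀ with h | h
  · have e : gammaWeight ν.re n₀ (n + 1) = gammaWeight ν.re n₀ n := by
      rw [gammaWeight, gammaWeight, show max (n + 1) n₀ = max n n₀ by omega]
    rw [e]
    have : (n : ℝ) ≤ n₀ := by exact_mod_cast h.le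
    refine mul_le_mul_of_nonneg_right ?_ (hn₀.gammaWeight_pos n).le
    linarith [abs_nonneg ν.re]
  · have h2 := hn₀.pos_arg h
    rw [gammaWeight_eq n₀ h, gammaWeight_eq n₀ (h.trans n.le_succ), Nat.cast_succ,
      show (n : ℝ) + 1 + ν.re = (n + ν.re) + 1 by ring, Real.Gamma_add_one (by linarith), ← mul_assoc]
    refine mul_le_mul_of_nonneg_right ?_ (hn₀.Gamma_pos h).le
    have : (0 : ℝ) ≤ n₀ := n₀.cast_nonneg
    have h3 := abs_nonneg ν.re
    have h4 := neg_abs_le ν.re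
    have h5 := le_abs_self ν.re
    nlinarith

/-- With `x = n + Re ν` one has `|n + ν| ≤ x + (Im ν)²/x`. The relative excess over `x` is of order
`n^{-2}`, hence harmless in an infinite product. -/
theorem exists_norm_mul_gammaWeight_le (hn₀ : BaseIndex ν n₀) :
    ∃ c : ℝ, 0 ≤ c ∧ ∀ n : ℕ, ‖(n : ℂ) + ν‖ * gammaWeight ν.re n₀ n ≤
      (1 + c / ((n : ℝ) + 2) ^ 2) * gammaWeight ν.re n₀ (n + 1) := by
  obtain ⟨c₁, hc₁, h₁⟩ := hn₀.exists_mul_gammaWeight_le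
  refine ⟨(n₀ + ‖ν‖) * (n₀ + 2) ^ 2 + ν.im ^ 2 * c₁ ^ 2, by positivity, fun n => ?_⟩
  rcases lt_or_ge n n₀ with h | h
  · have e : gammaWeight ν.re n₀ (n + 1) = gammaWeight ν.re n₀ n := by
      rw [gammaWeight, gammaWeight, show max (n + 1) n₀ = max n n₀ by omega]
    rw [e]
    have hn : (n : ℝ) ≤ n₀ := by exact_mod_cast h.le
    refine mul_le_mul_of_nonneg_right ?_ (hn₀.gammaWeight_pos n).le
    have h2 : ‖(n : ℂ) + ν‖ ≤ n₀ + ‖ν‖ := (norm_add_le _ _).trans (by simpa using hn)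
    have h3 : (n₀ + ‖ν‖) ≤ ((n₀ + ‖ν‖) * (n₀ + 2) ^ 2 + ν.im ^ 2 * c₁ ^ 2) / ((n : ℝ) + 2) ^ 2 := by
      rw [le_div_iff₀ (by positivity)]
      have : (n₀ + ‖ν‖) * ((n : ℝ) + 2) ^ 2 ≤ (n₀ + ‖ν‖) * ((n₀ : ℝ) + 2) ^ 2 := by gcongr
      nlinarith [mul_nonneg (sq_nonneg ν.im) (sq_nonneg c₁)]
    linarith
  · have h2 := hn₀.pos_arg h
    have hg := hn₀.Gamma_pos h
    have h4 := h₁ n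
    rw [gammaWeight_eq n₀ h, gammaWeight_eq n₀ (h.trans n.le_succ), Nat.cast_succ,
      show (n : ℝ) + 1 + ν.re = (n + ν.re) + 1 by ring, Real.Gamma_add_one (by linarith),
      ← mul_assoc, mul_le_mul_iff_of_pos_right hg] at h4 ⊢
    set x := (n : ℝ) + ν.re with hx
    set y := (n : ℝ) + 2 with hy
    have hy0 : 0 < y := by positivity
    have hx0 : 0 < x := by linarith
    have h5 : ‖(n : ℂ) + ν‖ ≤ x + ν.im ^ 2 / x := by
      rw [← abs_of_pos (show 0 < x + ν.im ^ 2 / x by positivity)]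
      refine (sq_le_sq.mp ?_).trans' (le_abs_self _)
      rw [Complex.sq_norm, Complex.normSq_apply]
      simp only [Complex.add_re, Complex.natCast_re, Complex.add_im, Complex.natCast_im, zero_add]
      have e : x * (ν.im ^ 2 / x) = ν.im ^ 2 := by field_simp
      nlinarith [sq_nonneg (ν.im ^ 2 / x)]
    refine h5.trans ?_
    rw [add_mul, one_mul]
    refine add_le_add le_rfl ?_
    rw [div_le_iff₀ hx0]
    have h6 : ν.im ^ 2 ≤ ν.im ^ 2 * c₁ ^ 2 / y ^ 2 * x * x := by
      rw [div_mul_eq_mul_div, div_mul_eq_mul_div, le_div_iff₀ (by positivity)]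
      have : y ^ 2 ≤ (c₁ * x) ^ 2 := by gcongr
      nlinarith [mul_le_mul_of_nonneg_left this (sq_nonneg ν.im)]
    refine h6.trans ?_
    gcongr
    have : 0 ≤ ((n₀ : ℝ) + ‖ν‖) * (n₀ + 2) ^ 2 := by positivity
    linarith

end BaseIndex

theorem sum_inv_sq_le (n : ℕ) : ∑ l ∈ Finset.range n, (1 : ℝ) / ((l : ℝ) + 2) ^ 2 ≤ 1 := by
  have h : ∑ l ∈ Finset.range n, (1 : ℝ) / ((l : ℝ) + 2) ^ 2 ≤ 1 - 1 / ((n : ℝ) + 1) := by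
    induction n with
    | zero => simp
    | succ n ih =>
      rw [Finset.sum_range_succ]
      have : (1 : ℝ) / ((n : ℝ) + 2) ^ 2 ≤ 1 / ((n : ℝ) + 1) - 1 / ((n : ℝ) + 1 + 1) := by
        rw [div_sub_div _ _ (by positivity) (by positivity),
          div_le_div_iff₀ (by positivity) (by positivity)]
        nlinarith [(Nat.cast_nonneg n : (0 : ℝ) ≤ n)]
      push_cast
      linarith
  have : (0 : ℝ) ≤ 1 / ((n : ℝ) + 1) := by positivity
  linarith

namespace FormalSystem

variable {ω ν : ℂ} {Pc Hc s g : ℕ → ℂ} {K κ : ℝ} {n₀ : ℕ}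

theorem mul_g_succ (h : FormalSystem ω ν Pc Hc s g K κ) (n : ℕ) :
    ((n + 1 : ℕ) : ℂ) * g (n + 1) = ∑ i ∈ Finset.range (n + 1),
      (Pc (i + 2) * g (n - i) + Hc (i + 2) * s (n - i)) := by
  rw [h.g_eq, Finset.sum_range_succ', Finset.sum_range_succ', h.P_zero, h.H_zero, h.P_one, h.H_one]
  simp only [zero_mul, add_zero]
  refine Finset.sum_congr rfl fun i _ => ?_
  rw [show n + 1 + 1 - (i + 1 + 1) = n - i by omega]

/-- One step of the recursion multiplies the bound for `s` by `1 + O(n^{-2})`. The additional decay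
of `g` has two sources: the factor `n` on the left of its recursion, and the fact that the right
side involves only lower indices, whose weight is smaller by another factor of order `n`. -/
theorem exists_norm_le (h : FormalSystem ω ν Pc Hc s g K κ) (hn₀ : BaseIndex ν n₀) :
    ∃ A : ℝ, 0 < A ∧ ∀ n, ‖s n‖ ≤ A * gammaWeight ν.re n₀ n ∧
      ‖g n‖ ≤ A * gammaWeight ν.re n₀ n / ((n : ℝ) + 1) ^ 2 := by
  obtain ⟨S, hS, hconv⟩ := hn₀.exists_convolution_le h.κ_pos h.κ_lt
  obtain ⟨c₁, hc₁, h₁⟩ := hn₀.exists_mul_gammaWeight_le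
  obtain ⟨c₂, hc₂, h₂⟩ := hn₀.exists_norm_mul_gammaWeight_le
  set W := gammaWeight ν.re n₀ with hW
  have hWp : ∀ n, 0 < W n := hn₀.gammaWeight_pos
  have hK := h.K_nonneg
  set C₁ := 4 * K * S * c₁ with hC₁
  have hC₁0 : 0 ≤ C₁ := by positivity
  have hg : ∀ (A : ℝ) (n : ℕ), (∀ m ≤ n, ‖s m‖ ≤ A * W m ∧ ‖g m‖ ≤ A * W m) →
      ‖g (n + 1)‖ ≤ C₁ * A * W (n + 1) / ((n : ℝ) + 2) ^ 2 := by
    intro A n hA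
    have hA0 : 0 ≤ A := by
      have := (norm_nonneg _).trans (hA 0 (Nat.zero_le _)).1
      exact nonneg_of_mul_nonneg_left this (hWp 0)
    have e : ((n : ℝ) + 1) * ‖g (n + 1)‖ ≤ 2 * K * A * (S * W n) := by
      calc ((n : ℝ) + 1) * ‖g (n + 1)‖ = ‖((n + 1 : ℕ) : ℂ) * g (n + 1)‖ := by
            rw [norm_mul, Complex.norm_natCast]; push_cast; rfl
        _ ≤ ∑ i ∈ Finset.range (n + 1), ‖Pc (i + 2) * g (n - i) + Hc (i + 2) * s (n - i)‖ := by
            rw [h.mul_g_succ]; exact norm_sum_le _ _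
        _ ≤ ∑ i ∈ Finset.range (n + 1),
              2 * K * A * (κ ^ (i + 2) * ((i + 2).factorial : ℝ) * W (n - i)) := by
            refine Finset.sum_le_sum fun i _ => ?_
            have a1 := (hA (n - i) (by omega)).1
            have a2 := (hA (n - i) (by omega)).2
            have a3 := h.P_le (i + 2)
            have a4 := h.H_le (i + 2)
            calc _ ≤ ‖Pc (i + 2)‖ * ‖g (n - i)‖ + ‖Hc (i + 2)‖ * ‖s (n - i)‖ := by
                  refine (norm_add_le _ _).trans ?_
                  rw [norm_mul, norm_mul]
              _ ≤ (K * κ ^ (i + 2) * (i + 2).factorial) * (A * W (n - i)) +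
                  (K * κ ^ (i + 2) * (i + 2).factorial) * (A * W (n - i)) := by
                  gcongr
                  · exact (norm_nonneg _).trans a3
                  · exact (norm_nonneg _).trans a3
              _ = _ := by ring
        _ ≤ _ := by
            rw [← Finset.mul_sum]
            gcongr
            exact hconv n
    have e2 := h₁ n
    rw [le_div_iff₀ (by positivity)]
    have hn : (0 : ℝ) ≤ n := n.cast_nonneg
    have : ‖g (n + 1)‖ * ((n : ℝ) + 2) ^ 2 ≤ 2 * ((((n : ℝ) + 1) * ‖g (n + 1)‖) * ((n : ℝ) + 2)) := by
      have := norm_nonneg (g (n + 1))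
      nlinarith [mul_nonneg this hn, mul_nonneg (mul_nonneg this hn) hn]
    refine this.trans ?_
    calc 2 * ((((n : ℝ) + 1) * ‖g (n + 1)‖) * ((n : ℝ) + 2))
        ≤ 2 * ((2 * K * A * (S * W n)) * ((n : ℝ) + 2)) := by gcongr
      _ = 4 * K * S * A * (((n : ℝ) + 2) * W n) := by ring
      _ ≤ 4 * K * S * A * (c₁ * W (n + 1)) := by gcongr
      _ = _ := by ring
  set C := C₁ + c₂ with hC
  set A₀ := 1 / W 0 with hA₀
  have hA₀p : 0 < A₀ := by have := hWp 0; positivity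
  -- These running constants grow at each step by at least the factor `1 + C/(n+2)²` that the
  -- recursion demands, and they stay below `A₀ e^C`.
  set A : ℕ → ℝ := fun n => A₀ * Real.exp (C * ∑ l ∈ Finset.range n, (1 : ℝ) / ((l : ℝ) + 2) ^ 2)
    with hAdef
  have hAp : ∀ n, 0 < A n := fun n => by positivity
  have hAsucc : ∀ n, A n * (1 + C / ((n : ℝ) + 2) ^ 2) ≤ A (n + 1) := by
    intro n
    have : 1 + C / ((n : ℝ) + 2) ^ 2 ≤ Real.exp (C * (1 / ((n : ℝ) + 2) ^ 2)) := by
      have := Real.add_one_le_exp (C * (1 / ((n : ℝ) + 2) ^ 2))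
      rw [mul_one_div] at this ⊢
      linarith
    simp only [hAdef]
    rw [Finset.sum_range_succ, mul_add C, Real.exp_add, ← mul_assoc]
    gcongr
  have hAmono : Monotone A := monotone_nat_of_le_succ fun n => by
    refine le_trans ?_ (hAsucc n)
    refine le_mul_of_one_le_right (hAp n).le ?_
    have : 0 ≤ C / ((n : ℝ) + 2) ^ 2 := by positivity
    linarith
  have hrec : ∀ n, ∀ m ≤ n, ‖s m‖ ≤ A m * W m ∧ ‖g m‖ ≤ A m * W m := by
    intro n
    induction n with
    | zero =>
      intro m hm
      obtain rfl : m = 0 := by omega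
      have e : A 0 * W 0 = 1 := by
        simp only [hAdef, hA₀, Finset.range_zero, Finset.sum_empty, mul_zero, Real.exp_zero, mul_one]
        exact one_div_mul_cancel (hWp 0).ne'
      rw [e, h.g_zero, h.s_zero]
      simp [h.norm_eq]
    | succ n ih =>
      intro m hm
      rcases Nat.lt_or_ge m (n + 1) with hlt | hge
      · exact ih m (by omega)
      obtain rfl : m = n + 1 := by omega
      have hg' := hg (A n) n fun m hm => by
        obtain ⟨i1, i2⟩ := ih m hm
        have := mul_le_mul_of_nonneg_right (hAmono hm) (hWp m).le
        exact ⟨i1.trans this, i2.trans this⟩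
      have hs := h.s_succ n
      have hs' : ‖s (n + 1)‖ ≤ ‖g (n + 1)‖ + ‖(n : ℂ) + ν‖ * ‖s n‖ := by
        calc ‖s (n + 1)‖ = ‖ω * s (n + 1)‖ := by rw [norm_mul, h.norm_eq, one_mul]
          _ ≤ _ := by rw [hs, ← norm_mul]; exact norm_add_le _ _
      have hs2 : ‖(n : ℂ) + ν‖ * ‖s n‖ ≤ A n * ((1 + c₂ / ((n : ℝ) + 2) ^ 2) * W (n + 1)) := by
        calc _ ≤ ‖(n : ℂ) + ν‖ * (A n * W n) := by gcongr; exact (ih n le_rfl).1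
          _ = A n * (‖(n : ℂ) + ν‖ * W n) := by ring
          _ ≤ _ := mul_le_mul_of_nonneg_left (h₂ n) (hAp n).le
      have hstep : C₁ * A n * W (n + 1) / ((n : ℝ) + 2) ^ 2 +
          A n * ((1 + c₂ / ((n : ℝ) + 2) ^ 2) * W (n + 1)) =
          A n * (1 + C / ((n : ℝ) + 2) ^ 2) * W (n + 1) := by rw [hC]; ring
      have hfin := mul_le_mul_of_nonneg_right (hAsucc n) (hWp (n + 1)).le
      refine ⟨by linarith, ?_⟩
      have : 0 ≤ A n * ((1 + c₂ / ((n : ℝ) + 2) ^ 2) * W (n + 1)) := by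
        have := hAp n; have := hWp (n + 1); positivity
      linarith
  set B := A₀ * Real.exp C with hB
  have hAB : ∀ n, A n ≤ B := fun n => by
    simp only [hAdef, hB]
    gcongr
    exact mul_le_of_le_one_right (by positivity) (sum_inv_sq_le n)
  have hall : ∀ n, ‖s n‖ ≤ B * W n ∧ ‖g n‖ ≤ B * W n := fun n => by
    obtain ⟨i1, i2⟩ := hrec n n le_rfl
    have := mul_le_mul_of_nonneg_right (hAB n) (hWp n).le
    exact ⟨i1.trans this, i2.trans this⟩
  have hBp : 0 < B := by positivity
  refine ⟨B * (1 + C₁), by positivity, fun n => ⟨?_, ?_⟩⟩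
  · refine (hall n).1.trans ?_
    refine mul_le_mul_of_nonneg_right ?_ (hWp n).le
    nlinarith
  · cases n with
    | zero =>
      refine (hall 0).2.trans ?_
      have := hWp 0
      simp only [Nat.cast_zero, zero_add, one_pow, div_one]
      refine mul_le_mul_of_nonneg_right ?_ this.le
      nlinarith
    | succ n =>
      refine (hg B n fun m _ => hall m).trans ?_
      push_cast
      rw [show (n : ℝ) + 1 + 1 = n + 2 by ring]
      have := hWp (n + 1)
      refine div_le_div_of_nonneg_right ?_ (by positivity)
      refine mul_le_mul_of_nonneg_right ?_ this.le
      nlinarith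

/-- After division by the Gamma function the dominant part of the recursion cancels, and the
increment is `ω^n g_{n+1} / Γ(n + 1 + ν) = O(n^{-2})`. The factor `2` in the majorant `2A/n`
compensates for replacing `Γ(n + Re ν)` by `|Γ(n + ν)|`. -/
theorem exists_tendsto (h : FormalSystem ω ν Pc Hc s g K κ) (hn₀ : BaseIndex ν n₀) :
    ∃ R : ℂ, Tendsto (fun n : ℕ => s n * ω ^ n / Complex.Gamma (n + ν)) atTop (𝓝 R) ∧
      ∃ C : ℝ, 0 ≤ C ∧ ∀ n, n₀ ≤ n → ‖s n * ω ^ n / Complex.Gamma (n + ν) - R‖ ≤ C / n := by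
  obtain ⟨A, hA, hb⟩ := h.exists_norm_le hn₀
  have hb0 : Tendsto (fun n : ℕ => 2 * A / (n : ℝ)) atTop (𝓝 0) :=
    tendsto_const_div_atTop_nhds_zero_nat _
  obtain ⟨R, hR, hR'⟩ := exists_tendsto_of_norm_sub_le_sub (n₀ := n₀)
    (f := fun n : ℕ => s n * ω ^ n / Complex.Gamma (n + ν)) hb0 (by
    intro n hn
    have hn1 := hn₀.natCast_one_le hn
    have hG0 : 0 < Real.Gamma ((n : ℝ) + ν.re) := hn₀.Gamma_pos hn
    have hG1 : 0 < Real.Gamma (((n + 1 : ℕ) : ℝ) + ν.re) := hn₀.Gamma_pos (by omega)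
    have hN0 : Complex.Gamma (n + ν) ≠ 0 := fun h0 => by
      have := hn₀.le_norm n hn; rw [h0] at this; simp at this; linarith
    have hN1 : Complex.Gamma ((n + 1 : ℕ) + ν) ≠ 0 := fun h0 => by
      have := hn₀.le_norm (n + 1) (by omega); rw [h0] at this; simp at this hG1; linarith
    have hne : (n : ℂ) + ν ≠ 0 := fun h0 => by
      have h1 := congrArg Complex.re h0
      simp only [Complex.add_re, Complex.natCast_re, Complex.zero_re] at h1
      linarith [hn₀.pos_arg hn]
    have e1 : Complex.Gamma ((n + 1 : ℕ) + ν) = (n + ν) * Complex.Gamma (n + ν) := by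
      rw [← Complex.Gamma_add_one _ hne]; congr 1; push_cast; ring
    have e2 : s (n + 1) * ω ^ (n + 1) / Complex.Gamma ((n + 1 : ℕ) + ν) -
        s n * ω ^ n / Complex.Gamma (n + ν) = ω ^ n * g (n + 1) / Complex.Gamma ((n + 1 : ℕ) + ν) := by
      rw [show s (n + 1) * ω ^ (n + 1) = ω ^ n * (ω * s (n + 1)) by ring, h.s_succ, e1]
      field_simp
      ring
    rw [e2, norm_div, norm_mul, norm_pow, h.norm_eq, one_pow, one_mul, div_le_iff₀ (norm_pos_iff.mpr hN1)]
    have b1 := (hb (n + 1)).2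
    rw [BaseIndex.gammaWeight_eq n₀ (by omega : n₀ ≤ n + 1)] at b1
    have b2 := hn₀.le_norm (n + 1) (by omega)
    refine b1.trans ?_
    have b3 : A / (((n + 1 : ℕ) : ℝ) + 1) ^ 2 ≤ A / n - A / (n + 1 : ℕ) := by
      push_cast
      rw [div_sub_div _ _ (by positivity) (by positivity), div_le_div_iff₀ (by positivity) (by positivity)]
      nlinarith [mul_nonneg hA.le (by positivity : (0:ℝ) ≤ n), mul_nonneg hA.le (by positivity : (0:ℝ) ≤ n * n)]
    have b4 : 0 ≤ A / (((n + 1 : ℕ) : ℝ) + 1) ^ 2 := by positivity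
    calc A * Real.Gamma (((n + 1 : ℕ) : ℝ) + ν.re) / (((n + 1 : ℕ) : ℝ) + 1) ^ 2
        = (A / (((n + 1 : ℕ) : ℝ) + 1) ^ 2) * Real.Gamma (((n + 1 : ℕ) : ℝ) + ν.re) := by ring
      _ ≤ (A / n - A / (n + 1 : ℕ)) * (2 * ‖Complex.Gamma ((n + 1 : ℕ) + ν)‖) := by
          gcongr; exact b4.trans b3
      _ = _ := by ring)
  exact ⟨R, hR, 2 * A, by positivity, hR'⟩

end FormalSystem

/-! ### Weights, the integrating factor, and partial sums. -/

/-- The function `X^a e^{-X}`. -/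
def powExp (a X : ℝ) : ℝ := X ^ a * Real.exp (-X)

theorem leastTerm_eq_powExp (ρ X : ℝ) : leastTerm ρ X = powExp (ρ - 1 / 2) X := rfl

theorem powExp_pos (a : ℝ) {X : ℝ} (hX : 0 < X) : 0 < powExp a X :=
  mul_pos (Real.rpow_pos_of_pos hX _) (Real.exp_pos _)

theorem powExp_add_nat (a : ℝ) (k : ℕ) {X : ℝ} (hX : 0 < X) :
    powExp (a + k) X = X ^ k * powExp a X := by
  rw [powExp, powExp, Real.rpow_add_natCast hX.ne']; ring

theorem exists_powExp_le (a : ℝ) {X₀ : ℝ} (hX₀ : 0 < X₀) :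
    ∃ C : ℝ, 1 ≤ C ∧ ∀ X s : ℝ, X₀ < X → X ≤ s → s ≤ X + 1 →
      powExp a s ≤ C * powExp a X ∧ powExp a X ≤ C * powExp a s := by
  have hq : 1 ≤ 1 + 1 / X₀ := by have : 0 < 1 / X₀ := by positivity
                                 linarith
  have hqa : 1 ≤ (1 + 1 / X₀) ^ |a| := Real.one_le_rpow hq (abs_nonneg _)
  have he : 1 ≤ Real.exp 1 := Real.one_le_exp zero_le_one
  refine ⟨(1 + 1 / X₀) ^ |a| * Real.exp 1, by nlinarith, fun X s hX hs hs' => ?_⟩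
  have hXp : 0 < X := hX₀.trans hX
  have hsp : 0 < s := hXp.trans_le hs
  have r1 : s ≤ (1 + 1 / X₀) * X := by
    have : 1 ≤ 1 / X₀ * X := by rw [one_div_mul_eq_div, one_le_div hX₀]; exact hX.le
    linarith
  have r2 : X ≤ (1 + 1 / X₀) * s := by nlinarith
  have h1 := rpow_le_rpow_abs_mul a hsp hXp hq r1 r2
  have h2 := rpow_le_rpow_abs_mul a hXp hsp hq r2 r1
  have hXa : 0 < X ^ a := Real.rpow_pos_of_pos hXp _
  have hsa : 0 < s ^ a := Real.rpow_pos_of_pos hsp _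
  have e1 : Real.exp (-s) ≤ Real.exp 1 * Real.exp (-X) := by
    rw [← Real.exp_add]; exact Real.exp_le_exp.mpr (by linarith)
  have e2 : Real.exp (-X) ≤ Real.exp 1 * Real.exp (-s) := by
    rw [← Real.exp_add]; exact Real.exp_le_exp.mpr (by linarith)
  constructor
  · calc s ^ a * Real.exp (-s) ≤ ((1 + 1 / X₀) ^ |a| * X ^ a) * (Real.exp 1 * Real.exp (-X)) := by
          gcongr
      _ = _ := by unfold powExp; ring
  · calc X ^ a * Real.exp (-X) ≤ ((1 + 1 / X₀) ^ |a| * s ^ a) * (Real.exp 1 * Real.exp (-s)) := by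
          gcongr
      _ = _ := by unfold powExp; ring

/-- The weight `X^a e^{-X} e^{L/X}`. -/
def volterraWeight (a L X : ℝ) : ℝ := powExp a X * Real.exp (L / X)

theorem volterraWeight_pos (a L : ℝ) {X : ℝ} (hX : 0 < X) : 0 < volterraWeight a L X :=
  mul_pos (powExp_pos a hX) (Real.exp_pos _)

theorem powExp_le_volterraWeight (a : ℝ) {L X : ℝ} (hL : 0 ≤ L) (hX : 0 < X) :
    powExp a X ≤ volterraWeight a L X :=
  le_mul_of_one_le_right (powExp_pos a hX).le (Real.one_le_exp (by positivity))

theorem volterraWeight_le (a : ℝ) {L X₀ X : ℝ} (hL : 0 ≤ L) (hX₀ : 0 < X₀) (hX : X₀ < X) :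
    volterraWeight a L X ≤ Real.exp (L / X₀) * powExp a X := by
  rw [volterraWeight, mul_comm]
  have := powExp_pos a (hX₀.trans hX)
  gcongr

theorem hasDerivAt_volterraWeight (a L : ℝ) {X : ℝ} (hX : 0 < X) :
    HasDerivAt (volterraWeight a L) (-(volterraWeight a L X * (1 - a / X + L / X ^ 2))) X := by
  have h1 : HasDerivAt (fun x : ℝ => x ^ a) (a * X ^ (a - 1)) X :=
    Real.hasDerivAt_rpow_const (Or.inl hX.ne')
  have h2 : HasDerivAt (fun x : ℝ => Real.exp (-x)) (Real.exp (-X) * (-1)) X :=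
    (hasDerivAt_neg X).exp
  have h3 : HasDerivAt (fun x : ℝ => Real.exp (L / x)) (Real.exp (L / X) * (L * -(X ^ 2)⁻¹)) X := by
    have := ((hasDerivAt_inv hX.ne').const_mul L).exp
    simpa only [div_eq_mul_inv] using this
  refine HasDerivAt.congr_deriv (f := volterraWeight a L) ((h1.mul h2).mul h3) ?_
  simp only [volterraWeight, powExp, Pi.mul_apply]
  rw [Real.rpow_sub hX, Real.rpow_one]
  field_simp
  ring

/-- The condition on `L` makes the discriminant of `X² - (a + Λ) X + L` nonpositive. The factor
`e^{L/X}` thus forces the logarithmic derivative of the weight below `-Λ/X` on the whole half-line,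
and not only for large `X`. -/
theorem volterraWeight_deriv_ge {a L Λ X : ℝ} (hL : (a + Λ) ^ 2 ≤ 4 * L) (hX : 0 < X) :
    Λ * (volterraWeight a L X / X) ≤ volterraWeight a L X * (1 - a / X + L / X ^ 2) := by
  have h1 : Λ / X ≤ 1 - a / X + L / X ^ 2 := by
    have e : 1 - a / X + L / X ^ 2 - Λ / X = (X ^ 2 - (a + Λ) * X + L) / X ^ 2 := by
      field_simp; ring
    have : 0 ≤ (X ^ 2 - (a + Λ) * X + L) / X ^ 2 := by
      apply div_nonneg _ (by positivity)
      nlinarith [sq_nonneg (2 * X - (a + Λ))]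
    linarith
  have := mul_le_mul_of_nonneg_left h1 (volterraWeight_pos a L hX).le
  calc _ = volterraWeight a L X * (Λ / X) := by ring
    _ ≤ _ := this

theorem tendsto_volterraWeight (a L : ℝ) : Tendsto (volterraWeight a L) atTop (𝓝 0) := by
  have h1 : Tendsto (fun x : ℝ => x ^ a * Real.exp (-1 * x)) atTop (𝓝 0) :=
    tendsto_rpow_mul_exp_neg_mul_atTop_nhds_zero a 1 one_pos
  have h2 : Tendsto (fun x : ℝ => Real.exp (L / x)) atTop (𝓝 (Real.exp 0)) :=
    (Real.continuous_exp.tendsto 0).comp (tendsto_const_nhds.div_atTop tendsto_id)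
  have := h1.mul h2
  simp only [zero_mul, neg_mul, one_mul] at this
  exact this

theorem volterraWeight_antitone {a L Λ : ℝ} (hΛ : 0 ≤ Λ) (hL : (a + Λ) ^ 2 ≤ 4 * L) :
    AntitoneOn (volterraWeight a L) (Set.Ioi 0) := by
  refine antitoneOn_of_deriv_nonpos (convex_Ioi 0)
    (fun x hx => (hasDerivAt_volterraWeight a L hx).continuousAt.continuousWithinAt)
    (fun x hx => ?_) (fun x hx => ?_)
  · rw [interior_Ioi] at hx
    exact (hasDerivAt_volterraWeight a L hx).differentiableAt.differentiableWithinAt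
  · rw [interior_Ioi] at hx
    have hx' : 0 < x := hx
    rw [(hasDerivAt_volterraWeight a L hx).deriv]
    have h1 := volterraWeight_deriv_ge hL hx'
    have h2 : 0 ≤ Λ * (volterraWeight a L x / x) := by
      have := volterraWeight_pos a L hx'
      positivity
    linarith

/-- The weight decreases at least at the rate `Λ` times the integrand, and its total decrease on
`(X, ∞)` is its value at `X`. As `Λ` is at our disposal, integral operators with kernels of this
size can be made contracting without shortening the interval. -/
theorem integrableOn_volterraWeight_div {a L Λ X : ℝ} (hΛ : 0 < Λ) (hL : (a + Λ) ^ 2 ≤ 4 * L)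
    (hX : 0 < X) :
    IntegrableOn (fun s => volterraWeight a L s / s) (Set.Ioi X) ∧
      ∫ s in Set.Ioi X, volterraWeight a L s / s ≤ volterraWeight a L X / Λ := by
  have hd : ∀ x ∈ Set.Ici X, HasDerivAt (volterraWeight a L)
      (-(volterraWeight a L x * (1 - a / x + L / x ^ 2))) x := fun x hx =>
    hasDerivAt_volterraWeight a L (hX.trans_le hx)
  have hge : ∀ x ∈ Set.Ioi X, Λ * (volterraWeight a L x / x) ≤
      volterraWeight a L x * (1 - a / x + L / x ^ 2) := fun x hx =>
    volterraWeight_deriv_ge hL (hX.trans hx)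
  have hpos : ∀ x ∈ Set.Ioi X, 0 ≤ volterraWeight a L x / x := fun x hx =>
    (div_pos (volterraWeight_pos a L (hX.trans hx)) (hX.trans hx)).le
  have hnp : ∀ x ∈ Set.Ioi X, -(volterraWeight a L x * (1 - a / x + L / x ^ 2)) ≤ 0 := fun x hx => by
    have := hge x hx
    have := mul_nonneg hΛ.le (hpos x hx)
    linarith
  have hi := integrableOn_Ioi_deriv_of_nonpos' hd hnp (tendsto_volterraWeight a L)
  have hv := integral_Ioi_of_hasDerivAt_of_nonpos' hd hnp (tendsto_volterraWeight a L)
  have hi2 : IntegrableOn (fun s => Λ * (volterraWeight a L s / s)) (Set.Ioi X) := by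
    refine Integrable.mono' hi.neg ?_ ?_
    · refine ContinuousOn.aestronglyMeasurable (fun x hx => ?_) measurableSet_Ioi
      have hx' : 0 < x := hX.trans hx
      exact (((hasDerivAt_volterraWeight a L hx').continuousAt.div continuousAt_id
        hx'.ne').const_mul Λ).continuousWithinAt
    · refine (ae_restrict_iff' measurableSet_Ioi).mpr (ae_of_all _ fun x hx => ?_)
      rw [Real.norm_of_nonneg (mul_nonneg hΛ.le (hpos x hx))]
      simpa using hge x hx
  have hi3 : IntegrableOn (fun s => volterraWeight a L s / s) (Set.Ioi X) := by
    have := hi2.const_mul Λ⁻¹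
    simp only [← mul_assoc, inv_mul_cancel₀ hΛ.ne', one_mul] at this
    exact this
  refine ⟨hi3, ?_⟩
  rw [le_div_iff₀' hΛ, ← integral_const_mul]
  calc _ ≤ ∫ x in Set.Ioi X, -(-(volterraWeight a L x * (1 - a / x + L / x ^ 2))) := by
        refine setIntegral_mono_on hi2 hi.neg measurableSet_Ioi fun x hx => ?_
        rw [neg_neg]; exact hge x hx
    _ = _ := by rw [integral_neg, hv]; simp

/-- A lower bound for the decrease of the weight over a unit interval. -/
theorem exists_powExp_le_volterraWeight_sub {a L : ℝ} (hL : (a + 1) ^ 2 ≤ 4 * L) :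
    ∃ C : ℝ, 0 < C ∧ ∀ k : ℕ, 1 ≤ k →
      powExp (a - 1) k ≤ C * (volterraWeight a L k - volterraWeight a L (k + 1)) := by
  have hL0 : 0 ≤ L := by nlinarith [sq_nonneg (a + 1)]
  obtain ⟨C, hC, h⟩ := exists_powExp_le (a - 1) (X₀ := 1 / 2) (by norm_num)
  refine ⟨C, by linarith, fun k hk => ?_⟩
  have hk1 : (1 : ℝ) ≤ k := by exact_mod_cast hk
  have hkp : (0 : ℝ) < k := by linarith
  obtain ⟨c, hc, hc'⟩ := exists_hasDerivAt_eq_slope (volterraWeight a L)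
    (fun x => -(volterraWeight a L x * (1 - a / x + L / x ^ 2)))
    (show (k : ℝ) < k + 1 by linarith)
    (fun x hx => (hasDerivAt_volterraWeight a L (hkp.trans_le hx.1)).continuousAt.continuousWithinAt)
    (fun x hx => hasDerivAt_volterraWeight a L (hkp.trans hx.1))
  rw [add_sub_cancel_left, div_one] at hc'
  have hcp : 0 < c := hkp.trans hc.1
  have h1 := volterraWeight_deriv_ge hL hcp
  have h2 := (h k c (by linarith) hc.1.le hc.2.le).2
  have h3 : powExp (a - 1) c ≤ 1 * (volterraWeight a L c / c) := by
    rw [one_mul]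
    have e : powExp (a - 1) c = powExp a c / c := by
      rw [powExp, powExp, Real.rpow_sub hcp, Real.rpow_one]; ring
    rw [e]
    gcongr
    exact powExp_le_volterraWeight a hL0 hcp
  refine h2.trans ?_
  gcongr
  linarith

/-- The integrating factor `X^{-ν} e^{ωX}`. -/
def intFactor (ω ν : ℂ) (X : ℝ) : ℂ := Complex.exp (ω * X - ν * (Real.log X : ℂ))

theorem intFactor_ne_zero (ω ν : ℂ) (X : ℝ) : intFactor ω ν X ≠ 0 := Complex.exp_ne_zero _

theorem hasDerivAt_intFactor (ω ν : ℂ) {X : ℝ} (hX : 0 < X) :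
    HasDerivAt (intFactor ω ν) (intFactor ω ν X * (ω - ν / X)) X := by
  have h1 : HasDerivAt (fun x : ℝ => ω * (x : ℂ)) (ω * 1) X :=
    (HasDerivAt.ofReal_comp (hasDerivAt_id X)).const_mul ω
  have h2 : HasDerivAt (fun x : ℝ => ν * (Real.log x : ℂ)) (ν * ((X⁻¹ : ℝ) : ℂ)) X :=
    (HasDerivAt.ofReal_comp (Real.hasDerivAt_log hX.ne')).const_mul ν
  refine HasDerivAt.congr_deriv (f := intFactor ω ν) (h1.sub h2).cexp ?_
  simp [intFactor, div_eq_mul_inv]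

theorem norm_intFactor (ω ν : ℂ) {X : ℝ} (hX : 0 < X) :
    ‖intFactor ω ν X‖ = X ^ (-ν.re) * Real.exp (ω.re * X) := by
  rw [intFactor, Complex.norm_exp, Real.rpow_def_of_pos hX, ← Real.exp_add]
  congr 1
  simp
  ring

theorem norm_intFactor_mul_powExp (ω ν : ℂ) (a : ℝ) {X : ℝ} (hX : 0 < X) :
    ‖intFactor ω ν X‖ * powExp (ν.re + a) X = X ^ a * Real.exp (-(1 - ω.re) * X) := by
  rw [norm_intFactor _ _ hX, powExp, mul_mul_mul_comm, ← Real.rpow_add hX, ← Real.exp_add]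
  congr 2 <;> ring

theorem continuousOn_intFactor (ω ν : ℂ) : ContinuousOn (intFactor ω ν) (Set.Ioi 0) :=
  fun _ hx => (hasDerivAt_intFactor ω ν hx).continuousAt.continuousWithinAt

/-- The partial sum `∑_{j < n} c_j X^{-j}`. -/
def partialSum (c : ℕ → ℂ) (n : ℕ) (X : ℝ) : ℂ := ∑ j ∈ Finset.range n, c j / (X : ℂ) ^ j

theorem partialSum_succ (c : ℕ → ℂ) (n : ℕ) (X : ℝ) :
    partialSum c (n + 1) X = partialSum c n X + c n / (X : ℂ) ^ n :=
  Finset.sum_range_succ _ _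

theorem norm_div_pow {X : ℝ} (hX : 0 < X) (z : ℂ) (n : ℕ) : ‖z / (X : ℂ) ^ n‖ = ‖z‖ / X ^ n := by
  rw [norm_div, norm_pow, Complex.norm_real, Real.norm_of_nonneg hX.le]

theorem hasDerivAt_div_pow (z : ℂ) (n : ℕ) {X : ℝ} (hX : 0 < X) :
    HasDerivAt (fun x : ℝ => z / (x : ℂ) ^ n) (-((n : ℂ) * z / (X : ℂ) ^ (n + 1))) X := by
  have hXc : (X : ℂ) ≠ 0 := by exact_mod_cast hX.ne'
  have h1 : HasDerivAt (fun x : ℝ => (x : ℂ) ^ n) (n * (X : ℂ) ^ (n - 1) * 1) X :=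
    (HasDerivAt.ofReal_comp (hasDerivAt_id X)).pow n
  refine (((h1.inv (pow_ne_zero n hXc)).const_mul z).congr_deriv ?_).congr_of_eventuallyEq
    (Eventually.of_forall fun x => div_eq_mul_inv _ _)
  rcases n with _ | n
  · simp
  · simp only [Nat.add_sub_cancel, mul_one]
    field_simp
    ring

theorem hasDerivAt_partialSum (c : ℕ → ℂ) (n : ℕ) {X : ℝ} (hX : 0 < X) :
    HasDerivAt (partialSum c n) (-∑ j ∈ Finset.range n, (j : ℂ) * c j / (X : ℂ) ^ (j + 1)) X := by
  rw [← Finset.sum_neg_distrib]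
  have := HasDerivAt.sum (u := Finset.range n) fun j _ => hasDerivAt_div_pow (c j) j hX
  refine this.congr_of_eventuallyEq (Eventually.of_forall fun x => ?_)
  simp [partialSum]

theorem continuousOn_partialSum (c : ℕ → ℂ) (n : ℕ) :
    ContinuousOn (partialSum c n) (Set.Ioi 0) :=
  fun _ hx => (hasDerivAt_partialSum c n hx).continuousAt.continuousWithinAt

/-! ### Truncations of the formal solution and their residuals. -/

/-- The system `u' = G - (ω - ν/X) u`, `G' = -(P G + H u)` on `(X₀, ∞)`, with coefficients that
have Gevrey expansions, together with a formal solution. -/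
structure ScaledSystem (X₀ : ℝ) (ω ν : ℂ) (P H : ℝ → ℂ) (Pc Hc s g : ℕ → ℂ) (K κ : ℝ) : Prop
    extends FormalSystem ω ν Pc Hc s g K κ where
  X₀_pos : 0 < X₀
  P_meas : AEStronglyMeasurable P (volume.restrict (Set.Ioi X₀))
  H_meas : AEStronglyMeasurable H (volume.restrict (Set.Ioi X₀))
  P_rem : ∀ (n : ℕ) (X : ℝ), X₀ < X →
    ‖P X - partialSum Pc n X‖ ≤ K * κ ^ n * n.factorial / X ^ n
  H_rem : ∀ (n : ℕ) (X : ℝ), X₀ < X →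
    ‖H X - partialSum Hc n X‖ ≤ K * κ ^ n * n.factorial / X ^ n

namespace FormalSystem

variable {ω ν : ℂ} {Pc Hc s g : ℕ → ℂ} {K κ : ℝ} {n₀ : ℕ}

/-- Multiplying the `k`-th term by `P` and `H` truncated at `n + 1 - k` collects precisely the
products of total order at most `n`. Summed along diagonals, they are the right sides of the
recursion for `g`. -/
theorem partialSum_identity (h : FormalSystem ω ν Pc Hc s g K κ) (n : ℕ) {X : ℝ} (hX : 0 < X) :
    ∑ k ∈ Finset.range n, (g k * partialSum Pc (n + 1 - k) X +
      s k * partialSum Hc (n + 1 - k) X) / (X : ℂ) ^ k =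
    ∑ j ∈ Finset.range n, (j : ℂ) * g j / (X : ℂ) ^ (j + 1) := by
  have hXc : (X : ℂ) ≠ 0 := by exact_mod_cast hX.ne'
  set F : ℕ → ℕ → ℂ := fun k i => (Pc i * g k + Hc i * s k) / (X : ℂ) ^ (k + i) with hF
  have h1 : ∑ k ∈ Finset.range n, (g k * partialSum Pc (n + 1 - k) X +
      s k * partialSum Hc (n + 1 - k) X) / (X : ℂ) ^ k =
      ∑ k ∈ Finset.range (n + 1), ∑ i ∈ Finset.range (n + 1 - k), F k i := by
    rw [Finset.sum_range_succ]
    -- The column `k = n`, needed for a full triangle, contains only the index `i = 0`, where `P`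
    -- and `H` have no coefficient.
    have e : ∑ i ∈ Finset.range (n + 1 - n), F n i = 0 := by
      rw [show n + 1 - n = 1 by omega]
      simp [hF, h.P_zero, h.H_zero]
    rw [e, add_zero]
    refine Finset.sum_congr rfl fun k _ => ?_
    rw [partialSum, partialSum, Finset.mul_sum, Finset.mul_sum, ← Finset.sum_add_distrib,
      Finset.sum_div]
    refine Finset.sum_congr rfl fun i _ => ?_
    simp only [hF, pow_add]
    field_simp
  rw [h1, ← Finset.sum_range_diag_flip, Finset.sum_range_succ']
  have e0 : ∑ k ∈ Finset.range (0 + 1), F k (0 - k) = 0 := by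
    simp [hF, h.P_zero, h.H_zero]
  rw [e0, add_zero]
  refine Finset.sum_congr rfl fun j _ => ?_
  rw [h.g_eq, Finset.sum_div, ← Finset.sum_range_reflect]
  refine Finset.sum_congr rfl fun i hi => ?_
  have hi' : i ≤ j + 1 := by simpa [Nat.lt_succ_iff] using hi
  have a1 : j + 1 + 1 - 1 - i = j + 1 - i := by omega
  have a2 : j + 1 - (j + 1 - i) = i := by omega
  have a3 : j + 1 - i + i = j + 1 := by omega
  simp only [hF, a1, a2, a3]

/-- All powers cancel by the recursion except a single boundary term, whose numerator `ω s_{q+1} -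
g_{q+1}` equals `(q + ν) s_q`. -/
theorem partialSum_ode (h : FormalSystem ω ν Pc Hc s g K κ) (q : ℕ) {X : ℝ} (hX : 0 < X) :
    (-∑ j ∈ Finset.range (q + 1), (j : ℂ) * s j / (X : ℂ) ^ (j + 1)) +
      (ω - ν / X) * partialSum s (q + 1) X =
    partialSum g (q + 1) X - (ω * s (q + 1) - g (q + 1)) / (X : ℂ) ^ (q + 1) := by
  have hXc : (X : ℂ) ≠ 0 := by exact_mod_cast hX.ne'
  induction q with
  | zero =>
    simp only [partialSum, zero_add, Finset.range_one, Finset.sum_singleton]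
    rw [show (1 : ℕ) = 0 + 1 from rfl, h.s_succ, h.g_zero]
    simp
    field_simp
  | succ q ih =>
    have e := h.s_succ (q + 1)
    rw [Finset.sum_range_succ, partialSum_succ, partialSum_succ g, e]
    have : (-(∑ j ∈ Finset.range (q + 1), (j : ℂ) * s j / (X : ℂ) ^ (j + 1) +
        ((q + 1 : ℕ) : ℂ) * s (q + 1) / (X : ℂ) ^ (q + 1 + 1))) +
        (ω - ν / X) * (partialSum s (q + 1) X + s (q + 1) / (X : ℂ) ^ (q + 1)) =
        ((-∑ j ∈ Finset.range (q + 1), (j : ℂ) * s j / (X : ℂ) ^ (j + 1)) +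
        (ω - ν / X) * partialSum s (q + 1) X) + ((ω - ν / X) * (s (q + 1) / (X : ℂ) ^ (q + 1)) -
        ((q + 1 : ℕ) : ℂ) * s (q + 1) / (X : ℂ) ^ (q + 1 + 1)) := by ring
    rw [this, ih]
    rw [pow_succ (X : ℂ) (q + 1)]
    field_simp
    ring

theorem hasDerivAt_intFactor_mul_partialSum (h : FormalSystem ω ν Pc Hc s g K κ) {n : ℕ}
    (hn : 1 ≤ n) {X : ℝ} (hX : 0 < X) :
    HasDerivAt (fun x => intFactor ω ν x * partialSum s n x)
      (intFactor ω ν X * (partialSum g n X - (ω * s n - g n) / (X : ℂ) ^ n)) X := by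
  obtain ⟨q, rfl⟩ : ∃ q, n = q + 1 := ⟨n - 1, by omega⟩
  refine ((hasDerivAt_intFactor ω ν hX).mul (hasDerivAt_partialSum s (q + 1) hX)).congr_deriv ?_
  rw [← h.partialSum_ode q hX]
  ring

end FormalSystem

namespace ScaledSystem

variable {X₀ : ℝ} {ω ν : ℂ} {P H : ℝ → ℂ} {Pc Hc s g : ℕ → ℂ} {K κ : ℝ} {n₀ : ℕ}

theorem norm_P_le (h : ScaledSystem X₀ ω ν P H Pc Hc s g K κ) {X : ℝ} (hX : X₀ < X) :
    ‖P X‖ ≤ 2 * K / X ^ 2 := by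
  have h1 := h.P_rem 2 X hX
  have hXp := h.X₀_pos.trans hX
  have e : partialSum Pc 2 X = 0 := by simp [partialSum, Finset.sum_range_succ, h.P_zero, h.P_one]
  rw [e, sub_zero] at h1
  refine h1.trans ?_
  have : κ ^ 2 ≤ 1 := pow_le_one₀ h.κ_pos.le h.κ_lt.le
  have hK := h.K_nonneg
  rw [Nat.factorial_two, Nat.cast_ofNat]
  gcongr ?_ / _
  nlinarith

theorem norm_H_le (h : ScaledSystem X₀ ω ν P H Pc Hc s g K κ) {X : ℝ} (hX : X₀ < X) :
    ‖H X‖ ≤ 2 * K / X ^ 2 := by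
  have h1 := h.H_rem 2 X hX
  have hXp := h.X₀_pos.trans hX
  have e : partialSum Hc 2 X = 0 := by simp [partialSum, Finset.sum_range_succ, h.H_zero, h.H_one]
  rw [e, sub_zero] at h1
  refine h1.trans ?_
  have : κ ^ 2 ≤ 1 := pow_le_one₀ h.κ_pos.le h.κ_lt.le
  have hK := h.K_nonneg
  rw [Nat.factorial_two, Nat.cast_ofNat]
  gcongr ?_ / _
  nlinarith

/-- The polynomial part of the residual of the second equation is removed by `partialSum_identity`;
only the remainders of `P` and `H` are left. -/
theorem residual_eq (h : ScaledSystem X₀ ω ν P H Pc Hc s g K κ) (n : ℕ) {X : ℝ} (hX : X₀ < X) :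
    P X * partialSum g n X + H X * partialSum s n X -
      ∑ j ∈ Finset.range n, (j : ℂ) * g j / (X : ℂ) ^ (j + 1) =
    ∑ k ∈ Finset.range n, (g k * (P X - partialSum Pc (n + 1 - k) X) +
      s k * (H X - partialSum Hc (n + 1 - k) X)) / (X : ℂ) ^ k := by
  rw [← h.partialSum_identity n (h.X₀_pos.trans hX), partialSum, partialSum, Finset.mul_sum,
    Finset.mul_sum, ← Finset.sum_add_distrib, ← Finset.sum_sub_distrib]
  refine Finset.sum_congr rfl fun k _ => ?_
  ring

/-- The remainders of order `n + 1 - k` bring in `κ^{n+1-k} (n + 1 - k)!`, and the sum over `k` is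
again a convolution with the weight, of size `gammaWeight` at `n - 1`. As `X ≤ n + 1`, the product
of this weight with `X` is bounded by the weight at `n`, which yields the gain `X^{-2}` over the
model term. -/
theorem exists_residual_le (h : ScaledSystem X₀ ω ν P H Pc Hc s g K κ) (hn₀ : BaseIndex ν n₀) :
    ∃ C : ℝ, 0 ≤ C ∧ ∀ n : ℕ, n₀ < n → ∀ X : ℝ, X₀ < X → X ≤ n + 1 →
      ‖P X * partialSum g n X + H X * partialSum s n X -
        ∑ j ∈ Finset.range n, (j : ℂ) * g j / (X : ℂ) ^ (j + 1)‖ ≤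
        C * modelTerm ν.re n X / X ^ 2 := by
  obtain ⟨A, hA, hb⟩ := h.exists_norm_le hn₀
  obtain ⟨S, hS, hconv⟩ := hn₀.exists_convolution_le h.κ_pos h.κ_lt
  obtain ⟨c, hc, hc'⟩ := hn₀.exists_mul_gammaWeight_le
  have hK := h.K_nonneg
  have hκ := h.κ_pos
  have hWp := hn₀.gammaWeight_pos
  refine ⟨2 * K * A * S * c, by positivity, fun n hn X hX hXn => ?_⟩
  have hXp := h.X₀_pos.trans hX
  obtain ⟨q, rfl⟩ : ∃ q, n = q + 1 := ⟨n - 1, by omega⟩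
  rw [h.residual_eq _ hX]
  have h1 : ∀ k ∈ Finset.range (q + 1), ‖(g k * (P X - partialSum Pc (q + 1 + 1 - k) X) +
      s k * (H X - partialSum Hc (q + 1 + 1 - k) X)) / (X : ℂ) ^ k‖ ≤
      2 * K * A / X ^ (q + 2) *
        (κ ^ (q - k + 2) * ((q - k + 2).factorial : ℝ) * gammaWeight ν.re n₀ k) := by
    intro k hk
    have hk' : k ≤ q := by simpa [Nat.lt_succ_iff] using hk
    have e : q + 1 + 1 - k = q - k + 2 := by omega
    rw [norm_div_pow hXp, e, div_le_iff₀ (by positivity)]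
    have a1 := h.P_rem (q - k + 2) X hX
    have a2 := h.H_rem (q - k + 2) X hX
    have a3 := (hb k).1
    have a4 : ‖g k‖ ≤ A * gammaWeight ν.re n₀ k := (hb k).2.trans (div_le_self
      (by have := hWp k; positivity) (by nlinarith [(Nat.cast_nonneg k : (0 : ℝ) ≤ k)]))
    have hw := hWp k
    calc _ ≤ ‖g k‖ * ‖P X - partialSum Pc (q - k + 2) X‖ +
          ‖s k‖ * ‖H X - partialSum Hc (q - k + 2) X‖ := by
          refine (norm_add_le _ _).trans ?_
          rw [norm_mul, norm_mul]
      _ ≤ (A * gammaWeight ν.re n₀ k) * (K * κ ^ (q - k + 2) * (q - k + 2).factorial /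
            X ^ (q - k + 2)) + (A * gammaWeight ν.re n₀ k) * (K * κ ^ (q - k + 2) *
            (q - k + 2).factorial / X ^ (q - k + 2)) := by gcongr
      _ = _ := by
          rw [show X ^ (q + 2) = X ^ (q - k + 2) * X ^ k by rw [← pow_add]; congr 1; omega]
          field_simp
          ring
  refine (norm_sum_le _ _).trans ((Finset.sum_le_sum h1).trans ?_)
  rw [← Finset.mul_sum]
  have h2 : ∑ k ∈ Finset.range (q + 1),
      (κ ^ (q - k + 2) * ((q - k + 2).factorial : ℝ) * gammaWeight ν.re n₀ k) ≤
      S * gammaWeight ν.re n₀ q := by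
    refine le_trans (le_of_eq ?_) (hconv q)
    rw [← Finset.sum_range_reflect]
    refine Finset.sum_congr rfl fun i hi => ?_
    have hi' : i ≤ q := by simpa [Nat.lt_succ_iff] using hi
    rw [show q + 1 - 1 - i = q - i by omega, show q - (q - i) = i by omega]
  have h3 := hc' q
  rw [modelTerm, ← BaseIndex.gammaWeight_eq n₀ (by omega : n₀ ≤ q + 1)]
  have hq : X ≤ (q : ℝ) + 2 := by push_cast at hXn; linarith
  have h4 : gammaWeight ν.re n₀ q * X ≤ c * gammaWeight ν.re n₀ (q + 1) := by
    have := mul_le_mul_of_nonneg_left hq (hWp q).le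
    linarith
  calc 2 * K * A / X ^ (q + 2) * _ ≤ 2 * K * A / X ^ (q + 2) * (S * gammaWeight ν.re n₀ q) := by
        gcongr
    _ = 2 * K * A * S / X ^ (q + 3) * (gammaWeight ν.re n₀ q * X) := by
        rw [pow_succ X (q + 2)]; field_simp
    _ ≤ 2 * K * A * S / X ^ (q + 3) * (c * gammaWeight ν.re n₀ (q + 1)) := by gcongr
    _ = _ := by
        rw [show q + 3 = q + 1 + 2 by ring, pow_add]; field_simp

/-- Sizes of the terms near the least one. -/
theorem exists_term_le (h : ScaledSystem X₀ ω ν P H Pc Hc s g K κ) (hn₀ : BaseIndex ν n₀) {M : ℕ}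
    (hM : n₀ + 1 ≤ M) :
    ∃ C : ℝ, 1 ≤ C ∧ ∀ (k : ℕ) (X : ℝ), X₀ < X → k ≤ X → X ≤ k + 1 →
      ‖s (k + M)‖ / X ^ (k + M) ≤ C * leastTerm ν.re X ∧
      ‖g (k + M)‖ / X ^ (k + M) ≤ C * leastTerm ν.re X / X ^ 2 ∧
      ‖P X * partialSum g (k + M) X + H X * partialSum s (k + M) X -
        ∑ j ∈ Finset.range (k + M), (j : ℂ) * g j / (X : ℂ) ^ (j + 1)‖ ≤
        C * leastTerm ν.re X / X ^ 2 := by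
  obtain ⟨A, hA, hb⟩ := h.exists_norm_le hn₀
  obtain ⟨C₁, hC₁, h₁⟩ := h.exists_residual_le hn₀
  have hX₀ := h.X₀_pos
  obtain ⟨C₂, hC₂, h₂⟩ := hn₀.modelTerm_equiv_leastTerm hX₀ (M := (M : ℝ) ^ 2 / X₀) (by positivity)
  have hAC : 0 ≤ A * C₂ := mul_nonneg hA.le (by linarith)
  have hCC : 0 ≤ C₁ * C₂ := mul_nonneg hC₁ (by linarith)
  refine ⟨1 + A * C₂ + C₁ * C₂, by linarith, fun k X hX hk hk' => ?_⟩
  have hXp := hX₀.trans hX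
  have hl := leastTerm_pos ν.re hXp
  have hM1 : (1 : ℝ) ≤ M := by exact_mod_cast (by omega : 1 ≤ M)
  have h3 := (h₂ X hX (k + M) (by omega) (by
    push_cast
    have a1 : 0 ≤ (k : ℝ) + M - X := by linarith
    have a2 : (k : ℝ) + M - X ≤ M := by linarith
    have a3 : (M : ℝ) ^ 2 ≤ (M : ℝ) ^ 2 / X₀ * X := by
      rw [div_mul_eq_mul_div, le_div_iff₀ hX₀]; gcongr
    nlinarith)).1
  have hmono : ∀ B : ℝ, 0 ≤ B → B ≤ A + C₁ →
      B * (C₂ * leastTerm ν.re X) ≤ (1 + A * C₂ + C₁ * C₂) * leastTerm ν.re X := by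
    intro B _ hB
    rw [← mul_assoc]
    refine mul_le_mul_of_nonneg_right ?_ hl.le
    nlinarith
  have hXn : X ≤ ((k + M : ℕ) : ℝ) + 1 := by push_cast; linarith
  have hnX : X ^ 2 ≤ (((k + M : ℕ) : ℝ) + 1) ^ 2 := by gcongr
  have hw : gammaWeight ν.re n₀ (k + M) / X ^ (k + M) = modelTerm ν.re (k + M) X := by
    rw [BaseIndex.gammaWeight_eq n₀ (by omega : n₀ ≤ k + M)]; rfl
  have hmp := hn₀.modelTerm_pos (by omega : n₀ ≤ k + M) hXp
  refine ⟨?_, ?_, ?_⟩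
  · calc _ ≤ (A * gammaWeight ν.re n₀ (k + M)) / X ^ (k + M) := by gcongr; exact (hb _).1
      _ = A * modelTerm ν.re (k + M) X := by rw [mul_div_assoc, hw]
      _ ≤ A * (C₂ * leastTerm ν.re X) := by gcongr
      _ ≤ _ := hmono A hA.le (by linarith)
  · calc _ ≤ (A * gammaWeight ν.re n₀ (k + M) / (((k + M : ℕ) : ℝ) + 1) ^ 2) / X ^ (k + M) := by
          gcongr; exact (hb _).2
      _ ≤ (A * gammaWeight ν.re n₀ (k + M) / X ^ 2) / X ^ (k + M) := by
          have := hn₀.gammaWeight_pos (k + M)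
          gcongr
      _ = A * modelTerm ν.re (k + M) X / X ^ 2 := by rw [← hw]; field_simp
      _ ≤ A * (C₂ * leastTerm ν.re X) / X ^ 2 := by gcongr
      _ ≤ _ := by gcongr ?_ / X ^ 2; exact hmono A hA.le (by linarith)
  · calc _ ≤ C₁ * modelTerm ν.re (k + M) X / X ^ 2 := h₁ (k + M) (by omega) X hX hXn
      _ ≤ C₁ * (C₂ * leastTerm ν.re X) / X ^ 2 := by gcongr
      _ ≤ _ := by gcongr ?_ / X ^ 2; exact hmono C₁ hC₁ (by linarith)

end ScaledSystem

/-! ### Partial sums cut near the least term. -/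

/-- Each of the finitely many early terms is `O(1/X)`. The later ones are at most a constant times
the term of index `n₀ + 2`, hence `O(X^{-2})`, and their number is at most `X + M`. -/
theorem exists_partialSum_sub_le {ν : ℂ} {n₀ : ℕ} (hn₀ : BaseIndex ν n₀) {X₀ A M : ℝ}
    (hX₀ : 0 < X₀) (hM : 0 ≤ M) {c : ℕ → ℂ} (hc : ∀ n, ‖c n‖ ≤ A * gammaWeight ν.re n₀ n) :
    ∃ C : ℝ, 0 ≤ C ∧ ∀ (n : ℕ) (X : ℝ), 1 ≤ n → X₀ < X → n ≤ X + M →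
      ‖partialSum c n X - c 0‖ ≤ C / X := by
  obtain ⟨C, hC, h⟩ := hn₀.modelTerm_le_mul_of_le hX₀ hM
  have hA : 0 ≤ A := nonneg_of_mul_nonneg_left ((norm_nonneg _).trans (hc 0)) (hn₀.gammaWeight_pos 0)
  set D := A * C * Real.Gamma (((n₀ + 2 : ℕ) : ℝ) + ν.re) / X₀ ^ n₀ with hD
  have hG := hn₀.Gamma_pos (show n₀ ≤ n₀ + 2 by omega)
  have hD0 : 0 ≤ D := by positivity
  set D₁ := ∑ j ∈ Finset.range (n₀ + 2), ‖c j‖ / X₀ ^ (j - 1) with hD₁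
  have hD₁0 : 0 ≤ D₁ := Finset.sum_nonneg fun j _ => by positivity
  refine ⟨(1 + M / X₀) * D + D₁, by positivity, fun n X hn hX hnX => ?_⟩
  have hXp := hX₀.trans hX
  obtain ⟨q, rfl⟩ : ∃ q, n = q + 1 := ⟨n - 1, by omega⟩
  have e : partialSum c (q + 1) X - c 0 = ∑ j ∈ Finset.range q, c (j + 1) / (X : ℂ) ^ (j + 1) := by
    rw [partialSum, Finset.sum_range_succ']; simp
  rw [e]
  have hterm : ∀ j ∈ Finset.range q, ‖c (j + 1) / (X : ℂ) ^ (j + 1)‖ ≤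
      D / X ^ 2 + (if j + 1 < n₀ + 2 then ‖c (j + 1)‖ / X₀ ^ (j + 1 - 1) else 0) / X := by
    intro j hj
    rw [norm_div_pow hXp]
    split_ifs with hlt
    · have : ‖c (j + 1)‖ / X ^ (j + 1) ≤ ‖c (j + 1)‖ / X₀ ^ (j + 1 - 1) / X := by
        rw [Nat.add_sub_cancel, div_div, pow_succ]
        gcongr
      have : 0 ≤ D / X ^ 2 := by positivity
      linarith
    · have hjq : j + 1 ≤ q := by simpa [Nat.succ_le_iff] using hj
      have h1 := h X hX (n₀ + 2) (j + 1) (by omega) (by omega) (by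
        have : ((j + 1 : ℕ) : ℝ) ≤ q := by exact_mod_cast hjq
        push_cast at hnX this ⊢
        linarith)
      rw [zero_div, add_zero]
      calc ‖c (j + 1)‖ / X ^ (j + 1) ≤ A * gammaWeight ν.re n₀ (j + 1) / X ^ (j + 1) := by
            gcongr; exact hc _
        _ = A * modelTerm ν.re (j + 1) X := by
            rw [BaseIndex.gammaWeight_eq n₀ (by omega : n₀ ≤ j + 1), modelTerm, mul_div_assoc]
        _ ≤ A * (C * modelTerm ν.re (n₀ + 2) X) := by gcongr
        _ = A * C * Real.Gamma (((n₀ + 2 : ℕ) : ℝ) + ν.re) / X ^ n₀ / X ^ 2 := by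
            rw [modelTerm, pow_add]; field_simp
        _ ≤ _ := by rw [hD]; gcongr
  refine (norm_sum_le _ _).trans ((Finset.sum_le_sum hterm).trans ?_)
  rw [Finset.sum_add_distrib, Finset.sum_const, Finset.card_range, nsmul_eq_mul, ← Finset.sum_div]
  have h2 : ∑ j ∈ Finset.range q, (if j + 1 < n₀ + 2 then ‖c (j + 1)‖ / X₀ ^ (j + 1 - 1) else 0)
      ≤ D₁ := by
    rw [← Finset.sum_filter]
    have : ∑ j ∈ Finset.range q with j + 1 < n₀ + 2, ‖c (j + 1)‖ / X₀ ^ (j + 1 - 1) ≤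
        ∑ j ∈ Finset.range (n₀ + 1), ‖c (j + 1)‖ / X₀ ^ (j + 1 - 1) := by
      refine Finset.sum_le_sum_of_subset_of_nonneg (fun j hj => ?_) fun j _ _ => by positivity
      simp only [Finset.mem_filter, Finset.mem_range] at hj ⊢
      omega
    refine this.trans ?_
    rw [hD₁, Finset.sum_range_succ' _ (n₀ + 1)]
    have : 0 ≤ ‖c 0‖ / X₀ ^ (0 - 1) := by positivity
    linarith
  have h3 : (q : ℝ) * (D / X ^ 2) ≤ (1 + M / X₀) * D / X := by
    have : (q : ℝ) ≤ (1 + M / X₀) * X := by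
      have : M ≤ M / X₀ * X := by rw [div_mul_eq_mul_div, le_div_iff₀ hX₀]; gcongr
      push_cast at hnX
      linarith
    calc (q : ℝ) * (D / X ^ 2) ≤ ((1 + M / X₀) * X) * (D / X ^ 2) := by gcongr
      _ = _ := by field_simp
  rw [add_div]
  gcongr

theorem re_le_one_of_norm_eq_one {ω : ℂ} (h : ‖ω‖ = 1) : ω.re ≤ 1 :=
  (Complex.re_le_norm ω).trans h.le

theorem re_lt_one_of_norm_eq_one {ω : ℂ} (h : ‖ω‖ = 1) (hne : ω ≠ 1) : ω.re < 1 := by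
  refine lt_of_le_of_ne (re_le_one_of_norm_eq_one h) fun h1 => hne ?_
  have h2 : ω.re ^ 2 + ω.im ^ 2 = 1 := by
    have := Complex.sq_norm ω
    rw [h, Complex.normSq_apply] at this
    nlinarith
  rw [h1] at h2
  have h3 : ω.im = 0 := by nlinarith
  exact Complex.ext (by simpa using h1) (by simpa using h3)

/-- The function `X^{-1/2} e^{-cX}`. -/
def decayFactor (c X : ℝ) : ℝ := X ^ (-(1 / 2) : ℝ) * Real.exp (-c * X)

theorem decayFactor_pos (c : ℝ) {X : ℝ} (hX : 0 < X) : 0 < decayFactor c X :=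
  mul_pos (Real.rpow_pos_of_pos hX _) (Real.exp_pos _)

theorem decayFactor_antitone {c : ℝ} (hc : 0 ≤ c) {X t : ℝ} (hX : 0 < X) (ht : X ≤ t) :
    decayFactor c t ≤ decayFactor c X := by
  unfold decayFactor
  have h1 : t ^ (-(1 / 2) : ℝ) ≤ X ^ (-(1 / 2) : ℝ) :=
    Real.rpow_le_rpow_of_nonpos hX ht (by norm_num)
  have h2 : -c * t ≤ -c * X := by nlinarith
  gcongr

theorem tendsto_decayFactor {c : ℝ} (hc : 0 ≤ c) :
    Tendsto (fun X : ℝ => decayFactor c X) atTop (𝓝 0) := by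
  have h1 : Tendsto (fun X : ℝ => X ^ (-(1 / 2) : ℝ)) atTop (𝓝 0) :=
    tendsto_rpow_neg_atTop (by norm_num)
  refine squeeze_zero' ?_ ?_ h1
  · filter_upwards [eventually_gt_atTop 0] with X hX using (decayFactor_pos c hX).le
  · filter_upwards [eventually_gt_atTop 0] with X hX
    refine mul_le_of_le_one_right (Real.rpow_pos_of_pos hX _).le (Real.exp_le_one_iff.mpr ?_)
    nlinarith

theorem norm_intFactor_mul_leastTerm (ω ν : ℂ) {X : ℝ} (hX : 0 < X) :
    ‖intFactor ω ν X‖ * leastTerm ν.re X = decayFactor (1 - ω.re) X := by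
  rw [leastTerm_eq_powExp, sub_eq_add_neg, norm_intFactor_mul_powExp _ _ _ hX]; rfl

/-- A telescoping majorant for sums over integers. For `c > 0` the decay is geometric and nothing is
lost. For `c = 0`, which means `ω = 1`, the decrease of `k^{-1/2}` is only of order `k^{-3/2}`, so
that a factor `1/k` has to be earned elsewhere. -/
theorem exists_decayFactor_le_sub {c : ℝ} (hc : 0 ≤ c) :
    ∃ C : ℝ, 0 < C ∧ ∀ k : ℕ, 1 ≤ k →
      (if c = 0 then decayFactor c k / k else decayFactor c k) ≤
        C * (decayFactor c k - decayFactor c (k + 1)) := by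
  rcases hc.eq_or_lt with rfl | hc
  · refine ⟨4, by norm_num, fun k hk => ?_⟩
    have hk1 : (1 : ℝ) ≤ k := by exact_mod_cast hk
    have hkp : (0 : ℝ) < k := by linarith
    have e : ∀ x : ℝ, 0 < x → decayFactor 0 x = (√x)⁻¹ := fun x hx => by
      rw [decayFactor, Real.rpow_neg hx.le, ← Real.sqrt_eq_rpow]; simp
    rw [if_pos rfl, e _ hkp, e _ (by linarith)]
    have s1 : 0 < √(k : ℝ) := Real.sqrt_pos.mpr hkp
    have s2 : 0 < √((k : ℝ) + 1) := Real.sqrt_pos.mpr (by linarith)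
    have q1 : √(k : ℝ) ^ 2 = k := Real.sq_sqrt hkp.le
    have q2 : √((k : ℝ) + 1) ^ 2 = k + 1 := Real.sq_sqrt (by linarith)
    have hle : √(k : ℝ) ≤ √((k : ℝ) + 1) := Real.sqrt_le_sqrt (by linarith)
    have e2 : (√(k : ℝ))⁻¹ - (√((k : ℝ) + 1))⁻¹ =
        1 / (√(k : ℝ) * √((k : ℝ) + 1) * (√((k : ℝ) + 1) + √(k : ℝ))) := by
      field_simp
      nlinarith
    rw [e2, inv_eq_one_div, div_div, mul_one_div, div_le_div_iff₀ (by positivity) (by positivity)]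
    have : √((k : ℝ) + 1) * (√((k : ℝ) + 1) + √(k : ℝ)) ≤ 4 * k := by nlinarith
    nlinarith
  · have h1 : 0 < 1 - Real.exp (-c) := by
      have : Real.exp (-c) < 1 := by
        rw [← Real.exp_zero]; exact Real.exp_lt_exp.mpr (by linarith)
      linarith
    refine ⟨(1 - Real.exp (-c))⁻¹, by positivity, fun k hk => ?_⟩
    have hkp : (0 : ℝ) < k := by exact_mod_cast hk
    rw [if_neg hc.ne', inv_mul_eq_div, le_div_iff₀ h1]
    have : decayFactor c (k + 1) ≤ decayFactor c k * Real.exp (-c) := by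
      unfold decayFactor
      rw [mul_assoc, ← Real.exp_add]
      have h2 : ((k : ℝ) + 1) ^ (-(1 / 2) : ℝ) ≤ (k : ℝ) ^ (-(1 / 2) : ℝ) :=
        Real.rpow_le_rpow_of_nonpos hkp (by linarith) (by norm_num)
      rw [show -c * ((k : ℝ) + 1) = -c * k + -c by ring]
      gcongr
    linarith

/-- The partial sum cut near the least term. -/
def floorSum (c : ℕ → ℂ) (M : ℕ) (X : ℝ) : ℂ := partialSum c (⌊X⌋₊ + M) X

theorem measurable_partialSum (c : ℕ → ℂ) (n : ℕ) : Measurable (partialSum c n) := by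
  unfold partialSum
  exact Finset.measurable_fun_sum _ fun j _ =>
    measurable_const.div (Complex.measurable_ofReal.pow_const _)

theorem measurable_floorSum (c : ℕ → ℂ) (M : ℕ) : Measurable (floorSum c M) := by
  have h : Measurable (Function.uncurry fun (X : ℝ) (n : ℕ) => partialSum c (n + M) X) :=
    measurable_from_prod_countable_left fun n => measurable_partialSum c (n + M)
  have h2 : Measurable fun X : ℝ => (X, ⌊X⌋₊) := measurable_id.prodMk Nat.measurable_floor
  have h3 := h.comp h2
  exact h3

theorem floorSum_eq (c : ℕ → ℂ) (M : ℕ) {k : ℕ} {X : ℝ} (h1 : k ≤ X) (h2 : X < k + 1) :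
    floorSum c M X = partialSum c (k + M) X := by
  rw [floorSum, (Nat.floor_eq_iff (k.cast_nonneg.trans h1)).mpr ⟨h1, h2⟩]

/-! ### An approximate solution made from the series cut near its least term. -/

namespace ScaledSystem

variable {X₀ : ℝ} {ω ν : ℂ} {P H : ℝ → ℂ} {Pc Hc s g : ℕ → ℂ} {K κ : ℝ} {n₀ : ℕ}

theorem integral_intFactor_mul (h : ScaledSystem X₀ ω ν P H Pc Hc s g K κ) {n : ℕ} (hn : 1 ≤ n)
    {a b : ℝ} (ha : 0 < a) (hab : a ≤ b) :
    ∫ t in a..b, intFactor ω ν t * partialSum g n t =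
      intFactor ω ν b * partialSum s n b - intFactor ω ν a * partialSum s n a +
        ∫ t in a..b, (ω * s n - g n) * (intFactor ω ν t / (t : ℂ) ^ n) := by
  have hsub : Set.uIcc a b ⊆ Set.Ioi 0 := fun x hx => by
    rw [Set.uIcc_of_le hab] at hx; exact ha.trans_le hx.1
  have hw : ContinuousOn (intFactor ω ν) (Set.uIcc a b) := (continuousOn_intFactor ω ν).mono hsub
  have hp : ContinuousOn (fun t : ℝ => (t : ℂ) ^ n) (Set.uIcc a b) := by fun_prop
  have hp0 : ∀ t ∈ Set.uIcc a b, (t : ℂ) ^ n ≠ 0 := fun t ht => by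
    have : 0 < t := hsub ht
    exact pow_ne_zero _ (by exact_mod_cast this.ne')
  have hi1 : IntervalIntegrable (fun t => intFactor ω ν t * partialSum g n t) volume a b :=
    (hw.mul ((continuousOn_partialSum g n).mono hsub)).intervalIntegrable
  have hi2 : IntervalIntegrable (fun t => (ω * s n - g n) * (intFactor ω ν t / (t : ℂ) ^ n))
      volume a b := (continuousOn_const.mul (hw.div hp hp0)).intervalIntegrable
  rw [← sub_eq_iff_eq_add, ← intervalIntegral.integral_sub hi1 hi2]
  refine Eq.trans (intervalIntegral.integral_congr fun t _ => ?_)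
    (intervalIntegral.integral_eq_sub_of_hasDerivAt
      (fun t ht => h.hasDerivAt_intFactor_mul_partialSum hn (hsub ht)) ?_)
  · ring
  · refine ContinuousOn.intervalIntegrable ?_
    exact hw.mul (((continuousOn_partialSum g n).mono hsub).sub (continuousOn_const.div hp hp0))

/-- The quantity estimated is the increment over `[X, k+1]` of `∫ w g - w s`, both series being cut
near the least term, including the jump of the cut at `k + 1`. It has the size of the least term
times `w = intFactor ω ν`, which suffices if `ω ≠ 1`. If `ω = 1`, this size `k^{-1/2}` is not
summable; but then the integral of `s_n w(t) t^{-n}` and the jump cancel up to a factor `1/k`,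
because `w(t) t^{-n}` varies slowly where `t` is close to `n`. -/
theorem exists_jump_le (h : ScaledSystem X₀ ω ν P H Pc Hc s g K κ) (hn₀ : BaseIndex ν n₀) {M : ℕ}
    (hM : n₀ + 1 ≤ M) :
    ∃ C : ℝ, 0 ≤ C ∧ ∀ (k : ℕ) (X : ℝ), X₀ < X → k ≤ X → X ≤ k + 1 →
      ‖(∫ t in X..(k + 1), intFactor ω ν t * partialSum g (k + M) t) -
        intFactor ω ν (k + 1) * partialSum s (k + 1 + M) (k + 1) +
        intFactor ω ν X * partialSum s (k + M) X‖ ≤ C * decayFactor (1 - ω.re) X ∧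
      ((k : ℝ) = X → 1 ≤ k →
      ‖(∫ t in X..(k + 1), intFactor ω ν t * partialSum g (k + M) t) -
        intFactor ω ν (k + 1) * partialSum s (k + 1 + M) (k + 1) +
        intFactor ω ν X * partialSum s (k + M) X‖ ≤
          C * (decayFactor (1 - ω.re) k - decayFactor (1 - ω.re) (k + 1))) := by
  obtain ⟨C₁, hC₁, h₁⟩ := h.exists_term_le hn₀ hM
  set c := 1 - ω.re with hc
  have hc0 : 0 ≤ c := by have := re_le_one_of_norm_eq_one h.norm_eq; linarith
  obtain ⟨C₂, hC₂, h₂⟩ := exists_decayFactor_le_sub hc0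
  have hX₀ := h.X₀_pos
  set D := C₁ * (1 + 1 / X₀ ^ 2) with hD
  have hD0 : 0 ≤ D := by positivity
  set D' := C₁ * ((M + 1 + ‖ν‖) + 1) with hD'
  have hD'0 : 0 ≤ D' := by positivity
  refine ⟨D + C₁ + ((D + C₁) + D') * C₂, by positivity, fun k X hX hk hk' => ?_⟩
  have hXp := hX₀.trans hX
  set n := k + M with hn
  have hn1 : 1 ≤ n := by omega
  set φ : ℝ → ℂ := fun t => intFactor ω ν t / (t : ℂ) ^ n with hφ
  -- the jump as an integral
  have hjump : (∫ t in X..(k + 1), intFactor ω ν t * partialSum g n t) -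
        intFactor ω ν (k + 1) * partialSum s (k + 1 + M) (k + 1) +
        intFactor ω ν X * partialSum s n X =
      (∫ t in X..(k + 1), (ω * s n - g n) * φ t) - s n * φ (k + 1) := by
    rw [h.integral_intFactor_mul hn1 hXp hk', show k + 1 + M = n + 1 by omega, partialSum_succ]
    simp only [hφ]
    push_cast
    ring
  have hterm : ∀ t : ℝ, X ≤ t → t ≤ k + 1 → ‖s n‖ * ‖φ t‖ ≤ C₁ * decayFactor c t ∧
      ‖g n‖ * ‖φ t‖ ≤ C₁ * decayFactor c t / t ^ 2 := by
    intro t ht ht'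
    have htp : 0 < t := hXp.trans_le ht
    obtain ⟨t1, t2, -⟩ := h₁ k t (hX.trans_le ht) (hk.trans ht) ht'
    rw [← norm_intFactor_mul_leastTerm ω ν htp]
    have hw := norm_nonneg (intFactor ω ν t)
    have e : ∀ z : ℂ, ‖z‖ * ‖φ t‖ = ‖intFactor ω ν t‖ * (‖z‖ / t ^ n) := by
      intro z; simp only [hφ]; rw [norm_div_pow htp]; ring
    rw [e, e]
    constructor
    · refine (mul_le_mul_of_nonneg_left t1 hw).trans (le_of_eq (by ring))
    · refine (mul_le_mul_of_nonneg_left t2 hw).trans (le_of_eq (by ring))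
  have hdecX : ∀ t : ℝ, X ≤ t → decayFactor c t ≤ decayFactor c X := fun t ht =>
    decayFactor_antitone hc0 hXp ht
  have hdp := decayFactor_pos c hXp
  have hB1 : ‖(∫ t in X..(k + 1), (ω * s n - g n) * φ t) - s n * φ (k + 1)‖ ≤
      (D + C₁) * decayFactor c X := by
    have i1 : ‖∫ t in X..(k + 1), (ω * s n - g n) * φ t‖ ≤ D * decayFactor c X * |(k + 1) - X| := by
      refine intervalIntegral.norm_integral_le_of_norm_le_const fun t ht => ?_
      rw [Set.uIoc_of_le hk'] at ht
      obtain ⟨t1, t2⟩ := hterm t ht.1.le ht.2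
      have hdt := hdecX t ht.1.le
      have htp : 0 < t := hXp.trans ht.1
      have hX₀t : X₀ ^ 2 ≤ t ^ 2 := by have := hX.trans ht.1; gcongr
      have hdtp := decayFactor_pos c htp
      calc ‖(ω * s n - g n) * φ t‖ ≤ (‖s n‖ + ‖g n‖) * ‖φ t‖ := by
            rw [norm_mul]
            gcongr
            refine (norm_sub_le _ _).trans ?_
            rw [norm_mul, h.norm_eq, one_mul]
        _ = ‖s n‖ * ‖φ t‖ + ‖g n‖ * ‖φ t‖ := by ring
        _ ≤ C₁ * decayFactor c t + C₁ * decayFactor c t / t ^ 2 := add_le_add t1 t2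
        _ ≤ C₁ * decayFactor c t + C₁ * decayFactor c t / X₀ ^ 2 := by gcongr
        _ = D * decayFactor c t := by rw [hD]; ring
        _ ≤ _ := by gcongr
    have i2 : |((k : ℝ) + 1) - X| ≤ 1 := by rw [abs_of_nonneg (by linarith)]; linarith
    have i3 : ‖s n * φ (k + 1)‖ ≤ C₁ * decayFactor c X := by
      rw [norm_mul]
      exact (hterm (k + 1) hk' le_rfl).1.trans (by gcongr; exact hdecX _ hk')
    have i4 : D * decayFactor c X * |((k : ℝ) + 1) - X| ≤ D * decayFactor c X :=
      mul_le_of_le_one_right (by positivity) i2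
    calc _ ≤ _ := norm_sub_le _ _
      _ ≤ D * decayFactor c X + C₁ * decayFactor c X := add_le_add (i1.trans i4) i3
      _ = _ := by ring
  rw [hjump]
  refine ⟨hB1.trans ?_, fun hkX hk1 => ?_⟩
  · refine mul_le_mul_of_nonneg_right ?_ hdp.le
    have : 0 ≤ ((D + C₁) + D') * C₂ := by positivity
    linarith
  · subst hkX
    have h3 := h₂ k hk1
    have hk1' : (1 : ℝ) ≤ k := by exact_mod_cast hk1
    have hpos : 0 ≤ decayFactor c k - decayFactor c (k + 1) := by
      have := hdecX (k + 1) (by linarith); linarith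
    by_cases hcz : c = 0
    · have hω : ω = 1 := by
        by_contra hne
        have := re_lt_one_of_norm_eq_one h.norm_eq hne
        rw [hc] at hcz; linarith
      rw [if_pos hcz] at h3
      have e1 : (∫ t in (k : ℝ)..(k + 1), (ω * s n - g n) * φ t) - s n * φ (k + 1) =
          ∫ t in (k : ℝ)..(k + 1), (s n * (φ t - φ (k + 1)) - g n * φ t) := by
        have hφc : ContinuousOn φ (Set.uIcc (k : ℝ) (k + 1)) := by
          rw [Set.uIcc_of_le hk']
          refine ContinuousOn.div ((continuousOn_intFactor ω ν).mono fun x hx => ?_) (by fun_prop)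
            fun x hx => ?_
          · exact hXp.trans_le hx.1
          · have : 0 < x := hXp.trans_le hx.1
            exact pow_ne_zero _ (by exact_mod_cast this.ne')
        -- The interval has length one, so the jump can be subtracted under the integral sign.
        have e2 : s n * φ (k + 1) = ∫ t in (k : ℝ)..(k + 1), s n * φ (k + 1) := by
          rw [intervalIntegral.integral_const]; simp
        rw [e2, ← intervalIntegral.integral_sub]
        · refine intervalIntegral.integral_congr fun t _ => ?_
          simp only [hω]; ring
        · exact (continuousOn_const.mul hφc).intervalIntegrable
        · exact intervalIntegrable_const
      have i1 : ‖∫ t in (k : ℝ)..(k + 1), (s n * (φ t - φ (k + 1)) - g n * φ t)‖ ≤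
          D' * (decayFactor c k / k) * |((k : ℝ) + 1) - k| := by
        refine intervalIntegral.norm_integral_le_of_norm_le_const fun t ht => ?_
        rw [Set.uIoc_of_le hk'] at ht
        have htp : 0 < t := hXp.trans ht.1
        have h4 : ‖s n * φ t - s n * φ (k + 1)‖ ≤
            (C₁ * (M + 1 + ‖ν‖) * (decayFactor c k / k)) * ‖t - ((k : ℝ) + 1)‖ := by
          refine (convex_Icc (k : ℝ) (k + 1)).norm_image_sub_le_of_norm_hasDerivWithin_le
            (f := fun x => s n * φ x) (f' := fun x => s n * (φ x * (ω - (ν + n) / x)))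
            (fun x hx => ?_) (fun x hx => ?_) ⟨hk', le_rfl⟩ ⟨ht.1.le, ht.2⟩
          · have hxp : 0 < x := hXp.trans_le hx.1
            have hxc : (x : ℂ) ≠ 0 := by exact_mod_cast hxp.ne'
            have hd := (hasDerivAt_intFactor ω ν hxp).mul (hasDerivAt_div_pow 1 n hxp)
            refine (((hd.const_mul (s n)).congr_deriv ?_).congr_of_eventuallyEq
              (Eventually.of_forall fun y => ?_)).hasDerivWithinAt
            · simp only [hφ]
              rw [pow_succ]
              field_simp
              ring
            · simp only [hφ, Pi.mul_apply]; rw [mul_one_div]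
          · have hxp : 0 < x := hXp.trans_le hx.1
            have hxc : (x : ℂ) ≠ 0 := by exact_mod_cast hxp.ne'
            have t1 := (hterm x hx.1 hx.2).1
            -- For `ω = 1` the logarithmic derivative of `φ` is `(x - n - ν)/x`, and `|x - n| ≤ M +
            -- 1` because `n = k + M`. This is the gain of a factor `1/k`.
            have b1 : ‖ω - (ν + n) / x‖ ≤ (M + 1 + ‖ν‖) / x := by
              have e : ω - (ν + n) / x = (((x - n : ℝ) : ℂ) - ν) / x := by
                rw [hω]; push_cast; field_simp; ring
              rw [e, norm_div, Complex.norm_real x, Real.norm_of_nonneg hxp.le]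
              gcongr
              refine (norm_sub_le _ _).trans ?_
              gcongr
              rw [Complex.norm_real, Real.norm_eq_abs, abs_le, hn]
              push_cast
              have h5 := hx.1
              have h6 := hx.2
              constructor <;> nlinarith [(Nat.cast_nonneg M : (0 : ℝ) ≤ M)]
            have hdx := hdecX x hx.1
            have hdp' := decayFactor_pos c hxp
            calc ‖s n * (φ x * (ω - (ν + n) / x))‖ = (‖s n‖ * ‖φ x‖) * ‖ω - (ν + n) / x‖ := by
                  rw [norm_mul, norm_mul]; ring
              _ ≤ (C₁ * decayFactor c x) * ((M + 1 + ‖ν‖) / x) := by gcongr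
              _ ≤ (C₁ * decayFactor c k) * ((M + 1 + ‖ν‖) / k) := by
                  gcongr; exact hx.1
              _ = _ := by ring
        have h5 : ‖g n * φ t‖ ≤ C₁ * (decayFactor c k / k) := by
          rw [norm_mul]
          refine (hterm t ht.1.le ht.2).2.trans ?_
          rw [mul_div_assoc]
          have h6 := hdecX t ht.1.le
          have h7 : (k : ℝ) ≤ t ^ 2 := by nlinarith [ht.1]
          gcongr
        have h6 : ‖t - ((k : ℝ) + 1)‖ ≤ 1 := by
          rw [Real.norm_eq_abs, abs_le]; constructor <;> linarith [ht.1, ht.2]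
        have h7 : (C₁ * (M + 1 + ‖ν‖) * (decayFactor c k / k)) * ‖t - ((k : ℝ) + 1)‖ ≤
            C₁ * (M + 1 + ‖ν‖) * (decayFactor c k / k) :=
          mul_le_of_le_one_right (by positivity) h6
        calc _ ≤ ‖s n * φ t - s n * φ (k + 1)‖ + ‖g n * φ t‖ := by
              rw [mul_sub]; exact norm_sub_le _ _
          _ ≤ C₁ * (M + 1 + ‖ν‖) * (decayFactor c k / k) + C₁ * (decayFactor c k / k) :=
              add_le_add (h4.trans h7) h5
          _ = _ := by rw [hD']; ring
      rw [e1]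
      refine i1.trans ?_
      rw [add_sub_cancel_left, abs_one, mul_one]
      calc D' * (decayFactor c k / k) ≤ D' * (C₂ * (decayFactor c k - decayFactor c (k + 1))) := by
            gcongr
        _ = D' * C₂ * (decayFactor c k - decayFactor c (k + 1)) := by ring
        _ ≤ _ := by
            gcongr
            have : 0 ≤ D + C₁ + (D + C₁) * C₂ := by positivity
            linarith
    · rw [if_neg hcz] at h3
      refine hB1.trans ?_
      calc (D + C₁) * decayFactor c k ≤
            (D + C₁) * (C₂ * (decayFactor c k - decayFactor c (k + 1))) := by gcongr
        _ = (D + C₁) * C₂ * (decayFactor c k - decayFactor c (k + 1)) := by ring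
        _ ≤ _ := by
            gcongr
            have : 0 ≤ D + C₁ + D' * C₂ := by positivity
            linarith

end ScaledSystem

theorem continuousOn_primitive_of_intervalIntegrable {f : ℝ → ℂ} {X₀ X₁ : ℝ} (hX₁ : X₀ < X₁)
    (hf : ∀ a b, X₀ < a → X₀ < b → IntervalIntegrable f volume a b) :
    ContinuousOn (fun x => ∫ t in X₁..x, f t) (Set.Ioi X₀) := by
  intro x hx
  have hx' : X₀ < x := hx
  set a := (X₀ + min x X₁) / 2 with ha
  have hmin : X₀ < min x X₁ := lt_min hx' hX₁
  have ha1 : X₀ < a := by linarith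
  have ha2 : a < min x X₁ := by linarith
  have hax : a < x := ha2.trans_le (min_le_left _ _)
  have hab : a ≤ x + 1 := by linarith
  have h1 := intervalIntegral.continuousOn_primitive_interval (μ := volume)
    ((intervalIntegrable_iff').mp (hf a (x + 1) ha1 (by linarith)) : IntegrableOn f _ volume)
  have h2 : ContinuousAt (fun y => ∫ t in a..y, f t) x := h1.continuousAt (by
    rw [Set.uIcc_of_le hab]; exact Icc_mem_nhds hax (by linarith))
  have h3 : ContinuousAt (fun y => (∫ t in a..y, f t) - ∫ t in a..X₁, f t) x :=
    h2.sub continuousAt_const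
  refine (h3.congr ?_).continuousWithinAt
  filter_upwards [lt_mem_nhds hx'] with y hy
  rw [sub_eq_iff_eq_add, add_comm]
  exact (intervalIntegral.integral_add_adjacent_intervals (hf a X₁ ha1 hX₁) (hf X₁ y hX₁ hy)).symm

theorem intervalIntegrable_mul_floorSum {f : ℝ → ℂ} (hf : ContinuousOn f (Set.Ioi 0)) (c : ℕ → ℂ)
    (M : ℕ) {a b : ℝ} (ha : 0 < a) (hb : 0 < b) :
    IntervalIntegrable (fun t => f t * floorSum c M t) volume a b := by
  have hmin : 0 < min a b := lt_min ha hb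
  have h1 : IntervalIntegrable (floorSum c M) volume a b := by
    refine (intervalIntegrable_const (c := ∑ j ∈ Finset.range (⌊max a b⌋₊ + M),
      ‖c j‖ / min a b ^ j)).mono_fun' (measurable_floorSum c M).aestronglyMeasurable ?_
    refine (ae_restrict_iff' measurableSet_uIoc).mpr (ae_of_all _ fun x hx => ?_)
    have hx1 : min a b < x := hx.1
    have hx2 : x ≤ max a b := hx.2
    have hxp : 0 < x := hmin.trans hx1
    change ‖∑ j ∈ Finset.range (⌊x⌋₊ + M), c j / (x : ℂ) ^ j‖ ≤ _
    refine (norm_sum_le _ _).trans ?_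
    have hsub : Finset.range (⌊x⌋₊ + M) ⊆ Finset.range (⌊max a b⌋₊ + M) := by
      have := Nat.floor_le_floor hx2
      exact Finset.range_mono (by omega)
    refine (Finset.sum_le_sum fun j _ => ?_).trans
      (Finset.sum_le_sum_of_subset_of_nonneg hsub fun j _ _ => by positivity)
    rw [norm_div_pow hxp]
    gcongr
  refine h1.continuousOn_mul (hf.mono fun x hx => ?_)
  rw [Set.uIcc, Set.mem_Icc] at hx
  exact hmin.trans_le hx.1

namespace ScaledSystem

variable {X₀ : ℝ} {ω ν : ℂ} {P H : ℝ → ℂ} {Pc Hc s g : ℕ → ℂ} {K κ : ℝ} {n₀ : ℕ}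

/-- The first equation is solved exactly with `floorSum g` in place of `G`. The constant of
integration is the limit, along the integers, of the difference between `∫ w g` and `w s`; this
choice keeps `u₀` as close to `floorSum s` as the least term. -/
theorem exists_first_approximation (h : ScaledSystem X₀ ω ν P H Pc Hc s g K κ)
    (hn₀ : BaseIndex ν n₀) {M : ℕ} (hM : n₀ + 1 ≤ M) :
    ∃ (u₀ : ℝ → ℂ) (C : ℝ) (c₀ : ℂ), 0 ≤ C ∧ ContinuousOn u₀ (Set.Ioi X₀) ∧
      (∀ X, X₀ < X → intFactor ω ν X * u₀ X =
        c₀ + ∫ t in (X₀ + 1)..X, intFactor ω ν t * floorSum g M t) ∧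
      ∀ X, X₀ < X → ‖u₀ X - floorSum s M X‖ ≤ C * leastTerm ν.re X := by
  obtain ⟨C, hC, hjump⟩ := h.exists_jump_le hn₀ hM
  have hX₀ := h.X₀_pos
  set c := 1 - ω.re with hc
  have hc0 : 0 ≤ c := by have := re_le_one_of_norm_eq_one h.norm_eq; linarith
  set w := intFactor ω ν with hw
  have hint : ∀ a b, 0 < a → 0 < b →
      IntervalIntegrable (fun t => w t * floorSum g M t) volume a b := fun a b ha hb =>
    intervalIntegrable_mul_floorSum (continuousOn_intFactor ω ν) g M ha hb
  set V : ℝ → ℂ := fun X => ∫ t in (X₀ + 1)..X, w t * floorSum g M t with hV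
  have hVsub : ∀ a b, 0 < a → 0 < b → V b - V a = ∫ t in a..b, w t * floorSum g M t := by
    intro a b ha hb
    exact intervalIntegral.integral_interval_sub_left (hint _ _ (by linarith) hb)
      (hint _ _ (by linarith) ha)
  have hpiece : ∀ (k : ℕ) (X : ℝ), 0 < X → k ≤ X → X ≤ k + 1 →
      ∫ t in X..(k + 1), w t * floorSum g M t = ∫ t in X..(k + 1), w t * partialSum g (k + M) t := by
    intro k X hX hk hk'
    refine intervalIntegral.integral_congr_Ioo_of_le hk' fun t ht => ?_
    rw [floorSum_eq g M (hk.trans ht.1.le) ht.2]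
  set f : ℕ → ℂ := fun k => V k - w k * partialSum s (k + M) k with hf
  have hstep : ∀ (k : ℕ) (X : ℝ), 0 < X → k ≤ X → X ≤ k + 1 →
      f (k + 1) - (V X - w X * partialSum s (k + M) X) =
      (∫ t in X..(k + 1), w t * partialSum g (k + M) t) -
        w (k + 1) * partialSum s (k + 1 + M) (k + 1) + w X * partialSum s (k + M) X := by
    intro k X hX hk hk'
    rw [← hpiece k X hX hk hk', ← hVsub X (k + 1) hX (by positivity)]
    simp only [hf]
    push_cast
    ring
  have hb0 : Tendsto (fun k : ℕ => C * decayFactor c k) atTop (𝓝 0) := by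
    simpa using ((tendsto_decayFactor hc0).comp tendsto_natCast_atTop_atTop).const_mul C
  obtain ⟨Vinf, -, hVinf⟩ := exists_tendsto_of_norm_sub_le_sub (n₀ := ⌊X₀⌋₊ + 1) (f := f) hb0 (by
    intro k hk
    have hk1 : X₀ < k := by
      have := Nat.lt_floor_add_one X₀
      have h2 : ((⌊X₀⌋₊ + 1 : ℕ) : ℝ) ≤ k := by exact_mod_cast hk
      push_cast at h2
      linarith
    have h3 := (hjump k k hk1 le_rfl (by linarith)).2 rfl (by omega)
    rw [← hstep k k (hX₀.trans hk1) le_rfl (by linarith)] at h3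
    refine h3.trans (le_of_eq ?_)
    push_cast
    ring)
  have hD : ∀ X, X₀ < X → ‖V X - w X * floorSum s M X - Vinf‖ ≤ 2 * C * decayFactor c X := by
    intro X hX
    have hXp := hX₀.trans hX
    set k := ⌊X⌋₊ with hk
    have hk1 : (k : ℝ) ≤ X := Nat.floor_le hXp.le
    have hk2 : X < k + 1 := Nat.lt_floor_add_one X
    rw [floorSum_eq s M hk1 hk2]
    have h3 := (hjump k X hX hk1 hk2.le).1
    rw [← hstep k X hXp hk1 hk2.le] at h3
    have hk3 : ⌊X₀⌋₊ + 1 ≤ k + 1 := by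
      have := Nat.floor_le_floor hX.le
      omega
    have h4 := hVinf (k + 1) hk3
    have h5 : decayFactor c ((k + 1 : ℕ) : ℝ) ≤ decayFactor c X :=
      decayFactor_antitone hc0 hXp (by push_cast; exact hk2.le)
    calc ‖V X - w X * partialSum s (k + M) X - Vinf‖
        = ‖(f (k + 1) - Vinf) - (f (k + 1) - (V X - w X * partialSum s (k + M) X))‖ := by
          congr 1; ring
      _ ≤ _ := norm_sub_le _ _
      _ ≤ C * decayFactor c X + C * decayFactor c X := by
          refine add_le_add (h4.trans ?_) h3
          gcongr
      _ = _ := by ring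
  have hVc : ContinuousOn V (Set.Ioi X₀) :=
    continuousOn_primitive_of_intervalIntegrable (by linarith)
      fun a b ha hb => hint a b (hX₀.trans ha) (hX₀.trans hb)
  refine ⟨fun X => (w X)⁻¹ * (V X - Vinf), 2 * C, -Vinf, by positivity, ?_, fun X hX => ?_,
    fun X hX => ?_⟩
  · refine ContinuousOn.mul (ContinuousOn.inv₀ ((continuousOn_intFactor ω ν).mono fun x hx =>
      hX₀.trans hx) fun x _ => intFactor_ne_zero ω ν x) (hVc.sub continuousOn_const)
  · rw [← mul_assoc, mul_inv_cancel₀ (intFactor_ne_zero ω ν X), one_mul]; ring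
  · have hXp := hX₀.trans hX
    have hwp : 0 < ‖w X‖ := norm_pos_iff.mpr (intFactor_ne_zero ω ν X)
    have e : (w X)⁻¹ * (V X - Vinf) - floorSum s M X =
        (w X)⁻¹ * (V X - w X * floorSum s M X - Vinf) := by
      have := intFactor_ne_zero ω ν X
      rw [← hw] at this
      field_simp
      ring
    rw [e, norm_mul, norm_inv, inv_mul_le_iff₀ hwp]
    refine (hD X hX).trans (le_of_eq ?_)
    rw [← norm_intFactor_mul_leastTerm ω ν hXp]
    ring

/-- The error of the first approximation in the integrated second equation. -/
theorem exists_second_error_le (h : ScaledSystem X₀ ω ν P H Pc Hc s g K κ)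
    (hn₀ : BaseIndex ν n₀) {M : ℕ} (hM : n₀ + 1 ≤ M) {u₀ : ℝ → ℂ} {C₀ L : ℝ} (hC₀ : 0 ≤ C₀)
    (hu₀ : ContinuousOn u₀ (Set.Ioi X₀))
    (hu₀' : ∀ X, X₀ < X → ‖u₀ X - floorSum s M X‖ ≤ C₀ * leastTerm ν.re X)
    (hL : (ν.re - 3 / 2 + 1) ^ 2 ≤ 4 * L) :
    IntegrableOn (fun t => P t * floorSum g M t + H t * u₀ t) (Set.Ioi X₀) ∧
    ∃ C : ℝ, 0 ≤ C ∧ ∀ X, X₀ < X →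
      ‖g 0 + (∫ t in Set.Ioi X, (P t * floorSum g M t + H t * u₀ t)) - floorSum g M X‖ ≤
        C * volterraWeight (ν.re - 3 / 2) L X := by
  have hX₀ := h.X₀_pos
  have hK := h.K_nonneg
  set a := ν.re - 3 / 2 with ha
  set J : ℝ → ℂ := fun t => P t * floorSum g M t + H t * u₀ t with hJ
  obtain ⟨A, hA, hb⟩ := h.exists_norm_le hn₀
  obtain ⟨C₁, hC₁, h₁⟩ := h.exists_term_le hn₀ hM
  have hgw : ∀ n, ‖g n‖ ≤ A * gammaWeight ν.re n₀ n := fun n => (hb n).2.trans (div_le_self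
      (by have := hn₀.gammaWeight_pos n; positivity)
      (by nlinarith [(Nat.cast_nonneg n : (0 : ℝ) ≤ n)]))
  obtain ⟨Cg, hCg, hg⟩ := exists_partialSum_sub_le hn₀ hX₀ (M := (M : ℝ)) (by positivity) hgw
  obtain ⟨Cs, hCs, hs⟩ := exists_partialSum_sub_le hn₀ hX₀ (M := (M : ℝ)) (by positivity)
    fun n => (hb n).1
  have hgf : ∀ X, X₀ < X → ‖floorSum g M X - g 0‖ ≤ Cg / X := fun X hX =>
    hg _ X (by omega) hX (by
      push_cast; have := Nat.floor_le (hX₀.trans hX).le; linarith)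
  have hsf : ∀ X, X₀ < X → ‖floorSum s M X - s 0‖ ≤ Cs / X := fun X hX =>
    hs _ X (by omega) hX (by
      push_cast; have := Nat.floor_le (hX₀.trans hX).le; linarith)
  -- boundedness
  have hlt : ∀ X, X₀ < X → leastTerm ν.re X ≤
      volterraWeight (ν.re - 1 / 2) ((ν.re - 1 / 2) ^ 2) X₀ := fun X hX => by
    rw [leastTerm_eq_powExp]
    refine (powExp_le_volterraWeight _ (sq_nonneg (ν.re - 1 / 2)) (hX₀.trans hX)).trans ?_
    exact volterraWeight_antitone le_rfl (by nlinarith [sq_nonneg (ν.re - 1 / 2)]) hX₀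
      (hX₀.trans hX) hX.le
  set B₁ := ‖g 0‖ + Cg / X₀ with hB₁
  have hB1 : ∀ X, X₀ < X → ‖floorSum g M X‖ ≤ B₁ := fun X hX => by
    have h1 := hgf X hX
    have h2 : Cg / X ≤ Cg / X₀ := by gcongr
    have h3 := norm_le_norm_add_norm_sub (g 0) (floorSum g M X)
    rw [norm_sub_rev] at h3
    linarith
  set B₂ := ‖s 0‖ + Cs / X₀ +
    C₀ * volterraWeight (ν.re - 1 / 2) ((ν.re - 1 / 2) ^ 2) X₀ with hB₂
  have hB2 : ∀ X, X₀ < X → ‖u₀ X‖ ≤ B₂ := fun X hX => by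
    have h1 := hsf X hX
    have h2 : Cs / X ≤ Cs / X₀ := by gcongr
    have h3 := norm_le_norm_add_norm_sub (s 0) (floorSum s M X)
    have h4 := norm_le_norm_add_norm_sub (floorSum s M X) (u₀ X)
    rw [norm_sub_rev] at h3 h4
    have h5 := hu₀' X hX
    have h6 := mul_le_mul_of_nonneg_left (hlt X hX) hC₀
    linarith
  have hB₁0 : 0 ≤ B₁ := by positivity
  have hB₂0 : 0 ≤ B₂ := (norm_nonneg _).trans (hB2 (X₀ + 1) (by linarith))
  set B := 2 * K * (B₁ + B₂) with hB
  have hB0 : 0 ≤ B := by positivity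
  have hJle : ∀ X, X₀ < X → ‖J X‖ ≤ B * X ^ (-2 : ℝ) := fun X hX => by
    have hXp := hX₀.trans hX
    have e : X ^ (-2 : ℝ) = (X ^ 2)⁻¹ := by
      rw [Real.rpow_neg hXp.le]; norm_cast
    calc ‖J X‖ ≤ ‖P X‖ * ‖floorSum g M X‖ + ‖H X‖ * ‖u₀ X‖ := by
          refine (norm_add_le _ _).trans ?_
          rw [norm_mul, norm_mul]
      _ ≤ (2 * K / X ^ 2) * B₁ + (2 * K / X ^ 2) * B₂ := by
          gcongr
          · exact h.norm_P_le hX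
          · exact hB1 X hX
          · exact h.norm_H_le hX
          · exact hB2 X hX
      _ = _ := by rw [e, hB]; ring
  have hrp : ∀ X, 0 < X → IntegrableOn (fun t : ℝ => B * t ^ (-2 : ℝ)) (Set.Ioi X) := fun X hX =>
    (integrableOn_Ioi_rpow_of_lt (by norm_num) hX).const_mul B
  have hJm : AEStronglyMeasurable J (volume.restrict (Set.Ioi X₀)) :=
    (h.P_meas.mul (measurable_floorSum g M).aestronglyMeasurable).add
      (h.H_meas.mul (hu₀.aestronglyMeasurable measurableSet_Ioi))
  have hJi : IntegrableOn J (Set.Ioi X₀) := by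
    refine Integrable.mono' (hrp X₀ hX₀) hJm ?_
    exact (ae_restrict_iff' measurableSet_Ioi).mpr (ae_of_all _ fun X hX => hJle X hX)
  refine ⟨hJi, ?_⟩
  have hJX : ∀ X, X₀ < X → IntegrableOn J (Set.Ioi X) := fun X hX =>
    hJi.mono_set (Set.Ioi_subset_Ioi hX.le)
  have htail : ∀ X, X₀ < X → ‖∫ t in Set.Ioi X, J t‖ ≤ B / X := fun X hX => by
    have hXp := hX₀.trans hX
    calc _ ≤ ∫ t in Set.Ioi X, B * t ^ (-2 : ℝ) := by
          refine norm_integral_le_of_norm_le (hrp X hXp) ?_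
          exact (ae_restrict_iff' measurableSet_Ioi).mpr
            (ae_of_all _ fun t ht => hJle t (hX.trans ht))
      _ = _ := by
          rw [integral_const_mul, integral_Ioi_rpow_of_lt (by norm_num) hXp]
          norm_num
          rw [Real.rpow_neg_one]; rfl
  -- telescoping
  obtain ⟨C₂, hC₂, h₂⟩ := exists_powExp_le (a - 1) hX₀
  obtain ⟨C₃, hC₃, h₃⟩ := exists_powExp_le_volterraWeight_sub hL
  have hL0 : 0 ≤ L := by nlinarith [sq_nonneg (a + 1)]
  have hpow : ∀ X, 0 < X → leastTerm ν.re X / X ^ 2 = powExp (a - 1) X := fun X hX => by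
    rw [leastTerm_eq_powExp, div_eq_iff (by positivity), mul_comm, ← powExp_add_nat _ _ hX]
    congr 1; rw [ha]; push_cast; ring
  set D := C₁ + 2 * K * C₀ with hD
  have hD0 : 0 ≤ D := by positivity
  -- The error sampled at the integers. Its increments consist of the residual, of `H` times the
  -- error of `u₀`, and of one term of the series `g`, all smaller than the least term by a factor
  -- `X^{-2}`.
  set e : ℕ → ℂ := fun k => g 0 + (∫ t in Set.Ioi (k : ℝ), J t) - partialSum g (k + M) k with he
  have hstep : ∀ (k : ℕ) (X : ℝ), X₀ < X → k ≤ X → X ≤ k + 1 →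
      ‖e (k + 1) - (g 0 + (∫ t in Set.Ioi X, J t) - partialSum g (k + M) X)‖ ≤
        (D + C₁) * C₂ * powExp (a - 1) X := by
    intro k X hX hk hk'
    have hXp := hX₀.trans hX
    have hk1 : X₀ < (k : ℝ) + 1 := hX.trans_le hk'
    set n := k + M with hn
    have hsub : Set.uIcc X (k + 1) ⊆ Set.Ioi 0 := fun x hx => by
      rw [Set.uIcc_of_le hk'] at hx; exact hXp.trans_le hx.1
    have hdi : ContinuousOn (fun t : ℝ => -∑ j ∈ Finset.range n, (j : ℂ) * g j / (t : ℂ) ^ (j + 1))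
        (Set.uIcc X (k + 1)) := by
      refine (continuousOn_finsetSum _ fun j _ => ?_).neg
      refine continuousOn_const.div (by fun_prop) fun t ht => ?_
      have : 0 < t := hsub ht
      exact pow_ne_zero _ (by exact_mod_cast this.ne')
    have i1 : (∫ t in Set.Ioi X, J t) - ∫ t in Set.Ioi ((k : ℝ) + 1), J t =
        ∫ t in X..(k + 1), J t := intervalIntegral.integral_Ioi_sub_Ioi (hJX X hX) hk'
    have i2 := intervalIntegral.integral_eq_sub_of_hasDerivAt
      (fun t ht => hasDerivAt_partialSum g n (hsub ht)) hdi.intervalIntegrable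
    have i3 : IntervalIntegrable J volume X (k + 1) :=
      (intervalIntegrable_iff_integrableOn_Ioc_of_le hk').mpr
        ((hJX X hX).mono_set Set.Ioc_subset_Ioi_self)
    have e1 : e (k + 1) - (g 0 + (∫ t in Set.Ioi X, J t) - partialSum g n X) =
        -(∫ t in X..(k + 1), (J t + -∑ j ∈ Finset.range n, (j : ℂ) * g j / (t : ℂ) ^ (j + 1))) -
          g n / (((k : ℝ) + 1 : ℝ) : ℂ) ^ n := by
      rw [intervalIntegral.integral_add i3 hdi.intervalIntegrable, i2, ← i1]
      simp only [he]
      rw [show k + 1 + M = n + 1 by omega, partialSum_succ]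
      push_cast
      ring
    have i4 : ‖∫ t in X..(k + 1), (J t + -∑ j ∈ Finset.range n, (j : ℂ) * g j / (t : ℂ) ^ (j + 1))‖
        ≤ (D * C₂ * powExp (a - 1) X) * |((k : ℝ) + 1) - X| := by
      -- The cut index jumps at the right end point, a null set.
      refine intervalIntegral.norm_integral_le_of_norm_le_const_ae ?_
      have hae : ∀ᵐ t : ℝ, t ≠ (k : ℝ) + 1 := by
        rw [ae_iff]; simp
      filter_upwards [hae] with t hne ht
      rw [Set.uIoc_of_le hk'] at ht
      have ht2 : t < k + 1 := lt_of_le_of_ne ht.2 hne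
      have htp : 0 < t := hXp.trans ht.1
      have htX : X₀ < t := hX.trans ht.1
      have r1 := (h₁ k t htX (hk.trans ht.1.le) ht.2).2.2
      have r2 := hu₀' t htX
      rw [floorSum_eq s M (hk.trans ht.1.le) ht2] at r2
      have e2 : J t + -∑ j ∈ Finset.range n, (j : ℂ) * g j / (t : ℂ) ^ (j + 1) =
          (P t * partialSum g n t + H t * partialSum s n t -
            ∑ j ∈ Finset.range n, (j : ℂ) * g j / (t : ℂ) ^ (j + 1)) +
          H t * (u₀ t - partialSum s n t) := by
        simp only [hJ]
        rw [floorSum_eq g M (hk.trans ht.1.le) ht2]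
        ring
      have hlp := leastTerm_pos ν.re htp
      rw [e2]
      calc _ ≤ C₁ * leastTerm ν.re t / t ^ 2 + (2 * K / t ^ 2) * (C₀ * leastTerm ν.re t) := by
            refine (norm_add_le _ _).trans (add_le_add r1 ?_)
            rw [norm_mul]
            have := h.norm_H_le htX
            gcongr
        _ = D * (leastTerm ν.re t / t ^ 2) := by rw [hD]; ring
        _ = D * powExp (a - 1) t := by rw [hpow t htp]
        _ ≤ D * (C₂ * powExp (a - 1) X) := by
            gcongr; exact (h₂ X t hX ht.1.le (by linarith)).1
        _ = _ := by ring
    have hpp := powExp_pos (a - 1) hXp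
    have i5 : ‖g n / (((k : ℝ) + 1 : ℝ) : ℂ) ^ n‖ ≤ C₁ * C₂ * powExp (a - 1) X := by
      have hk1p : 0 < (k : ℝ) + 1 := by positivity
      rw [norm_div_pow hk1p]
      have r1 := (h₁ k (k + 1) hk1 (by linarith) le_rfl).2.1
      rw [mul_div_assoc, hpow _ hk1p] at r1
      refine r1.trans ?_
      rw [mul_assoc]
      gcongr
      exact (h₂ X (k + 1) hX hk' (by linarith)).1
    have i6 : |((k : ℝ) + 1) - X| ≤ 1 := by rw [abs_of_nonneg (by linarith)]; linarith
    rw [e1]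
    calc _ ≤ D * C₂ * powExp (a - 1) X * |((k : ℝ) + 1) - X| + C₁ * C₂ * powExp (a - 1) X := by
          refine (norm_sub_le _ _).trans (add_le_add ?_ i5)
          rw [norm_neg]; exact i4
      _ ≤ D * C₂ * powExp (a - 1) X + C₁ * C₂ * powExp (a - 1) X := by
          exact add_le_add (mul_le_of_le_one_right (by positivity) i6) le_rfl
      _ = _ := by ring
  set D' := (D + C₁) * C₂ with hD'
  have hD'0 : 0 ≤ D' := by positivity
  have hv0 : Tendsto (fun k : ℕ => D' * C₃ * volterraWeight a L k) atTop (𝓝 0) := by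
    simpa using ((tendsto_volterraWeight a L).comp tendsto_natCast_atTop_atTop).const_mul (D' * C₃)
  have hk0 : ∀ k : ℕ, ⌊X₀⌋₊ + 1 ≤ k → X₀ < k := fun k hk => by
    have := Nat.lt_floor_add_one X₀
    have h2 : ((⌊X₀⌋₊ + 1 : ℕ) : ℝ) ≤ k := by exact_mod_cast hk
    push_cast at h2
    linarith
  obtain ⟨R, hR, hR'⟩ := exists_tendsto_of_norm_sub_le_sub (n₀ := ⌊X₀⌋₊ + 1) (f := e) hv0 (by
    intro k hk
    refine (hstep k k (hk0 k hk) le_rfl (by linarith)).trans ?_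
    have h3 := h₃ k (by omega)
    calc D' * powExp (a - 1) k ≤
          D' * (C₃ * (volterraWeight a L k - volterraWeight a L (k + 1))) := by gcongr
      _ = _ := by push_cast; ring)
  -- The tail integral and the deviation of the partial sum from `g 0` are both `O(1/k)`. So the
  -- limit of the telescoping sequence is zero, and its tail bound is a bound for the error itself.
  have he0 : Tendsto e atTop (𝓝 0) := by
    have hz : Tendsto (fun k : ℕ => (B + Cg) / (k : ℝ)) atTop (𝓝 0) :=
      tendsto_const_div_atTop_nhds_zero_nat _
    refine squeeze_zero_norm' ?_ hz
    filter_upwards [eventually_ge_atTop (⌊X₀⌋₊ + 1)] with k hk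
    have hkX := hk0 k hk
    have r1 := htail k hkX
    have r2 := hg (k + M) k (by omega) hkX (by push_cast; linarith)
    calc ‖e k‖ = ‖(∫ t in Set.Ioi (k : ℝ), J t) - (partialSum g (k + M) k - g 0)‖ := by
          simp only [he]; congr 1; ring
      _ ≤ B / k + Cg / k := (norm_sub_le _ _).trans (add_le_add r1 r2)
      _ = _ := by ring
  obtain rfl : R = 0 := tendsto_nhds_unique hR he0
  refine ⟨D' * C₃ + D' * (1 / X₀), by positivity, fun X hX => ?_⟩
  have hXp := hX₀.trans hX
  set k := ⌊X⌋₊ with hk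
  have hk1 : (k : ℝ) ≤ X := Nat.floor_le hXp.le
  have hk2 : X < k + 1 := Nat.lt_floor_add_one X
  rw [floorSum_eq g M hk1 hk2]
  have r1 := hstep k X hX hk1 hk2.le
  have r2 := hR' (k + 1) (by have := Nat.floor_le_floor hX.le; omega)
  rw [sub_zero] at r2
  have hanti : volterraWeight a L ((k + 1 : ℕ) : ℝ) ≤ volterraWeight a L X :=
    volterraWeight_antitone zero_le_one hL hXp (by rw [Set.mem_Ioi]; positivity)
      (by push_cast; exact hk2.le)
  have r3 : powExp (a - 1) X ≤ 1 / X₀ * volterraWeight a L X := by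
    have e1 : powExp (a - 1) X = 1 / X * powExp a X := by
      rw [powExp, powExp, Real.rpow_sub hXp, Real.rpow_one]; ring
    rw [e1]
    have := powExp_pos a hXp
    have := powExp_le_volterraWeight a hL0 hXp
    gcongr
  calc _ = ‖e (k + 1) - (e (k + 1) - (g 0 + (∫ t in Set.Ioi X, J t) - partialSum g (k + M) X))‖ := by
        congr 1; ring
    _ ≤ _ := norm_sub_le _ _
    _ ≤ D' * C₃ * volterraWeight a L X + D' * (1 / X₀ * volterraWeight a L X) := by
        refine add_le_add (r2.trans ?_) (r1.trans ?_)
        · gcongr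
        · gcongr
    _ = _ := by ring

end ScaledSystem

/-! ### The Volterra equation for the correction. -/

/-- The solution of `v' = f - (ω - ν/X) v` that is smallest at infinity. -/
def tailSolution (ω ν : ℂ) (f : ℝ → ℂ) (X : ℝ) : ℂ :=
  -((intFactor ω ν X)⁻¹ * ∫ t in Set.Ioi X, intFactor ω ν t * f t)

section TailSolution

variable {X₀ L C : ℝ} {ω ν : ℂ} {f : ℝ → ℂ}

/-- The exponent `Re ν - 3/2` of the weight is chosen such that multiplication by the integrating
factor leaves `t^{-3/2}`, which is integrable at infinity even if `ω = 1`. The other factors do not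
increase with `t` and are frozen at `X`. -/
theorem intFactor_mul_le (hω : ‖ω‖ = 1) (hL : 0 ≤ L) (hC : 0 ≤ C) {X t : ℝ} (hX : 0 < X)
    (hXt : X ≤ t) (hf : ‖f t‖ ≤ C * volterraWeight (ν.re - 3 / 2) L t) :
    ‖intFactor ω ν t * f t‖ ≤
      C * (Real.exp (-(1 - ω.re) * X) * Real.exp (L / X)) * t ^ (-3 / 2 : ℝ) := by
  have ht := hX.trans_le hXt
  have hc : 0 ≤ 1 - ω.re := by have := re_le_one_of_norm_eq_one hω; linarith
  have e := norm_intFactor_mul_powExp ω ν (-3 / 2) ht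
  rw [norm_mul]
  calc _ ≤ ‖intFactor ω ν t‖ * (C * volterraWeight (ν.re - 3 / 2) L t) := by gcongr
    _ = C * (‖intFactor ω ν t‖ * powExp (ν.re + -3 / 2) t) * Real.exp (L / t) := by
        rw [volterraWeight, show ν.re - 3 / 2 = ν.re + -3 / 2 by ring]; ring
    _ = C * (Real.exp (-(1 - ω.re) * t) * Real.exp (L / t)) * t ^ (-3 / 2 : ℝ) := by rw [e]; ring
    _ ≤ _ := by
        have h1 : -(1 - ω.re) * t ≤ -(1 - ω.re) * X := by nlinarith
        have h2 : L / t ≤ L / X := by gcongr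
        have := Real.exp_le_exp.mpr h1
        have := Real.exp_le_exp.mpr h2
        gcongr

theorem integrableOn_intFactor_mul (hω : ‖ω‖ = 1) (hX₀ : 0 < X₀) (hL : 0 ≤ L) (hC : 0 ≤ C)
    (hfm : AEStronglyMeasurable f (volume.restrict (Set.Ioi X₀)))
    (hf : ∀ X, X₀ < X → ‖f X‖ ≤ C * volterraWeight (ν.re - 3 / 2) L X) :
    IntegrableOn (fun t => intFactor ω ν t * f t) (Set.Ioi X₀) := by
  have hi : IntegrableOn (fun t : ℝ => C * (Real.exp (-(1 - ω.re) * X₀) * Real.exp (L / X₀)) *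
      t ^ (-3 / 2 : ℝ)) (Set.Ioi X₀) :=
    (integrableOn_Ioi_rpow_of_lt (by norm_num) hX₀).const_mul _
  refine Integrable.mono' hi ?_ ((ae_restrict_iff' measurableSet_Ioi).mpr
    (ae_of_all _ fun t ht => intFactor_mul_le hω hL hC hX₀ (le_of_lt ht) (hf t ht)))
  exact (((continuousOn_intFactor ω ν).mono fun x hx => hX₀.trans hx).aestronglyMeasurable
    measurableSet_Ioi).mul hfm

/-- The factor `2X` stems from `∫_X^∞ t^{-3/2} dt = 2 X^{-1/2}`: solving the first equation costs
one power of `X`, and the decay of `H` can afford it. -/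
theorem norm_tailSolution_le (hω : ‖ω‖ = 1) (hX₀ : 0 < X₀) (hL : 0 ≤ L) (hC : 0 ≤ C)
    (hf : ∀ X, X₀ < X → ‖f X‖ ≤ C * volterraWeight (ν.re - 3 / 2) L X) {X : ℝ} (hX : X₀ ≤ X) :
    ‖tailSolution ω ν f X‖ ≤ 2 * C * (X * volterraWeight (ν.re - 3 / 2) L X) := by
  have hXp := hX₀.trans_le hX
  have hw : 0 < ‖intFactor ω ν X‖ := norm_pos_iff.mpr (intFactor_ne_zero ω ν X)
  rw [tailSolution, norm_neg, norm_mul, norm_inv, inv_mul_le_iff₀ hw]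
  set D := C * (Real.exp (-(1 - ω.re) * X) * Real.exp (L / X)) with hD
  have hi : IntegrableOn (fun t : ℝ => D * t ^ (-3 / 2 : ℝ)) (Set.Ioi X) :=
    (integrableOn_Ioi_rpow_of_lt (by norm_num) hXp).const_mul _
  have h1 : ‖∫ t in Set.Ioi X, intFactor ω ν t * f t‖ ≤ ∫ t in Set.Ioi X, D * t ^ (-3 / 2 : ℝ) :=
    norm_integral_le_of_norm_le hi ((ae_restrict_iff' measurableSet_Ioi).mpr
      (ae_of_all _ fun t ht => intFactor_mul_le hω hL hC hXp (le_of_lt ht)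
        (hf t (hX.trans_lt ht))))
  refine h1.trans (le_of_eq ?_)
  have e := norm_intFactor_mul_powExp ω ν (-3 / 2) hXp
  rw [integral_const_mul, integral_Ioi_rpow_of_lt (by norm_num) hXp, volterraWeight,
    show ν.re - 3 / 2 = ν.re + -3 / 2 by ring]
  have e2 : X ^ ((-3 / 2 : ℝ) + 1) = X * X ^ (-3 / 2 : ℝ) := by
    rw [Real.rpow_add hXp, Real.rpow_one, mul_comm]
  rw [e2]
  calc _ = 2 * C * X * (X ^ (-3 / 2 : ℝ) * Real.exp (-(1 - ω.re) * X)) * Real.exp (L / X) := by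
        rw [hD]; ring
    _ = _ := by rw [← e]; ring

theorem continuousOn_integral_Ioi {F : ℝ → ℂ} (hF : IntegrableOn F (Set.Ioi X₀)) :
    ContinuousOn (fun X => ∫ t in Set.Ioi X, F t) (Set.Ici X₀) := by
  have h1 : ContinuousOn (fun X => (∫ t in Set.Ioi X₀, F t) - ∫ t in X₀..X, F t) (Set.Ici X₀) := by
    refine continuousOn_const.sub ?_
    intro x hx
    have hx' : X₀ ≤ x := hx
    have hi : IntegrableOn F (Set.uIcc X₀ (x + 1)) volume := by
      rw [Set.uIcc_of_le (by linarith), integrableOn_Icc_iff_integrableOn_Ioc]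
      exact hF.mono_set Set.Ioc_subset_Ioi_self
    have h2 := intervalIntegral.continuousOn_primitive_interval hi
    rw [Set.uIcc_of_le (by linarith)] at h2
    refine (h2 x ⟨hx', by linarith⟩).mono_of_mem_nhdsWithin ?_
    rw [← Set.Ici_inter_Iic]
    exact inter_mem_nhdsWithin _ (Iic_mem_nhds (by linarith))
  refine h1.congr fun X hX => ?_
  have : (∫ t in Set.Ioi X₀, F t) - ∫ t in Set.Ioi X, F t = ∫ t in X₀..X, F t :=
    intervalIntegral.integral_Ioi_sub_Ioi hF hX
  simp only [← this]; ring

theorem continuousOn_tailSolution (hX₀ : 0 < X₀)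
    (hf : IntegrableOn (fun t => intFactor ω ν t * f t) (Set.Ioi X₀)) :
    ContinuousOn (tailSolution ω ν f) (Set.Ici X₀) :=
  ((((continuousOn_intFactor ω ν).mono fun _ hx => hX₀.trans_le hx).inv₀
    fun x _ => intFactor_ne_zero ω ν x).mul (continuousOn_integral_Ioi hf)).neg

theorem tailSolution_sub {f₁ f₂ : ℝ → ℂ}
    (h₁ : IntegrableOn (fun t => intFactor ω ν t * f₁ t) (Set.Ioi X₀))
    (h₂ : IntegrableOn (fun t => intFactor ω ν t * f₂ t) (Set.Ioi X₀)) {X : ℝ} (hX : X₀ ≤ X) :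
    tailSolution ω ν (fun t => f₁ t - f₂ t) X = tailSolution ω ν f₁ X - tailSolution ω ν f₂ X := by
  have hs := Set.Ioi_subset_Ioi hX
  simp only [tailSolution, mul_sub]
  rw [integral_sub (h₁.mono_set hs) (h₂.mono_set hs)]
  ring

end TailSolution

namespace ScaledSystem

variable {X₀ : ℝ} {ω ν : ℂ} {P H : ℝ → ℂ} {Pc Hc s g : ℕ → ℂ} {K κ L C Λ : ℝ}

/-- With `m` the weight, both `P f` and `H` times the tail solution are at most `C m/t` times a
constant, `2K(1/X₀ + 2)` altogether. `Λ` exceeds twice this constant, so integration gains at least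
a factor `2`. -/
theorem volterra_bound (h : ScaledSystem X₀ ω ν P H Pc Hc s g K κ)
    (hΛ : Λ = 4 * K * (1 / X₀ + 2) + 1) (hL : (ν.re - 3 / 2 + Λ) ^ 2 ≤ 4 * L) (hC : 0 ≤ C)
    {f : ℝ → ℂ} (hfm : AEStronglyMeasurable f (volume.restrict (Set.Ioi X₀)))
    (hf : ∀ X, X₀ < X → ‖f X‖ ≤ C * volterraWeight (ν.re - 3 / 2) L X) :
    IntegrableOn (fun t => P t * f t + H t * tailSolution ω ν f t) (Set.Ioi X₀) ∧
    ∀ X, X₀ ≤ X → ‖∫ t in Set.Ioi X, (P t * f t + H t * tailSolution ω ν f t)‖ ≤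
      C / 2 * volterraWeight (ν.re - 3 / 2) L X := by
  have hX₀ := h.X₀_pos
  have hK := h.K_nonneg
  have hL0 : 0 ≤ L := by nlinarith [sq_nonneg (ν.re - 3 / 2 + Λ)]
  have hΛ0 : 0 < Λ := by rw [hΛ]; positivity
  set D := 2 * K * C * (1 / X₀ + 2) with hD
  have hD0 : 0 ≤ D := by positivity
  have hi := integrableOn_intFactor_mul h.norm_eq hX₀ hL0 hC hfm hf
  have hle : ∀ t, X₀ < t → ‖P t * f t + H t * tailSolution ω ν f t‖ ≤
      D * (volterraWeight (ν.re - 3 / 2) L t / t) := fun t ht => by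
    have htp := hX₀.trans ht
    have hm := volterraWeight_pos (ν.re - 3 / 2) L htp
    have h1 := norm_tailSolution_le h.norm_eq hX₀ hL0 hC hf ht.le
    calc _ ≤ ‖P t‖ * ‖f t‖ + ‖H t‖ * ‖tailSolution ω ν f t‖ := by
          refine (norm_add_le _ _).trans ?_
          rw [norm_mul, norm_mul]
      _ ≤ (2 * K / t ^ 2) * (C * volterraWeight (ν.re - 3 / 2) L t) +
          (2 * K / t ^ 2) * (2 * C * (t * volterraWeight (ν.re - 3 / 2) L t)) := by
          have := h.norm_P_le ht
          have := h.norm_H_le ht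
          have := hf t ht
          gcongr
      _ = 2 * K * C * (1 / t + 2) * (volterraWeight (ν.re - 3 / 2) L t / t) := by
          field_simp
      _ ≤ _ := by
          have : 1 / t ≤ 1 / X₀ := by gcongr
          rw [hD]
          gcongr
  have hm : AEStronglyMeasurable (fun t => P t * f t + H t * tailSolution ω ν f t)
      (volume.restrict (Set.Ioi X₀)) :=
    (h.P_meas.mul hfm).add (h.H_meas.mul (((continuousOn_tailSolution hX₀ hi).mono
      Set.Ioi_subset_Ici_self).aestronglyMeasurable measurableSet_Ioi))
  refine ⟨Integrable.mono' ((integrableOn_volterraWeight_div hΛ0 hL hX₀).1.const_mul D) hm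
    ((ae_restrict_iff' measurableSet_Ioi).mpr (ae_of_all _ fun t ht => hle t ht)), fun X hX => ?_⟩
  have hXp := hX₀.trans_le hX
  obtain ⟨i1, i2⟩ := integrableOn_volterraWeight_div hΛ0 hL hXp
  have hmp := volterraWeight_pos (ν.re - 3 / 2) L hXp
  calc _ ≤ ∫ t in Set.Ioi X, D * (volterraWeight (ν.re - 3 / 2) L t / t) :=
        norm_integral_le_of_norm_le (i1.const_mul D) ((ae_restrict_iff' measurableSet_Ioi).mpr
          (ae_of_all _ fun t ht => hle t (hX.trans_lt ht)))
    _ = D * ∫ t in Set.Ioi X, volterraWeight (ν.re - 3 / 2) L t / t := integral_const_mul _ _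
    _ ≤ D * (volterraWeight (ν.re - 3 / 2) L X / Λ) := by gcongr
    _ = D / Λ * volterraWeight (ν.re - 3 / 2) L X := by ring
    _ ≤ _ := by
        refine mul_le_mul_of_nonneg_right ?_ hmp.le
        rw [div_le_iff₀ hΛ0, hΛ, hD]
        nlinarith

/-- Banach's fixed point theorem for functions of the form `m b`, with `m` the weight and `b`
bounded and continuous; the contraction constant is the `1/2` of `volterra_bound`. -/
theorem exists_volterra_solution (h : ScaledSystem X₀ ω ν P H Pc Hc s g K κ)
    (hΛ : Λ = 4 * K * (1 / X₀ + 2) + 1) (hL : (ν.re - 3 / 2 + Λ) ^ 2 ≤ 4 * L) (hC : 0 ≤ C)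
    {f : ℝ → ℂ} (hfm : AEStronglyMeasurable f (volume.restrict (Set.Ioi X₀)))
    (hf : ∀ X, X₀ < X → ‖f X‖ ≤ C * volterraWeight (ν.re - 3 / 2) L X) :
    ∃ (η : ℝ → ℂ) (C' : ℝ), 0 ≤ C' ∧ ContinuousOn η (Set.Ioi X₀) ∧
      (∀ X, X₀ < X → ‖η X‖ ≤ C' * volterraWeight (ν.re - 3 / 2) L X) ∧
      ∀ X, X₀ < X → η X = ∫ t in Set.Ioi X, (P t * (f t + η t) +
        H t * tailSolution ω ν (fun t => f t + η t) t) := by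
  have hX₀ := h.X₀_pos
  have hL0 : 0 ≤ L := by nlinarith [sq_nonneg (ν.re - 3 / 2 + Λ)]
  set m := volterraWeight (ν.re - 3 / 2) L with hm
  have hmp : ∀ X, X₀ ≤ X → 0 < m X := fun X hX => volterraWeight_pos _ _ (hX₀.trans_le hX)
  have hmc : ContinuousOn m (Set.Ici X₀) := fun x hx =>
    (hasDerivAt_volterraWeight _ _ (hX₀.trans_le hx)).continuousAt.continuousWithinAt
  -- the operator in the weighted space
  set F : BoundedContinuousFunction ℝ ℂ → ℝ → ℂ := fun b t => f t + m t * b t with hF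
  have hFm : ∀ b, AEStronglyMeasurable (F b) (volume.restrict (Set.Ioi X₀)) := fun b =>
    hfm.add (((Complex.continuous_ofReal.comp_continuousOn
      (hmc.mono Set.Ioi_subset_Ici_self)).aestronglyMeasurable measurableSet_Ioi).mul
      b.continuous.aestronglyMeasurable)
  have hFle : ∀ b X, X₀ < X → ‖F b X‖ ≤ (C + ‖b‖) * m X := fun b X hX => by
    have hp := hmp X hX.le
    refine (norm_add_le _ _).trans ?_
    rw [norm_mul, Complex.norm_real, Real.norm_of_nonneg hp.le, add_mul, mul_comm (m X)]
    exact add_le_add (hf X hX) (mul_le_mul_of_nonneg_right (b.norm_coe_le_norm X) hp.le)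
  have hV := fun b => h.volterra_bound hΛ hL (add_nonneg hC (norm_nonneg b)) (hFm b) (hFle b)
  set V : BoundedContinuousFunction ℝ ℂ → ℝ → ℂ := fun b X =>
    ∫ t in Set.Ioi X, (P t * F b t + H t * tailSolution ω ν (F b) t) with hVdef
  -- The operator yields functions on `[X₀, ∞)`. Extending them by their value at `X₀` makes them
  -- elements of the complete space of bounded continuous functions on the line.
  have hmax : Continuous fun X : ℝ => max X X₀ := by fun_prop
  have hTc : ∀ b, Continuous fun X : ℝ => ((m (max X X₀) : ℂ))⁻¹ * V b (max X X₀) := fun b => by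
    have h1 : ContinuousOn (fun X => ((m X : ℂ))⁻¹ * V b X) (Set.Ici X₀) :=
      ((Complex.continuous_ofReal.comp_continuousOn hmc).inv₀ fun x hx => by
        simpa using (hmp x hx).ne').mul (continuousOn_integral_Ioi (hV b).1)
    exact h1.comp_continuous hmax fun x => Set.mem_Ici.mpr (le_max_right _ _)
  have hTb : ∀ b X, ‖((m (max X X₀) : ℂ))⁻¹ * V b (max X X₀)‖ ≤ (C + ‖b‖) / 2 := fun b X => by
    have hp := hmp _ (le_max_right X X₀)
    rw [norm_mul, norm_inv, Complex.norm_real, Real.norm_of_nonneg hp.le, inv_mul_le_iff₀ hp,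
      mul_comm]
    exact (hV b).2 _ (le_max_right _ _)
  set T : BoundedContinuousFunction ℝ ℂ → BoundedContinuousFunction ℝ ℂ := fun b =>
    BoundedContinuousFunction.ofNormedAddCommGroup _ (hTc b) _ (hTb b) with hT
  have hcontr : ContractingWith (1 / 2) T := by
    refine ⟨by rw [← NNReal.coe_lt_coe]; norm_num, LipschitzWith.of_dist_le_mul fun b₁ b₂ => ?_⟩
    rw [BoundedContinuousFunction.dist_le (by positivity)]
    intro X
    set Y := max X X₀ with hY
    have hYX : X₀ ≤ Y := le_max_right _ _
    have hp := hmp Y hYX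
    have hsub : ∀ t, F b₁ t - F b₂ t = m t * (b₁ - b₂) t := fun t => by
      simp only [hF, BoundedContinuousFunction.coe_sub, Pi.sub_apply]; ring
    have hdm : AEStronglyMeasurable (fun t => F b₁ t - F b₂ t) (volume.restrict (Set.Ioi X₀)) :=
      (hFm b₁).sub (hFm b₂)
    have hdle : ∀ X, X₀ < X → ‖F b₁ X - F b₂ X‖ ≤ ‖b₁ - b₂‖ * m X := fun X hX => by
      have hp := hmp X hX.le
      rw [hsub, norm_mul, Complex.norm_real, Real.norm_of_nonneg hp.le, mul_comm]
      exact mul_le_mul_of_nonneg_right ((b₁ - b₂).norm_coe_le_norm X) hp.le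
    have hb := (h.volterra_bound hΛ hL (norm_nonneg _) hdm hdle).2 Y hYX
    have hi₁ := integrableOn_intFactor_mul h.norm_eq hX₀ hL0 (add_nonneg hC (norm_nonneg b₁))
      (hFm b₁) (hFle b₁)
    have hi₂ := integrableOn_intFactor_mul h.norm_eq hX₀ hL0 (add_nonneg hC (norm_nonneg b₂))
      (hFm b₂) (hFle b₂)
    have hVs : ∫ t in Set.Ioi Y, (P t * (F b₁ t - F b₂ t) +
        H t * tailSolution ω ν (fun t => F b₁ t - F b₂ t) t) = V b₁ Y - V b₂ Y := by
      have hs := Set.Ioi_subset_Ioi hYX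
      rw [hVdef, ← integral_sub ((hV b₁).1.mono_set hs) ((hV b₂).1.mono_set hs)]
      refine setIntegral_congr_fun measurableSet_Ioi fun t ht => ?_
      rw [tailSolution_sub hi₁ hi₂ (hYX.trans (le_of_lt ht))]
      ring
    rw [hVs] at hb
    have e : T b₁ X - T b₂ X = ((m Y : ℂ))⁻¹ * (V b₁ Y - V b₂ Y) := by
      simp only [hT, BoundedContinuousFunction.coe_ofNormedAddCommGroup]; ring
    rw [dist_eq_norm, e, norm_mul, norm_inv, Complex.norm_real, Real.norm_of_nonneg hp.le,
      inv_mul_le_iff₀ hp, dist_eq_norm]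
    refine hb.trans (le_of_eq ?_)
    push_cast
    ring
  set b := hcontr.fixedPoint with hb
  have hfix : T b = b := hcontr.fixedPoint_isFixedPt
  have hfixX : ∀ X, X₀ < X → (m X : ℂ) * b X = V b X := fun X hX => by
    have hp := hmp X hX.le
    have h1 : b X = ((m (max X X₀) : ℂ))⁻¹ * V b (max X X₀) := by
      conv_lhs => rw [← hfix]
      rfl
    rw [max_eq_left hX.le] at h1
    have : (m X : ℂ) ≠ 0 := by exact_mod_cast hp.ne'
    rw [h1, mul_inv_cancel_left₀ this]
  refine ⟨fun X => m X * b X, ‖b‖, norm_nonneg _, ?_, fun X hX => ?_, fun X hX => hfixX X hX⟩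
  · exact (Complex.continuous_ofReal.comp_continuousOn
      (hmc.mono Set.Ioi_subset_Ici_self)).mul b.continuous.continuousOn
  · have hp := hmp X hX.le
    rw [norm_mul, Complex.norm_real, Real.norm_of_nonneg hp.le, mul_comm]
    exact mul_le_mul_of_nonneg_right (b.norm_coe_le_norm X) hp.le

/-- A solution that is approximated by the formal solution, summed up to the least term, with an
error of the size of the least term. -/
theorem exists_solution (h : ScaledSystem X₀ ω ν P H Pc Hc s g K κ) {n₀ : ℕ}
    (hn₀ : BaseIndex ν n₀) {M : ℕ} (hM : n₀ + 1 ≤ M) :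
    ∃ (u G : ℝ → ℂ) (C : ℝ), 0 ≤ C ∧ ContinuousOn G (Set.Ioi X₀) ∧
      (∀ X, X₀ < X → HasDerivAt u (G X - (ω - ν / X) * u X) X) ∧
      (∀ X Y, X₀ < X → X₀ < Y → G Y - G X = -∫ t in X..Y, (P t * G t + H t * u t)) ∧
      (∀ X, X₀ < X → ‖u X - floorSum s M X‖ ≤ C * leastTerm ν.re X) := by
  have hX₀ := h.X₀_pos
  have hK := h.K_nonneg
  set a := ν.re - 3 / 2 with ha
  obtain ⟨Λ, hΛ⟩ : ∃ Λ, Λ = 4 * K * (1 / X₀ + 2) + 1 := ⟨_, rfl⟩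
  -- The sum serves two purposes: the first square is required by the contraction, the second by the
  -- telescoping over unit intervals.
  set L := (a + Λ) ^ 2 + (a + 1) ^ 2 with hLdef
  have hL1 : (a + Λ) ^ 2 ≤ 4 * L := by nlinarith [sq_nonneg (a + Λ), sq_nonneg (a + 1)]
  have hL2 : (a + 1) ^ 2 ≤ 4 * L := by nlinarith [sq_nonneg (a + Λ), sq_nonneg (a + 1)]
  have hL0 : 0 ≤ L := by positivity
  obtain ⟨u₀, C₀, c₀, hC₀, hu₀c, hu₀, hu₀'⟩ := h.exists_first_approximation hn₀ hM
  obtain ⟨hJi, C₁, hC₁, hE⟩ := h.exists_second_error_le hn₀ hM hC₀ hu₀c hu₀' hL2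
  set J : ℝ → ℂ := fun t => P t * floorSum g M t + H t * u₀ t with hJ
  set E : ℝ → ℂ := fun X => g 0 + (∫ t in Set.Ioi X, J t) - floorSum g M X with hEdef
  have hJc : ContinuousOn (fun X => ∫ t in Set.Ioi X, J t) (Set.Ioi X₀) :=
    (continuousOn_integral_Ioi hJi).mono Set.Ioi_subset_Ici_self
  have hEm : AEStronglyMeasurable E (volume.restrict (Set.Ioi X₀)) :=
    ((continuousOn_const.add hJc).aestronglyMeasurable measurableSet_Ioi).sub
      (measurable_floorSum g M).aestronglyMeasurable
  obtain ⟨η, C₂, hC₂, hηc, hη, hη'⟩ := h.exists_volterra_solution hΛ hL1 hC₁ hEm hE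
  set χ : ℝ → ℂ := fun t => E t + η t with hχ
  have hχm : AEStronglyMeasurable χ (volume.restrict (Set.Ioi X₀)) :=
    hEm.add (hηc.aestronglyMeasurable measurableSet_Ioi)
  have hχle : ∀ X, X₀ < X → ‖χ X‖ ≤ (C₁ + C₂) * volterraWeight a L X := fun X hX => by
    rw [add_mul]
    exact (norm_add_le _ _).trans (add_le_add (hE X hX) (hη X hX))
  have hwχ := integrableOn_intFactor_mul h.norm_eq hX₀ hL0 (by positivity) hχm hχle
  have hVi := (h.volterra_bound hΛ hL1 (by positivity) hχm hχle).1
  have hΨ := fun X (hX : X₀ ≤ X) => norm_tailSolution_le h.norm_eq hX₀ hL0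
    (show 0 ≤ C₁ + C₂ by positivity) hχle hX
  set w := intFactor ω ν with hw
  set Ψ := tailSolution ω ν χ with hΨdef
  -- `G` equals `floorSum g + χ`; the jumps of the cut series and those of `χ` cancel, so `G` is
  -- continuous. Accordingly `u` is `u₀` plus the response `Ψ` of the first equation to `χ`.
  set G : ℝ → ℂ := fun X => g 0 + (∫ t in Set.Ioi X, J t) + η X with hG
  set u : ℝ → ℂ := fun X => u₀ X + Ψ X with hu
  have hGχ : ∀ X, G X = floorSum g M X + χ X := fun X => by
    simp only [hG, hχ, hEdef]; ring
  have hGc : ContinuousOn G (Set.Ioi X₀) := (continuousOn_const.add hJc).add hηc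
  have hPG : ∀ t, P t * G t + H t * u t = J t + (P t * χ t + H t * Ψ t) := fun t => by
    rw [hGχ]; simp only [hJ, hu]; ring
  have hPGi : IntegrableOn (fun t => P t * G t + H t * u t) (Set.Ioi X₀) := by
    simp only [hPG]; exact hJi.add hVi
  have hGint : ∀ X, X₀ < X → G X = g 0 + ∫ t in Set.Ioi X, (P t * G t + H t * u t) := by
    intro X hX
    have hs := Set.Ioi_subset_Ioi hX.le
    simp only [hPG]
    rw [integral_add (hJi.mono_set hs) (hVi.mono_set hs), ← hη' X hX]
    simp only [hG]; ring
  refine ⟨u, G, C₀ + 2 * (C₁ + C₂) * Real.exp (L / X₀), by positivity, hGc, fun X hX => ?_,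
    fun X Y hX hY => ?_, fun X hX => ?_⟩
  · have hXp := hX₀.trans hX
    have hwc : ContinuousOn w (Set.Ioi X₀) :=
      (continuousOn_intFactor ω ν).mono fun x hx => hX₀.trans hx
    have hwG : ContinuousOn (fun t => w t * G t) (Set.Ioi X₀) := hwc.mul hGc
    have hwg : ∀ a b, X₀ < a → X₀ < b →
        IntervalIntegrable (fun t => w t * floorSum g M t) volume a b := fun a b ha hb =>
      intervalIntegrable_mul_floorSum (continuousOn_intFactor ω ν) g M (hX₀.trans ha) (hX₀.trans hb)
    have key : ∀ Y, X₀ < Y → w Y * u Y =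
        (c₀ - ∫ t in Set.Ioi (X₀ + 1), w t * χ t) + ∫ t in (X₀ + 1)..Y, w t * G t := by
      intro Y hY
      have h1 : w Y * Ψ Y = -∫ t in Set.Ioi Y, w t * χ t := by
        rw [hΨdef, tailSolution, mul_neg, mul_inv_cancel_left₀ (intFactor_ne_zero ω ν Y)]
      have hχi : ∀ a b, X₀ < a → X₀ < b → IntervalIntegrable (fun t => w t * χ t) volume a b :=
        fun a b ha hb => intervalIntegrable_iff.mpr (hwχ.mono_set fun x hx =>
          (lt_min ha hb).trans hx.1)
      have h2 : (∫ t in (X₀ + 1)..Y, w t * χ t) + ∫ t in Set.Ioi Y, w t * χ t =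
          ∫ t in Set.Ioi (X₀ + 1), w t * χ t := by
        refine intervalIntegral.integral_interval_add_Ioi (hwχ.mono_set ?_)
          (hwχ.mono_set ?_)
        · exact Set.Ioi_subset_Ioi (by linarith)
        · exact Set.Ioi_subset_Ioi hY.le
      have h3 : ∫ t in (X₀ + 1)..Y, w t * G t =
          (∫ t in (X₀ + 1)..Y, w t * floorSum g M t) + ∫ t in (X₀ + 1)..Y, w t * χ t := by
        rw [← intervalIntegral.integral_add (hwg _ _ (by linarith) hY) (hχi _ _ (by linarith) hY)]
        refine intervalIntegral.integral_congr fun t _ => ?_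
        simp only [hGχ]; ring
      have h4 := hu₀ Y hY
      rw [h3, ← h2]
      simp only [hu, mul_add]
      rw [h1, h4]
      ring
    have hd : HasDerivAt (fun Y => ∫ t in (X₀ + 1)..Y, w t * G t) (w X * G X) X := by
      refine intervalIntegral.integral_hasDerivAt_right ?_ ?_ (hwG.continuousAt (Ioi_mem_nhds hX))
      · refine (hwG.mono fun t ht => ?_).intervalIntegrable
        exact (lt_min (by linarith) hX).trans_le ht.1
      · exact hwG.stronglyMeasurableAtFilter isOpen_Ioi X hX
    have hd2 := (hd.const_add (c₀ - ∫ t in Set.Ioi (X₀ + 1), w t * χ t))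
    have hw' := hasDerivAt_intFactor ω ν hXp
    have hd3 := (hw'.inv (intFactor_ne_zero ω ν X)).mul hd2
    have hwX := intFactor_ne_zero ω ν X
    refine HasDerivAt.congr_of_eventuallyEq (f := fun Y => (intFactor ω ν Y)⁻¹ *
      ((c₀ - ∫ t in Set.Ioi (X₀ + 1), w t * χ t) + ∫ t in (X₀ + 1)..Y, w t * G t))
      (hd3.congr_deriv ?_) ?_
    · simp only [Pi.inv_apply]
      rw [← key X hX, ← hw]
      rw [← hw] at hwX
      field_simp
      ring
    · filter_upwards [lt_mem_nhds hX] with Y hY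
      rw [← key Y hY, ← mul_assoc, inv_mul_cancel₀ (intFactor_ne_zero ω ν Y), one_mul]
  · rw [hGint X hX, hGint Y hY]
    have h1 : (∫ t in X..Y, (P t * G t + H t * u t)) +
        ∫ t in Set.Ioi Y, (P t * G t + H t * u t) = ∫ t in Set.Ioi X, (P t * G t + H t * u t) :=
      intervalIntegral.integral_interval_add_Ioi (hPGi.mono_set (Set.Ioi_subset_Ioi hX.le))
        (hPGi.mono_set (Set.Ioi_subset_Ioi hY.le))
    rw [← h1]; ring
  · have hXp := hX₀.trans hX
    have h1 := hΨ X hX.le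
    have h2 := volterraWeight_le a hL0 hX₀ hX
    have h3 : X * powExp a X = leastTerm ν.re X := by
      rw [leastTerm_eq_powExp, show ν.re - 1 / 2 = a + (1 : ℕ) by rw [ha]; push_cast; ring,
        powExp_add_nat a 1 hXp, pow_one]
    calc ‖u X - floorSum s M X‖ = ‖(u₀ X - floorSum s M X) + Ψ X‖ := by
          simp only [hu]; congr 1; ring
      _ ≤ C₀ * leastTerm ν.re X + 2 * (C₁ + C₂) * (X * (Real.exp (L / X₀) * powExp a X)) := by
          refine (norm_add_le _ _).trans (add_le_add (hu₀' X hX) (h1.trans ?_))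
          gcongr
      _ = _ := by rw [← h3]; ring

end ScaledSystem

/-! ### Dawson's function. -/

/-- The Dawson function, scaled such that it solves `f' = 1 - t f / X`. -/
def scaledDawson (X t : ℝ) : ℝ :=
  Real.exp (-t ^ 2 / (2 * X)) * ∫ s in (0 : ℝ)..t, Real.exp (s ^ 2 / (2 * X))

section Dawson

variable {X : ℝ}

theorem scaledDawson_zero (X : ℝ) : scaledDawson X 0 = 0 := by simp [scaledDawson]

theorem hasDerivAt_scaledDawson (hX : 0 < X) (t : ℝ) :
    HasDerivAt (scaledDawson X) (1 - t * scaledDawson X t / X) t := by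
  have hc : Continuous fun s : ℝ => Real.exp (s ^ 2 / (2 * X)) := by fun_prop
  have h1 : HasDerivAt (fun t : ℝ => -t ^ 2 / (2 * X)) (-(2 * t) / (2 * X)) t := by
    simpa using ((hasDerivAt_pow 2 t).neg).div_const (2 * X)
  have h2 := intervalIntegral.integral_hasDerivAt_right (hc.intervalIntegrable 0 t)
    (hc.stronglyMeasurableAtFilter _ _) hc.continuousAt
  refine HasDerivAt.congr_deriv (f := scaledDawson X) (h1.exp.mul h2) ?_
  have e : Real.exp (-t ^ 2 / (2 * X)) * Real.exp (t ^ 2 / (2 * X)) = 1 := by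
    rw [← Real.exp_add, neg_div, neg_add_cancel, Real.exp_zero]
  rw [e, scaledDawson]
  field_simp
  ring

theorem scaledDawson_nonneg (X : ℝ) {t : ℝ} (ht : 0 ≤ t) : 0 ≤ scaledDawson X t :=
  mul_nonneg (Real.exp_pos _).le
    (intervalIntegral.integral_nonneg ht fun _ _ => (Real.exp_pos _).le)

/-- Replacing `s²` by `t s` in the exponent makes the integral elementary. -/
theorem mul_scaledDawson_le (hX : 0 < X) {t : ℝ} (ht : 0 ≤ t) : t * scaledDawson X t ≤ 2 * X := by
  have hc : Continuous fun s : ℝ => Real.exp (s ^ 2 / (2 * X)) := by fun_prop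
  have hc' : Continuous fun s : ℝ => Real.exp (t * s / (2 * X)) * t := by fun_prop
  have hd : ∀ s ∈ Set.uIcc 0 t, HasDerivAt (fun s : ℝ => 2 * X * Real.exp (t * s / (2 * X)))
      (Real.exp (t * s / (2 * X)) * t) s := fun s _ => by
    have h1 : HasDerivAt (fun s : ℝ => t * s / (2 * X)) (t / (2 * X)) s := by
      simpa using ((hasDerivAt_id s).const_mul t).div_const (2 * X)
    refine (h1.exp.const_mul (2 * X)).congr_deriv ?_
    field_simp
  have h1 : t * ∫ s in (0 : ℝ)..t, Real.exp (s ^ 2 / (2 * X)) ≤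
      2 * X * Real.exp (t ^ 2 / (2 * X)) := by
    rw [← intervalIntegral.integral_const_mul]
    calc _ ≤ ∫ s in (0 : ℝ)..t, Real.exp (t * s / (2 * X)) * t := by
          refine intervalIntegral.integral_mono_on ht ((hc.const_mul t).intervalIntegrable _ _)
            (hc'.intervalIntegrable _ _) fun s hs => ?_
          rw [mul_comm]
          have : s ^ 2 ≤ t * s := by nlinarith [hs.1, hs.2]
          gcongr
      _ = _ := intervalIntegral.integral_eq_sub_of_hasDerivAt hd (hc'.intervalIntegrable _ _)
      _ ≤ _ := by
          simp only [mul_zero, zero_div, Real.exp_zero, ← pow_two]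
          linarith
  have e : Real.exp (-t ^ 2 / (2 * X)) * Real.exp (t ^ 2 / (2 * X)) = 1 := by
    rw [← Real.exp_add, neg_div, neg_add_cancel, Real.exp_zero]
  calc t * scaledDawson X t
      = Real.exp (-t ^ 2 / (2 * X)) * (t * ∫ s in (0 : ℝ)..t, Real.exp (s ^ 2 / (2 * X))) := by
        rw [scaledDawson]; ring
    _ ≤ Real.exp (-t ^ 2 / (2 * X)) * (2 * X * Real.exp (t ^ 2 / (2 * X))) := by gcongr
    _ = 2 * X * (Real.exp (-t ^ 2 / (2 * X)) * Real.exp (t ^ 2 / (2 * X))) := by ring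
    _ = 2 * X := by rw [e, mul_one]

theorem exists_scaledDawson_sub (hX : 0 < X) {a b : ℝ} (hab : a < b) :
    ∃ ξ, a < ξ ∧ ξ < b ∧
      scaledDawson X b - scaledDawson X a = (1 - ξ * scaledDawson X ξ / X) * (b - a) := by
  obtain ⟨ξ, h1, h2⟩ := exists_hasDerivAt_eq_slope (scaledDawson X) _ hab
    (fun x _ => (hasDerivAt_scaledDawson hX x).continuousAt.continuousWithinAt)
    (fun x _ => hasDerivAt_scaledDawson hX x)
  refine ⟨ξ, h1.1, h1.2, ?_⟩
  rw [h2, div_mul_cancel₀ _ (by linarith)]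

/-- By the differential equation and `mul_scaledDawson_le`, the derivative lies between `-1` and
`1`. -/
theorem abs_scaledDawson_sub_le (hX : 0 < X) {a b : ℝ} (ha : 0 ≤ a) (hab : a ≤ b) :
    |scaledDawson X b - scaledDawson X a| ≤ b - a := by
  rcases hab.eq_or_lt with rfl | hab
  · simp
  obtain ⟨ξ, h1, h2, h3⟩ := exists_scaledDawson_sub hX hab
  have hξ : 0 ≤ ξ := by linarith
  have h4 : 0 ≤ ξ * scaledDawson X ξ / X := by
    have := scaledDawson_nonneg X hξ
    positivity
  have h5 : ξ * scaledDawson X ξ / X ≤ 2 := by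
    rw [div_le_iff₀ hX]; exact mul_scaledDawson_le hX hξ
  rw [h3, abs_mul, abs_of_nonneg (sub_nonneg.mpr hab.le)]
  exact mul_le_of_le_one_left (by linarith) (abs_le.mpr ⟨by linarith, by linarith⟩)

theorem scaledDawson_le_self (hX : 0 < X) {t : ℝ} (ht : 0 ≤ t) : scaledDawson X t ≤ t := by
  have := abs_scaledDawson_sub_le hX le_rfl ht
  rw [scaledDawson_zero, sub_zero, sub_zero] at this
  exact (le_abs_self _).trans this

/-- The differential equation as a pair of difference inequalities. Sums of model terms, divided by
the outer term, satisfy the corresponding recursions, and these bounds allow the comparison. -/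
theorem scaledDawson_add_one (hX : 0 < X) {t : ℝ} (ht : 0 ≤ t) :
    scaledDawson X t + 1 - (t + 1) * (scaledDawson X t + 1) / X ≤ scaledDawson X (t + 1) ∧
      scaledDawson X (t + 1) ≤ scaledDawson X t + 1 - t * (scaledDawson X t - 1) / X := by
  obtain ⟨ξ, h1, h2, h3⟩ := exists_scaledDawson_sub hX (lt_add_one t)
  have hξ : 0 ≤ ξ := by linarith
  have h4 := abs_le.mp (abs_scaledDawson_sub_le hX ht h1.le)
  have h5 := scaledDawson_nonneg X ht
  have h6 := scaledDawson_nonneg X hξ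
  have h7 : ξ * scaledDawson X ξ ≤ (t + 1) * (scaledDawson X t + 1) :=
    mul_le_mul h2.le (by linarith) h6 (by linarith)
  have h8 : t * (scaledDawson X t - 1) ≤ ξ * scaledDawson X ξ := by
    refine (mul_le_mul_of_nonneg_left (show scaledDawson X t - 1 ≤ scaledDawson X ξ by linarith)
      ht).trans (mul_le_mul_of_nonneg_right h1.le h6)
  have h9 := div_le_div_of_nonneg_right h7 hX.le
  have h10 := div_le_div_of_nonneg_right h8 hX.le
  rw [show t + 1 - t = 1 by ring, mul_one] at h3
  constructor <;> linarith

/-- The substitution scales `s` by `√(2X)`. This is why `aStar` contains the factor `√2`: the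
maximum over `t` becomes `aStar * √X`. -/
theorem scaledDawson_eq (hX : 0 < X) (t : ℝ) :
    scaledDawson X t = √(2 * X) * (Real.exp (-(t / √(2 * X)) ^ 2) *
      ∫ s in (0 : ℝ)..(t / √(2 * X)), Real.exp (s ^ 2)) := by
  have hs : 0 < √(2 * X) := by positivity
  have hsq : √(2 * X) ^ 2 = 2 * X := Real.sq_sqrt (by positivity)
  have h1 : ∫ s in (0 : ℝ)..t, Real.exp ((s / √(2 * X)) ^ 2) =
      √(2 * X) * ∫ s in (0 : ℝ)..(t / √(2 * X)), Real.exp (s ^ 2) := by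
    rw [intervalIntegral.integral_comp_div (fun s => Real.exp (s ^ 2)) hs.ne', zero_div, smul_eq_mul]
  have h2 : ∫ s in (0 : ℝ)..t, Real.exp (s ^ 2 / (2 * X)) =
      ∫ s in (0 : ℝ)..t, Real.exp ((s / √(2 * X)) ^ 2) := by
    simp only [div_pow, hsq]
  rw [scaledDawson, h2, h1, div_pow, hsq, neg_div]
  ring

/-- The maximum in the definition of `aStar` is attained. -/
theorem exists_aStar_eq : ∃ u : ℝ, 0 < u ∧ 0 < aStar ∧
    (∀ v : ℝ, 0 ≤ v → √2 * (Real.exp (-v ^ 2) * ∫ t in (0 : ℝ)..v, Real.exp (t ^ 2)) ≤ aStar) ∧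
    √2 * (Real.exp (-u ^ 2) * ∫ t in (0 : ℝ)..u, Real.exp (t ^ 2)) = aStar := by
  set F : ℝ → ℝ := fun u => Real.exp (-u ^ 2) * ∫ t in (0 : ℝ)..u, Real.exp (t ^ 2) with hF
  have hFD : ∀ u, F u = scaledDawson (1 / 2) u := fun u => by
    simp only [hF, scaledDawson]; norm_num
  have hhalf : (0 : ℝ) < 1 / 2 := by norm_num
  have hcont : Continuous F := by
    have : F = scaledDawson (1 / 2) := funext hFD
    rw [this]
    exact continuous_iff_continuousAt.mpr fun x => (hasDerivAt_scaledDawson hhalf x).continuousAt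
  have hF1 : 0 < F 1 := by
    refine mul_pos (Real.exp_pos _) ?_
    refine intervalIntegral.intervalIntegral_pos_of_pos_on ?_ (fun x _ => Real.exp_pos _) one_pos
    exact (by fun_prop : Continuous fun t : ℝ => Real.exp (t ^ 2)).intervalIntegrable _ _
  -- `mul_scaledDawson_le` at `X = 1/2` gives `F v ≤ 1/v`, so beyond `1 / F 1` the function stays
  -- below `F 1`, and a maximum over a compact interval is a global one.
  set k := max 1 (1 / F 1) with hk
  have hk1 : 1 ≤ k := le_max_left _ _
  obtain ⟨u, hu, hmax⟩ := isCompact_Icc.exists_isMaxOn (s := Set.Icc 0 k)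
    ⟨0, by simp; linarith⟩ hcont.continuousOn
  have hF1u : F 1 ≤ F u := hmax ⟨zero_le_one, hk1⟩
  have hle : ∀ v, 0 ≤ v → F v ≤ F u := fun v hv => by
    rcases le_or_gt v k with h | h
    · exact hmax ⟨hv, h⟩
    · have h1 := mul_scaledDawson_le hhalf hv
      rw [← hFD] at h1
      have h2 : 1 / F 1 < v := (le_max_right _ _).trans_lt h
      have hv0 : 0 < v := by linarith
      rw [div_lt_iff₀ hF1] at h2
      have : v * F v < v * F 1 := by linarith
      exact (lt_of_mul_lt_mul_left this hv).le.trans hF1u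
  have hg : IsGreatest (F '' Set.Ici 0) (F u) :=
    ⟨⟨u, hu.1, rfl⟩, by rintro _ ⟨v, hv, rfl⟩; exact hle v hv⟩
  have ha : √2 * F u = aStar := by rw [aStar, hg.csSup_eq]
  have hs : (0 : ℝ) < √2 := by positivity
  have hu0 : u ≠ 0 := by
    rintro rfl
    have h0 : F 0 = 0 := by rw [hFD, scaledDawson_zero]
    linarith
  refine ⟨u, lt_of_le_of_ne hu.1 (Ne.symm hu0), by rw [← ha]; exact mul_pos hs (by linarith),
    fun v hv => ?_, ha⟩
  rw [← ha]
  exact mul_le_mul_of_nonneg_left (hle v hv) hs.le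

theorem aStar_pos : 0 < aStar := let ⟨_, _, h, _⟩ := exists_aStar_eq; h

theorem scaledDawson_le (hX : 0 < X) {t : ℝ} (ht : 0 ≤ t) : scaledDawson X t ≤ aStar * √X := by
  obtain ⟨-, -, -, h, -⟩ := exists_aStar_eq
  have := h (t / √(2 * X)) (by positivity)
  rw [scaledDawson_eq hX, Real.sqrt_mul zero_le_two] at *
  have hs : 0 ≤ √X := Real.sqrt_nonneg X
  nlinarith

theorem exists_scaledDawson_eq : ∃ u : ℝ, 0 < u ∧ ∀ X : ℝ, 0 < X →
    scaledDawson X (u * √X) = aStar * √X := by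
  obtain ⟨u, hu, -, -, h⟩ := exists_aStar_eq
  refine ⟨u * √2, by positivity, fun X hX => ?_⟩
  have hs : 0 < √X := by positivity
  have e : u * √2 * √X / √(2 * X) = u := by
    rw [Real.sqrt_mul zero_le_two]
    field_simp
  rw [scaledDawson_eq hX, e, ← h, Real.sqrt_mul zero_le_two]
  ring

/-- Comparison of the scaled Dawson function with `a_* √n`, `n` being the index at distance `t`
to the left of `X`. -/
theorem scaledDawson_le_sqrt (hX : 0 < X) {t n ρ : ℝ} (ht : 0 ≤ t) (hn : 0 ≤ n)
    (hnt : X = n + ρ + t) : scaledDawson X t ≤ aStar * √n + (2 + |ρ| * aStar / √X) := by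
  have ha := aStar_pos
  have hf := scaledDawson_le hX ht
  have hf0 := scaledDawson_nonneg X ht
  have hs : 0 < √X := by positivity
  have hsX : √X * √X = X := Real.mul_self_sqrt hX.le
  rcases le_total X n with h | h
  · have h1 : √X ≤ √n := Real.sqrt_le_sqrt h
    have h2 : 0 ≤ |ρ| * aStar / √X := by positivity
    nlinarith
  · have h1 : √X * √X ≤ √X * √n + (X - n) := by
      have h3 : n ≤ √X * √n := by
        have h4 : √n * √n ≤ √X * √n :=
          mul_le_mul_of_nonneg_right (Real.sqrt_le_sqrt h) (Real.sqrt_nonneg _)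
        rwa [Real.mul_self_sqrt hn] at h4
      linarith
    have h2 : scaledDawson X t * (X - n) ≤ 2 * X + |ρ| * (aStar * √X) := by
      have h3 := mul_scaledDawson_le hX ht
      have h4 : scaledDawson X t * ρ ≤ (aStar * √X) * |ρ| :=
        (mul_le_mul_of_nonneg_left (le_abs_self ρ) hf0).trans
          (mul_le_mul_of_nonneg_right hf (abs_nonneg ρ))
      have e : X - n = ρ + t := by linarith
      rw [e]
      linarith
    have h3 : scaledDawson X t * X ≤ (aStar * √n + (2 + |ρ| * aStar / √X)) * X := by
      calc scaledDawson X t * X = scaledDawson X t * (√X * √X) := by rw [hsX]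
        _ ≤ scaledDawson X t * (√X * √n + (X - n)) := by gcongr
        _ = scaledDawson X t * (√X * √n) + scaledDawson X t * (X - n) := by ring
        _ ≤ (aStar * √X) * (√X * √n) + (2 * X + |ρ| * (aStar * √X)) := by gcongr
        _ = (aStar * √n) * (√X * √X) + 2 * X + |ρ| * aStar / √X * (√X * √X) := by
            field_simp
            ring
        _ = _ := by rw [hsX]; ring
    exact le_of_mul_le_mul_right h3 hX

end Dawson

/-! ### Sums of model terms on either side of the least one. -/

namespace BaseIndex

variable {ν : ℂ} {n₀ : ℕ}

/-- With `t = n + Re ν - X`, the quotient `y` of the sum by the next term obeys `y(t+1) = (y(t) +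
1)/(1 + t/X)`, a discretization of `f' = 1 - t f / X`. The outer term grows by the factor `1 + t/X`,
so the tolerated error gains `(7 + c) t/X` of it at each step, which absorbs the discretization
error. -/
theorem abs_sum_modelTerm_sub_le_of_ge (hn₀ : BaseIndex ν n₀) {X c : ℝ} (hX : 0 < X) {N : ℕ}
    (hN : n₀ ≤ N) (hN1 : X + 1 ≤ N + ν.re) (hNc : N + ν.re ≤ X + c) {n : ℕ} (hn : N ≤ n)
    (hnX : n + ν.re ≤ 2 * X + 1) :
    |∑ j ∈ Finset.Ico N n, modelTerm ν.re j X -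
      scaledDawson X (n + ν.re - X) * modelTerm ν.re n X| ≤ (7 + c) * modelTerm ν.re n X := by
  induction n, hn using Nat.le_induction with
  | base =>
    have hp := hn₀.modelTerm_pos hN hX
    have ht : 0 ≤ N + ν.re - X := by linarith
    have h1 := scaledDawson_nonneg X ht
    have h2 := scaledDawson_le_self hX ht
    rw [Finset.Ico_self, Finset.sum_empty, zero_sub, abs_neg, abs_mul, abs_of_nonneg h1,
      abs_of_pos hp]
    gcongr
    linarith
  | succ n hn ih =>
    have hnn : n₀ ≤ n := hN.trans hn
    have hp := hn₀.modelTerm_pos hnn hX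
    have hNn : (N : ℝ) ≤ n := by exact_mod_cast hn
    push_cast at hnX
    specialize ih (by linarith)
    set t := n + ν.re - X with ht
    have ht1 : 1 ≤ t := by linarith
    have htX : t ≤ X := by linarith
    have hc : 0 ≤ c := by linarith
    have e1 : ((n + 1 : ℕ) : ℝ) + ν.re - X = t + 1 := by push_cast; rw [ht]; ring
    have e2 : (n : ℝ) + ν.re = X + t := by rw [ht]; ring
    obtain ⟨h1, h2⟩ := scaledDawson_add_one hX (show 0 ≤ t by linarith)
    have h3 := scaledDawson_nonneg X (show 0 ≤ t by linarith)
    have h4 := scaledDawson_le_self hX (show 0 ≤ t by linarith)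
    have h5 := mul_scaledDawson_le hX (show 0 ≤ t by linarith)
    rw [Finset.sum_Ico_succ_top hn, hn₀.modelTerm_succ hnn hX, e1, e2]
    set f := scaledDawson X t
    set f' := scaledDawson X (t + 1)
    set m := modelTerm ν.re n X
    set S := ∑ j ∈ Finset.Ico N n, modelTerm ν.re j X
    set q := t / X with hq
    have hq0 : 0 ≤ q := by positivity
    have hq1 : q ≤ 1 := by rw [hq, div_le_one hX]; exact htX
    have hiX : 1 / X ≤ q := by rw [hq]; gcongr
    have hfq : f * q ≤ 2 := by rw [hq, ← mul_div_assoc, div_le_iff₀ hX]; linarith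
    have hfX : f * (1 / X) ≤ q := by rw [hq, mul_one_div]; gcongr
    have e3 : (X + t) / X = 1 + q := by rw [hq]; field_simp
    have e4 : (t + 1) * (f + 1) / X = (q + 1 / X) * (f + 1) := by rw [hq]; ring
    have e5 : t * (f - 1) / X = q * (f - 1) := by rw [hq]; ring
    rw [e4] at h1
    rw [e5] at h2
    rw [e3]
    rw [abs_le] at ih ⊢
    have hup : f + 1 ≤ f' * (1 + q) + (7 + c) * q := by
      have g1 : (f + 1 - (q + 1 / X) * (f + 1)) * (1 + q) ≤ f' * (1 + q) := by gcongr
      have g2 : f * q * q ≤ 2 * q := by gcongr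
      have g3 : (f * (1 / X) + 1 / X) * (1 + q) ≤ (q + q) * 2 := by gcongr; linarith
      have g4 : q * q ≤ q := mul_le_of_le_one_left hq0 hq1
      have g5 : 0 ≤ c * q := by positivity
      have e6 : (f + 1 - (q + 1 / X) * (f + 1)) * (1 + q) =
          f + 1 - f * q * q - q * q - (f * (1 / X) + 1 / X) * (1 + q) := by ring
      linarith
    have hlo : f' * (1 + q) ≤ f + 1 + (7 + c) * q := by
      have g1 : f' * (1 + q) ≤ (f + 1 - q * (f - 1)) * (1 + q) := by gcongr
      have g4 : q * q ≤ q := mul_le_of_le_one_left hq0 hq1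
      have g5 : 0 ≤ c * q := by positivity
      have g6 : 0 ≤ f * q * q := by positivity
      have e6 : (f + 1 - q * (f - 1)) * (1 + q) = f + 1 + 2 * q + q * q - f * q * q := by ring
      linarith
    have hup' := mul_le_mul_of_nonneg_right hup hp.le
    have hlo' := mul_le_mul_of_nonneg_right hlo hp.le
    constructor <;> linarith

/-- On the left of `X` the induction runs downwards. With `t` the distance of `n + 1 + Re ν` from
`X`, the quotient of the sum by its first term obeys `y(t+1) = 1 + (1 - (t+1)/X) y(t)`; the factor
in front of `y(t)` is below one and leaves room for the discretization error. -/
theorem exists_abs_sum_modelTerm_sub_le_of_le (hn₀ : BaseIndex ν n₀) {X₀ M : ℝ} (hX₀ : 0 < X₀)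
    (hM : 0 ≤ M) :
    ∃ B : ℝ, 0 ≤ B ∧ ∀ X : ℝ, X₀ < X → ∀ N : ℕ, X + 1 ≤ N + ν.re → (N : ℝ) ≤ X + M → ∀ n : ℕ,
      n₀ ≤ n → n ≤ N → 0 ≤ X - n - ν.re →
      |∑ j ∈ Finset.Ico n N, modelTerm ν.re j X -
        scaledDawson X (X - n - ν.re) * modelTerm ν.re n X| ≤ B * modelTerm ν.re n X := by
  obtain ⟨C, hC, h⟩ := hn₀.modelTerm_le_mul_of_le hX₀ hM
  refine ⟨C * (M + |ν.re| + 1) + 3, by positivity, fun X hX₀X N hN1 hNM => ?_⟩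
  have hX : 0 < X := hX₀.trans hX₀X
  set B := C * (M + |ν.re| + 1) + 3 with hB
  have hB3 : 3 ≤ B := by
    have : 0 ≤ C * (M + |ν.re| + 1) := by positivity
    linarith
  suffices ∀ d n : ℕ, n + d = N → n₀ ≤ n → 0 ≤ X - n - ν.re →
      |∑ j ∈ Finset.Ico n N, modelTerm ν.re j X -
        scaledDawson X (X - n - ν.re) * modelTerm ν.re n X| ≤ B * modelTerm ν.re n X from
    fun n hn hnN h0 => this (N - n) n (by omega) hn h0
  intro d
  induction d with
  | zero =>
    intro n hd hn h0
    obtain rfl : n = N := by omega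
    linarith
  | succ d ih =>
    intro n hd hn h0
    have hp := hn₀.modelTerm_pos hn hX
    -- The induction starts at the last index for which `n + Re ν ≤ X`: from there to `N` only
    -- boundedly many terms occur, each bounded by the first up to a constant.
    rcases lt_or_ge (X - n - ν.re) 1 with h1 | h1
    · have g1 := scaledDawson_nonneg X h0
      have g2 := scaledDawson_le_self hX h0
      have g3 : 0 ≤ ∑ j ∈ Finset.Ico n N, modelTerm ν.re j X := Finset.sum_nonneg fun j hj =>
        (hn₀.modelTerm_pos (hn.trans (Finset.mem_Ico.mp hj).1) hX).le
      have g4 : ∑ j ∈ Finset.Ico n N, modelTerm ν.re j X ≤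
          ∑ j ∈ Finset.Ico n N, C * modelTerm ν.re n X := Finset.sum_le_sum fun j hj => by
        have hj' := Finset.mem_Ico.mp hj
        have : (j : ℝ) ≤ N := by exact_mod_cast hj'.2.le
        exact h X hX₀X n j hn hj'.1 (by linarith)
      rw [Finset.sum_const, Nat.card_Ico, nsmul_eq_mul, Nat.cast_sub (by omega)] at g4
      have g5 : (N : ℝ) - n ≤ M + |ν.re| + 1 := by
        have := le_abs_self ν.re
        linarith
      have g6 : ((N : ℝ) - n) * (C * modelTerm ν.re n X) ≤
          (M + |ν.re| + 1) * (C * modelTerm ν.re n X) := by gcongr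
      have g7 : scaledDawson X (X - n - ν.re) * modelTerm ν.re n X ≤ 1 * modelTerm ν.re n X := by
        gcongr; linarith
      have g8 : 0 ≤ scaledDawson X (X - n - ν.re) * modelTerm ν.re n X := by positivity
      rw [abs_le, hB]
      constructor <;> nlinarith
    · have e1 : X - ((n + 1 : ℕ) : ℝ) - ν.re = X - n - ν.re - 1 := by push_cast; ring
      have ih' := ih (n + 1) (by omega) (by omega) (by rw [e1]; linarith)
      rw [e1, hn₀.modelTerm_succ hn hX] at ih'
      rw [Finset.sum_eq_sum_Ico_succ_bot (by omega)]
      have hpos := hn₀.pos_arg hn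
      set t := X - n - ν.re - 1 with ht
      have ht0 : 0 ≤ t := by linarith
      have e2 : X - n - ν.re = t + 1 := by rw [ht]; ring
      rw [e2]
      obtain ⟨h1, h2⟩ := scaledDawson_add_one hX ht0
      have h3 := scaledDawson_nonneg X ht0
      have h4 := scaledDawson_le_self hX ht0
      set f := scaledDawson X t
      set f' := scaledDawson X (t + 1)
      set m := modelTerm ν.re n X
      set S := ∑ j ∈ Finset.Ico (n + 1) N, modelTerm ν.re j X
      set q := ((n : ℝ) + ν.re) / X with hq
      have hq0 : 0 ≤ q := by rw [hq]; apply div_nonneg <;> linarith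
      have e3 : q = 1 - (t + 1) / X := by
        rw [hq, ht]; field_simp; ring
      rw [abs_le] at ih' ⊢
      have hup : 1 + q * (f + B) ≤ f' + B := by
        have : 0 ≤ (t + 1) * (B - 1) / X := by apply div_nonneg _ hX.le; nlinarith
        have e4 : f + 1 - (t + 1) * (f + 1) / X = 1 + q * (f + B) - B + (t + 1) * (B - 1) / X := by
          rw [e3]; ring
        linarith
      have hlo : f' - B ≤ 1 + q * (f - B) := by
        have : 0 ≤ ((t + 1) * B - f - t) / X := by apply div_nonneg _ hX.le; nlinarith
        have e4 : f + 1 - t * (f - 1) / X = 1 + q * (f - B) + B - ((t + 1) * B - f - t) / X := by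
          rw [e3]; ring
        linarith
      have hup' := mul_le_mul_of_nonneg_right hup hp.le
      have hlo' := mul_le_mul_of_nonneg_right hlo hp.le
      constructor <;> linarith

/-- As long as the indices stay below about `2X`, the comparison with Dawson's function applies.
Afterwards the terms at least double at each step, and the bound propagates by itself. -/
theorem sum_modelTerm_le_of_ge (hn₀ : BaseIndex ν n₀) {X c : ℝ} (hX : 0 < X) {N : ℕ}
    (hN : n₀ ≤ N) (hN1 : X + 1 ≤ N + ν.re) (hNc : N + ν.re ≤ X + c) {n : ℕ} (hn : N ≤ n) :
    ∑ j ∈ Finset.Ico N n, modelTerm ν.re j X ≤ (aStar * √X + (7 + c)) * modelTerm ν.re n X := by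
  have hc : 1 ≤ c := by linarith
  have ha := aStar_pos
  induction n, hn using Nat.le_induction with
  | base =>
    have hp := hn₀.modelTerm_pos hN hX
    rw [Finset.Ico_self, Finset.sum_empty]
    positivity
  | succ n hn ih =>
    have hNn : (N : ℝ) ≤ n := by exact_mod_cast hn
    have hp := hn₀.modelTerm_pos (hN.trans hn) hX
    rcases le_or_gt ((n : ℝ) + ν.re) (2 * X) with h | h
    · have h1 := hn₀.abs_sum_modelTerm_sub_le_of_ge hX hN hN1 hNc (hn.trans (Nat.le_succ n))
        (by push_cast; linarith)
      have hp' := hn₀.modelTerm_pos (hN.trans (hn.trans (Nat.le_succ n))) hX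
      have h2 := scaledDawson_le hX (t := ((n + 1 : ℕ) : ℝ) + ν.re - X) (by push_cast; linarith)
      have h3 := mul_le_mul_of_nonneg_right h2 hp'.le
      have h4 := (abs_le.mp h1).2
      linarith
    · rw [Finset.sum_Ico_succ_top hn, hn₀.modelTerm_succ (hN.trans hn) hX]
      have h1 : 2 ≤ ((n : ℝ) + ν.re) / X := by rw [le_div_iff₀ hX]; linarith
      have h2 : 1 ≤ aStar * √X + (7 + c) := by
        have : 0 ≤ aStar * √X := by positivity
        linarith
      have h3 : (aStar * √X + (7 + c)) * modelTerm ν.re n X * 2 ≤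
          (aStar * √X + (7 + c)) * modelTerm ν.re n X * (((n : ℝ) + ν.re) / X) := by gcongr
      nlinarith

end BaseIndex

/-! ### Sums between an arbitrary index and the cut. -/

theorem partialSum_sub_partialSum (c : ℕ → ℂ) {p q : ℕ} (h : p ≤ q) (X : ℝ) :
    partialSum c q X - partialSum c p X = ∑ j ∈ Finset.Ico p q, c j / (X : ℂ) ^ j :=
  (Finset.sum_Ico_eq_sub _ h).symm

/-- The index, close to `X`, at which a series is truncated. -/
def cutIndex (M : ℕ) (X : ℝ) : ℕ := ⌊X⌋₊ + M

theorem floorSum_eq_partialSum (c : ℕ → ℂ) (M : ℕ) (X : ℝ) :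
    floorSum c M X = partialSum c (cutIndex M X) X := rfl

theorem cutIndex_le (M : ℕ) {X : ℝ} (hX : 0 ≤ X) : (cutIndex M X : ℝ) ≤ X + M := by
  rw [cutIndex]; push_cast; have := Nat.floor_le hX; linarith

theorem lt_cutIndex (M : ℕ) (X : ℝ) : X + M - 1 < cutIndex M X := by
  rw [cutIndex]; push_cast; have := Nat.lt_floor_add_one X; linarith

theorem le_cutIndex (M : ℕ) (X : ℝ) : M ≤ cutIndex M X := Nat.le_add_left _ _

theorem sq_cutIndex_sub_le {M : ℕ} {X₀ X : ℝ} (hX₀ : 0 < X₀) (hX : X₀ < X) :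
    ((cutIndex M X : ℝ) - X) ^ 2 ≤ ((M : ℝ) + 1) ^ 2 / X₀ * X := by
  have h1 := cutIndex_le M (hX₀.trans hX).le
  have h2 := lt_cutIndex M X
  have h3 : ((cutIndex M X : ℝ) - X) ^ 2 ≤ ((M : ℝ) + 1) ^ 2 := by
    have : (0 : ℝ) ≤ M := M.cast_nonneg
    exact sq_le_sq' (by linarith) (by linarith)
  have h4 : ((M : ℝ) + 1) ^ 2 * X₀ ≤ ((M : ℝ) + 1) ^ 2 * X := by gcongr
  rw [div_mul_eq_mul_div, le_div_iff₀ hX₀]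
  nlinarith [sq_nonneg ((cutIndex M X : ℝ) - X)]

namespace BaseIndex

variable {ν : ℂ} {n₀ M : ℕ} {X₀ : ℝ}

/-- Up to a constant the terms decrease before the cut, and they increase after it; the cut term is
comparable with the least one. -/
theorem exists_cutIndex_le (hn₀ : BaseIndex ν n₀) (hX₀ : 0 < X₀) (hM : n₀ ≤ M)
    (hM' : |ν.re| + 2 ≤ M) :
    ∃ C : ℝ, 1 ≤ C ∧ ∀ X : ℝ, X₀ < X → ∀ n : ℕ, n₀ ≤ n →
      leastTerm ν.re X ≤ C * modelTerm ν.re n X ∧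
      modelTerm ν.re (cutIndex M X) X ≤ C * modelTerm ν.re n X := by
  obtain ⟨C₁, hC₁, h₁⟩ := hn₀.modelTerm_le_mul_of_le hX₀ (M := (M : ℝ)) (by positivity)
  obtain ⟨C₂, hC₂, h₂⟩ := hn₀.modelTerm_equiv_leastTerm hX₀
    (M := ((M : ℝ) + 1) ^ 2 / X₀) (by positivity)
  refine ⟨C₂ * C₁, one_le_mul_of_one_le_of_one_le hC₂ hC₁, fun X hX n hn => ?_⟩
  have hXp := hX₀.trans hX
  have hN : n₀ ≤ cutIndex M X := hM.trans (le_cutIndex M X)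
  have hp := hn₀.modelTerm_pos hn hXp
  have key : modelTerm ν.re (cutIndex M X) X ≤ C₁ * modelTerm ν.re n X := by
    rcases le_total n (cutIndex M X) with h | h
    · exact h₁ X hX n _ hn h (cutIndex_le M hXp.le)
    · refine (hn₀.modelTerm_mono hN hXp ?_ h).trans (le_mul_of_one_le_left hp.le hC₁)
      have := lt_cutIndex M X
      have := neg_abs_le ν.re
      linarith
  have h3 := (h₂ X hX _ hN (sq_cutIndex_sub_le hX₀ hX)).2
  have hp' := hn₀.modelTerm_pos hN hXp
  constructor
  · calc _ ≤ _ := h3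
      _ ≤ C₂ * (C₁ * modelTerm ν.re n X) := by gcongr
      _ = _ := by ring
  · refine key.trans ?_
    rw [mul_assoc]
    exact le_mul_of_one_le_left (by positivity) hC₂

/-- Sums between a given index and the least term. -/
theorem exists_sum_modelTerm_le (hn₀ : BaseIndex ν n₀) (hX₀ : 0 < X₀) (hM : n₀ ≤ M)
    (hM' : |ν.re| + 2 ≤ M) :
    ∃ B : ℝ, 0 ≤ B ∧ ∀ X : ℝ, X₀ < X → ∀ n : ℕ, n₀ ≤ n →
      ∑ j ∈ Finset.Ico (min n (cutIndex M X)) (max n (cutIndex M X)), modelTerm ν.re j X ≤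
        (aStar * √n + B) * modelTerm ν.re n X := by
  have ha := aStar_pos
  obtain ⟨C, hC, h⟩ := hn₀.modelTerm_le_mul_of_le hX₀ (M := (M : ℝ)) (by positivity)
  obtain ⟨B, hB, hlow⟩ := hn₀.exists_abs_sum_modelTerm_sub_le_of_le hX₀ (M := (M : ℝ))
    (by positivity)
  refine ⟨B + (2 + |ν.re| * aStar / √X₀) + (M + |ν.re|) * C + (7 + (M + |ν.re|)), by positivity,
    fun X hX n hn => ?_⟩
  have hXp := hX₀.trans hX
  set N := cutIndex M X with hNdef
  have hN : n₀ ≤ N := hM.trans (le_cutIndex M X)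
  have hp := hn₀.modelTerm_pos hn hXp
  have hNM : (N : ℝ) ≤ X + M := cutIndex_le M hXp.le
  have hN1 : X + 1 ≤ N + ν.re := by
    have := lt_cutIndex M X
    have := neg_abs_le ν.re
    linarith
  have habs := le_abs_self ν.re
  have hMr : 0 ≤ (M + |ν.re|) * C := by positivity
  have hq : 0 ≤ |ν.re| * aStar / √X₀ := by positivity
  rcases le_total n N with hnN | hnN
  · rw [min_eq_left hnN, max_eq_right hnN]
    rcases le_or_gt 0 (X - n - ν.re) with h0 | h0
    · have h1 := (abs_le.mp (hlow X hX N hN1 hNM n hn hnN h0)).2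
      have h2 := scaledDawson_le_sqrt hXp (ρ := ν.re) h0 (Nat.cast_nonneg n) (by ring)
      have h3 : |ν.re| * aStar / √X ≤ |ν.re| * aStar / √X₀ := by
        gcongr
      have h4 := mul_le_mul_of_nonneg_right h2 hp.le
      calc _ ≤ (aStar * √n + (2 + |ν.re| * aStar / √X) + B) * modelTerm ν.re n X := by linarith
        _ ≤ _ := by
          refine mul_le_mul_of_nonneg_right ?_ hp.le
          have : (0 : ℝ) ≤ M + |ν.re| := by positivity
          linarith
    · have g4 : ∑ j ∈ Finset.Ico n N, modelTerm ν.re j X ≤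
          ∑ j ∈ Finset.Ico n N, C * modelTerm ν.re n X := Finset.sum_le_sum fun j hj => by
        have hj' := Finset.mem_Ico.mp hj
        have : (j : ℝ) ≤ N := by exact_mod_cast hj'.2.le
        exact h X hX n j hn hj'.1 (by linarith)
      rw [Finset.sum_const, Nat.card_Ico, nsmul_eq_mul, Nat.cast_sub hnN] at g4
      have g5 : ((N : ℝ) - n) * (C * modelTerm ν.re n X) ≤
          (M + |ν.re|) * (C * modelTerm ν.re n X) := by
        gcongr
        linarith
      calc _ ≤ (M + |ν.re|) * C * modelTerm ν.re n X := by linarith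
        _ ≤ _ := by
          refine mul_le_mul_of_nonneg_right ?_ hp.le
          have : (0 : ℝ) ≤ M + |ν.re| := by positivity
          have : 0 ≤ aStar * √n := by positivity
          linarith
  · rw [min_eq_right hnN, max_eq_left hnN]
    refine (hn₀.sum_modelTerm_le_of_ge hXp hN hN1 (c := M + |ν.re|) (by linarith) hnN).trans ?_
    refine mul_le_mul_of_nonneg_right ?_ hp.le
    have h1 : X ≤ n := by
      have : (N : ℝ) ≤ n := by exact_mod_cast hnN
      have := lt_cutIndex M X
      have := abs_nonneg ν.re
      linarith
    have h2 : aStar * √X ≤ aStar * √n := by gcongr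
    linarith

/-- Since `((j + Re ν)/X - 1) T_j = T_{j+1} - T_j` telescopes for the model terms `T_j`, these sums
carry no factor `√n`, in contrast to the sum of the terms themselves. They control all corrections
of lower order. -/
theorem exists_sum_div_le (hn₀ : BaseIndex ν n₀) (hX₀ : 0 < X₀) (hM : n₀ ≤ M)
    (hM' : |ν.re| + 2 ≤ M) :
    ∃ C : ℝ, 0 ≤ C ∧ ∀ X : ℝ, X₀ < X → ∀ n : ℕ, n₀ ≤ n →
      ∑ j ∈ Finset.Ico (min n (cutIndex M X)) (max n (cutIndex M X)),
        modelTerm ν.re j X / X ≤ C * modelTerm ν.re n X ∧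
      ∑ j ∈ Finset.Ico (min n (cutIndex M X)) (max n (cutIndex M X)),
        |((j : ℝ) + ν.re) / X - 1| * modelTerm ν.re j X ≤ C * modelTerm ν.re n X ∧
      ∑ j ∈ Finset.Ico (min n (cutIndex M X)) (max n (cutIndex M X)),
        modelTerm ν.re j X / j ≤ C * modelTerm ν.re n X := by
  obtain ⟨C, hC, h⟩ := hn₀.modelTerm_le_mul_of_le hX₀ (M := (M : ℝ)) (by positivity)
  set c : ℝ := M + |ν.re| with hc
  have hc0 : 0 ≤ c := by positivity
  have habs := le_abs_self ν.re
  have habs' := neg_abs_le ν.re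
  have habs0 := abs_nonneg ν.re
  set C₁ := (1 + M / X₀) * C with hC₁
  have hC₁1 : 1 ≤ C₁ := by
    refine one_le_mul_of_one_le_of_one_le ?_ hC
    have : (0 : ℝ) ≤ M / X₀ := by positivity
    linarith
  set C₂ := 1 + 2 * c * C₁ with hC₂
  have hC₂1 : 1 ≤ C₂ := by
    have : 0 ≤ 2 * c * C₁ := by positivity
    linarith
  refine ⟨C₁ + C₂ + (1 + |ν.re|) * C₁, by positivity, fun X hX n hn => ?_⟩
  have hXp := hX₀.trans hX
  set N := cutIndex M X with hNdef
  have hN : n₀ ≤ N := hM.trans (le_cutIndex M X)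
  have hp := hn₀.modelTerm_pos hn hXp
  have hNM : (N : ℝ) ≤ X + M := cutIndex_le M hXp.le
  have hN1 : X + 1 ≤ N + ν.re := by
    have := lt_cutIndex M X
    linarith
  have hpos : ∀ j ∈ Finset.Ico (min n N) (max n N), 0 < modelTerm ν.re j X := fun j hj =>
    hn₀.modelTerm_pos ((le_min hn hN).trans (Finset.mem_Ico.mp hj).1) hXp
  have htel : ∀ p q : ℕ, n₀ ≤ p → p ≤ q →
      ∑ j ∈ Finset.Ico p q, (((j : ℝ) + ν.re) / X - 1) * modelTerm ν.re j X =
      modelTerm ν.re q X - modelTerm ν.re p X := fun p q hp hpq => by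
    rw [← Finset.sum_Ico_sub (fun j => modelTerm ν.re j X) hpq]
    refine Finset.sum_congr rfl fun j hj => ?_
    rw [hn₀.modelTerm_succ (hp.trans (Finset.mem_Ico.mp hj).1) hXp]
    ring
  suffices hs : ∑ j ∈ Finset.Ico (min n N) (max n N), modelTerm ν.re j X / X ≤
        C₁ * modelTerm ν.re n X ∧
      ∑ j ∈ Finset.Ico (min n N) (max n N), |((j : ℝ) + ν.re) / X - 1| * modelTerm ν.re j X ≤
        C₂ * modelTerm ν.re n X by
    obtain ⟨h1, h2⟩ := hs
    have h3 : ∑ j ∈ Finset.Ico (min n N) (max n N), modelTerm ν.re j X / j ≤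
        ∑ j ∈ Finset.Ico (min n N) (max n N), (|((j : ℝ) + ν.re) / X - 1| * modelTerm ν.re j X +
          (1 + |ν.re|) * (modelTerm ν.re j X / X)) := by
      refine Finset.sum_le_sum fun j hj => ?_
      have hm := hpos j hj
      have hj1 : 1 ≤ (j : ℝ) :=
        hn₀.natCast_one_le ((le_min hn hN).trans (Finset.mem_Ico.mp hj).1)
      have hj0 : (0 : ℝ) < j := by linarith
      set z := ((j : ℝ) + ν.re) / X - 1 with hz
      -- Writing `1/j` by means of `1/X` and `z` reduces the third sum to the other two.
      have e : (1 : ℝ) / j = ((j : ℝ) + ν.re) / j * (1 / X) - z * (1 / j) := by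
        rw [hz]; field_simp; ring
      have g1 : ((j : ℝ) + ν.re) / j ≤ 1 + |ν.re| := by
        rw [div_le_iff₀ hj0]; nlinarith
      have g2 : -z * (1 / j) ≤ |z| := by
        have : 1 / (j : ℝ) ≤ 1 := by rw [div_le_one hj0]; exact hj1
        calc -z * (1 / j) ≤ |z| * (1 / j) := by gcongr; exact neg_le_abs z
          _ ≤ |z| * 1 := by gcongr
          _ = _ := mul_one _
      have g3 : (1 : ℝ) / j ≤ (1 + |ν.re|) * (1 / X) + |z| := by
        have : ((j : ℝ) + ν.re) / j * (1 / X) ≤ (1 + |ν.re|) * (1 / X) := by gcongr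
        linarith
      have g4 := mul_le_mul_of_nonneg_right g3 hm.le
      calc _ = 1 / (j : ℝ) * modelTerm ν.re j X := by ring
        _ ≤ _ := g4
        _ = _ := by ring
    rw [Finset.sum_add_distrib, ← Finset.mul_sum] at h3
    have h4 := mul_le_mul_of_nonneg_left h1 (show 0 ≤ 1 + |ν.re| by positivity)
    have k1 := mul_pos (show 0 < C₁ by linarith) hp
    have k2 := mul_pos (show 0 < C₂ by linarith) hp
    have k3 := mul_nonneg (show 0 ≤ 1 + |ν.re| by positivity) k1.le
    refine ⟨?_, ?_, ?_⟩ <;> nlinarith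
  rcases le_total n N with hnN | hnN
  · rw [min_eq_left hnN, max_eq_right hnN] at *
    have h1 : ∑ j ∈ Finset.Ico n N, modelTerm ν.re j X / X ≤ C₁ * modelTerm ν.re n X := by
      have g4 : ∑ j ∈ Finset.Ico n N, modelTerm ν.re j X / X ≤
          ∑ j ∈ Finset.Ico n N, C * modelTerm ν.re n X / X := Finset.sum_le_sum fun j hj => by
        have hj' := Finset.mem_Ico.mp hj
        have : (j : ℝ) ≤ N := by exact_mod_cast hj'.2.le
        exact div_le_div_of_nonneg_right (h X hX n j hn hj'.1 (by linarith)) hXp.le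
      rw [Finset.sum_const, Nat.card_Ico, nsmul_eq_mul, Nat.cast_sub hnN] at g4
      have g5 : ((N : ℝ) - n) / X ≤ 1 + M / X₀ := by
        have k1 : (M : ℝ) / X ≤ M / X₀ := by gcongr
        have k2 : ((N : ℝ) - n) / X ≤ (X + M) / X := by
          gcongr
          have : (0 : ℝ) ≤ n := n.cast_nonneg
          linarith
        rw [add_div, div_self hXp.ne'] at k2
        linarith
      calc _ ≤ _ := g4
        _ = ((N : ℝ) - n) / X * (C * modelTerm ν.re n X) := by ring
        _ ≤ (1 + M / X₀) * (C * modelTerm ν.re n X) := by gcongr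
        _ = _ := by rw [hC₁]; ring
    refine ⟨h1, ?_⟩
    have h2 : ∑ j ∈ Finset.Ico n N, |((j : ℝ) + ν.re) / X - 1| * modelTerm ν.re j X ≤
        ∑ j ∈ Finset.Ico n N, (-((((j : ℝ) + ν.re) / X - 1) * modelTerm ν.re j X) +
          2 * c * (modelTerm ν.re j X / X)) := by
      refine Finset.sum_le_sum fun j hj => ?_
      have hm := hpos j hj
      have hj' := Finset.mem_Ico.mp hj
      have hjN : (j : ℝ) ≤ N := by exact_mod_cast hj'.2.le
      set z := ((j : ℝ) + ν.re) / X - 1 with hz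
      have g1 : z ≤ c / X := by
        rw [hz, sub_le_iff_le_add, div_add_one hXp.ne']
        exact div_le_div_of_nonneg_right (by linarith) hXp.le
      have g0 : 0 ≤ c / X := by positivity
      -- Before the cut `z` is negative up to `O(1/X)`, so its absolute value differs from the
      -- telescoping `-z` by a multiple of the first sum.
      have g2 : |z| ≤ -z + 2 * (c / X) := by
        rcases abs_cases z with ⟨e, _⟩ | ⟨e, _⟩ <;> rw [e] <;> linarith
      calc _ ≤ (-z + 2 * (c / X)) * modelTerm ν.re j X := by gcongr
        _ = _ := by ring
    rw [Finset.sum_add_distrib, Finset.sum_neg_distrib, htel n N hn hnN, ← Finset.mul_sum] at h2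
    have h3 := mul_le_mul_of_nonneg_left h1 (show 0 ≤ 2 * c by positivity)
    have h4 := hn₀.modelTerm_pos hN hXp
    rw [hC₂]
    linarith
  · rw [min_eq_right hnN, max_eq_left hnN] at *
    have hz : ∀ j ∈ Finset.Ico N n, 1 / X ≤ ((j : ℝ) + ν.re) / X - 1 := fun j hj => by
      have : (N : ℝ) ≤ j := by exact_mod_cast (Finset.mem_Ico.mp hj).1
      rw [le_sub_iff_add_le, div_add_one hXp.ne']
      exact div_le_div_of_nonneg_right (by linarith) hXp.le
    have h4 := hn₀.modelTerm_pos hN hXp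
    have h5 := htel N n hN hnN
    have h2 : ∑ j ∈ Finset.Ico N n, |((j : ℝ) + ν.re) / X - 1| * modelTerm ν.re j X ≤
        modelTerm ν.re n X := by
      have : ∑ j ∈ Finset.Ico N n, |((j : ℝ) + ν.re) / X - 1| * modelTerm ν.re j X =
          ∑ j ∈ Finset.Ico N n, (((j : ℝ) + ν.re) / X - 1) * modelTerm ν.re j X := by
        refine Finset.sum_congr rfl fun j hj => ?_
        rw [abs_of_nonneg ((by positivity : 0 ≤ 1 / X).trans (hz j hj))]
      rw [this, h5]
      linarith
    refine ⟨?_, h2.trans (le_mul_of_one_le_left hp.le hC₂1)⟩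
    calc _ ≤ ∑ j ∈ Finset.Ico N n, (((j : ℝ) + ν.re) / X - 1) * modelTerm ν.re j X := by
          refine Finset.sum_le_sum fun j hj => ?_
          have hm := hpos j hj
          rw [div_eq_mul_one_div, mul_comm]
          exact mul_le_mul_of_nonneg_right (hz j hj) hm.le
      _ ≤ modelTerm ν.re n X := by rw [h5]; linarith
      _ ≤ _ := le_mul_of_one_le_left hp.le hC₁1

end BaseIndex

/-! ### Remainder bounds for all truncations. -/

namespace FormalSystem

variable {ω ν : ℂ} {Pc Hc s g : ℕ → ℂ} {K κ X₀ : ℝ} {n₀ M : ℕ}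

theorem norm_partialSum_sub_floorSum_le (c : ℕ → ℂ) (M n : ℕ) (X : ℝ) {D : ℝ}
    (h : ‖∑ j ∈ Finset.Ico (min n (cutIndex M X)) (max n (cutIndex M X)), c j / (X : ℂ) ^ j‖ ≤ D) :
    ‖floorSum c M X - partialSum c n X‖ ≤ D := by
  rw [floorSum_eq_partialSum]
  rcases le_total n (cutIndex M X) with h1 | h1
  · rw [partialSum_sub_partialSum c h1]
    rwa [min_eq_left h1, max_eq_right h1] at h
  · rw [norm_sub_rev, partialSum_sub_partialSum c h1]
    rwa [min_eq_right h1, max_eq_left h1] at h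

/-- Without the oscillating factor `ω^n` it is enough to sum absolute values. The limit `R`
contributes `|R|` times a sum of model terms, hence `a_* |R| √n`; the deviation `O(1/j)` of the
normalized coefficients from `R` contributes only a bounded multiple of the outer term. -/
theorem exists_floorSum_sub_le_of_eq_one (h : FormalSystem 1 ν Pc Hc s g K κ)
    (hn₀ : BaseIndex ν n₀) (hX₀ : 0 < X₀) (hM : n₀ ≤ M) (hM' : |ν.re| + 2 ≤ M) {R : ℂ}
    (hR : Tendsto (fun n : ℕ => s n / Complex.Gamma (n + ν)) atTop (𝓝 R)) :
    ∃ B : ℝ, 0 ≤ B ∧ ∀ X : ℝ, X₀ < X → ∀ n : ℕ, n₀ ≤ n →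
      ‖floorSum s M X - partialSum s n X‖ ≤ (aStar * ‖R‖ * √n + B) * modelTerm ν.re n X := by
  obtain ⟨R', hR', C, hC, hle⟩ := h.exists_tendsto hn₀
  simp only [one_pow, mul_one] at hR' hle
  obtain rfl := tendsto_nhds_unique hR hR'
  obtain ⟨B₁, hB₁, h₁⟩ := hn₀.exists_sum_modelTerm_le hX₀ hM hM'
  obtain ⟨B₂, hB₂, h₂⟩ := hn₀.exists_sum_div_le hX₀ hM hM'
  refine ⟨‖R‖ * B₁ + C * B₂, by positivity, fun X hX n hn => ?_⟩
  have hXp := hX₀.trans hX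
  refine norm_partialSum_sub_floorSum_le s M n X ?_
  set I := Finset.Ico (min n (cutIndex M X)) (max n (cutIndex M X)) with hI
  have hterm : ∀ j ∈ I, ‖s j / (X : ℂ) ^ j‖ ≤
      ‖R‖ * modelTerm ν.re j X + C * (modelTerm ν.re j X / j) := fun j hj => by
    have hj0 : n₀ ≤ j := (le_min hn (hM.trans (le_cutIndex M X))).trans (Finset.mem_Ico.mp hj).1
    have hG := hn₀.Gamma_pos hj0
    have hG0 : Complex.Gamma (j + ν) ≠ 0 := fun h0 => by
      have := hn₀.le_norm j hj0
      rw [h0, norm_zero, mul_zero] at this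
      linarith
    have g1 : ‖s j‖ ≤ (‖R‖ + C / j) * Real.Gamma (j + ν.re) := by
      calc ‖s j‖ = ‖s j / Complex.Gamma (j + ν)‖ * ‖Complex.Gamma (j + ν)‖ := by
            rw [← norm_mul, div_mul_cancel₀ _ hG0]
        _ ≤ (‖R‖ + C / j) * Real.Gamma (j + ν.re) := by
            refine mul_le_mul ?_ (hn₀.norm_le j hj0) (norm_nonneg _) (by positivity)
            have := norm_le_norm_add_norm_sub R (s j / Complex.Gamma (j + ν))
            rw [norm_sub_rev] at this
            linarith [hle j hj0]
    rw [norm_div_pow hXp]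
    calc _ ≤ (‖R‖ + C / j) * Real.Gamma (j + ν.re) / X ^ j := by gcongr
      _ = _ := by rw [modelTerm]; ring
  calc _ ≤ ∑ j ∈ I, (‖R‖ * modelTerm ν.re j X + C * (modelTerm ν.re j X / j)) :=
        (norm_sum_le _ _).trans (Finset.sum_le_sum hterm)
    _ ≤ ‖R‖ * ((aStar * √n + B₁) * modelTerm ν.re n X) + C * (B₂ * modelTerm ν.re n X) := by
        rw [Finset.sum_add_distrib, ← Finset.mul_sum, ← Finset.mul_sum]
        exact add_le_add (mul_le_mul_of_nonneg_left (h₁ X hX n hn) (norm_nonneg _))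
          (mul_le_mul_of_nonneg_left (h₂ X hX n hn).2.2 hC)
    _ = _ := by ring

/-- Summation by parts: the oscillation of `ω^{-j}` removes the factor `√n`. -/
theorem exists_floorSum_sub_le_of_ne_one (h : FormalSystem ω ν Pc Hc s g K κ) (hω : ω ≠ 1)
    (hn₀ : BaseIndex ν n₀) (hX₀ : 0 < X₀) (hM : n₀ ≤ M) (hM' : |ν.re| + 2 ≤ M) :
    ∃ B : ℝ, 0 ≤ B ∧ ∀ X : ℝ, X₀ < X → ∀ n : ℕ, n₀ ≤ n →
      ‖floorSum s M X - partialSum s n X‖ ≤ B * modelTerm ν.re n X := by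
  obtain ⟨A, hA, hb⟩ := h.exists_norm_le hn₀
  obtain ⟨B₂, hB₂, h₂⟩ := hn₀.exists_sum_div_le hX₀ hM hM'
  obtain ⟨C, hC, hcut⟩ := hn₀.exists_cutIndex_le hX₀ hM hM'
  have hω1 : 0 < ‖ω - 1‖ := norm_pos_iff.mpr (sub_ne_zero.mpr hω)
  set D := A * (1 + |ν.re|) * B₂ + (A * B₂ + A * |ν.im| * B₂) + (A * C + A * C) with hD
  have hD0 : 0 ≤ D := by positivity
  refine ⟨D / ‖ω - 1‖, by positivity, fun X hX n hn => ?_⟩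
  have hXp := hX₀.trans hX
  have hXc : (X : ℂ) ≠ 0 := by exact_mod_cast hXp.ne'
  refine norm_partialSum_sub_floorSum_le s M n X ?_
  obtain ⟨k₁, k₂, -⟩ := h₂ X hX n hn
  have hNn : n₀ ≤ cutIndex M X := hM.trans (le_cutIndex M X)
  have hpm := hn₀.modelTerm_pos hn hXp
  set p := min n (cutIndex M X) with hpdef
  set q := max n (cutIndex M X) with hqdef
  have hpq : p ≤ q := min_le_max
  have hp0 : n₀ ≤ p := le_min hn hNn
  set t : ℕ → ℂ := fun j => s j / (X : ℂ) ^ j with ht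
  have hmod : ∀ j, n₀ ≤ j → A * gammaWeight ν.re n₀ j / X ^ j = A * modelTerm ν.re j X :=
    fun j hj => by rw [BaseIndex.gammaWeight_eq n₀ hj, modelTerm]; ring
  have htle : ∀ j, n₀ ≤ j → ‖t j‖ ≤ A * modelTerm ν.re j X := fun j hj => by
    rw [← hmod j hj]
    simp only [ht]
    rw [norm_div_pow hXp]
    exact div_le_div_of_nonneg_right (hb j).1 (by positivity)
  have hend : ∀ j, j = n ∨ j = cutIndex M X → ‖t j‖ ≤ A * (C * modelTerm ν.re n X) := by
    rintro j (rfl | rfl)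
    · refine (htle j hn).trans ?_
      gcongr
      exact le_mul_of_one_le_left hpm.le hC
    · refine (htle _ hNn).trans ?_
      gcongr
      exact (hcut X hX n hn).2
  have hpe : p = n ∨ p = cutIndex M X := min_choice _ _
  have hqe : q = n ∨ q = cutIndex M X := max_choice _ _
  -- The recursion expresses `(ω - 1) t_j` by a difference and by two terms whose sums are bounded
  -- multiples of the outer term; the difference telescopes.
  have hrec : ∀ j, (ω - 1) * t j = g (j + 1) / (X : ℂ) ^ (j + 1) +
      (((j : ℂ) + ν) / X - 1) * t j - ω * (t (j + 1) - t j) := fun j => by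
    simp only [ht]
    have := h.s_succ j
    have e : ω * (s (j + 1) / (X : ℂ) ^ (j + 1)) =
        (g (j + 1) + (j + ν) * s j) / (X : ℂ) ^ (j + 1) := by rw [← this]; ring
    rw [mul_sub, e, pow_succ]
    field_simp
    ring
  have hsum : (ω - 1) * ∑ j ∈ Finset.Ico p q, t j =
      (∑ j ∈ Finset.Ico p q, g (j + 1) / (X : ℂ) ^ (j + 1)) +
      (∑ j ∈ Finset.Ico p q, (((j : ℂ) + ν) / X - 1) * t j) - ω * (t q - t p) := by
    rw [← Finset.sum_Ico_sub t hpq, Finset.mul_sum, Finset.mul_sum, ← Finset.sum_add_distrib,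
      ← Finset.sum_sub_distrib]
    exact Finset.sum_congr rfl fun j _ => hrec j
  have b1 : ‖∑ j ∈ Finset.Ico p q, g (j + 1) / (X : ℂ) ^ (j + 1)‖ ≤
      A * (1 + |ν.re|) * (B₂ * modelTerm ν.re n X) := by
    calc _ ≤ ∑ j ∈ Finset.Ico p q, A * (1 + |ν.re|) * (modelTerm ν.re j X / X) := by
          refine (norm_sum_le _ _).trans (Finset.sum_le_sum fun j hj => ?_)
          have hj0 : n₀ ≤ j := hp0.trans (Finset.mem_Ico.mp hj).1
          have hm := hn₀.modelTerm_pos hj0 hXp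
          rw [norm_div_pow hXp]
          have g1 : ‖g (j + 1)‖ / X ^ (j + 1) ≤
              A * modelTerm ν.re (j + 1) X / (((j + 1 : ℕ) : ℝ) + 1) ^ 2 := by
            rw [← hmod (j + 1) (by omega), div_right_comm]
            exact div_le_div_of_nonneg_right (hb (j + 1)).2 (by positivity)
          refine g1.trans ?_
          rw [hn₀.modelTerm_succ hj0 hXp]
          have hj' : (0 : ℝ) ≤ j := j.cast_nonneg
          have g2 : ((j : ℝ) + ν.re) / (((j + 1 : ℕ) : ℝ) + 1) ^ 2 ≤ 1 + |ν.re| := by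
            rw [div_le_iff₀ (by positivity)]
            push_cast
            have r1 := le_abs_self ν.re
            have r2 := abs_nonneg ν.re
            nlinarith [mul_nonneg r2 hj', mul_nonneg r2 (mul_nonneg hj' hj')]
          calc _ = A * (((j : ℝ) + ν.re) / (((j + 1 : ℕ) : ℝ) + 1) ^ 2) *
                (modelTerm ν.re j X / X) := by ring
            _ ≤ _ := by gcongr
      _ = A * (1 + |ν.re|) * ∑ j ∈ Finset.Ico p q, modelTerm ν.re j X / X := by
          rw [Finset.mul_sum]
      _ ≤ _ := by gcongr
  have b2 : ‖∑ j ∈ Finset.Ico p q, (((j : ℂ) + ν) / X - 1) * t j‖ ≤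
      A * (B₂ * modelTerm ν.re n X) + A * |ν.im| * (B₂ * modelTerm ν.re n X) := by
    calc _ ≤ ∑ j ∈ Finset.Ico p q, (A * (|((j : ℝ) + ν.re) / X - 1| * modelTerm ν.re j X) +
            A * |ν.im| * (modelTerm ν.re j X / X)) := by
          refine (norm_sum_le _ _).trans (Finset.sum_le_sum fun j hj => ?_)
          have hj0 : n₀ ≤ j := hp0.trans (Finset.mem_Ico.mp hj).1
          have hm := hn₀.modelTerm_pos hj0 hXp
          have e : ((j : ℂ) + ν) / X - 1 =
              ((((j : ℝ) + ν.re) / X - 1 : ℝ) : ℂ) + ((ν.im / X : ℝ) : ℂ) * Complex.I := by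
            conv_lhs => rw [← Complex.re_add_im ν]
            push_cast
            ring
          have g1 : ‖((j : ℂ) + ν) / X - 1‖ ≤ |((j : ℝ) + ν.re) / X - 1| + |ν.im| / X := by
            rw [e]
            refine (norm_add_le _ _).trans ?_
            rw [norm_mul, Complex.norm_I, mul_one, Complex.norm_real, Complex.norm_real,
              Real.norm_eq_abs, Real.norm_eq_abs, abs_div, abs_of_pos hXp]
          rw [norm_mul]
          calc _ ≤ (|((j : ℝ) + ν.re) / X - 1| + |ν.im| / X) * (A * modelTerm ν.re j X) :=
                mul_le_mul g1 (htle j hj0) (norm_nonneg _) (by positivity)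
            _ = _ := by ring
      _ = A * (∑ j ∈ Finset.Ico p q, |((j : ℝ) + ν.re) / X - 1| * modelTerm ν.re j X) +
            A * |ν.im| * ∑ j ∈ Finset.Ico p q, modelTerm ν.re j X / X := by
          rw [Finset.sum_add_distrib, Finset.mul_sum, Finset.mul_sum]
      _ ≤ _ := by gcongr
  have b3 : ‖ω * (t q - t p)‖ ≤ A * (C * modelTerm ν.re n X) + A * (C * modelTerm ν.re n X) := by
    rw [norm_mul, h.norm_eq, one_mul]
    exact (norm_sub_le _ _).trans (add_le_add (hend q hqe) (hend p hpe))
  have b4 : ‖ω - 1‖ * ‖∑ j ∈ Finset.Ico p q, t j‖ ≤ D * modelTerm ν.re n X := by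
    rw [← norm_mul, hsum]
    refine (norm_sub_le _ _).trans ((add_le_add ((norm_add_le _ _).trans (add_le_add b1 b2))
      b3).trans (le_of_eq ?_))
    rw [hD]; ring
  rw [div_mul_eq_mul_div, le_div_iff₀ hω1, mul_comm]
  exact b4

open Classical in
/-- The bound for all truncations. -/
theorem exists_approximation (h : FormalSystem ω ν Pc Hc s g K κ)
    (hn₀ : BaseIndex ν n₀) (hX₀ : 0 < X₀) (hM : n₀ ≤ M) (hM' : |ν.re| + 2 ≤ M) {R : ℂ}
    (hR : Tendsto (fun n : ℕ => s n * ω ^ n / Complex.Gamma (n + ν)) atTop (𝓝 R))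
    {u : ℝ → ℂ} {C₀ : ℝ} (hC₀ : 0 ≤ C₀)
    (hu : ∀ X, X₀ < X → ‖u X - floorSum s M X‖ ≤ C₀ * leastTerm ν.re X) :
    ∃ B : ℝ, 0 ≤ B ∧ ∀ (n : ℕ) (X : ℝ), X₀ < X → ‖u X - partialSum s n X‖ ≤
      ((if ω = 1 then aStar * ‖R‖ else 0) * √n + B) * gammaPos (n + ν.re) / X ^ n := by
  have ha := aStar_pos
  set A : ℝ := if ω = 1 then aStar * ‖R‖ else 0 with hA
  have hA0 : 0 ≤ A := by rw [hA]; split_ifs <;> positivity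
  obtain ⟨B₁, hB₁, h₁⟩ : ∃ B : ℝ, 0 ≤ B ∧ ∀ X : ℝ, X₀ < X → ∀ n : ℕ, n₀ ≤ n →
      ‖floorSum s M X - partialSum s n X‖ ≤ (A * √n + B) * modelTerm ν.re n X := by
    by_cases hω : ω = 1
    · subst hω
      simp only [one_pow, mul_one] at hR
      rw [hA, if_pos rfl]
      exact h.exists_floorSum_sub_le_of_eq_one hn₀ hX₀ hM hM' hR
    · rw [hA, if_neg hω]
      simp only [zero_mul, zero_add]
      exact h.exists_floorSum_sub_le_of_ne_one hω hn₀ hX₀ hM hM'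
  obtain ⟨C, hC, hcut⟩ := hn₀.exists_cutIndex_le hX₀ hM hM'
  set B₂ := B₁ + C₀ * C with hB₂
  have hB₂0 : 0 ≤ B₂ := by positivity
  have hbig : ∀ n X, n₀ ≤ n → X₀ < X →
      ‖u X - partialSum s n X‖ ≤ (A * √n + B₂) * modelTerm ν.re n X := by
    intro n X hn hX
    have g1 := h₁ X hX n hn
    have g2 := (hcut X hX n hn).1
    calc _ = ‖(u X - floorSum s M X) + (floorSum s M X - partialSum s n X)‖ := by congr 1; ring
      _ ≤ C₀ * (C * modelTerm ν.re n X) + (A * √n + B₁) * modelTerm ν.re n X :=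
          (norm_add_le _ _).trans (add_le_add ((hu X hX).trans (by gcongr)) g1)
      _ = _ := by rw [hB₂]; ring
  -- Below `n₀`, where the Gamma function is not controlled, the omitted terms of the series are
  -- restored one at a time, downwards from `n₀`.
  have hsmall : ∀ n, n ≤ n₀ → ∃ D : ℝ, 0 ≤ D ∧ ∀ X, X₀ < X →
      ‖u X - partialSum s n X‖ ≤ D / X ^ n := by
    intro n hn
    induction hn using Nat.decreasingInduction with
    | self =>
      have hG := hn₀.Gamma_pos le_rfl
      refine ⟨(A * √n₀ + B₂) * Real.Gamma (n₀ + ν.re), by positivity, fun X hX => ?_⟩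
      have := hbig n₀ X le_rfl hX
      rwa [modelTerm, ← mul_div_assoc] at this
    | of_succ k hk ih =>
      obtain ⟨D, hD, hD'⟩ := ih
      refine ⟨D / X₀ + ‖s k‖, by positivity, fun X hX => ?_⟩
      have hXp := hX₀.trans hX
      have g1 := hD' X hX
      rw [partialSum_succ] at g1
      calc _ = ‖(u X - (partialSum s k X + s k / (X : ℂ) ^ k)) + s k / (X : ℂ) ^ k‖ := by
            congr 1; ring
        _ ≤ D / X ^ (k + 1) + ‖s k‖ / X ^ k := by
            refine (norm_add_le _ _).trans (add_le_add g1 ?_)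
            rw [norm_div_pow hXp]
        _ ≤ (D / X₀) / X ^ k + ‖s k‖ / X ^ k := by
            have : D / X ^ (k + 1) = D / X / X ^ k := by rw [pow_succ']; field_simp
            rw [this]
            gcongr
        _ = _ := by ring
  choose! D hD hD' using hsmall
  have hgp : ∀ n : ℕ, 0 < gammaPos (n + ν.re) := fun n => by
    rw [gammaPos]; split_ifs with h
    · exact Real.Gamma_pos_of_pos h
    · exact one_pos
  -- The finite sum dominates each of the finitely many exceptional constants; of `gammaPos` only
  -- the positivity matters there.
  refine ⟨B₂ + ∑ n ∈ Finset.range n₀, D n / gammaPos (n + ν.re), ?_, fun n X hX => ?_⟩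
  · exact add_nonneg hB₂0 (Finset.sum_nonneg fun n hn =>
      div_nonneg (hD n (Finset.mem_range.mp hn).le) (hgp n).le)
  have hXp := hX₀.trans hX
  have hsn : 0 ≤ ∑ n ∈ Finset.range n₀, D n / gammaPos (n + ν.re) := Finset.sum_nonneg fun n hn =>
    div_nonneg (hD n (Finset.mem_range.mp hn).le) (hgp n).le
  have hg := hgp n
  rcases lt_or_ge n n₀ with hn | hn
  · refine (hD' n hn.le X hX).trans ?_
    gcongr
    rw [← div_le_iff₀ hg]
    have g1 : D n / gammaPos (n + ν.re) ≤ ∑ n ∈ Finset.range n₀, D n / gammaPos (n + ν.re) :=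
      Finset.single_le_sum (f := fun n : ℕ => D n / gammaPos (n + ν.re)) (fun i hi =>
        div_nonneg (hD i (Finset.mem_range.mp hi).le) (hgp i).le) (Finset.mem_range.mpr hn)
    have g2 : 0 ≤ A * √n := by positivity
    linarith
  · refine (hbig n X hn hX).trans ?_
    have e : gammaPos (n + ν.re) = Real.Gamma (n + ν.re) := by
      rw [gammaPos, if_pos (by linarith [hn₀.pos_arg hn])]
    rw [modelTerm, ← e, ← mul_div_assoc]
    gcongr
    linarith

end FormalSystem

/-! ### Rigidity: the optimal bounds determine a function up to the second exponential. -/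

/-- Two pairs of points with the same difference `z`, in two disks whose radii add up to hardly
more than `‖z‖`, are close to each other. -/
theorem norm_sub_sq_le_of_sub_eq {a a' b b' z : ℂ} {p q η : ℝ} (hη : 0 ≤ η) (ha : ‖a‖ ≤ p)
    (ha' : ‖a'‖ ≤ p) (hb : ‖b‖ ≤ q) (hb' : ‖b'‖ ≤ q) (h : a - b = z) (h' : a' - b' = z)
    (hz : p + q ≤ ‖z‖ + η) : ‖a - a'‖ ^ 2 ≤ 8 * p * η := by
  have hp : 0 ≤ p := (norm_nonneg a).trans ha
  -- As `2z = (a + a') - (b + b')` and `‖b + b'‖ ≤ 2q`, the vector `a + a'` is almost as long as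
  -- `2p` permits; the parallelogram law then leaves little for `a - a'`.
  have h1 := parallelogram_law_with_norm ℝ a a'
  have h2 : 2 * ‖z‖ ≤ ‖a + a'‖ + 2 * q := by
    have e : (2 : ℂ) * z = (a + a') - (b + b') := by rw [← h]; linear_combination (h' - h) * (-1)
    have : 2 * ‖z‖ = ‖(a + a') - (b + b')‖ := by rw [← e, norm_mul, Complex.norm_ofNat]
    rw [this]
    refine (norm_sub_le _ _).trans ?_
    have := norm_add_le b b'
    linarith
  have h3 : 2 * (p - η) ≤ ‖a + a'‖ := by linarith
  have h4 : ‖a‖ * ‖a‖ ≤ p * p := mul_self_le_mul_self (norm_nonneg _) ha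
  have h5 : ‖a'‖ * ‖a'‖ ≤ p * p := mul_self_le_mul_self (norm_nonneg _) ha'
  have h6 := norm_nonneg (a + a')
  rcases le_total η p with h7 | h7
  · have h8 : 2 * (p - η) * (2 * (p - η)) ≤ ‖a + a'‖ * ‖a + a'‖ :=
      mul_self_le_mul_self (by linarith) h3
    nlinarith
  · nlinarith [mul_nonneg h6 h6, mul_le_mul_of_nonneg_left h7 hp]

namespace FormalSystem

variable {ω ν : ℂ} {Pc Hc s g : ℕ → ℂ} {K κ X₀ : ℝ} {n₀ M : ℕ}

/-- Normalized by the real Gamma function, the coefficients may rotate because of `Im ν`, but only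
by `O(1/j)` per step. Over a window of length `√X` around `X` the terms of the series therefore have
almost the same phase, and their sum shows no cancellation. -/
theorem exists_normalized_sub_le (h : FormalSystem 1 ν Pc Hc s g K κ) (hn₀ : BaseIndex ν n₀) :
    ∃ C : ℝ, 0 ≤ C ∧ ∀ k j : ℕ, n₀ ≤ k → k ≤ j →
      ‖s j / (Real.Gamma (j + ν.re) : ℂ) - s k / (Real.Gamma (k + ν.re) : ℂ)‖ ≤
        C * ((j : ℝ) - k) / k := by
  obtain ⟨A, hA, hb⟩ := h.exists_norm_le hn₀
  set C := A + A * |ν.im| * (1 + |ν.re|) with hC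
  have hC0 : 0 ≤ C := by positivity
  set c : ℕ → ℂ := fun j => s j / (Real.Gamma (j + ν.re) : ℂ) with hc
  have hstep : ∀ j, n₀ ≤ j → ‖c (j + 1) - c j‖ ≤ C / j := by
    intro j hj
    have hG := hn₀.Gamma_pos hj
    have hG1 := hn₀.Gamma_pos (hj.trans j.le_succ)
    have hpos := hn₀.pos_arg hj
    have hj1 := hn₀.natCast_one_le hj
    have hx : (0 : ℝ) < j + ν.re := by linarith
    have hGs : Real.Gamma (((j + 1 : ℕ) : ℝ) + ν.re) = (j + ν.re) * Real.Gamma (j + ν.re) := by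
      rw [← Real.Gamma_add_one hx.ne']; congr 1; push_cast; ring
    have hs := h.s_succ j
    rw [one_mul] at hs
    have e : c (j + 1) - c j = g (j + 1) / (Real.Gamma (((j + 1 : ℕ) : ℝ) + ν.re) : ℂ) +
        c j * (ν.im * Complex.I / ((j + ν.re : ℝ) : ℂ)) := by
      have h1 : (Real.Gamma (j + ν.re) : ℂ) ≠ 0 := by exact_mod_cast hG.ne'
      have h2 : ((j + ν.re : ℝ) : ℂ) ≠ 0 := by exact_mod_cast hx.ne'
      simp only [hc]
      rw [hs, hGs, Complex.ofReal_mul]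
      field_simp
      have h3 := Complex.re_add_im ν
      push_cast
      linear_combination (-s j) * h3
    have b1 : ‖g (j + 1) / (Real.Gamma (((j + 1 : ℕ) : ℝ) + ν.re) : ℂ)‖ ≤ A / j := by
      have := (hb (j + 1)).2
      rw [BaseIndex.gammaWeight_eq n₀ (hj.trans j.le_succ)] at this
      rw [norm_div, Complex.norm_real, Real.norm_of_nonneg hG1.le, div_le_iff₀ hG1]
      refine this.trans ?_
      rw [div_mul_eq_mul_div]
      gcongr
      push_cast
      nlinarith
    have b2 : ‖c j‖ ≤ A := by
      have := (hb j).1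
      rw [BaseIndex.gammaWeight_eq n₀ hj] at this
      simp only [hc]
      rwa [norm_div, Complex.norm_real, Real.norm_of_nonneg hG.le, div_le_iff₀ hG]
    have b3 : ‖(ν.im : ℂ) * Complex.I / ((j + ν.re : ℝ) : ℂ)‖ ≤ |ν.im| * (1 + |ν.re|) / j := by
      rw [norm_div, norm_mul, Complex.norm_I, mul_one, Complex.norm_real, Complex.norm_real,
        Real.norm_eq_abs, Real.norm_of_nonneg hx.le, div_le_div_iff₀ hx (by linarith), mul_assoc]
      gcongr
      have := neg_abs_le ν.re
      nlinarith [abs_nonneg ν.re]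
    rw [e]
    calc _ ≤ A / j + A * (|ν.im| * (1 + |ν.re|) / j) := by
          refine (norm_add_le _ _).trans (add_le_add b1 ?_)
          rw [norm_mul]
          gcongr
      _ = _ := by rw [hC]; ring
  refine ⟨C, hC0, fun k j hk hkj => ?_⟩
  have hk1 := hn₀.natCast_one_le hk
  change ‖c j - c k‖ ≤ _
  induction j, hkj using Nat.le_induction with
  | base => simp
  | succ j hkj ih =>
    have hkj' : (k : ℝ) ≤ j := by exact_mod_cast hkj
    calc ‖c (j + 1) - c k‖ = ‖(c (j + 1) - c j) + (c j - c k)‖ := by congr 1; ring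
      _ ≤ C / k + C * ((j : ℝ) - k) / k := by
          refine (norm_add_le _ _).trans (add_le_add ((hstep j (hk.trans hkj)).trans ?_) ih)
          gcongr
      _ = _ := by push_cast; ring

theorem tendsto_norm_normalized {s : ℕ → ℂ} {R : ℂ}
    (hR : Tendsto (fun n : ℕ => s n / Complex.Gamma (n + ν)) atTop (𝓝 R)) :
    Tendsto (fun n : ℕ => ‖s n / (Real.Gamma (n + ν.re) : ℂ)‖) atTop (𝓝 ‖R‖) := by
  have h1 := hR.norm.mul (tendsto_norm_Gamma_div_Gamma_re ν)
  rw [mul_one] at h1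
  refine h1.congr' ?_
  obtain ⟨n₀, hn₀⟩ := exists_baseIndex ν
  filter_upwards [eventually_ge_atTop n₀] with n hn
  have hB := hn₀ n hn
  have hG := hB.Gamma_pos le_rfl
  have hG0 : 0 < ‖Complex.Gamma (n + ν)‖ := by
    have := hB.le_norm n le_rfl
    linarith
  rw [norm_div, norm_div, Complex.norm_real, Real.norm_of_nonneg hG.le, abs_of_pos hG]
  field_simp

set_option maxHeartbeats 1000000 in
/-- The sum of the terms between two suitable indices is, up to a small relative error, as large
as the bounds for the remainders allow. -/
theorem eventually_exists_le_norm_sub (h : FormalSystem 1 ν Pc Hc s g K κ) {R : ℂ}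
    (hR : Tendsto (fun n : ℕ => s n / Complex.Gamma (n + ν)) atTop (𝓝 R)) (B : ℝ) :
    ∃ C : ℝ, 1 ≤ C ∧ ∀ δ : ℝ, 0 < δ → ∀ᶠ X : ℝ in atTop, ∃ (k l : ℕ) (p q : ℝ), 0 ≤ p ∧ 0 ≤ q ∧
      p ≤ C * powExp ν.re X ∧ q ≤ C * powExp ν.re X ∧
      powExp ν.re X ≤ C * p ∧ powExp ν.re X ≤ C * q ∧
      (aStar * ‖R‖ * √k + B) * gammaPos (k + ν.re) / X ^ k ≤ (aStar * ‖R‖ + δ) * p ∧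
      (aStar * ‖R‖ * √l + B) * gammaPos (l + ν.re) / X ^ l ≤ (aStar * ‖R‖ + δ) * q ∧
      (aStar * ‖R‖ - δ) * (p + q) ≤ ‖partialSum s l X - partialSum s k X‖ := by
  obtain ⟨n₀, hn₀⟩ := exists_baseIndex ν
  replace hn₀ := hn₀ n₀ le_rfl
  have ha := aStar_pos
  -- At the distance `u √X` Dawson's function attains its maximum `a_* √X`. With `k` and `l` at this
  -- distance to the left and to the right of `X`, the model sum from `k` to the cut is close to
  -- `a_* √X τ_k`, and the one from the cut to `l` is close to `a_* √X τ_l`.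
  obtain ⟨u, hu, hud⟩ := exists_scaledDawson_eq
  set M : ℕ := max n₀ ⌈|ν.re| + 2⌉₊ with hM
  have hMn : n₀ ≤ M := le_max_left _ _
  have hM' : |ν.re| + 2 ≤ M :=
    (Nat.le_ceil _).trans (by exact_mod_cast le_max_right n₀ ⌈|ν.re| + 2⌉₊)
  have hρ := le_abs_self ν.re
  have hρ' := neg_abs_le ν.re
  have hρ0 := abs_nonneg ν.re
  obtain ⟨B₁, hB₁, hlow⟩ := hn₀.exists_abs_sum_modelTerm_sub_le_of_le one_pos (M := (M : ℝ))
    (by positivity)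
  obtain ⟨D, hD, hvar⟩ := h.exists_normalized_sub_le hn₀
  set c : ℝ := u + |ν.re| + 1 with hc
  have hc1 : 1 ≤ c := by linarith
  obtain ⟨E, hE, hequiv⟩ := hn₀.modelTerm_equiv_leastTerm one_pos (M := c ^ 2) (by positivity)
  set B₂ : ℝ := B₁ + (7 + (M + |ν.re|)) + 1 with hB₂
  have hB₂0 : 0 ≤ B₂ := by positivity
  refine ⟨E, hE, fun δ hδ => ?_⟩
  have hr : Tendsto (fun X : ℝ => √X) atTop atTop := Real.tendsto_sqrt_atTop
  -- the indices
  set k : ℝ → ℕ := fun X => ⌊X - ν.re - u * √X⌋₊ with hk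
  set l : ℝ → ℕ := fun X => ⌈X - ν.re + u * √X⌉₊ with hl
  have hbase : ∀ᶠ X : ℝ in atTop, 1 < X ∧ M + |ν.re| + 3 ≤ u * √X ∧
      u * √X + |ν.re| + 2 ≤ X / 2 ∧ (n₀ : ℝ) ≤ X / 2 := by
    filter_upwards [hr.eventually_ge_atTop ((M + |ν.re| + 3) / u),
      hr.eventually_ge_atTop (4 * (u + |ν.re| + 2 + n₀)), eventually_gt_atTop 1] with X h1 h2 h3
    have hX : 0 < X := by linarith
    have hsX : √X * √X = X := Real.mul_self_sqrt hX.le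
    have hs1 : 1 ≤ √X := Real.one_le_sqrt.mpr h3.le
    rw [div_le_iff₀ hu] at h1
    have hn : (0 : ℝ) ≤ n₀ := n₀.cast_nonneg
    have g1 : 4 * (u + |ν.re| + 2 + n₀) * √X ≤ √X * √X := by gcongr
    have g2 : |ν.re| + 2 + n₀ ≤ (|ν.re| + 2 + n₀) * √X := le_mul_of_one_le_right (by positivity) hs1
    have g3 : 0 ≤ u * √X := by positivity
    exact ⟨h3, by linarith, by nlinarith, by nlinarith⟩
  have hktend : Tendsto k atTop atTop := by
    refine tendsto_nat_floor_atTop.comp ?_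
    refine tendsto_atTop_mono' atTop ?_ (tendsto_id.atTop_div_const (show (0 : ℝ) < 2 by norm_num))
    filter_upwards [hbase] with X hX
    simp only [id]
    linarith [hX.2.2.1]
  have hinv : ∀ b : ℝ, Tendsto (fun X : ℝ => b / √X) atTop (𝓝 0) := fun b =>
    tendsto_const_nhds.div_atTop hr
  have hlim : Tendsto (fun X : ℝ => (‖s (k X) / (Real.Gamma (k X + ν.re) : ℂ)‖ -
      D * (4 * (u + 1)) / √X) * (aStar - B₂ / √X)) atTop (𝓝 ((‖R‖ - 0) * (aStar - 0))) :=
    (((tendsto_norm_normalized hR).comp hktend).sub (hinv _)).mul (tendsto_const_nhds.sub (hinv _))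
  rw [sub_zero, sub_zero, mul_comm ‖R‖] at hlim
  set A := aStar * ‖R‖ with hA
  have hA0 : 0 ≤ A := by positivity
  have ev1 := hlim.eventually (lt_mem_nhds (show A - δ < A by linarith))
  have ev2 := (hinv B₂).eventually (gt_mem_nhds ha)
  have ev3 := (hinv (A * c + |B|)).eventually (gt_mem_nhds hδ)
  filter_upwards [hbase, ev1, ev2, ev3] with X ⟨hX1, hX2, hX3, hX4⟩ h1 h2 h3
  have hXp : 0 < X := by linarith
  set r := √X with hrdef
  have hrp : 0 < r := by positivity
  have hr1 : 1 ≤ r := Real.one_le_sqrt.mpr hX1.le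
  have hrr : r * r = X := Real.mul_self_sqrt hXp.le
  have hMnn : (0 : ℝ) ≤ M := M.cast_nonneg
  -- positions of the indices
  have hk1 : (k X : ℝ) ≤ X - ν.re - u * r := Nat.floor_le (by linarith)
  have hk2 : X - ν.re - u * r < k X + 1 := Nat.lt_floor_add_one _
  have hl1 : X - ν.re + u * r ≤ l X := Nat.le_ceil _
  have hl2 : (l X : ℝ) < X - ν.re + u * r + 1 := Nat.ceil_lt_add_one (by linarith)
  set N := cutIndex M X with hN
  have hN0 : n₀ ≤ N := hMn.trans (le_cutIndex M X)
  have hNM : (N : ℝ) ≤ X + M := cutIndex_le M hXp.le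
  have hNM' := lt_cutIndex M X
  have hN1 : X + 1 ≤ N + ν.re := by linarith
  have hk0 : n₀ ≤ k X := by
    have : (n₀ : ℝ) < k X + 1 := by linarith
    exact Nat.lt_succ_iff.mp (by exact_mod_cast this)
  have hkN : k X ≤ N := by
    have : (k X : ℝ) ≤ N := by linarith
    exact_mod_cast this
  have hNl : N ≤ l X := by
    have : (N : ℝ) ≤ l X := by linarith
    exact_mod_cast this
  have hl0 : n₀ ≤ l X := hN0.trans hNl
  have hkl : k X ≤ l X := hkN.trans hNl
  have hτk := hn₀.modelTerm_pos hk0 hXp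
  have hτl := hn₀.modelTerm_pos hl0 hXp
  set τk := modelTerm ν.re (k X) X with hτkdef
  set τl := modelTerm ν.re (l X) X with hτldef
  -- size of the terms
  have hW : powExp ν.re X = r * leastTerm ν.re X := by
    rw [powExp, leastTerm, ← mul_assoc, hrdef, Real.sqrt_eq_rpow, ← Real.rpow_add hXp]
    congr 2; ring
  have hcr : (c * r) ^ 2 = c ^ 2 * X := by rw [← hrr]; ring
  have hρr : |ν.re| ≤ |ν.re| * r := le_mul_of_one_le_right hρ0 hr1
  have hce : c * r = u * r + |ν.re| * r + r := by rw [hc]; ring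
  have hur0 : 0 ≤ u * r := by positivity
  have ek := hequiv X hX1 (k X) hk0 (by
    rw [← hcr]
    apply sq_le_sq' <;> linarith)
  have el := hequiv X hX1 (l X) hl0 (by
    rw [← hcr]
    apply sq_le_sq' <;> linarith)
  -- lower bound of the sum of the model terms
  have hS : (aStar * r - B₂) * (τk + τl) ≤ ∑ j ∈ Finset.Ico (k X) (l X), modelTerm ν.re j X := by
    rw [← Finset.sum_Ico_consecutive _ hkN hNl]
    have hd : ∀ t, u * r ≤ t → t ≤ u * r + 1 → aStar * r - 1 ≤ scaledDawson X t := by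
      intro t ht ht'
      have := (abs_le.mp (abs_scaledDawson_sub_le hXp (show 0 ≤ u * r by positivity) ht)).1
      rw [hud X hXp] at this
      linarith
    have g1 := (abs_le.mp (hlow X hX1 N hN1 hNM (k X) hk0 hkN (by linarith))).1
    have g2 := (abs_le.mp (hn₀.abs_sum_modelTerm_sub_le_of_ge hXp hN0 hN1
      (c := M + |ν.re|) (by linarith) hNl (by linarith))).1
    have g3 := mul_le_mul_of_nonneg_right (hd (X - k X - ν.re) (by linarith) (by linarith)) hτk.le
    have g4 := mul_le_mul_of_nonneg_right (hd (l X + ν.re - X) (by linarith) (by linarith)) hτl.le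
    have g5 : 0 ≤ (7 + (M + |ν.re|)) * τk := by positivity
    have g6 : 0 ≤ B₁ * τl := by positivity
    rw [hB₂]
    linarith
  -- lower bound of the sum of the terms
  have hZ : (‖s (k X) / (Real.Gamma (k X + ν.re) : ℂ)‖ - D * (4 * (u + 1)) / r) *
      ∑ j ∈ Finset.Ico (k X) (l X), modelTerm ν.re j X ≤
      ‖partialSum s (l X) X - partialSum s (k X) X‖ := by
    rw [partialSum_sub_partialSum s hkl]
    set ck := s (k X) / (Real.Gamma (k X + ν.re) : ℂ) with hck
    have hkh : X / 2 ≤ k X := by linarith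
    have g1 : ∀ j ∈ Finset.Ico (k X) (l X),
        ‖ck * (modelTerm ν.re j X : ℂ) - s j / (X : ℂ) ^ j‖ ≤
          D * (4 * (u + 1)) / r * modelTerm ν.re j X := by
      intro j hj
      obtain ⟨hj1, hj2⟩ := Finset.mem_Ico.mp hj
      have hm := hn₀.modelTerm_pos (hk0.trans hj1) hXp
      have hG := hn₀.Gamma_pos (hk0.trans hj1)
      have e : ck * (modelTerm ν.re j X : ℂ) - s j / (X : ℂ) ^ j =
          -((s j / (Real.Gamma (j + ν.re) : ℂ) - ck) * (modelTerm ν.re j X : ℂ)) := by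
        have : (Real.Gamma (j + ν.re) : ℂ) ≠ 0 := by exact_mod_cast hG.ne'
        have hXc : (X : ℂ) ≠ 0 := by exact_mod_cast hXp.ne'
        rw [modelTerm]
        push_cast
        field_simp
        ring
      rw [e, norm_neg, norm_mul, Complex.norm_real, Real.norm_of_nonneg hm.le]
      refine mul_le_mul_of_nonneg_right ((hvar (k X) j hk0 hj1).trans ?_) hm.le
      have hjl : (j : ℝ) ≤ l X := by exact_mod_cast hj2.le
      have g2 : (j : ℝ) - k X ≤ 2 * (u + 1) * r := by
        have e2 : 2 * (u + 1) * r = 2 * (u * r) + 2 * r := by ring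
        linarith
      have g3 : (0 : ℝ) ≤ (j : ℝ) - k X := sub_nonneg.mpr (by exact_mod_cast hj1)
      calc D * ((j : ℝ) - k X) / k X ≤ D * (2 * (u + 1) * r) / (X / 2) := by gcongr
        _ = _ := by rw [← hrr]; field_simp; ring
    have g2 : ‖ck * ((∑ j ∈ Finset.Ico (k X) (l X), modelTerm ν.re j X : ℝ) : ℂ) -
        ∑ j ∈ Finset.Ico (k X) (l X), s j / (X : ℂ) ^ j‖ ≤
        D * (4 * (u + 1)) / r * ∑ j ∈ Finset.Ico (k X) (l X), modelTerm ν.re j X := by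
      rw [Complex.ofReal_sum, Finset.mul_sum, ← Finset.sum_sub_distrib, Finset.mul_sum]
      exact (norm_sum_le _ _).trans (Finset.sum_le_sum g1)
    have hS0 : 0 ≤ ∑ j ∈ Finset.Ico (k X) (l X), modelTerm ν.re j X := Finset.sum_nonneg
      fun j hj => (hn₀.modelTerm_pos (hk0.trans (Finset.mem_Ico.mp hj).1) hXp).le
    have g3 := norm_sub_norm_le (ck * ((∑ j ∈ Finset.Ico (k X) (l X), modelTerm ν.re j X : ℝ) : ℂ))
      (∑ j ∈ Finset.Ico (k X) (l X), s j / (X : ℂ) ^ j)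
    rw [norm_mul, Complex.norm_real, Real.norm_of_nonneg hS0] at g3
    linarith
  have hgam : ∀ n : ℕ, n₀ ≤ n → gammaPos (n + ν.re) / X ^ n = modelTerm ν.re n X := fun n hn => by
    rw [gammaPos, if_pos (by linarith [hn₀.pos_arg hn]), modelTerm]
  have hbound : ∀ n : ℕ, n₀ ≤ n → √(n : ℝ) ≤ r + c →
      (A * √n + B) * gammaPos (n + ν.re) / X ^ n ≤ (A + δ) * (r * modelTerm ν.re n X) := by
    intro n hn hs
    rw [mul_div_assoc, hgam n hn, ← mul_assoc]
    refine mul_le_mul_of_nonneg_right ?_ (hn₀.modelTerm_pos hn hXp).le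
    rw [div_lt_iff₀ hrp] at h3
    have := mul_le_mul_of_nonneg_left hs hA0
    have := le_abs_self B
    linarith
  have hsq : ∀ n : ℕ, (n : ℝ) ≤ X + 2 * c * r → √(n : ℝ) ≤ r + c := fun n hn => by
    rw [Real.sqrt_le_iff]
    refine ⟨by positivity, ?_⟩
    have e2 : (r + c) ^ 2 = r * r + 2 * c * r + c ^ 2 := by ring
    have := sq_nonneg c
    linarith
  have hur : u * r ≤ c * r := by gcongr; linarith
  have hcr' : |ν.re| + 1 ≤ c * r := by linarith
  refine ⟨k X, l X, r * τk, r * τl, by positivity, by positivity, ?_, ?_, ?_, ?_,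
    hbound _ hk0 (hsq _ (by linarith)), hbound _ hl0 (hsq _ (by linarith)), ?_⟩
  · rw [hW, mul_left_comm]; exact mul_le_mul_of_nonneg_left ek.1 hrp.le
  · rw [hW, mul_left_comm]; exact mul_le_mul_of_nonneg_left el.1 hrp.le
  · rw [hW, mul_left_comm]; exact mul_le_mul_of_nonneg_left ek.2 hrp.le
  · rw [hW, mul_left_comm]; exact mul_le_mul_of_nonneg_left el.2 hrp.le
  · set y := ‖s (k X) / (Real.Gamma (k X + ν.re) : ℂ)‖ - D * (4 * (u + 1)) / r with hy
    have hsum : 0 ≤ r * τk + r * τl := by positivity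
    -- If `y < 0`, the inequality `h1` shows that `A - δ` is negative, and the claim is trivial.
    rcases le_or_gt 0 y with hy0 | hy0
    · refine le_trans ?_ ((mul_le_mul_of_nonneg_left hS hy0).trans hZ)
      have e : y * ((aStar * r - B₂) * (τk + τl)) = (y * (aStar - B₂ / r)) * (r * τk + r * τl) := by
        field_simp
      rw [e]
      exact mul_le_mul_of_nonneg_right h1.le hsum
    · have : y * (aStar - B₂ / r) ≤ 0 := mul_nonpos_of_nonpos_of_nonneg hy0.le (by linarith)
      exact (mul_nonpos_of_nonpos_of_nonneg (by linarith) hsum).trans (norm_nonneg _)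

/-- If two functions have remainders within the optimal bounds, then their difference is small
with respect to the second exponential. -/
theorem eventually_norm_sub_le (h : FormalSystem 1 ν Pc Hc s g K κ) {R : ℂ}
    (hR : Tendsto (fun n : ℕ => s n / Complex.Gamma (n + ν)) atTop (𝓝 R)) {B : ℝ} {f₁ f₂ : ℝ → ℂ}
    {e : ℝ → ℝ} (he : ∀ δ : ℝ, 0 < δ → ∀ᶠ X in atTop, e X ≤ δ * powExp ν.re X)
    (hf₁ : ∀ᶠ X in atTop, ∀ n : ℕ, ‖f₁ X - partialSum s n X‖ ≤
      (aStar * ‖R‖ * √n + B) * gammaPos (n + ν.re) / X ^ n + e X)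
    (hf₂ : ∀ᶠ X in atTop, ∀ n : ℕ, ‖f₂ X - partialSum s n X‖ ≤
      (aStar * ‖R‖ * √n + B) * gammaPos (n + ν.re) / X ^ n + e X) {η : ℝ} (hη : 0 < η) :
    ∀ᶠ X in atTop, ‖f₁ X - f₂ X‖ ≤ η * powExp ν.re X := by
  have ha := aStar_pos
  obtain ⟨C, hC, hmain⟩ := h.eventually_exists_le_norm_sub hR B
  set A := aStar * ‖R‖ with hA
  have hA0 : 0 ≤ A := by positivity
  -- `δ` is chosen such that `64 (A + 2) C² δ ≤ η²`
  obtain ⟨δ, hδ, hδ1, hδη⟩ : ∃ δ : ℝ, 0 < δ ∧ δ ≤ 1 ∧ 64 * (A + 2) * C ^ 2 * δ ≤ η ^ 2 := by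
    refine ⟨min 1 (η ^ 2 / (64 * (A + 2) * C ^ 2)), by positivity, min_le_left _ _, ?_⟩
    have hp : 0 < 64 * (A + 2) * C ^ 2 := by positivity
    calc _ ≤ 64 * (A + 2) * C ^ 2 * (η ^ 2 / (64 * (A + 2) * C ^ 2)) := by
          gcongr; exact min_le_right _ _
      _ = _ := by field_simp
  filter_upwards [hf₁, hf₂, hmain δ hδ, he (δ / C) (by positivity), eventually_gt_atTop 0]
    with X g₁ g₂ ⟨k, l, p, q, hp, hq, hpC, hqC, hpC', hqC', hk, hl, hZ⟩ heX hXp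
  set W := powExp ν.re X with hW
  have hW0 : 0 < W := powExp_pos _ hXp
  have hep : e X ≤ δ * p := heX.trans (by
    rw [div_mul_eq_mul_div, div_le_iff₀ (by linarith), mul_assoc, mul_comm p]; gcongr)
  have heq : e X ≤ δ * q := heX.trans (by
    rw [div_mul_eq_mul_div, div_le_iff₀ (by linarith), mul_assoc, mul_comm q]; gcongr)
  -- The disks about the partial sums of index `k` and `l` have radii `(A + 2δ) p` and `(A + 2δ) q`,
  -- and their centres are at least `(A - δ)(p + q)` apart. The radii thus exceed the distance by at
  -- most `3δ (p + q)`.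
  have key := norm_sub_sq_le_of_sub_eq (a := f₁ X - partialSum s k X)
    (a' := f₂ X - partialSum s k X) (b := f₁ X - partialSum s l X) (b' := f₂ X - partialSum s l X)
    (z := partialSum s l X - partialSum s k X) (p := (A + 2 * δ) * p) (q := (A + 2 * δ) * q)
    (η := 3 * δ * (p + q)) (by positivity) ((g₁ k).trans (by linarith)) ((g₂ k).trans (by linarith))
    ((g₁ l).trans (by linarith)) ((g₂ l).trans (by linarith)) (by ring) (by ring) (by linarith)
  rw [sub_sub_sub_cancel_right] at key
  refine abs_le_of_sq_le_sq' ?_ (by positivity) |>.2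
  calc _ ≤ _ := key
    _ ≤ 8 * ((A + 2) * (C * W)) * (3 * δ * (C * W + C * W)) := by
        gcongr
        linarith
    _ = 48 * (A + 2) * C ^ 2 * δ * W ^ 2 := by ring
    _ ≤ η ^ 2 * W ^ 2 := by
        gcongr
        have : 0 ≤ (A + 2) * C ^ 2 * δ := by positivity
        linarith
    _ = _ := by ring

end FormalSystem

/-! ### Operations on Gevrey expansions. -/

section Gevrey

open PowerSeries in
/-- `f` has the Gevrey expansion `∑ f_n X^{-n}` on `(X₀, ∞)`. -/
def GevreyOn (X₀ κ : ℝ) (f : ℝ → ℂ) (F : PowerSeries ℂ) : Prop :=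
  ∃ K : ℝ, 0 ≤ K ∧ (∀ n : ℕ, ‖coeff n F‖ ≤ K * κ ^ n * n.factorial) ∧
    ∀ (n : ℕ) (X : ℝ), X₀ < X →
      ‖f X - partialSum (fun j => coeff j F) n X‖ ≤ K * κ ^ n * n.factorial / X ^ n

variable {X₀ κ : ℝ} {f g : ℝ → ℂ} {F G : PowerSeries ℂ}

theorem GevreyOn.add (hf : GevreyOn X₀ κ f F) (hg : GevreyOn X₀ κ g G) :
    GevreyOn X₀ κ (fun X => f X + g X) (F + G) := by
  obtain ⟨K, hK, h1, h2⟩ := hf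
  obtain ⟨K', hK', h1', h2'⟩ := hg
  refine ⟨K + K', by positivity, fun n => ?_, fun n X hX => ?_⟩
  · rw [map_add]
    refine (norm_add_le _ _).trans ((add_le_add (h1 n) (h1' n)).trans (le_of_eq ?_))
    ring
  · have e : f X + g X - partialSum (fun j => PowerSeries.coeff j (F + G)) n X =
        (f X - partialSum (fun j => PowerSeries.coeff j F) n X) +
        (g X - partialSum (fun j => PowerSeries.coeff j G) n X) := by
      simp only [partialSum, map_add, add_div, Finset.sum_add_distrib]
      ring
    rw [e]
    refine (norm_add_le _ _).trans ((add_le_add (h2 n X hX) (h2' n X hX)).trans (le_of_eq ?_))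
    ring

theorem GevreyOn.const_mul (z : ℂ) (hf : GevreyOn X₀ κ f F) :
    GevreyOn X₀ κ (fun X => z * f X) (PowerSeries.C z * F) := by
  obtain ⟨K, hK, h1, h2⟩ := hf
  refine ⟨‖z‖ * K, by positivity, fun n => ?_, fun n X hX => ?_⟩
  · rw [PowerSeries.coeff_C_mul, norm_mul]
    refine (mul_le_mul_of_nonneg_left (h1 n) (norm_nonneg z)).trans (le_of_eq ?_)
    ring
  · have e : z * f X - partialSum (fun j => PowerSeries.coeff j (PowerSeries.C z * F)) n X =
        z * (f X - partialSum (fun j => PowerSeries.coeff j F) n X) := by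
      simp only [partialSum, PowerSeries.coeff_C_mul, mul_sub, Finset.mul_sum, mul_div_assoc]
    rw [e, norm_mul]
    refine (mul_le_mul_of_nonneg_left (h2 n X hX) (norm_nonneg z)).trans (le_of_eq ?_)
    ring

theorem gevreyOn_one (hX₀ : 0 < X₀) (hκ : 0 < κ) : GevreyOn X₀ κ (fun _ => 1) 1 := by
  refine ⟨1, zero_le_one, fun n => ?_, fun n X hX => ?_⟩
  · rw [PowerSeries.coeff_one]
    split_ifs with h
    · subst h; simp
    · rw [norm_zero]; positivity
  · have hXp := hX₀.trans hX
    rcases n with _ | n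
    · simp [partialSum]
    · have e : partialSum (fun j => PowerSeries.coeff j (1 : PowerSeries ℂ)) (n + 1) X = 1 := by
        rw [partialSum, Finset.sum_range_succ']
        simp [PowerSeries.coeff_one]
      rw [e, sub_self, norm_zero]
      positivity

theorem GevreyOn.div (hX₀ : 0 < X₀) (hκ : 0 < κ) (hf : GevreyOn X₀ κ f F) :
    GevreyOn X₀ κ (fun X => f X / X) (PowerSeries.X * F) := by
  obtain ⟨K, hK, h1, h2⟩ := hf
  refine ⟨K / κ + K / X₀, by positivity, fun n => ?_, fun n X hX => ?_⟩
  · rcases n with _ | n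
    · rw [PowerSeries.coeff_zero_X_mul, norm_zero]; positivity
    · rw [PowerSeries.coeff_succ_X_mul]
      calc _ ≤ K * κ ^ n * n.factorial := h1 n
        _ ≤ K * κ ^ n * (n + 1).factorial := by
            gcongr; exact n.le_succ
        _ = K / κ * κ ^ (n + 1) * (n + 1).factorial := by rw [pow_succ]; field_simp
        _ ≤ _ := by
            gcongr
            have : 0 ≤ K / X₀ := by positivity
            linarith
  · have hXp := hX₀.trans hX
    have hXc : (X : ℂ) ≠ 0 := by exact_mod_cast hXp.ne'
    rcases n with _ | n
    · have := h2 0 X hX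
      simp only [partialSum, Finset.range_zero, Finset.sum_empty, sub_zero, pow_zero, mul_one,
        Nat.factorial_zero, Nat.cast_one, div_one] at this ⊢
      rw [norm_div, Complex.norm_real, Real.norm_of_nonneg hXp.le]
      have h3 : ‖f X‖ / X ≤ K / X₀ := by gcongr
      have : 0 ≤ K / κ := by positivity
      linarith
    · have e : f X / X - partialSum (fun j => PowerSeries.coeff j (PowerSeries.X * F)) (n + 1) X =
          (f X - partialSum (fun j => PowerSeries.coeff j F) n X) / X := by
        rw [partialSum, Finset.sum_range_succ']
        simp only [PowerSeries.coeff_succ_X_mul, PowerSeries.coeff_zero_X_mul, zero_div, add_zero,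
          partialSum, sub_div, Finset.sum_div, pow_succ, div_div]
      rw [e, norm_div, Complex.norm_real, Real.norm_of_nonneg hXp.le, div_le_iff₀ hXp]
      refine (h2 n X hX).trans ?_
      calc K * κ ^ n * n.factorial / X ^ n ≤ K * κ ^ n * (n + 1).factorial / X ^ n := by
            gcongr; exact n.le_succ
        _ = K / κ * κ ^ (n + 1) * (n + 1).factorial / X ^ (n + 1) * X := by
            rw [pow_succ, pow_succ]; field_simp
        _ ≤ _ := by
            gcongr
            have : 0 ≤ K / X₀ := by positivity
            linarith

end Gevrey

/-! ### Formal solutions and their recursion. -/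

section Formal

open PowerSeries

/-- The coefficient `P` of the system for `(u, G)`. -/
def firstCoeff (A : PowerSeries ℂ) (L L' r r' : ℂ) : PowerSeries ℂ :=
  A + C (L + L') + C (r + r') * X

/-- The coefficient `H` of the system for `(u, G)`. -/
def secondCoeff (A B : PowerSeries ℂ) (L' r' : ℂ) : PowerSeries ℂ :=
  (C L' + C r' * X) ^ 2 - C r' * X ^ 2 + A * (C L' + C r' * X) + B

/-- The recursion satisfied by the coefficients of a formal solution. -/
structure FormalRecursion (ω ν : ℂ) (Pc Hc s g : ℕ → ℂ) : Prop where
  g_zero : g 0 = ω * s 0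
  s_succ : ∀ n : ℕ, ω * s (n + 1) = g (n + 1) + (n + ν) * s n
  g_eq : ∀ n : ℕ, (n : ℂ) * g n =
    ∑ j ∈ Finset.range (n + 2), (Pc j * g (n + 1 - j) + Hc j * s (n + 1 - j))

/-- The formal counterpart of the reduction to a first order system: `G` is obtained from `F` by
splitting off the first order factor belonging to the other exponential. `secondCoeff` is what the
operator makes of `e^{L'x} x^{r'}`, divided by this function. -/
theorem isFormalSolution_iff_derivative (A B F : PowerSeries ℂ) (L L' r r' : ℂ) :
    IsFormalSolution (fun n => coeff n A) (fun n => coeff n B) L r F ↔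
      X ^ 2 * derivative ℂ (formalDeriv L r F - (C L' + C r' * X) * F) =
        firstCoeff A L L' r r' * (formalDeriv L r F - (C L' + C r' * X) * F) +
          secondCoeff A B L' r' * F := by
  have hA : mk (fun n => coeff n A) = A := by ext; simp
  have hB : mk (fun n => coeff n B) = B := by ext; simp
  rw [IsFormalSolution, hA, hB, eq_comm, ← sub_eq_zero (a := X ^ 2 * _)]
  have e : firstCoeff A L L' r r' * (formalDeriv L r F - (C L' + C r' * X) * F) +
      secondCoeff A B L' r' * F - X ^ 2 * derivative ℂ (formalDeriv L r F - (C L' + C r' * X) * F) =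
      formalDeriv L r (formalDeriv L r F) + A * formalDeriv L r F + B * F := by
    have hd : derivative ℂ (formalDeriv L r F - (C L' + C r' * X) * F) =
        derivative ℂ (formalDeriv L r F) - (C r' * F + (C L' + C r' * X) * derivative ℂ F) := by
      simp only [map_sub, Derivation.leibniz, map_add, derivative_C, derivative_X, smul_eq_mul,
        mul_one, mul_zero, add_zero, zero_add]
      ring
    rw [hd, formalDeriv, formalDeriv, firstCoeff, secondCoeff, map_add, map_add]
    ring
  rw [eq_comm, ← e, ← neg_eq_zero, neg_sub]

theorem coeff_X_sq_mul_derivative (G : PowerSeries ℂ) (n : ℕ) :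
    coeff (n + 1) (X ^ 2 * derivative ℂ G) = n * coeff n G := by
  rcases n with _ | n
  · rw [coeff_X_pow_mul']; simp
  · rw [coeff_X_pow_mul', if_pos (by omega), coeff_derivative]
    simp only [show n + 1 + 1 - 2 = n by omega]
    push_cast
    ring

theorem isFormalSolution_iff_recursion {A B : PowerSeries ℂ} {L L' r r' : ℂ}
    (hP0 : coeff 0 (firstCoeff A L L' r r') = 0) (hH0 : coeff 0 (secondCoeff A B L' r') = 0)
    (F : PowerSeries ℂ) :
    IsFormalSolution (fun n => coeff n A) (fun n => coeff n B) L r F ↔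
      ∃ g, FormalRecursion (L - L') (r' - r) (fun n => coeff n (firstCoeff A L L' r r'))
        (fun n => coeff n (secondCoeff A B L' r')) (fun n => coeff n F) g := by
  rw [isFormalSolution_iff_derivative A B F L L' r r']
  set G := formalDeriv L r F - (C L' + C r' * X) * F with hG
  have hGe : G = C (L - L') * F - (X * (C (r' - r) * F) + X * (X * derivative ℂ F)) := by
    rw [hG, formalDeriv, map_sub, map_sub]; ring
  have hG0 : coeff 0 G = (L - L') * coeff 0 F := by
    rw [hGe]; simp
  have hG1 : ∀ n, coeff (n + 1) G = (L - L') * coeff (n + 1) F - (n + (r' - r)) * coeff n F := by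
    intro n
    have e : ∀ U V W : PowerSeries ℂ, coeff (n + 1) (U - (V + W)) =
        coeff (n + 1) U - (coeff (n + 1) V + coeff (n + 1) W) := fun U V W => by simp
    rw [hGe, e, coeff_C_mul, coeff_succ_X_mul, coeff_succ_X_mul, coeff_C_mul]
    rcases n with _ | n
    · rw [coeff_zero_X_mul]; push_cast; ring
    · rw [coeff_succ_X_mul, coeff_derivative]; push_cast; ring
  have hsum : ∀ (U V : PowerSeries ℂ) n, coeff n (U * V) =
      ∑ j ∈ Finset.range (n + 1), coeff j U * coeff (n - j) V := fun U V n => by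
    rw [coeff_mul, Finset.Nat.sum_antidiagonal_eq_sum_range_succ_mk]
  constructor
  · intro h
    refine ⟨fun n => coeff n G, hG0, fun n => by rw [hG1]; ring, fun n => ?_⟩
    have h1 := congrArg (coeff (n + 1)) h
    rw [coeff_X_sq_mul_derivative, map_add, hsum, hsum, ← Finset.sum_add_distrib] at h1
    exact h1
  · rintro ⟨g, h1, h2, h3⟩
    have hg : ∀ n, g n = coeff n G := fun n => by
      rcases n with _ | n
      · rw [h1, hG0]
      · rw [hG1]; linear_combination (-1) * h2 n
    ext n
    rcases n with _ | n
    · rw [map_add, coeff_X_pow_mul', if_neg (by omega), hsum, hsum, Finset.sum_range_one,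
        Finset.sum_range_one, hP0, hH0]
      ring
    · rw [coeff_X_sq_mul_derivative, map_add, hsum, hsum, ← Finset.sum_add_distrib, ← hg, h3 n]
      simp only [hg]

/-- The coefficients of the normalized formal solution. -/
def formalPair (ω ν : ℂ) (Pc Hc : ℕ → ℂ) : ℕ → ℂ × ℂ
  | 0 => (1, ω)
  | n + 1 =>
    let g := (∑ j : Fin (n + 1), (Pc (n + 2 - j) * (formalPair ω ν Pc Hc j).2 +
      Hc (n + 2 - j) * (formalPair ω ν Pc Hc j).1)) / (n + 1)
    ((g + (n + ν) * (formalPair ω ν Pc Hc n).1) / ω, g)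

variable {ω ν : ℂ} {Pc Hc s g s' g' : ℕ → ℂ}

/-- The vanishing of the first two coefficients removes the indices `n + 2` and `n + 1` from the
convolution. So the recursion determines the term of index `n + 1` from earlier ones. -/
theorem sum_recursion_eq (hP0 : Pc 0 = 0) (hP1 : Pc 1 = 0) (hH0 : Hc 0 = 0) (hH1 : Hc 1 = 0)
    (s g : ℕ → ℂ) (n : ℕ) :
    ∑ j ∈ Finset.range (n + 1 + 2), (Pc j * g (n + 1 + 1 - j) + Hc j * s (n + 1 + 1 - j)) =
      ∑ j ∈ Finset.range (n + 1), (Pc (n + 2 - j) * g j + Hc (n + 2 - j) * s j) := by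
  rw [← Finset.sum_range_reflect, Finset.sum_range_succ, Finset.sum_range_succ]
  have e1 : n + 1 + 2 - 1 - (n + 1) = 1 := by omega
  have e2 : n + 1 + 2 - 1 - (n + 1 + 1) = 0 := by omega
  rw [e1, e2, hP0, hP1, hH0, hH1]
  simp only [zero_mul, add_zero]
  refine Finset.sum_congr rfl fun j hj => ?_
  have := Finset.mem_range.mp hj
  rw [show n + 1 + 2 - 1 - j = n + 2 - j by omega, show n + 1 + 1 - (n + 2 - j) = j by omega]

theorem formalRecursion_formalPair (hω : ω ≠ 0) (hP0 : Pc 0 = 0) (hP1 : Pc 1 = 0) (hH0 : Hc 0 = 0)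
    (hH1 : Hc 1 = 0) : FormalRecursion ω ν Pc Hc (fun n => (formalPair ω ν Pc Hc n).1)
      (fun n => (formalPair ω ν Pc Hc n).2) := by
  refine ⟨by simp [formalPair], fun n => ?_, fun n => ?_⟩
  · conv_lhs => rw [formalPair]
    conv_rhs => rw [formalPair]
    simp only
    rw [mul_div_cancel₀ _ hω]
  · rcases n with _ | n
    · simp [Finset.sum_range_succ, hP0, hP1, hH0, hH1]
    · refine Eq.trans ?_ (sum_recursion_eq hP0 hP1 hH0 hH1 (fun n => (formalPair ω ν Pc Hc n).1)
        (fun n => (formalPair ω ν Pc Hc n).2) n).symm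
      conv_lhs => rw [formalPair]
      simp only
      have : ((n : ℂ) + 1) ≠ 0 := by exact_mod_cast n.succ_ne_zero
      push_cast
      rw [mul_div_cancel₀ _ this, Finset.sum_range]

theorem FormalRecursion.eq_mul (hω : ω ≠ 0) (hP0 : Pc 0 = 0) (hP1 : Pc 1 = 0) (hH0 : Hc 0 = 0)
    (hH1 : Hc 1 = 0) (h : FormalRecursion ω ν Pc Hc s g) (h1 : s 0 = 1)
    (h' : FormalRecursion ω ν Pc Hc s' g') (n : ℕ) : s' n = s' 0 * s n ∧ g' n = s' 0 * g n := by
  induction n using Nat.strong_induction_on with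
  | _ n ih =>
    rcases n with _ | n
    · rw [h1, h.g_zero, h'.g_zero, h1]
      exact ⟨by ring, by ring⟩
    · have hn : (((n + 1 : ℕ) : ℂ)) ≠ 0 := by exact_mod_cast n.succ_ne_zero
      have hg : g' (n + 1) = s' 0 * g (n + 1) := by
        refine mul_left_cancel₀ hn ?_
        rw [h'.g_eq, mul_left_comm, h.g_eq, sum_recursion_eq hP0 hP1 hH0 hH1,
          sum_recursion_eq hP0 hP1 hH0 hH1, Finset.mul_sum]
        refine Finset.sum_congr rfl fun j hj => ?_
        obtain ⟨i1, i2⟩ := ih j (Finset.mem_range.mp hj)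
        rw [i1, i2]; ring
      refine ⟨mul_left_cancel₀ hω ?_, hg⟩
      rw [h'.s_succ, mul_left_comm, h.s_succ, hg, (ih n n.lt_succ_self).1]
      ring

theorem FormalRecursion.const_mul (h : FormalRecursion ω ν Pc Hc s g) (c : ℂ) :
    FormalRecursion ω ν Pc Hc (fun n => c * s n) (fun n => c * g n) := by
  refine ⟨by rw [h.g_zero]; ring, fun n => ?_, fun n => ?_⟩
  · linear_combination c * h.s_succ n
  · rw [mul_left_comm, h.g_eq, Finset.mul_sum]
    exact Finset.sum_congr rfl fun j _ => by ring

end Formal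

/-! ### The normalized second order equation as a system. -/

/-- The equation `Y'' + α Y' + β Y = 0` on `(X₀, ∞)`, with coefficients that have Gevrey expansions,
and its characteristic data, normalized such that the characteristic roots have distance 1. -/
structure RealProblem (X₀ : ℝ) (α β : ℝ → ℂ) (A B : PowerSeries ℂ) (κ : ℝ) (L L' r r' : ℂ) :
    Prop where
  X₀_pos : 0 < X₀
  κ_pos : 0 < κ
  κ_lt : κ < 1
  α_meas : AEStronglyMeasurable α (volume.restrict (Set.Ioi X₀))
  β_meas : AEStronglyMeasurable β (volume.restrict (Set.Ioi X₀))
  α_gevrey : GevreyOn X₀ κ α A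
  β_gevrey : GevreyOn X₀ κ β B
  norm_eq : ‖L - L'‖ = 1
  sum_eq : L + L' = -PowerSeries.coeff 0 A
  root' : L' ^ 2 + PowerSeries.coeff 0 A * L' + PowerSeries.coeff 0 B = 0
  exp_eq : (L - L') * r = -(PowerSeries.coeff 1 A * L + PowerSeries.coeff 1 B)
  exp_eq' : (L' - L) * r' = -(PowerSeries.coeff 1 A * L' + PowerSeries.coeff 1 B)

namespace RealProblem

open PowerSeries

variable {X₀ κ : ℝ} {α β : ℝ → ℂ} {A B : PowerSeries ℂ} {L L' r r' : ℂ}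

theorem swap (h : RealProblem X₀ α β A B κ L L' r r') : RealProblem X₀ α β A B κ L' L r' r where
  X₀_pos := h.X₀_pos
  κ_pos := h.κ_pos
  κ_lt := h.κ_lt
  α_meas := h.α_meas
  β_meas := h.β_meas
  α_gevrey := h.α_gevrey
  β_gevrey := h.β_gevrey
  norm_eq := by rw [norm_sub_rev]; exact h.norm_eq
  sum_eq := by rw [add_comm]; exact h.sum_eq
  root' := by linear_combination h.root' + (L - L') * h.sum_eq
  exp_eq := h.exp_eq'
  exp_eq' := h.exp_eq

theorem sub_ne_zero (h : RealProblem X₀ α β A B κ L L' r r') : L - L' ≠ 0 :=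
  norm_pos_iff.mp (by rw [h.norm_eq]; exact one_pos)

/-- The roots add up to `-A₀` and the exponents to `-A₁`, where `A₀`, `A₁` are the first
coefficients of `A`. -/
theorem coeff_firstCoeff (h : RealProblem X₀ α β A B κ L L' r r') :
    coeff 0 (firstCoeff A L L' r r') = 0 ∧ coeff 1 (firstCoeff A L L' r r') = 0 := by
  have h0 := h.sub_ne_zero
  constructor
  · rw [firstCoeff, map_add, map_add]
    simp only [coeff_zero_C, h.sum_eq, coeff_C_mul, coeff_zero_X]
    ring
  · rw [firstCoeff, map_add, map_add, coeff_C_mul, coeff_one_X, coeff_C, if_neg one_ne_zero]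
    refine mul_left_cancel₀ h0 ?_
    linear_combination h.exp_eq - h.exp_eq'

/-- The coefficient of order `0` is the characteristic polynomial at `L'`; the one of order `1`
vanishes by the equation that defines `r'`. -/
theorem coeff_secondCoeff (h : RealProblem X₀ α β A B κ L L' r r') :
    coeff 0 (secondCoeff A B L' r') = 0 ∧ coeff 1 (secondCoeff A B L' r') = 0 := by
  have e : secondCoeff A B L' r' = C (L' ^ 2) + X * C (2 * L' * r') + X ^ 2 * C (r' ^ 2 - r') +
      C L' * A + X * (C r' * A) + B := by
    rw [secondCoeff]; simp only [map_mul, map_pow, map_sub, map_ofNat]; ring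
  constructor
  · rw [e]
    simp only [map_add, coeff_zero_X_mul, coeff_C_mul, coeff_zero_C, coeff_X_pow_mul']
    simp only [show ¬ (2 ≤ 0) by omega, if_false]
    linear_combination h.root'
  · rw [e]
    have h1 : ∀ F : PowerSeries ℂ, coeff 1 (X * F) = coeff 0 F := fun F => coeff_succ_X_mul 0 F
    simp only [map_add, h1, coeff_C_mul, coeff_X_pow_mul', coeff_C,
      if_neg one_ne_zero, if_true]
    simp only [show ¬ (2 ≤ 1) by omega, if_false]
    linear_combination h.exp_eq' + r' * h.sum_eq

/-- The system for `(u, G)` and the formal solution. -/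
theorem exists_scaledSystem (h : RealProblem X₀ α β A B κ L L' r r') :
    ∃ (K : ℝ) (s g : ℕ → ℂ),
      ScaledSystem X₀ (L - L') (r' - r) (fun X => α X + (L + L') + (r + r') / X)
        (fun X => (L' + r' / X) ^ 2 - r' / X ^ 2 + α X * (L' + r' / X) + β X)
        (fun n => coeff n (firstCoeff A L L' r r')) (fun n => coeff n (secondCoeff A B L' r')) s g
        K κ ∧
      ∀ F : PowerSeries ℂ, IsFormalSolution (fun n => coeff n A) (fun n => coeff n B) L r F ↔
        ∃ c : ℂ, F = c • PowerSeries.mk s := by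
  have hX₀ := h.X₀_pos
  have h1 := gevreyOn_one hX₀ h.κ_pos
  have hX := h1.div hX₀ h.κ_pos
  have hX2 := hX.div hX₀ h.κ_pos
  have hαX := h.α_gevrey.div hX₀ h.κ_pos
  obtain ⟨K₁, hK₁, hP, hP'⟩ := ((h.α_gevrey.add (h1.const_mul (L + L'))).add
    (hX.const_mul (r + r')))
  obtain ⟨K₂, hK₂, hH, hH'⟩ := (((((h1.const_mul (L' ^ 2)).add (hX.const_mul (2 * L' * r'))).add
    (hX2.const_mul (r' ^ 2 - r'))).add (h.α_gevrey.const_mul L')).add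
    (hαX.const_mul r')).add h.β_gevrey
  have eP : A + C (L + L') * 1 + C (r + r') * (X * 1) = firstCoeff A L L' r r' := by
    rw [firstCoeff]; ring
  have eH : C (L' ^ 2) * 1 + C (2 * L' * r') * (X * 1) + C (r' ^ 2 - r') * (X * (X * 1)) +
      C L' * A + C r' * (X * A) + B = secondCoeff A B L' r' := by
    rw [secondCoeff]; simp only [map_mul, map_pow, map_sub, map_ofNat]; ring
  rw [eP] at hP hP'
  rw [eH] at hH hH'
  obtain ⟨p0, p1⟩ := h.coeff_firstCoeff
  obtain ⟨q0, q1⟩ := h.coeff_secondCoeff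
  have hrec := formalRecursion_formalPair (ν := r' - r) h.sub_ne_zero
    (Pc := fun n => coeff n (firstCoeff A L L' r r'))
    (Hc := fun n => coeff n (secondCoeff A B L' r')) p0 p1 q0 q1
  set s : ℕ → ℂ := fun n => (formalPair (L - L') (r' - r)
    (fun n => coeff n (firstCoeff A L L' r r')) (fun n => coeff n (secondCoeff A B L' r')) n).1
    with hs
  set g : ℕ → ℂ := fun n => (formalPair (L - L') (r' - r)
    (fun n => coeff n (firstCoeff A L L' r r')) (fun n => coeff n (secondCoeff A B L' r')) n).2
    with hg
  have hs0 : s 0 = 1 := by simp [hs, formalPair]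
  have hκ := h.κ_pos
  have hinv : Measurable fun X : ℝ => (X : ℂ) := Complex.measurable_ofReal
  refine ⟨K₁ + K₂, s, g, ⟨⟨h.norm_eq, h.κ_pos, h.κ_lt, by positivity, p0, p1, q0, q1, fun n => ?_,
    fun n => ?_, hs0, hrec.g_zero, hrec.s_succ, hrec.g_eq⟩, hX₀, ?_, ?_, fun n X hX => ?_,
    fun n X hX => ?_⟩, fun F => ?_⟩
  · refine (hP n).trans ?_
    gcongr; linarith
  · refine (hH n).trans ?_
    gcongr; linarith
  · refine (h.α_meas.add aestronglyMeasurable_const).add ?_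
    exact (measurable_const.div hinv).aestronglyMeasurable
  · have m1 : Measurable fun X : ℝ => L' + r' / (X : ℂ) := (measurable_const.div hinv).const_add _
    refine ((AEStronglyMeasurable.sub ?_ ?_).add (h.α_meas.mul m1.aestronglyMeasurable)).add h.β_meas
    · exact (m1.pow_const 2).aestronglyMeasurable
    · exact (measurable_const.div (hinv.pow_const 2)).aestronglyMeasurable
  · have hXp := hX₀.trans hX
    have e : α X + (L + L') + (r + r') / X = α X + (L + L') * 1 + (r + r') * (1 / (X : ℂ)) := by ring
    rw [e]
    refine (hP' n X hX).trans ?_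
    gcongr; linarith
  · have hXp := hX₀.trans hX
    have e : (L' + r' / X) ^ 2 - r' / X ^ 2 + α X * (L' + r' / X) + β X =
        L' ^ 2 * 1 + 2 * L' * r' * (1 / (X : ℂ)) + (r' ^ 2 - r') * (1 / (X : ℂ) / X) + L' * α X +
          r' * (α X / X) + β X := by ring
    rw [e]
    refine (hH' n X hX).trans ?_
    gcongr; linarith
  · rw [isFormalSolution_iff_recursion p0 q0]
    constructor
    · rintro ⟨g', hg'⟩
      refine ⟨coeff 0 F, ?_⟩
      ext n
      rw [(hrec.eq_mul h.sub_ne_zero p0 p1 q0 q1 hs0 hg' n).1]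
      simp
    · rintro ⟨c, rfl⟩
      refine ⟨fun n => c * g n, ?_⟩
      have := hrec.const_mul c
      simpa using this

end RealProblem

/-! ### Product rule and Gronwall's inequality in integral form. -/

section Primitive

theorem absolutelyContinuousOnInterval_add_integral {f : ℝ → ℂ} {a b C : ℝ}
    (hf : IntervalIntegrable f volume a b) (hC : ∀ x ∈ Set.uIcc a b, ‖f x‖ ≤ C) (c : ℂ) :
    AbsolutelyContinuousOnInterval (fun x => c + ∫ t in a..x, f t) a b := by
  have hC0 : 0 ≤ C := (norm_nonneg _).trans (hC a Set.left_mem_uIcc)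
  refine (LipschitzOnWith.of_dist_le_mul (K := ⟨C, hC0⟩) fun x hx y hy => ?_).absolutelyContinuousOnInterval
  have hi : ∀ z ∈ Set.uIcc a b, IntervalIntegrable f volume a z := fun z hz =>
    hf.mono_set (Set.uIcc_subset_uIcc Set.left_mem_uIcc hz)
  rw [dist_eq_norm, dist_eq_norm, add_sub_add_left_eq_sub,
    intervalIntegral.integral_interval_sub_left (hi x hx) (hi y hy)]
  refine intervalIntegral.norm_integral_le_of_norm_le_const fun z hz => hC z ?_
  exact Set.uIcc_subset_uIcc hy hx (Set.uIoc_subset_uIcc hz)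

/-- The product rule, in integrated form, for a continuously differentiable and a Lipschitz
continuous factor. -/
theorem mul_sub_mul_eq_integral {a b C : ℝ} {E E' G f : ℝ → ℂ}
    (hE : ∀ x ∈ Set.uIcc a b, HasDerivAt E (E' x) x) (hE' : ContinuousOn E' (Set.uIcc a b))
    (hf : IntervalIntegrable f volume a b) (hC : ∀ x ∈ Set.uIcc a b, ‖f x‖ ≤ C)
    (hG : ∀ x ∈ Set.uIcc a b, G x - G a = ∫ t in a..x, f t) :
    E b * G b - E a * G a = ∫ t in a..b, (E' t * G t + E t * f t) := by
  have hE'i : IntervalIntegrable E' volume a b := hE'.intervalIntegrable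
  have hEc : ContinuousOn E (Set.uIcc a b) := fun x hx => (hE x hx).continuousAt.continuousWithinAt
  have hGe : ∀ x ∈ Set.uIcc a b, G x = G a + ∫ t in a..x, f t := fun x hx => by
    rw [← hG x hx]; ring
  have hEe : ∀ x ∈ Set.uIcc a b, E x = E a + ∫ t in a..x, E' t := fun x hx => by
    have hs := Set.uIcc_subset_uIcc Set.left_mem_uIcc hx
    rw [intervalIntegral.integral_eq_sub_of_hasDerivAt (fun y hy => hE y (hs hy))
      ((hE'.mono hs).intervalIntegrable)]
    ring
  have hGac := absolutelyContinuousOnInterval_add_integral hf hC (G a)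
  have hGc : ContinuousOn G (Set.uIcc a b) := hGac.continuousOn.congr hGe
  obtain ⟨D, hD⟩ := isCompact_uIcc.exists_bound_of_continuousOn hE'
  obtain ⟨D₁, hD₁⟩ := isCompact_uIcc.exists_bound_of_continuousOn hEc
  obtain ⟨D₂, hD₂⟩ := isCompact_uIcc.exists_bound_of_continuousOn (hE'.mul hGc)
  have hEac := absolutelyContinuousOnInterval_add_integral hE'i hD (E a)
  have hki : IntervalIntegrable (fun t => E' t * G t + E t * f t) volume a b :=
    (hE'.mul hGc).intervalIntegrable.add (hf.continuousOn_mul hEc)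
  have hkb : ∀ x ∈ Set.uIcc a b, ‖E' x * G x + E x * f x‖ ≤ D₂ + D₁ * C := fun x hx => by
    refine (norm_add_le _ _).trans (add_le_add (hD₂ x hx) ?_)
    rw [norm_mul]
    exact mul_le_mul (hD₁ x hx) (hC x hx) (norm_nonneg _) ((norm_nonneg _).trans (hD₁ x hx))
  have hkac := absolutelyContinuousOnInterval_add_integral hki hkb 0
  -- The product minus the integral of its expected derivative is absolutely continuous and has
  -- derivative zero almost everywhere, hence it is constant.
  have key := (hEac.smul hGac).sub hkac
  obtain ⟨c, hc⟩ := key.const_of_ae_hasDerivAt_zero (by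
    filter_upwards [hf.ae_hasDerivAt_integral, hE'i.ae_hasDerivAt_integral,
      hki.ae_hasDerivAt_integral] with x h1 h2 h3 hx
    have g1 := (h1 hx a Set.left_mem_uIcc).const_add (G a)
    have g2 := (h2 hx a Set.left_mem_uIcc).const_add (E a)
    have g3 := (h3 hx a Set.left_mem_uIcc).const_add 0
    refine ((g2.mul g1).sub g3).congr_deriv ?_
    rw [← hGe x hx, ← hEe x hx]
    ring)
  have ha := hc a Set.left_mem_uIcc
  have hb := hc b Set.right_mem_uIcc
  simp only [Pi.sub_apply, Pi.mul_apply, smul_eq_mul, intervalIntegral.integral_same, add_zero,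
    sub_zero, zero_add] at ha hb
  rw [← hGe b Set.right_mem_uIcc, ← hEe b Set.right_mem_uIcc] at hb
  linear_combination hb - ha

/-- Gronwall's inequality in integral form. -/
theorem eq_zero_of_le_mul_integral_of_le {N : ℝ → ℝ} {a b M : ℝ} (hab : a ≤ b) {s : Set ℝ}
    (hs : IsOpen s) (hsub : Set.Icc a b ⊆ s) (hN : ContinuousOn N s) (hN0 : ∀ x ∈ s, 0 ≤ N x)
    (h : ∀ x ∈ Set.Icc a b, N x ≤ M * ∫ t in a..x, N t) : N b = 0 := by
  have hi : ∀ x ∈ Set.Icc a b, IntervalIntegrable N volume a x := fun x hx =>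
    (hN.mono (by
      rw [Set.uIcc_of_le hx.1]
      exact (Set.Icc_subset_Icc_right hx.2).trans hsub)).intervalIntegrable
  have h0 : ∀ x ∈ Set.Icc a b, 0 ≤ ∫ t in a..x, N t := fun x hx =>
    intervalIntegral.integral_nonneg hx.1 fun t ht => hN0 t (hsub ⟨ht.1, ht.2.trans hx.2⟩)
  have hd : ∀ x ∈ Set.Icc a b, HasDerivAt (fun x => ∫ t in a..x, N t) (N x) x := fun x hx =>
    intervalIntegral.integral_hasDerivAt_right (hi x hx)
      (hN.stronglyMeasurableAtFilter hs x (hsub hx)) (hN.continuousAt (hs.mem_nhds (hsub hx)))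
  have := norm_le_gronwallBound_of_norm_deriv_right_le (f := fun x => ∫ t in a..x, N t) (f' := N)
    (δ := 0) (K := M) (ε := 0) (fun x hx => (hd x hx).continuousAt.continuousWithinAt)
    (fun x hx => (hd x ⟨hx.1, hx.2.le⟩).hasDerivWithinAt)
    (by simp) (fun x hx => by
      have hx' : x ∈ Set.Icc a b := ⟨hx.1, hx.2.le⟩
      rw [Real.norm_of_nonneg (hN0 x (hsub hx')), Real.norm_of_nonneg (h0 x hx'), add_zero]
      exact h x hx') b ⟨hab, le_rfl⟩
  rw [gronwallBound_ε0_δ0] at this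
  have hb : b ∈ Set.Icc a b := ⟨hab, le_rfl⟩
  have e : ∫ t in a..b, N t = 0 := norm_le_zero_iff.mp this
  have := h b hb
  rw [e, mul_zero] at this
  exact le_antisymm this (hN0 b (hsub hb))

theorem eq_zero_of_le_mul_abs_integral {N : ℝ → ℝ} {X₀ a M : ℝ} (hN : ContinuousOn N (Set.Ioi X₀))
    (hN0 : ∀ x, X₀ < x → 0 ≤ N x) (ha : X₀ < a)
    (h : ∀ x, X₀ < x → N x ≤ M * |∫ t in a..x, N t|) {x : ℝ} (hx : X₀ < x) : N x = 0 := by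
  have hpos : ∀ u v, X₀ < u → u ≤ v → 0 ≤ ∫ t in u..v, N t := fun u v hu huv =>
    intervalIntegral.integral_nonneg huv fun t ht => hN0 t (hu.trans_le ht.1)
  rcases le_total a x with hax | hax
  · refine eq_zero_of_le_mul_integral_of_le hax isOpen_Ioi (fun t ht => ha.trans_le ht.1) hN
      (fun t ht => hN0 t ht) (M := M) fun t ht => ?_
    have := h t (ha.trans_le ht.1)
    rwa [abs_of_nonneg (hpos _ _ ha ht.1)] at this
  -- To the left of `a`, Gronwall's inequality is applied after the reflection `t ↦ -t`.
  · have := eq_zero_of_le_mul_integral_of_le (N := fun t => N (-t)) (a := -a) (b := -x) (M := M)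
      (neg_le_neg hax) (isOpen_Iio (a := -X₀))
      (fun t ht => (lt_neg_of_lt_neg (hx.trans_le (le_neg_of_le_neg ht.2)) : t < -X₀))
      (hN.comp continuous_neg.continuousOn fun t ht => (lt_neg_of_lt_neg ht : X₀ < -t))
      (fun t ht => hN0 _ (lt_neg_of_lt_neg ht)) (fun t ht => by
        have h1 : X₀ < -t := hx.trans_le (le_neg_of_le_neg ht.2)
        have h2 := h (-t) h1
        rw [intervalIntegral.integral_comp_neg, neg_neg]
        rwa [intervalIntegral.integral_symm, abs_neg,
          abs_of_nonneg (hpos _ _ h1 (neg_le.mp ht.1))] at h2)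
    simpa using this

end Primitive

/-! ### Solutions of the normalized equation and the initial value problem. -/

/-- `Y` is a solution of `Y'' + α Y' + β Y = 0` on `(X₀, ∞)`, with derivative `Z`. -/
structure IsRealSolution (X₀ : ℝ) (α β Y Z : ℝ → ℂ) : Prop where
  cont : ContinuousOn Z (Set.Ioi X₀)
  deriv : ∀ X, X₀ < X → HasDerivAt Y (Z X) X
  integral : ∀ s t, X₀ < s → X₀ < t → Z t - Z s = ∫ τ in s..t, -(α τ * Z τ + β τ * Y τ)

namespace IsRealSolution

variable {X₀ κ : ℝ} {α β Y Z Y' Z' : ℝ → ℂ}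

theorem continuousOn (h : IsRealSolution X₀ α β Y Z) : ContinuousOn Y (Set.Ioi X₀) :=
  fun x hx => (h.deriv x hx).continuousAt.continuousWithinAt

theorem intervalIntegrable_of_bounded {f : ℝ → ℂ} {C : ℝ}
    (hm : AEStronglyMeasurable f (volume.restrict (Set.Ioi X₀))) (hf : ∀ x, X₀ < x → ‖f x‖ ≤ C)
    {s t : ℝ} (hs : X₀ < s) (ht : X₀ < t) : IntervalIntegrable f volume s t := by
  have hsub : Set.uIoc s t ⊆ Set.Ioi X₀ := fun x hx => (lt_min hs ht).trans hx.1
  have hfin : IsFiniteMeasure (volume.restrict (Set.uIoc s t)) := by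
    rw [Set.uIoc]; infer_instance
  refine intervalIntegrable_iff.mpr (Integrable.of_bound (hm.mono_set hsub) C ?_)
  filter_upwards [ae_restrict_mem measurableSet_uIoc] with x hx using hf x (hsub hx)

theorem intervalIntegrable {C : ℝ} (hα : AEStronglyMeasurable α (volume.restrict (Set.Ioi X₀)))
    (hβ : AEStronglyMeasurable β (volume.restrict (Set.Ioi X₀))) (hα' : ∀ x, X₀ < x → ‖α x‖ ≤ C)
    (hβ' : ∀ x, X₀ < x → ‖β x‖ ≤ C) (h : IsRealSolution X₀ α β Y Z) {s t : ℝ} (hs : X₀ < s)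
    (ht : X₀ < t) : IntervalIntegrable (fun τ => -(α τ * Z τ + β τ * Y τ)) volume s t := by
  have hsub : Set.uIcc s t ⊆ Set.Ioi X₀ := fun x hx => (lt_min hs ht).trans_le hx.1
  exact (((intervalIntegrable_of_bounded hα hα' hs ht).mul_continuousOn (h.cont.mono hsub)).add
    ((intervalIntegrable_of_bounded hβ hβ' hs ht).mul_continuousOn (h.continuousOn.mono hsub))).neg

theorem linearCombination {C : ℝ} (hα : AEStronglyMeasurable α (volume.restrict (Set.Ioi X₀)))
    (hβ : AEStronglyMeasurable β (volume.restrict (Set.Ioi X₀))) (hα' : ∀ x, X₀ < x → ‖α x‖ ≤ C)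
    (hβ' : ∀ x, X₀ < x → ‖β x‖ ≤ C) (h : IsRealSolution X₀ α β Y Z)
    (h' : IsRealSolution X₀ α β Y' Z') (c c' : ℂ) :
    IsRealSolution X₀ α β (fun X => c * Y X + c' * Y' X) (fun X => c * Z X + c' * Z' X) where
  cont := (continuousOn_const.mul h.cont).add (continuousOn_const.mul h'.cont)
  deriv := fun X hX => ((h.deriv X hX).const_mul c).add ((h'.deriv X hX).const_mul c')
  integral := fun s t hs ht => by
    have e : ∀ τ, -(α τ * (c * Z τ + c' * Z' τ) + β τ * (c * Y τ + c' * Y' τ)) =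
        c * (-(α τ * Z τ + β τ * Y τ)) + c' * (-(α τ * Z' τ + β τ * Y' τ)) := fun τ => by ring
    simp only [e]
    rw [intervalIntegral.integral_add
      ((h.intervalIntegrable hα hβ hα' hβ' hs ht).const_mul c)
      ((h'.intervalIntegrable hα hβ hα' hβ' hs ht).const_mul c'),
      intervalIntegral.integral_const_mul, intervalIntegral.integral_const_mul,
      ← h.integral s t hs ht, ← h'.integral s t hs ht]
    ring

/-- A solution with vanishing initial values vanishes. -/
theorem eq_zero {C : ℝ} (hα' : ∀ x, X₀ < x → ‖α x‖ ≤ C) (hβ' : ∀ x, X₀ < x → ‖β x‖ ≤ C)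
    (h : IsRealSolution X₀ α β Y Z) {t₀ : ℝ} (ht₀ : X₀ < t₀) (hY : Y t₀ = 0) (hZ : Z t₀ = 0)
    {x : ℝ} (hx : X₀ < x) : Y x = 0 := by
  have hC : 0 ≤ C := (norm_nonneg _).trans (hα' t₀ ht₀)
  have hNc : ContinuousOn (fun x => ‖Y x‖ + ‖Z x‖) (Set.Ioi X₀) := h.continuousOn.norm.add h.cont.norm
  have key := eq_zero_of_le_mul_abs_integral (N := fun x => ‖Y x‖ + ‖Z x‖) (M := 1 + C) hNc
    (fun x _ => by positivity) ht₀ (fun x hx => ?_) hx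
  · have := norm_nonneg (Y x)
    have := norm_nonneg (Z x)
    exact norm_le_zero_iff.mp (by linarith)
  · have hsub : Set.uIcc t₀ x ⊆ Set.Ioi X₀ := fun y hy => (lt_min ht₀ hx).trans_le hy.1
    have hi : IntervalIntegrable (fun x => ‖Y x‖ + ‖Z x‖) volume t₀ x :=
      (hNc.mono hsub).intervalIntegrable
    have e1 : Y x = ∫ t in t₀..x, Z t := by
      rw [intervalIntegral.integral_eq_sub_of_hasDerivAt (fun y hy => h.deriv y (hsub hy))
        (h.cont.mono hsub).intervalIntegrable, hY, sub_zero]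
    have e2 : Z x = ∫ t in t₀..x, -(α t * Z t + β t * Y t) := by
      rw [← h.integral t₀ x ht₀ hx, hZ, sub_zero]
    have b1 : ‖Y x‖ ≤ |∫ t in t₀..x, (‖Y t‖ + ‖Z t‖)| := by
      rw [e1]
      refine intervalIntegral.norm_integral_le_abs_of_norm_le ?_ hi
      exact ae_of_all _ fun t => le_add_of_nonneg_left (norm_nonneg _)
    have b2 : ‖Z x‖ ≤ |∫ t in t₀..x, C * (‖Y t‖ + ‖Z t‖)| := by
      rw [e2]
      refine intervalIntegral.norm_integral_le_abs_of_norm_le ?_ (hi.const_mul C)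
      filter_upwards [ae_restrict_mem measurableSet_uIoc] with t ht
      have htX : X₀ < t := hsub (Set.uIoc_subset_uIcc ht)
      rw [norm_neg]
      refine (norm_add_le _ _).trans ?_
      rw [norm_mul, norm_mul]
      have := mul_le_mul_of_nonneg_right (hα' t htX) (norm_nonneg (Z t))
      have := mul_le_mul_of_nonneg_right (hβ' t htX) (norm_nonneg (Y t))
      linarith
    rw [intervalIntegral.integral_const_mul, abs_mul, abs_of_nonneg hC] at b2
    linarith

end IsRealSolution

/-! ### Optimal approximations and the basic solutions. -/

open Classical in
/-- The coefficient of `√n` in the optimal bounds. -/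
def stokesBound (ω R : ℂ) : ℝ := if ω = 1 then aStar * ‖R‖ else 0

theorem stokesBound_nonneg (ω R : ℂ) : 0 ≤ stokesBound ω R := by
  have := aStar_pos
  unfold stokesBound
  split_ifs <;> positivity

/-- The bound for the remainder after `n` terms. -/
def optimalBound (ω ν R : ℂ) (B : ℝ) (n : ℕ) (X : ℝ) : ℝ :=
  (stokesBound ω R * √n + B) * gammaPos (n + ν.re) / X ^ n

theorem gammaPos_pos (u : ℝ) : 0 < gammaPos u := by
  unfold gammaPos
  split_ifs with h
  · exact Real.Gamma_pos_of_pos h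
  · exact one_pos

theorem optimalBound_mono (ω ν R : ℂ) {B B' : ℝ} (hB : B ≤ B') (n : ℕ) {X : ℝ} (hX : 0 < X) :
    optimalBound ω ν R B n X ≤ optimalBound ω ν R B' n X := by
  have := gammaPos_pos (n + ν.re)
  unfold optimalBound
  gcongr

theorem tendsto_optimalBound_one (ω ν R : ℂ) (B : ℝ) :
    Tendsto (optimalBound ω ν R B 1) atTop (𝓝 0) := by
  unfold optimalBound
  simp only [pow_one]
  exact tendsto_const_nhds.div_atTop tendsto_id

/-- `u` is approximated by the series `∑ s_n X^{-n}`, with remainders within the optimal bounds, and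
these bounds determine a function up to `o(X^ν e^{-ωX})`. -/
structure IsOptimalApproximation (X₀ : ℝ) (ω ν : ℂ) (s : ℕ → ℂ) (R : ℂ) (B : ℝ) (u : ℝ → ℂ) :
    Prop where
  X₀_pos : 0 < X₀
  norm_eq : ‖ω‖ = 1
  s_zero : s 0 = 1
  nonneg : 0 ≤ B
  le : ∀ (n : ℕ) (X : ℝ), X₀ < X → ‖u X - partialSum s n X‖ ≤ optimalBound ω ν R B n X
  rigid : ∀ (B' : ℝ) (f₁ f₂ : ℝ → ℂ) (e : ℝ → ℝ),
    (∀ δ : ℝ, 0 < δ → ∀ᶠ X in atTop, e X ≤ δ * ‖intFactor ω ν X‖⁻¹) →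
    (∀ᶠ X in atTop, ∀ n, ‖f₁ X - partialSum s n X‖ ≤ optimalBound ω ν R B' n X + e X) →
    (∀ᶠ X in atTop, ∀ n, ‖f₂ X - partialSum s n X‖ ≤ optimalBound ω ν R B' n X + e X) →
    ∀ η : ℝ, 0 < η → ∀ᶠ X in atTop, ‖f₁ X - f₂ X‖ ≤ η * ‖intFactor ω ν X‖⁻¹

theorem norm_intFactor_one_inv (ν : ℂ) {X : ℝ} (hX : 0 < X) :
    ‖intFactor 1 ν X‖⁻¹ = powExp ν.re X := by
  rw [norm_intFactor _ _ hX, powExp, mul_inv, Real.rpow_neg hX.le, inv_inv, ← Real.exp_neg]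
  simp

/-- Without the factor `√n` the bound at the cut has the size of the least term. Multiplied by the
integrating factor it is `O(X^{-1/2} e^{-(1 - Re ω) X})`, which tends to zero. -/
theorem eventually_optimalBound_cutIndex_le {ω ν : ℂ} (R : ℂ) (hω : ‖ω‖ = 1) (hω1 : ω ≠ 1)
    {n₀ : ℕ} (hn₀ : BaseIndex ν n₀) (B : ℝ) {η : ℝ} (hη : 0 < η) :
    ∀ᶠ X in atTop, optimalBound ω ν R B (cutIndex n₀ X) X ≤ η * ‖intFactor ω ν X‖⁻¹ := by
  obtain ⟨C, hC, h⟩ := hn₀.modelTerm_equiv_leastTerm one_pos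
    (M := ((n₀ : ℝ) + 1) ^ 2 / 1) (by positivity)
  have hre := re_le_one_of_norm_eq_one hω
  have ht := (tendsto_decayFactor (c := 1 - ω.re) (by linarith)).const_mul (|B| * C)
  rw [mul_zero] at ht
  filter_upwards [ht.eventually_le_const hη, eventually_gt_atTop 1] with X hX hX1
  have hXp : 0 < X := by linarith
  have hN := le_cutIndex n₀ X
  have hpos : 0 < (cutIndex n₀ X : ℝ) + ν.re := by
    have := hn₀.two_le
    have : (n₀ : ℝ) ≤ cutIndex n₀ X := by exact_mod_cast hN
    linarith
  have hI : 0 < ‖intFactor ω ν X‖ := norm_pos_iff.mpr (intFactor_ne_zero ω ν X)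
  rw [← norm_intFactor_mul_leastTerm _ _ hXp] at hX
  have e : optimalBound ω ν R B (cutIndex n₀ X) X = B * modelTerm ν.re (cutIndex n₀ X) X := by
    rw [optimalBound, stokesBound, if_neg hω1, gammaPos, if_pos hpos, modelTerm]; ring
  have hm := hn₀.modelTerm_pos hN hXp
  rw [e, ← div_eq_mul_inv, le_div_iff₀ hI]
  calc B * modelTerm ν.re (cutIndex n₀ X) X * ‖intFactor ω ν X‖
      ≤ |B| * (C * leastTerm ν.re X) * ‖intFactor ω ν X‖ := by
        refine mul_le_mul_of_nonneg_right ?_ hI.le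
        exact mul_le_mul (le_abs_self B) (h X hX1 _ hN (sq_cutIndex_sub_le one_pos hX1)).1 hm.le
          (abs_nonneg B)
    _ = |B| * C * (‖intFactor ω ν X‖ * leastTerm ν.re X) := by ring
    _ ≤ η := hX

/-- If `ω ≠ 1`, the triangle inequality at the cut suffices. If `ω = 1` and `R ≠ 0`, the bound at
the cut is itself of the size of the second exponential, and the argument with two almost tangent
disks is needed. -/
theorem FormalSystem.rigid {ω ν : ℂ} {Pc Hc s g : ℕ → ℂ} {K κ : ℝ}
    (h : FormalSystem ω ν Pc Hc s g K κ) {R : ℂ}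
    (hR : Tendsto (fun n : ℕ => s n * ω ^ n / Complex.Gamma (n + ν)) atTop (𝓝 R)) (B' : ℝ)
    (f₁ f₂ : ℝ → ℂ) (e : ℝ → ℝ)
    (he : ∀ δ : ℝ, 0 < δ → ∀ᶠ X in atTop, e X ≤ δ * ‖intFactor ω ν X‖⁻¹)
    (h₁ : ∀ᶠ X in atTop, ∀ n, ‖f₁ X - partialSum s n X‖ ≤ optimalBound ω ν R B' n X + e X)
    (h₂ : ∀ᶠ X in atTop, ∀ n, ‖f₂ X - partialSum s n X‖ ≤ optimalBound ω ν R B' n X + e X)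
    (η : ℝ) (hη : 0 < η) : ∀ᶠ X in atTop, ‖f₁ X - f₂ X‖ ≤ η * ‖intFactor ω ν X‖⁻¹ := by
  by_cases hω : ω = 1
  · subst hω
    simp only [one_pow, mul_one] at hR
    simp only [optimalBound, stokesBound, if_true] at h₁ h₂
    have he' : ∀ δ : ℝ, 0 < δ → ∀ᶠ X in atTop, e X ≤ δ * powExp ν.re X := fun δ hδ => by
      filter_upwards [he δ hδ, eventually_gt_atTop 0] with X hX hXp
      rwa [norm_intFactor_one_inv ν hXp] at hX
    filter_upwards [h.eventually_norm_sub_le hR he' h₁ h₂ hη, eventually_gt_atTop 0] with X hX hXp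
    rwa [norm_intFactor_one_inv ν hXp]
  · obtain ⟨n₀, hn₀⟩ := exists_baseIndex ν
    filter_upwards [h₁, h₂, he (η / 4) (by positivity),
      eventually_optimalBound_cutIndex_le R h.norm_eq hω (hn₀ n₀ le_rfl) B' (η := η / 4)
        (by positivity)] with X g₁ g₂ g₃ g₄
    have k₁ := g₁ (cutIndex n₀ X)
    have k₂ := g₂ (cutIndex n₀ X)
    have := norm_sub_le_norm_sub_add_norm_sub (f₁ X) (partialSum s (cutIndex n₀ X) X) (f₂ X)
    rw [norm_sub_rev (partialSum s (cutIndex n₀ X) X)] at this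
    linarith

namespace RealProblem

variable {X₀ κ : ℝ} {α β : ℝ → ℂ} {A B : PowerSeries ℂ} {L L' r r' : ℂ}

theorem exists_bound (h : RealProblem X₀ α β A B κ L L' r r') :
    ∃ C : ℝ, (∀ x, X₀ < x → ‖α x‖ ≤ C) ∧ ∀ x, X₀ < x → ‖β x‖ ≤ C := by
  obtain ⟨K, -, -, h1⟩ := h.α_gevrey
  obtain ⟨K', -, -, h2⟩ := h.β_gevrey
  refine ⟨max K K', fun x hx => ?_, fun x hx => ?_⟩
  · have := h1 0 x hx
    simp [partialSum] at this
    exact this.trans (le_max_left _ _)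
  · have := h2 0 x hx
    simp [partialSum] at this
    exact this.trans (le_max_right _ _)

/-- The solution of the second order equation that belongs to a solution `(u, G)` of the system. -/
theorem isRealSolution_of_system (h : RealProblem X₀ α β A B κ L L' r r') {u G : ℝ → ℂ}
    (hG : ContinuousOn G (Set.Ioi X₀))
    (hu : ∀ X, X₀ < X → HasDerivAt u (G X - (L - L' - (r' - r) / X) * u X) X)
    (hGu : ∀ X Y, X₀ < X → X₀ < Y → G Y - G X = -∫ t in X..Y,
      ((α t + (L + L') + (r + r') / t) * G t +
        ((L' + r' / t) ^ 2 - r' / t ^ 2 + α t * (L' + r' / t) + β t) * u t)) :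
    IsRealSolution X₀ α β (fun X => intFactor L (-r) X * u X)
      (fun X => intFactor L (-r) X * G X + intFactor L (-r) X * ((L' + r' / X) * u X)) := by
  have hX₀ := h.X₀_pos
  obtain ⟨C, hα, hβ⟩ := h.exists_bound
  have hE : ∀ X : ℝ, X₀ < X →
      HasDerivAt (intFactor L (-r)) (intFactor L (-r) X * (L + r / X)) X := fun X hX =>
    (hasDerivAt_intFactor L (-r) (hX₀.trans hX)).congr_deriv (by ring)
  have hEc : ContinuousOn (intFactor L (-r)) (Set.Ioi X₀) :=
    (continuousOn_intFactor L (-r)).mono fun x hx => hX₀.trans hx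
  have huc : ContinuousOn u (Set.Ioi X₀) := fun x hx => (hu x hx).continuousAt.continuousWithinAt
  have hinv : ∀ (z : ℂ) (k : ℕ), ContinuousOn (fun X : ℝ => z / (X : ℂ) ^ k) (Set.Ioi X₀) :=
    fun z k => continuousOn_const.div (Complex.continuous_ofReal.continuousOn.pow k) fun x hx =>
      pow_ne_zero _ (by exact_mod_cast (hX₀.trans hx).ne')
  have hb : ∀ z z' : ℂ, ContinuousOn (fun X : ℝ => z + z' / (X : ℂ)) (Set.Ioi X₀) := fun z z' => by
    have := hinv z' 1
    simp only [pow_one] at this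
    exact continuousOn_const.add this
  refine ⟨(hEc.mul hG).add (hEc.mul ((hb L' r').mul huc)), fun X hX => ?_, fun s t hs ht => ?_⟩
  · refine ((hE X hX).mul (hu X hX)).congr_deriv ?_
    ring
  have hsub : Set.uIcc s t ⊆ Set.Ioi X₀ := fun x hx => (lt_min hs ht).trans_le hx.1
  set P : ℝ → ℂ := fun t => α t + (L + L') + (r + r') / t with hP
  set H : ℝ → ℂ := fun t => (L' + r' / t) ^ 2 - r' / t ^ 2 + α t * (L' + r' / t) + β t with hH
  set f : ℝ → ℂ := fun t => -(P t * G t + H t * u t) with hf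
  have hαi := IsRealSolution.intervalIntegrable_of_bounded h.α_meas hα hs ht
  have hβi := IsRealSolution.intervalIntegrable_of_bounded h.β_meas hβ hs ht
  have hf' : f = fun t => -(α t * (G t + (L' + r' / t) * u t) + β t * u t +
      ((L + L' + (r + r') / t) * G t + ((L' + r' / t) ^ 2 - r' / t ^ 2) * u t)) := by
    funext t; simp only [hf, hP, hH]; ring
  have hc1 : ContinuousOn (fun t : ℝ => G t + (L' + r' / t) * u t) (Set.Ioi X₀) :=
    hG.add ((hb L' r').mul huc)
  have hc2 : ContinuousOn (fun t : ℝ => (L + L' + (r + r') / t) * G t +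
      ((L' + r' / t) ^ 2 - r' / t ^ 2) * u t) (Set.Ioi X₀) :=
    ((hb _ _).mul hG).add ((((hb L' r').pow 2).sub (hinv r' 2)).mul huc)
  have hfi : IntervalIntegrable f volume s t := by
    rw [hf']
    exact (((hαi.mul_continuousOn (hc1.mono hsub)).add (hβi.mul_continuousOn (huc.mono hsub))).add
      (hc2.mono hsub).intervalIntegrable).neg
  obtain ⟨D₁, hD₁⟩ := isCompact_uIcc.exists_bound_of_continuousOn (hc1.mono hsub)
  obtain ⟨D₂, hD₂⟩ := isCompact_uIcc.exists_bound_of_continuousOn (hc2.mono hsub)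
  obtain ⟨D₃, hD₃⟩ := isCompact_uIcc.exists_bound_of_continuousOn (huc.mono hsub)
  have hC : 0 ≤ C := (norm_nonneg _).trans (hα s hs)
  have hfb : ∀ x ∈ Set.uIcc s t, ‖f x‖ ≤ C * D₁ + C * D₃ + D₂ := fun x hx => by
    rw [hf', norm_neg]
    refine (norm_add_le _ _).trans (add_le_add ((norm_add_le _ _).trans (add_le_add ?_ ?_))
      (hD₂ x hx)) <;> rw [norm_mul]
    · exact mul_le_mul (hα x (hsub hx)) (hD₁ x hx) (norm_nonneg _) hC
    · exact mul_le_mul (hβ x (hsub hx)) (hD₃ x hx) (norm_nonneg _) hC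
  have hE'c : ContinuousOn (fun X : ℝ => intFactor L (-r) X * (L + r / X)) (Set.Ioi X₀) :=
    hEc.mul (hb L r)
  -- Only `G` fails to be continuously differentiable, since `α` and `β` are merely measurable and
  -- bounded. The other summand of the derivative is treated with the ordinary fundamental theorem.
  have key1 := mul_sub_mul_eq_integral (E := intFactor L (-r)) (fun x hx => hE x (hsub hx))
    (hE'c.mono hsub) hfi hfb (fun x hx => by
      rw [hGu s x hs (hsub hx), ← intervalIntegral.integral_neg])
  have hd2 : ∀ x, X₀ < x → HasDerivAt (fun X : ℝ => intFactor L (-r) X * ((L' + r' / X) * u X))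
      (intFactor L (-r) x * (L + r / x) * ((L' + r' / x) * u x) + intFactor L (-r) x *
        (-r' / x ^ 2 * u x + (L' + r' / x) * (G x - (L - L' - (r' - r) / x) * u x))) x := fun x hx => by
    have hx0 : (x : ℂ) ≠ 0 := by exact_mod_cast (hX₀.trans hx).ne'
    have h1 : HasDerivAt (fun X : ℝ => L' + r' / (X : ℂ)) (-r' / x ^ 2) x := by
      refine (((hasDerivAt_const x r').div (HasDerivAt.ofReal_comp (hasDerivAt_id x))
        hx0).const_add L').congr_deriv ?_
      simp
    exact (hE x hx).mul (h1.mul (hu x hx))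
  have hc3 : ContinuousOn (fun x : ℝ => intFactor L (-r) x * (L + r / x) * ((L' + r' / x) * u x) +
      intFactor L (-r) x * (-r' / x ^ 2 * u x +
        (L' + r' / x) * (G x - (L - L' - (r' - r) / x) * u x))) (Set.Ioi X₀) := by
    have := hb (L - L') (-(r' - r))
    have e : ∀ x : ℝ, L - L' + -(r' - r) / (x : ℂ) = L - L' - (r' - r) / x := fun x => by ring
    simp only [e] at this
    exact (hE'c.mul ((hb L' r').mul huc)).add (hEc.mul (((hinv _ 2).mul huc).add
      ((hb L' r').mul (hG.sub (this.mul huc)))))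
  have key2 := intervalIntegral.integral_eq_sub_of_hasDerivAt (fun x hx => hd2 x (hsub hx))
    (hc3.mono hsub).intervalIntegrable
  have hi1 : IntervalIntegrable (fun x : ℝ => intFactor L (-r) x * (L + r / x) * G x +
      intFactor L (-r) x * f x) volume s t :=
    ((hE'c.mul hG).mono hsub).intervalIntegrable.add (hfi.continuousOn_mul (hEc.mono hsub))
  have e1 : intFactor L (-r) t * G t + intFactor L (-r) t * ((L' + r' / t) * u t) -
      (intFactor L (-r) s * G s + intFactor L (-r) s * ((L' + r' / s) * u s)) =
      (intFactor L (-r) t * G t - intFactor L (-r) s * G s) +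
      (intFactor L (-r) t * ((L' + r' / t) * u t) - intFactor L (-r) s * ((L' + r' / s) * u s)) := by
    ring
  rw [e1, key1, ← key2, ← intervalIntegral.integral_add hi1 (hc3.mono hsub).intervalIntegrable]
  congr 1
  funext x
  simp only [hf, hP, hH]
  ring

/-- The basic solution attached to a characteristic root. -/
theorem exists_basicSolution (h : RealProblem X₀ α β A B κ L L' r r') :
    ∃ (s : ℕ → ℂ) (R : ℂ) (u Z : ℝ → ℂ) (C : ℝ),
      (∀ F : PowerSeries ℂ, IsFormalSolution (fun n => PowerSeries.coeff n A)
        (fun n => PowerSeries.coeff n B) L r F ↔ ∃ c : ℂ, F = c • PowerSeries.mk s) ∧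
      Tendsto (fun n : ℕ => s n * (L - L') ^ n / Complex.Gamma (n + (r' - r))) atTop (𝓝 R) ∧
      IsRealSolution X₀ α β (fun X => intFactor L (-r) X * u X) Z ∧
      IsOptimalApproximation X₀ (L - L') (r' - r) s R C u := by
  obtain ⟨K, s, g, hs, hF⟩ := h.exists_scaledSystem
  obtain ⟨n₀, hn₀⟩ := exists_baseIndex (r' - r)
  obtain ⟨M₁, hM₁⟩ := exists_nat_ge (|(r' - r).re| + 2)
  obtain ⟨R, hR, -⟩ := hs.exists_tendsto (hn₀ n₀ le_rfl)
  set M := n₀ + 1 + M₁ with hM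
  obtain ⟨u, G, C₀, hC₀, hG, hu, hGu, hle⟩ := hs.exists_solution (hn₀ n₀ le_rfl) (M := M) (by omega)
  have hM' : |(r' - r).re| + 2 ≤ M := by
    refine hM₁.trans ?_
    exact_mod_cast (by omega : M₁ ≤ M)
  obtain ⟨C, hC, happ⟩ := hs.exists_approximation (hn₀ n₀ le_rfl) hs.X₀_pos (by omega) hM' hR hC₀ hle
  exact ⟨s, R, u, _, C, hF, hR, h.isRealSolution_of_system hG hu hGu, hs.X₀_pos, h.norm_eq, hs.s_zero,
    hC, happ, hs.rigid hR⟩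

end RealProblem

/-! ### Uniqueness of the constants and the fundamental system. -/

section

/-- `Y` is uniformly asymptotic to the formal solution with constants `C`, `C'`. -/
def UniformExpansion (X₀ : ℝ) (L L' r r' : ℂ) (s s' : ℕ → ℂ) (R R' : ℂ) (B : ℝ) (Y : ℝ → ℂ)
    (C C' : ℂ) : Prop :=
  ∀ X : ℝ, X₀ < X → ∀ k k' : ℕ,
    ‖Y X - C * (intFactor L (-r) X * partialSum s k X) -
        C' * (intFactor L' (-r') X * partialSum s' k' X)‖ ≤
      ‖intFactor L (-r) X‖ * (‖C‖ * optimalBound (L - L') (r' - r) R B k X) +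
        ‖intFactor L' (-r') X‖ * (‖C'‖ * optimalBound (L' - L) (r - r') R' B k' X)

variable {X₀ : ℝ} {L L' r r' : ℂ} {s s' : ℕ → ℂ} {R R' : ℂ} {B : ℝ} {Y u u' : ℝ → ℂ} {C C' : ℂ}

theorem UniformExpansion.swap (h : UniformExpansion X₀ L L' r r' s s' R R' B Y C C') :
    UniformExpansion X₀ L' L r' r s' s R' R B Y C' C := fun X hX k k' => by
  have := h X hX k' k
  rwa [add_comm, sub_right_comm] at this

theorem UniformExpansion.congr {Y' : ℝ → ℂ} (h : UniformExpansion X₀ L L' r r' s s' R R' B Y C C')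
    (hY : ∀ X, X₀ < X → Y X = Y' X) : UniformExpansion X₀ L L' r r' s s' R R' B Y' C C' :=
  fun X hX k k' => by rw [← hY X hX]; exact h X hX k k'

theorem intFactor_eq_mul (L L' r r' : ℂ) (X : ℝ) :
    intFactor L (-r) X = intFactor L' (-r') X * intFactor (L - L') (r' - r) X := by
  rw [intFactor, intFactor, intFactor, ← Complex.exp_add]
  congr 1; ring

theorem partialSum_one (s : ℕ → ℂ) (X : ℝ) : partialSum s 1 X = s 0 := by simp [partialSum]

theorem IsOptimalApproximation.tendsto {ω ν : ℂ} {B₁ : ℝ}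
    (hu : IsOptimalApproximation X₀ ω ν s R B₁ u) : Tendsto u atTop (𝓝 1) := by
  rw [tendsto_iff_norm_sub_tendsto_zero]
  refine squeeze_zero' (Eventually.of_forall fun _ => norm_nonneg _) ?_
    (tendsto_optimalBound_one ω ν R B₁)
  filter_upwards [eventually_gt_atTop X₀] with X hX
  have := hu.le 1 X hX
  rwa [partialSum_one, hu.s_zero] at this

theorem UniformExpansion.norm_add_mul_inv_le {c c' : ℂ}
    (h : UniformExpansion X₀ L L' r r' s s' R R' B
      (fun X => c * (intFactor L (-r) X * u X) + c' * (intFactor L' (-r') X * u' X)) C C')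
    {X : ℝ} (hX : X₀ < X) (k k' : ℕ) :
    ‖(c * u X - C * partialSum s k X) +
        (c' * u' X - C' * partialSum s' k' X) * (intFactor (L - L') (r' - r) X)⁻¹‖ ≤
      ‖C‖ * optimalBound (L - L') (r' - r) R B k X +
        ‖intFactor (L - L') (r' - r) X‖⁻¹ *
          (‖C'‖ * optimalBound (L' - L) (r - r') R' B k' X) := by
  have h1 := h X hX k k'
  beta_reduce at h1
  have hE := intFactor_ne_zero L (-r) X
  have hJ := intFactor_ne_zero (L - L') (r' - r) X
  have e : intFactor L' (-r') X = intFactor L (-r) X * (intFactor (L - L') (r' - r) X)⁻¹ := by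
    rw [intFactor_eq_mul L L' r r', mul_inv_cancel_right₀ hJ]
  rw [e, norm_mul, norm_inv, mul_assoc ‖intFactor L (-r) X‖, ← mul_add] at h1
  refine le_of_mul_le_mul_left (le_trans (le_of_eq ?_) h1) (norm_pos_iff.mpr hE)
  rw [← norm_mul]
  congr 1
  ring

/-- The constants are determined by a solution if the second exponential is recessive. -/
theorem UniformExpansion.eq_of_tendsto {c c' : ℂ} {B₁ B₂ : ℝ}
    (hu : IsOptimalApproximation X₀ (L - L') (r' - r) s R B₁ u)
    (hu' : IsOptimalApproximation X₀ (L' - L) (r - r') s' R' B₂ u') (hB : B₁ ≤ B)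
    (hJ : Tendsto (fun X => ‖intFactor (L - L') (r' - r) X‖⁻¹) atTop (𝓝 0))
    (h : UniformExpansion X₀ L L' r r' s s' R R' B
      (fun X => c * (intFactor L (-r) X * u X) + c' * (intFactor L' (-r') X * u' X)) C C') :
    c = C ∧ c' = C' := by
  have hu1 := hu.tendsto
  have hu1' := hu'.tendsto
  have hb := tendsto_optimalBound_one (L - L') (r' - r) R B
  have hb' := tendsto_optimalBound_one (L' - L) (r - r') R' B
  have hJ' : Tendsto (fun X => (intFactor (L - L') (r' - r) X)⁻¹) atTop (𝓝 0) := by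
    rw [tendsto_zero_iff_norm_tendsto_zero]; simpa only [norm_inv] using hJ
  have h1 : ∀ᶠ X in atTop, ‖(c * u X - C) + (c' * u' X - C') *
      (intFactor (L - L') (r' - r) X)⁻¹‖ ≤ ‖C‖ * optimalBound (L - L') (r' - r) R B 1 X +
        ‖intFactor (L - L') (r' - r) X‖⁻¹ *
          (‖C'‖ * optimalBound (L' - L) (r - r') R' B 1 X) := by
    filter_upwards [eventually_gt_atTop X₀] with X hX
    have := h.norm_add_mul_inv_le hX 1 1
    rwa [partialSum_one, partialSum_one, hu.s_zero, hu'.s_zero, mul_one, mul_one] at this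
  have hcC : c = C := by
    have t1 := (((hu1.const_mul c).sub_const C).add
      (((hu1'.const_mul c').sub_const C').mul hJ')).norm
    have t2 := (hb.const_mul ‖C‖).add (hJ.mul (hb'.const_mul ‖C'‖))
    have := le_of_tendsto_of_tendsto t1 t2 h1
    simp only [mul_one, mul_zero, add_zero] at this
    exact sub_eq_zero.mp (norm_le_zero_iff.mp this)
  subst hcC
  refine ⟨rfl, ?_⟩
  have key : ∀ η : ℝ, 0 < η → ∀ᶠ X in atTop, ‖c' * u' X - C'‖ ≤ η := by
    intro η hη
    -- For `c = 0` the first exponential is absent and the bound can be divided by the second one.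
    -- Otherwise division by `c` shows that `u` and its perturbation by the second exponential both
    -- meet the optimal bounds, up to `o` of that exponential; rigidity then makes the coefficient
    -- of the perturbation tend to zero.
    by_cases hc : c = 0
    · have t := hb'.const_mul ‖C'‖
      rw [mul_zero] at t
      filter_upwards [h1, t.eventually_le_const hη] with X hX hX'
      have hJ0 := norm_pos_iff.mpr (intFactor_ne_zero (L - L') (r' - r) X)
      rw [hc, zero_mul, zero_sub, neg_zero, zero_add, norm_mul, norm_inv, norm_zero, zero_mul,
        zero_add, mul_comm] at hX
      exact (le_of_mul_le_mul_left hX (inv_pos.mpr hJ0)).trans hX'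
    · have hcn := norm_pos_iff.mpr hc
      have he : ∀ δ : ℝ, 0 < δ → ∀ᶠ X in atTop,
          ‖intFactor (L - L') (r' - r) X‖⁻¹ * (‖C'‖ * optimalBound (L' - L) (r - r') R' B 1 X) / ‖c‖ ≤
            δ * ‖intFactor (L - L') (r' - r) X‖⁻¹ := fun δ hδ => by
        have t := hb'.const_mul ‖C'‖
        rw [mul_zero] at t
        filter_upwards [t.eventually_le_const (mul_pos hδ hcn)] with X hX
        rw [div_le_iff₀ hcn]
        calc _ ≤ ‖intFactor (L - L') (r' - r) X‖⁻¹ * (δ * ‖c‖) := by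
              gcongr
          _ = _ := by ring
      have g := hu.rigid B (fun X => u X + (c' * u' X - C') / c * (intFactor (L - L') (r' - r) X)⁻¹)
        u _ he ?_ ?_ (η / ‖c‖) (by positivity)
      · filter_upwards [g] with X hX
        have hJ0 := norm_pos_iff.mpr (intFactor_ne_zero (L - L') (r' - r) X)
        rw [add_sub_cancel_left, norm_mul, norm_inv, norm_div] at hX
        have := le_of_mul_le_mul_right hX (inv_pos.mpr hJ0)
        rwa [div_le_div_iff_of_pos_right hcn] at this
      · filter_upwards [eventually_gt_atTop X₀] with X hX n
        have g1 := h.norm_add_mul_inv_le hX n 1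
        rw [partialSum_one, hu'.s_zero, mul_one] at g1
        refine le_of_mul_le_mul_left (le_trans (le_of_eq ?_) (g1.trans (le_of_eq ?_))) hcn
        · rw [← norm_mul]
          congr 1
          field_simp
          ring
        · field_simp
      · filter_upwards [eventually_gt_atTop X₀, eventually_gt_atTop 0] with X hX hXp n
        refine (hu.le n X hX).trans ((optimalBound_mono _ _ _ hB n hXp).trans
          (le_add_of_nonneg_right ?_))
        have := stokesBound_nonneg (L' - L) R'
        have := gammaPos_pos (((1 : ℕ) : ℝ) + (r - r').re)
        have hB0 : 0 ≤ B := hu.nonneg.trans hB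
        unfold optimalBound
        positivity
  have t := ((hu1'.const_mul c').sub_const C').norm
  have : ‖c' * 1 - C'‖ ≤ 0 := le_of_forall_pos_le_add fun η hη => by
    rw [zero_add]; exact le_of_tendsto t (key η hη)
  rw [mul_one] at this
  exact sub_eq_zero.mp (norm_le_zero_iff.mp this)

theorem tendsto_norm_intFactor_inv {ω ν : ℂ} (h : 0 < ω.re ∨ ω.re = 0 ∧ ν.re < 0) :
    Tendsto (fun X => ‖intFactor ω ν X‖⁻¹) atTop (𝓝 0) := by
  have e : ∀ᶠ X : ℝ in atTop, X ^ ν.re * Real.exp (-ω.re * X) = ‖intFactor ω ν X‖⁻¹ := by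
    filter_upwards [eventually_gt_atTop 0] with X hX
    rw [norm_intFactor _ _ hX, mul_inv, Real.rpow_neg hX.le, inv_inv, ← Real.exp_neg, neg_mul]
  refine Tendsto.congr' e ?_
  rcases h with h | ⟨h, h'⟩
  · exact tendsto_rpow_mul_exp_neg_mul_atTop_nhds_zero _ _ h
  · simpa [h] using tendsto_rpow_neg_atTop (neg_pos.mpr h')

/-- The constants are determined by a solution if both exponentials have the same size. -/
theorem UniformExpansion.eq_of_norm_eq {c c' : ℂ} {B₁ B₂ : ℝ}
    (hu : IsOptimalApproximation X₀ (L - L') (r' - r) s R B₁ u)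
    (hu' : IsOptimalApproximation X₀ (L' - L) (r - r') s' R' B₂ u')
    (h1 : (L - L').re = 0) (h2 : (r' - r).re = 0)
    (h : UniformExpansion X₀ L L' r r' s s' R R' B
      (fun X => c * (intFactor L (-r) X * u X) + c' * (intFactor L' (-r') X * u' X)) C C') :
    c = C ∧ c' = C' := by
  set ω := L - L' with hω
  set ν := r' - r with hν
  have hJ : ∀ X : ℝ, 0 < X → ‖intFactor ω ν X‖ = 1 := fun X hX => by
    rw [norm_intFactor _ _ hX, h1, h2]; simp
  have hlim : Tendsto (fun X => (c - C) * intFactor ω ν X + (c' - C')) atTop (𝓝 0) := by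
    have t1 : Tendsto (fun X => ‖C‖ * optimalBound ω ν R B 1 X +
        ‖C'‖ * optimalBound (L' - L) (r - r') R' B 1 X + ‖c‖ * ‖u X - 1‖ + ‖c'‖ * ‖u' X - 1‖)
        atTop (𝓝 0) := by
      have a1 := tendsto_iff_norm_sub_tendsto_zero.mp hu.tendsto
      have a2 := tendsto_iff_norm_sub_tendsto_zero.mp hu'.tendsto
      simpa using ((((tendsto_optimalBound_one ω ν R B).const_mul ‖C‖).add
        ((tendsto_optimalBound_one (L' - L) (r - r') R' B).const_mul ‖C'‖)).add
        (a1.const_mul ‖c‖)).add (a2.const_mul ‖c'‖)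
    rw [tendsto_zero_iff_norm_tendsto_zero]
    refine squeeze_zero' (Eventually.of_forall fun _ => norm_nonneg _) ?_ t1
    filter_upwards [eventually_gt_atTop X₀, eventually_gt_atTop 0] with X hX hXp
    have g := h.norm_add_mul_inv_le hX 1 1
    have hJX := hJ X hXp
    rw [partialSum_one, partialSum_one, hu.s_zero, hu'.s_zero, mul_one, mul_one, hJX, inv_one,
      one_mul] at g
    have e : (c - C) * intFactor ω ν X + (c' - C') = ((c * u X - C) + (c' * u' X - C') *
        (intFactor ω ν X)⁻¹) * intFactor ω ν X - c * (u X - 1) * intFactor ω ν X -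
        c' * (u' X - 1) := by
      have := intFactor_ne_zero ω ν X
      field_simp
      ring
    rw [e]
    refine (norm_sub_le _ _).trans (add_le_add ((norm_sub_le _ _).trans (add_le_add ?_ ?_)) ?_)
    · rw [norm_mul, hJX, mul_one]; exact g
    · rw [norm_mul, norm_mul, hJX, mul_one]
    · rw [norm_mul]
  -- Here `ω = ±i`, and `log (X + π) - log X` tends to zero, so a shift by `π` asymptotically
  -- reverses the sign of the oscillating factor. Adding the shifted relation eliminates it.
  have hshift : Tendsto (fun X => intFactor ω ν X + intFactor ω ν (X + Real.pi)) atTop (𝓝 0) := by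
    have hexp : Complex.exp (ω * Real.pi) = -1 := by
      have him : ω.im = 1 ∨ ω.im = -1 := by
        have h3 := Complex.sq_norm ω
        rw [hu.norm_eq, Complex.normSq_apply, h1] at h3
        have : (ω.im - 1) * (ω.im + 1) = 0 := by nlinarith
        rcases mul_eq_zero.mp this with h | h
        · left; linarith
        · right; linarith
      rcases him with him | him
      · have : ω = Complex.I := Complex.ext (by simp [h1]) (by simp [him])
        rw [this, mul_comm, Complex.exp_pi_mul_I]
      · have : ω = -Complex.I := Complex.ext (by simp [h1]) (by simp [him])
        rw [this, neg_mul, Complex.exp_neg, mul_comm, Complex.exp_pi_mul_I]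
        norm_num
    have t1 : Tendsto (fun X : ℝ => 1 + Complex.exp (ω * Real.pi - ν *
        ((Real.log (X + Real.pi) - Real.log X : ℝ) : ℂ))) atTop (𝓝 0) := by
      have t2 : Tendsto (fun X : ℝ => ((Real.log (X + Real.pi) - Real.log X : ℝ) : ℂ)) atTop
          (𝓝 ((0 : ℝ) : ℂ)) :=
        (Complex.continuous_ofReal.tendsto 0).comp (Real.tendsto_log_comp_add_sub_log Real.pi)
      have t3 := (((t2.const_mul ν).const_sub (ω * Real.pi)).cexp).const_add 1
      simpa [hexp] using t3
    rw [tendsto_zero_iff_norm_tendsto_zero] at t1 ⊢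
    refine t1.congr' ?_
    filter_upwards [eventually_gt_atTop 0] with X hX
    have e : intFactor ω ν (X + Real.pi) = intFactor ω ν X * Complex.exp (ω * Real.pi - ν *
        ((Real.log (X + Real.pi) - Real.log X : ℝ) : ℂ)) := by
      rw [intFactor, intFactor, ← Complex.exp_add]
      congr 1
      push_cast
      ring
    rw [e, ← mul_one_add, norm_mul, hJ X hX, one_mul]
  have h2' : c' - C' = 0 := by
    have t1 := hlim.add (hlim.comp (tendsto_atTop_add_const_right atTop Real.pi tendsto_id))
    have t2 := (hshift.const_mul (c - C)).add_const (2 * (c' - C'))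
    have := tendsto_nhds_unique (t1.congr fun X => ?_) t2
    · simp only [mul_zero, zero_add, add_zero] at this
      have h3 : (2 : ℂ) * (c' - C') = 0 := this.symm
      simpa using h3
    · simp only [Function.comp, id]; ring
  refine ⟨?_, sub_eq_zero.mp h2'⟩
  have t1 := (hlim.norm).congr' (f₂ := fun _ => ‖c - C‖) (by
    filter_upwards [eventually_gt_atTop 0] with X hX
    rw [h2', add_zero, norm_mul, hJ X hX, mul_one])
  have := tendsto_nhds_unique t1 tendsto_const_nhds
  rw [norm_zero] at this
  exact sub_eq_zero.mp (norm_eq_zero.mp this.symm)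

/-- The quotient of the two exponentials has absolute value `X^{-Re ν} e^{Re ω X}`, where `ω = L -
L'` and `ν = r' - r`. It tends to infinity, tends to zero, or is identically one; in the first two
cases the dominant exponential is put first. The converse is the triangle inequality. -/
theorem uniformExpansion_iff {c c' : ℂ} {B₁ B₂ : ℝ}
    (hu : IsOptimalApproximation X₀ (L - L') (r' - r) s R B₁ u)
    (hu' : IsOptimalApproximation X₀ (L' - L) (r - r') s' R' B₂ u') (hB : B₁ ≤ B) (hB' : B₂ ≤ B) :
    UniformExpansion X₀ L L' r r' s s' R R' B
      (fun X => c * (intFactor L (-r) X * u X) + c' * (intFactor L' (-r') X * u' X)) C C' ↔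
    c = C ∧ c' = C' := by
  constructor
  · intro h
    have hs : UniformExpansion X₀ L' L r' r s' s R' R B
        (fun X => c' * (intFactor L' (-r') X * u' X) + c * (intFactor L (-r) X * u X)) C' C :=
      h.swap.congr fun X _ => add_comm _ _
    have e1 : (L' - L).re = -(L - L').re := by simp
    have e2 : (r - r').re = -(r' - r).re := by simp
    rcases lt_trichotomy (L - L').re 0 with h1 | h1 | h1
    · exact (hs.eq_of_tendsto hu' hu hB'
        (tendsto_norm_intFactor_inv (Or.inl (by linarith)))).symm
    · rcases lt_trichotomy (r' - r).re 0 with h2 | h2 | h2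
      · exact h.eq_of_tendsto hu hu' hB (tendsto_norm_intFactor_inv (Or.inr ⟨h1, h2⟩))
      · exact h.eq_of_norm_eq hu hu' h1 h2
      · exact (hs.eq_of_tendsto hu' hu hB'
          (tendsto_norm_intFactor_inv (Or.inr ⟨by linarith, by linarith⟩))).symm
    · exact h.eq_of_tendsto hu hu' hB (tendsto_norm_intFactor_inv (Or.inl h1))
  · rintro ⟨rfl, rfl⟩ X hX k k'
    have hXp := hu.X₀_pos.trans hX
    have g1 := (hu.le k X hX).trans (optimalBound_mono _ _ _ hB k hXp)
    have g2 := (hu'.le k' X hX).trans (optimalBound_mono _ _ _ hB' k' hXp)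
    have e : c * (intFactor L (-r) X * u X) + c' * (intFactor L' (-r') X * u' X) -
        c * (intFactor L (-r) X * partialSum s k X) -
        c' * (intFactor L' (-r') X * partialSum s' k' X) =
        intFactor L (-r) X * (c * (u X - partialSum s k X)) +
        intFactor L' (-r') X * (c' * (u' X - partialSum s' k' X)) := by ring
    rw [e]
    refine (norm_add_le _ _).trans ?_
    rw [norm_mul, norm_mul, norm_mul, norm_mul]
    gcongr

/-- The solutions of the normalized equation and their asymptotic expansions. -/
theorem RealProblem.exists_fundamentalSystem {κ : ℝ} {α β : ℝ → ℂ} {A A' : PowerSeries ℂ}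
    (h : RealProblem X₀ α β A A' κ L L' r r') :
    ∃ (s s' : ℕ → ℂ) (R R' : ℂ) (Y₁ Z₁ Y₂ Z₂ : ℝ → ℂ) (B₀ : ℝ),
      (s 0 = 1 ∧ ∀ F : PowerSeries ℂ, IsFormalSolution (fun n => PowerSeries.coeff n A)
        (fun n => PowerSeries.coeff n A') L r F ↔ ∃ c : ℂ, F = c • PowerSeries.mk s) ∧
      (s' 0 = 1 ∧ ∀ F : PowerSeries ℂ, IsFormalSolution (fun n => PowerSeries.coeff n A)
        (fun n => PowerSeries.coeff n A') L' r' F ↔ ∃ c : ℂ, F = c • PowerSeries.mk s') ∧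
      Tendsto (fun n : ℕ => s n * (L - L') ^ n / Complex.Gamma (n + (r' - r))) atTop (𝓝 R) ∧
      Tendsto (fun n : ℕ => s' n * (L' - L) ^ n / Complex.Gamma (n + (r - r'))) atTop (𝓝 R') ∧
      IsRealSolution X₀ α β Y₁ Z₁ ∧ IsRealSolution X₀ α β Y₂ Z₂ ∧ 0 < B₀ ∧
      (∀ B, B₀ ≤ B → ∀ c c' C C' : ℂ, UniformExpansion X₀ L L' r r' s s' R R' B
        (fun X => c * Y₁ X + c' * Y₂ X) C C' ↔ c = C ∧ c' = C') ∧
      ∀ Y Z, IsRealSolution X₀ α β Y Z → ∃ c c' : ℂ, ∀ X, X₀ < X → Y X = c * Y₁ X + c' * Y₂ X := by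
  obtain ⟨s, R, u, Z₁, B₁, hF, hR, hY₁, hu⟩ := h.exists_basicSolution
  obtain ⟨s', R', u', Z₂, B₂, hF', hR', hY₂, hu'⟩ := h.swap.exists_basicSolution
  obtain ⟨D, hα, hβ⟩ := h.exists_bound
  have hiff : ∀ B, max (max B₁ B₂) 1 ≤ B → ∀ c c' C C' : ℂ,
      UniformExpansion X₀ L L' r r' s s' R R' B
        (fun X => c * (intFactor L (-r) X * u X) + c' * (intFactor L' (-r') X * u' X)) C C' ↔
      c = C ∧ c' = C' := fun B hB c c' C C' =>
    uniformExpansion_iff hu hu' (((le_max_left _ _).trans (le_max_left _ _)).trans hB)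
      (((le_max_right _ _).trans (le_max_left _ _)).trans hB)
  refine ⟨s, s', R, R', _, Z₁, _, Z₂, max (max B₁ B₂) 1, ⟨hu.s_zero, hF⟩, ⟨hu'.s_zero, hF'⟩, hR, hR',
    hY₁, hY₂, lt_max_of_lt_right one_pos, hiff, fun Y Z hY => ?_⟩
  set Y₁ : ℝ → ℂ := fun X => intFactor L (-r) X * u X with hY₁d
  set Y₂ : ℝ → ℂ := fun X => intFactor L' (-r') X * u' X with hY₂d
  obtain ⟨t₀, ht₀⟩ := exists_gt X₀
  have hlin := fun c c' : ℂ => hY₁.linearCombination h.α_meas h.β_meas hα hβ hY₂ c c'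
  let T : ℂ × ℂ →ₗ[ℂ] ℂ × ℂ :=
    { toFun := fun c => (c.1 * Y₁ t₀ + c.2 * Y₂ t₀, c.1 * Z₁ t₀ + c.2 * Z₂ t₀)
      map_add' := fun c d => by ext <;> simp <;> ring
      map_smul' := fun z c => by ext <;> simp <;> ring }
  -- If a combination has zero initial values, it vanishes, and its expansion has the constants `(0,
  -- 0)` as well as its own coefficients, so these vanish. An injective endomorphism of `ℂ²` is
  -- onto, so the initial values of every solution are attained.
  have hT : Function.Injective T := by
    rw [injective_iff_map_eq_zero]
    intro c hc
    have hc1 : c.1 * Y₁ t₀ + c.2 * Y₂ t₀ = 0 := congrArg Prod.fst hc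
    have hc2 : c.1 * Z₁ t₀ + c.2 * Z₂ t₀ = 0 := congrArg Prod.snd hc
    have hz := fun X (hX : X₀ < X) => (hlin c.1 c.2).eq_zero hα hβ ht₀ hc1 hc2 hX
    have hz0 := (hiff _ le_rfl 0 0 0 0).mpr ⟨rfl, rfl⟩
    have := (hiff _ le_rfl c.1 c.2 0 0).mp (hz0.congr fun X hX => by
      have := hz X hX
      simp only [zero_mul, add_zero]
      exact this.symm)
    exact Prod.ext this.1 this.2
  obtain ⟨c, hc⟩ := (LinearMap.injective_iff_surjective.mp hT) (Y t₀, Z t₀)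
  have hc1 : c.1 * Y₁ t₀ + c.2 * Y₂ t₀ = Y t₀ := congrArg Prod.fst hc
  have hc2 : c.1 * Z₁ t₀ + c.2 * Z₂ t₀ = Z t₀ := congrArg Prod.snd hc
  refine ⟨c.1, c.2, fun X hX => ?_⟩
  have hd := hY.linearCombination h.α_meas h.β_meas hα hβ (hlin c.1 c.2) 1 (-1)
  have := hd.eq_zero hα hβ ht₀ (by rw [hc1]; ring) (by rw [hc2]; ring) hX
  linear_combination this

end

/-! ### Transport between the ray and the real half-line. -/

section

/-- The factor `e^{iθ} / d` between the coordinate `X = d |x|` and the point `x` of the ray. -/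
def rayScale (θ d : ℝ) : ℂ := Complex.exp ((θ : ℂ) * Complex.I) / d

variable {θ x₀ d κ : ℝ}

theorem rayPoint_div (θ d X : ℝ) : rayPoint θ (X / d) = X * rayScale θ d := by
  rw [rayPoint, rayScale]; push_cast; ring

theorem rayScale_ne_zero (hd : 0 < d) : rayScale θ d ≠ 0 :=
  div_ne_zero (Complex.exp_ne_zero _) (by exact_mod_cast hd.ne')

theorem norm_rayScale (hd : 0 < d) : ‖rayScale θ d‖ = d⁻¹ := by
  rw [rayScale, norm_div, Complex.norm_exp_ofReal_mul_I, Complex.norm_real,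
    Real.norm_of_nonneg hd.le, one_div]

theorem norm_rayPoint {t : ℝ} (ht : 0 < t) : ‖rayPoint θ t‖ = t := by
  rw [rayPoint, norm_mul, Complex.norm_exp_ofReal_mul_I, Complex.norm_real,
    Real.norm_of_nonneg ht.le, mul_one]

theorem forall_mem_ray (hd : 0 < d) {p : ℂ → Prop} :
    (∀ x ∈ ray θ x₀, p x) ↔ ∀ X : ℝ, d * x₀ < X → p (rayPoint θ (X / d)) := by
  constructor
  · intro h X hX
    exact h _ ⟨X / d, by rwa [lt_div_iff₀' hd], rfl⟩
  · rintro h x ⟨t, ht, rfl⟩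
    have := h (d * t) (by gcongr)
    rwa [mul_div_cancel_left₀ _ hd.ne'] at this

section Coefficients

theorem aestronglyMeasurable_comp_div {f : ℝ → ℂ} (hd : 0 < d)
    (hf : AEStronglyMeasurable f (volume.restrict (Set.Ioi x₀))) :
    AEStronglyMeasurable (fun X => f (X / d)) (volume.restrict (Set.Ioi (d * x₀))) := by
  have hm : Measurable fun X : ℝ => X * d⁻¹ := measurable_id.mul_const _
  refine hf.comp_quasiMeasurePreserving (f := fun X => X / d) ⟨measurable_id.div_const d, ?_⟩
  have e : Set.Ioi (d * x₀) = (fun X : ℝ => X * d⁻¹) ⁻¹' Set.Ioi x₀ := by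
    ext X
    rw [Set.mem_preimage, Set.mem_Ioi, Set.mem_Ioi, ← div_eq_mul_inv, lt_div_iff₀' hd]
  simp only [div_eq_mul_inv]
  rw [e, ← Measure.restrict_map hm measurableSet_Ioi,
    Real.map_volume_mul_right (inv_ne_zero hd.ne'), Measure.restrict_smul]
  exact Measure.smul_absolutelyContinuous

/-- The coefficient series in the coordinate `X`. -/
def scaledSeries (ζ : ℂ) (c : ℕ → ℂ) : PowerSeries ℂ := PowerSeries.rescale ζ⁻¹ (PowerSeries.mk c)

theorem coeff_scaledSeries (ζ : ℂ) (c : ℕ → ℂ) (n : ℕ) :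
    PowerSeries.coeff n (scaledSeries ζ c) = c n / ζ ^ n := by
  rw [scaledSeries, PowerSeries.coeff_rescale, PowerSeries.coeff_mk, inv_pow, div_eq_inv_mul]

theorem gevreyOn_scaledSeries {f : ℂ → ℂ} {c : ℕ → ℂ} (hx₀ : 0 < x₀) (hd : 0 < d)
    (h : HasGevreySeries f c (ray θ x₀) κ) :
    GevreyOn (d * x₀) (κ * d) (fun X => f (rayPoint θ (X / d))) (scaledSeries (rayScale θ d) c) := by
  obtain ⟨K, h1, h2⟩ := h
  have hζ : ‖rayScale θ d‖ = d⁻¹ := norm_rayScale hd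
  refine ⟨K, (norm_nonneg (c 0)).trans (by simpa using h1 0), fun n => ?_, fun n X hX => ?_⟩
  · rw [coeff_scaledSeries, norm_div, norm_pow, hζ, inv_pow, div_inv_eq_mul]
    refine (mul_le_mul_of_nonneg_right (h1 n) (by positivity)).trans (le_of_eq ?_)
    rw [mul_pow]; ring
  · have hXp : 0 < X := lt_trans (by positivity) hX
    have := (forall_mem_ray hd).mp (h2 n) X hX
    rw [norm_rayPoint (by positivity)] at this
    refine le_trans (le_of_eq ?_) (this.trans (le_of_eq ?_))
    · congr 2
      rw [partialSum]
      refine Finset.sum_congr rfl fun j _ => ?_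
      rw [coeff_scaledSeries, rayPoint_div, mul_pow, mul_comm, div_div, mul_comm]
    · rw [div_pow, mul_pow]; field_simp

end Coefficients

section Formal

open PowerSeries

theorem rescale_injective {ζ : ℂ} (hζ : ζ ≠ 0) {F G : PowerSeries ℂ}
    (h : rescale ζ⁻¹ F = rescale ζ⁻¹ G) : F = G := by
  ext n
  have := congrArg (coeff n) h
  rw [coeff_rescale, coeff_rescale] at this
  exact mul_left_cancel₀ (pow_ne_zero n (inv_ne_zero hζ)) this

/-- For `x = ζ X` one has `d/dX = ζ d/dx`, and a series in `1/x` turns into a series in `1/X` on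
rescaling by `ζ⁻¹`. -/
theorem formalDeriv_rescale {ζ : ℂ} (hζ : ζ ≠ 0) (l r : ℂ) (F : PowerSeries ℂ) :
    formalDeriv (ζ * l) r (rescale ζ⁻¹ F) = C ζ * rescale ζ⁻¹ (formalDeriv l r F) := by
  have hC : ∀ z : ℂ, rescale ζ⁻¹ (C z) = C z := fun z => by
    ext n; rw [coeff_rescale, coeff_C]; split_ifs with h <;> simp [h]
  have hD : derivative ℂ (rescale ζ⁻¹ F) = C ζ⁻¹ * rescale ζ⁻¹ (derivative ℂ F) := by
    ext n
    rw [coeff_derivative, coeff_C_mul, coeff_rescale, coeff_rescale, coeff_derivative]; ring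
  have h1 : C ζ * C ζ⁻¹ = (1 : PowerSeries ℂ) := by rw [← map_mul, mul_inv_cancel₀ hζ, map_one]
  rw [formalDeriv, formalDeriv, map_sub, map_add, map_mul, map_mul, map_mul, map_mul, map_mul,
    hC, hC, hD, map_pow, rescale_X]
  linear_combination (-(C r * X * rescale ζ⁻¹ F) + C ζ⁻¹ * X ^ 2 *
    rescale ζ⁻¹ (derivative ℂ F)) * h1

theorem isFormalSolution_rescale {ζ : ℂ} (hζ : ζ ≠ 0) (ac bc : ℕ → ℂ) (l r : ℂ)
    (F : PowerSeries ℂ) :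
    IsFormalSolution (fun n => coeff n (C ζ * scaledSeries ζ ac))
      (fun n => coeff n (C (ζ ^ 2) * scaledSeries ζ bc)) (ζ * l) r (rescale ζ⁻¹ F) ↔
      IsFormalSolution ac bc l r F := by
  have hmk : ∀ G : PowerSeries ℂ, mk (fun n => coeff n G) = G := fun G => by ext; simp
  have hCd : ∀ (z : ℂ) (G : PowerSeries ℂ) , formalDeriv (ζ * l) r (C z * G) =
      C z * formalDeriv (ζ * l) r G := fun z G => by
    rw [formalDeriv, formalDeriv, Derivation.leibniz, derivative_C]
    simp only [smul_eq_mul, mul_zero, add_zero]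
    ring
  rw [IsFormalSolution, IsFormalSolution, hmk, hmk, formalDeriv_rescale hζ, hCd,
    formalDeriv_rescale hζ, scaledSeries, scaledSeries]
  have e : C ζ * (C ζ * rescale ζ⁻¹ (formalDeriv l r (formalDeriv l r F))) +
      C ζ * rescale ζ⁻¹ (mk ac) * (C ζ * rescale ζ⁻¹ (formalDeriv l r F)) +
      C (ζ ^ 2) * rescale ζ⁻¹ (mk bc) * rescale ζ⁻¹ F = C (ζ ^ 2) * rescale ζ⁻¹
      (formalDeriv l r (formalDeriv l r F) + mk ac * formalDeriv l r F + mk bc * F) := by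
    simp only [map_add, map_mul, map_pow]; ring
  rw [e]
  constructor
  · intro h
    rcases mul_eq_zero.mp h with h | h
    · exact absurd ((map_eq_zero_iff C C_injective).mp h) (pow_ne_zero 2 hζ)
    · exact rescale_injective hζ (by rw [h, map_zero])
  · intro h
    rw [h, map_zero, mul_zero]

theorem rescale_eq_smul_iff {ζ : ℂ} (hζ : ζ ≠ 0) (s : ℕ → ℂ) (F : PowerSeries ℂ) (c : ℂ) :
    rescale ζ⁻¹ F = c • mk s ↔ F = c • rescale ζ (mk s) := by
  have e : rescale ζ⁻¹ (c • rescale ζ (mk s)) = c • mk s := by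
    ext n
    rw [coeff_rescale, coeff_smul, coeff_smul, coeff_rescale, smul_eq_mul, smul_eq_mul, inv_pow]
    field_simp
  constructor
  · intro h
    exact rescale_injective hζ (h.trans e.symm)
  · rintro rfl
    exact e

end Formal

section Solutions

variable {a b y : ℂ → ℂ}

theorem IsSolutionOnRay.exists_isRealSolution (hd : 0 < d) (h : IsSolutionOnRay a b θ x₀ y) :
    ∃ Z, IsRealSolution (d * x₀) (fun X => rayScale θ d * a (rayPoint θ (X / d)))
      (fun X => rayScale θ d ^ 2 * b (rayPoint θ (X / d))) (fun X => y (rayPoint θ (X / d))) Z := by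
  obtain ⟨p, h1, h2, h3⟩ := h
  have hlt : ∀ X, d * x₀ < X → x₀ < X / d := fun X hX => by rwa [lt_div_iff₀' hd]
  refine ⟨fun X => rayScale θ d * p (rayPoint θ (X / d)), ?_, fun X hX => ?_, fun s t hs ht => ?_⟩
  · exact continuousOn_const.mul (h1.comp (continuous_id.div_const d).continuousOn hlt)
  · have hdiv : HasDerivAt (fun X : ℝ => X / d) (1 / d) X := (hasDerivAt_id X).div_const d
    refine ((h2 (X / d) (hlt X hX)).scomp X hdiv).congr_deriv ?_
    rw [rayScale, Complex.real_smul]; push_cast; ring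
  · have := h3 _ _ (hlt s hs) (hlt t ht)
    rw [← mul_sub, this, ← intervalIntegral.integral_const_mul]
    have hsub := intervalIntegral.integral_comp_div (a := s) (b := t) (c := d) (fun τ : ℝ =>
      rayScale θ d * (-(a (rayPoint θ τ) * p (rayPoint θ τ) + b (rayPoint θ τ) * y (rayPoint θ τ)) *
        Complex.exp ((θ : ℂ) * Complex.I))) hd.ne'
    rw [← inv_smul_eq_iff₀ hd.ne'] at hsub
    rw [← hsub, ← intervalIntegral.integral_smul]
    congr 1
    funext τ
    rw [Complex.real_smul, rayScale]
    push_cast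
    ring

/-- Because `x₀ > 0`, a point of the ray is determined by its absolute value, so `Y (d * ‖x‖)` is a
function on the plane with the required values on the ray. -/
theorem isSolutionOnRay_of_isRealSolution {Y Z : ℝ → ℂ} (hx₀ : 0 < x₀) (hd : 0 < d)
    (h : IsRealSolution (d * x₀) (fun X => rayScale θ d * a (rayPoint θ (X / d)))
      (fun X => rayScale θ d ^ 2 * b (rayPoint θ (X / d))) Y Z) :
    IsSolutionOnRay a b θ x₀ fun x => Y (d * ‖x‖) := by
  have hζ := rayScale_ne_zero (θ := θ) hd
  have hdc : (d : ℂ) ≠ 0 := by exact_mod_cast hd.ne'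
  have hlt : ∀ t, x₀ < t → d * x₀ < d * t := fun t ht => by gcongr
  have hp : ∀ t, x₀ < t → ‖rayPoint θ t‖ = t := fun t ht => norm_rayPoint (hx₀.trans ht)
  refine ⟨fun x => (rayScale θ d)⁻¹ * Z (d * ‖x‖), ?_, fun t ht => ?_, fun s t hs ht => ?_⟩
  · refine ContinuousOn.congr (f := fun t => (rayScale θ d)⁻¹ * Z (d * t)) ?_ fun t ht => by
      simp only [hp t ht]
    exact continuousOn_const.mul (h.cont.comp (continuous_const.mul continuous_id).continuousOn hlt)
  · have hm : HasDerivAt (fun t : ℝ => d * t) d t := by simpa using (hasDerivAt_id t).const_mul d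
    refine (((h.deriv _ (hlt t ht)).scomp t hm).congr_of_eventuallyEq ?_).congr_deriv ?_
    · filter_upwards [lt_mem_nhds ht] with τ hτ
      rw [hp τ hτ]; rfl
    · beta_reduce
      rw [hp t ht, Complex.real_smul, rayScale]
      have := Complex.exp_ne_zero ((θ : ℂ) * Complex.I)
      field_simp
  · beta_reduce
    rw [hp s hs, hp t ht, ← mul_sub, h.integral _ _ (hlt s hs) (hlt t ht),
      ← intervalIntegral.integral_const_mul]
    have hsub := intervalIntegral.integral_comp_mul_left (a := s) (b := t) (c := d) (fun τ : ℝ =>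
      (rayScale θ d)⁻¹ * -(rayScale θ d * a (rayPoint θ (τ / d)) * Z τ +
        rayScale θ d ^ 2 * b (rayPoint θ (τ / d)) * Y τ)) hd.ne'
    rw [eq_inv_smul_iff₀ hd.ne'] at hsub
    rw [← hsub, ← intervalIntegral.integral_smul]
    refine intervalIntegral.integral_congr fun τ hτ => ?_
    have hτ' : x₀ < τ := (lt_min hs ht).trans_le hτ.1
    rw [hp τ hτ', mul_div_cancel_left₀ _ hd.ne', Complex.real_smul]
    have e : Complex.exp ((θ : ℂ) * Complex.I) = d * rayScale θ d := by
      rw [rayScale, mul_div_cancel₀ _ hdc]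
    rw [e]
    field_simp

end Solutions

section Expansion

/-- As `X > 0`, the principal logarithm satisfies `log (X ζ) = log X + log ζ`, and the power splits.
The constants in front of the formal solutions thus change by the factor `ζ^r`. -/
theorem truncation_rayPoint (hd : 0 < d) (l r : ℂ) (s : ℕ → ℂ) (k : ℕ) {X : ℝ} (hX : 0 < X) :
    truncation l r (PowerSeries.rescale (rayScale θ d) (PowerSeries.mk s)) k (rayPoint θ (X / d)) =
      rayScale θ d ^ r * (intFactor (rayScale θ d * l) (-r) X * partialSum s k X) ∧
    ‖rayPoint θ (X / d) ^ r * Complex.exp (l * rayPoint θ (X / d))‖ =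
      ‖rayScale θ d ^ r‖ * ‖intFactor (rayScale θ d * l) (-r) X‖ := by
  have hζ := rayScale_ne_zero (θ := θ) hd
  have hXc : (X : ℂ) ≠ 0 := by exact_mod_cast hX.ne'
  have e : rayPoint θ (X / d) ^ r * Complex.exp (l * rayPoint θ (X / d)) =
      rayScale θ d ^ r * intFactor (rayScale θ d * l) (-r) X := by
    rw [rayPoint_div, Complex.cpow_def_of_ne_zero (mul_ne_zero hXc hζ),
      Complex.cpow_def_of_ne_zero hζ, Complex.log_ofReal_mul hX hζ, intFactor, ← Complex.exp_add,
      ← Complex.exp_add]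
    congr 1; ring
  refine ⟨?_, by rw [e, norm_mul]⟩
  rw [truncation, e, mul_assoc, partialSum]
  congr 2
  refine Finset.sum_congr rfl fun j _ => ?_
  rw [PowerSeries.coeff_rescale, PowerSeries.coeff_mk, rayPoint_div, mul_pow]
  field_simp

/-- After division by `d`, the number `e^{iθ} (l - l')` has modulus one, so it is positive precisely
if it equals `1`. -/
theorem stokesConst_eq (hd : 0 < d) {l l' : ℂ} (hl : ‖l - l'‖ = d) (R : ℂ) :
    stokesConst θ l l' R = stokesBound (rayScale θ d * l - rayScale θ d * l') R := by
  have hdc : (d : ℂ) ≠ 0 := by exact_mod_cast hd.ne'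
  suffices h : (∃ t : ℝ, 0 < t ∧ Complex.exp ((θ : ℂ) * Complex.I) * (l - l') = (t : ℂ)) ↔
      rayScale θ d * l - rayScale θ d * l' = 1 by
    simp only [stokesConst, stokesBound, h]
  rw [← mul_sub, rayScale, div_mul_eq_mul_div, div_eq_one_iff_eq hdc]
  constructor
  · rintro ⟨t, ht, h⟩
    have := congrArg norm h
    rw [norm_mul, Complex.norm_exp_ofReal_mul_I, one_mul, hl, Complex.norm_real,
      Real.norm_of_nonneg ht.le] at this
    rw [h, this]
  · intro h
    exact ⟨d, hd, h⟩

/-- The factors `|Δ|^{-k}` of the weight and `|x|^{-k}` of the estimate combine to `X^{-k}`. -/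
theorem uniformlyAsymptotic_iff (hx₀ : 0 < x₀) (hd : 0 < d) {l₁ l₂ : ℂ} (hl : ‖l₁ - l₂‖ = d)
    (r₁ r₂ : ℂ) (s s' : ℕ → ℂ) (R R' : ℂ) (B : ℝ) (y : ℂ → ℂ) (C₁ C₂ : ℂ) :
    UniformlyAsymptotic (ray θ x₀) y C₁ C₂ l₁ l₂ r₁ r₂
      (PowerSeries.rescale (rayScale θ d) (PowerSeries.mk s))
      (PowerSeries.rescale (rayScale θ d) (PowerSeries.mk s'))
      (weight C₁ (stokesConst θ l₁ l₂ R) B (r₂ - r₁).re (l₂ - l₁))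
      (weight C₂ (stokesConst θ l₂ l₁ R') B (-(r₂ - r₁).re) (l₂ - l₁)) ↔
    UniformExpansion (d * x₀) (rayScale θ d * l₁) (rayScale θ d * l₂) r₁ r₂ s s' R R' B
      (fun X => y (rayPoint θ (X / d))) (C₁ * rayScale θ d ^ r₁) (C₂ * rayScale θ d ^ r₂) := by
  have hl' : ‖l₂ - l₁‖ = d := by rw [norm_sub_rev, hl]
  have hw : ∀ (C z E R ω ν : ℂ) (σ : ℝ) (k : ℕ) (X : ℝ), 0 < X → ν.re = σ →
      ‖z‖ * ‖E‖ * (weight C (stokesBound ω R) B σ (l₂ - l₁) k / (X / d) ^ k) =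
        ‖E‖ * (‖C * z‖ * optimalBound ω ν R B k X) := fun C z E R ω ν σ k X hX hσ => by
    rw [weight, optimalBound, hl', norm_mul, hσ, div_pow]
    field_simp
  rw [UniformlyAsymptotic, UniformExpansion, forall_mem_ray hd]
  refine forall₂_congr fun X hX => forall₂_congr fun k k' => ?_
  have hXp : 0 < X := lt_trans (by positivity) hX
  obtain ⟨e1, e2⟩ := truncation_rayPoint (θ := θ) hd l₁ r₁ s k hXp
  obtain ⟨e3, e4⟩ := truncation_rayPoint (θ := θ) hd l₂ r₂ s' k' hXp
  rw [e1, e2, e3, e4, norm_rayPoint (by positivity), stokesConst_eq hd hl, stokesConst_eq hd hl',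
    hw C₁ _ _ R _ (r₂ - r₁) _ k X hXp rfl, hw C₂ _ _ R' _ (r₁ - r₂) _ k' X hXp (by simp),
    mul_assoc C₁, mul_assoc C₂]

end Expansion

end

/-! ### Characteristic data on the ray. -/

theorem add_eq_neg_and_sq_eq {p q l₁ l₂ : ℂ} (hl₁ : l₁ ^ 2 + p * l₁ + q = 0)
    (hl₂ : l₂ ^ 2 + p * l₂ + q = 0) (hl : l₁ ≠ l₂) :
    l₁ + l₂ = -p ∧ (l₁ - l₂) ^ 2 = p ^ 2 - 4 * q := by
  have h1 : l₁ + l₂ = -p := mul_left_cancel₀ (sub_ne_zero.mpr hl) (by linear_combination hl₁ - hl₂)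
  refine ⟨h1, ?_⟩
  have hp : p = -(l₁ + l₂) := by rw [h1, neg_neg]
  subst hp
  linear_combination 4 * hl₁

/-- The equation on the ray, in the coordinate `X = |l₁ - l₂| |x|`. -/
theorem realProblem_of_ray {θ x₀ : ℝ} (hx₀ : 0 < x₀) {a b : ℂ → ℂ}
    (ha : LocIntegrableOnRay a θ x₀) (hb : LocIntegrableOnRay b θ x₀)
    {ac bc : ℕ → ℂ} {κ : ℝ} (hκ : 0 < κ) (hκ' : κ < (√‖ac 0 ^ 2 - 4 * bc 0‖)⁻¹)
    (haG : HasGevreySeries a ac (ray θ x₀) κ) (hbG : HasGevreySeries b bc (ray θ x₀) κ)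
    {l₁ l₂ : ℂ} (hl₁ : l₁ ^ 2 + ac 0 * l₁ + bc 0 = 0) (hl₂ : l₂ ^ 2 + ac 0 * l₂ + bc 0 = 0)
    (hl : l₁ ≠ l₂) {r₁ r₂ : ℂ} (hr₁ : r₁ = charExponent ac bc l₁)
    (hr₂ : r₂ = charExponent ac bc l₂) {d : ℝ} {ζ : ℂ} (hd : d = ‖l₁ - l₂‖) (hζ : ζ = rayScale θ d) :
    RealProblem (d * x₀) (fun X => ζ * a (rayPoint θ (X / d)))
      (fun X => ζ ^ 2 * b (rayPoint θ (X / d))) (PowerSeries.C ζ * scaledSeries ζ ac)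
      (PowerSeries.C (ζ ^ 2) * scaledSeries ζ bc) (κ * d) (ζ * l₁) (ζ * l₂) r₁ r₂ := by
  obtain ⟨hsum, hsq⟩ := add_eq_neg_and_sq_eq hl₁ hl₂ hl
  have hl0 : l₁ - l₂ ≠ 0 := sub_ne_zero.mpr hl
  have hdp : 0 < d := by rw [hd]; exact norm_pos_iff.mpr hl0
  have hζ0 : ζ ≠ 0 := hζ ▸ rayScale_ne_zero hdp
  have hn1 : ‖ζ‖ = d⁻¹ := hζ ▸ norm_rayScale hdp
  have h0 : ∀ z c, PowerSeries.coeff 0 (PowerSeries.C z * scaledSeries ζ c) = z * c 0 := fun z c => by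
    rw [PowerSeries.coeff_C_mul, coeff_scaledSeries, pow_zero, div_one]
  have h1 : ∀ z c, PowerSeries.coeff 1 (PowerSeries.C z * scaledSeries ζ c) = z * (c 1 / ζ) :=
    fun z c => by rw [PowerSeries.coeff_C_mul, coeff_scaledSeries, pow_one]
  have hr : ∀ l l' r, r = charExponent ac bc l → l ≠ l' → l + l' = -ac 0 →
      (l - l') * r = -(ac 1 * l + bc 1) := fun l l' r hr hne hs => by
    have : ac 0 + 2 * l = l - l' := by linear_combination hs
    rw [hr, charExponent, this, mul_div_cancel₀ _ (sub_ne_zero.mpr hne)]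
  have e1 := hr l₁ l₂ r₁ hr₁ hl hsum
  have e2 := hr l₂ l₁ r₂ hr₂ hl.symm (by rw [add_comm]; exact hsum)
  refine ⟨by positivity, by positivity, ?_, ?_, ?_, ?_, ?_, ?_, ?_, ?_, ?_, ?_⟩
  -- The discriminant is the square of `l₁ - l₂`, so the hypothesis on `κ` says that `κ d < 1`.
  · rw [← hsq, norm_pow, Real.sqrt_sq (norm_nonneg _), ← hd] at hκ'
    rwa [← one_div, lt_div_iff₀ hdp] at hκ'
  · exact aestronglyMeasurable_const.mul (aestronglyMeasurable_comp_div hdp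
      (LocallyIntegrableOn.aestronglyMeasurable ha))
  · exact aestronglyMeasurable_const.mul (aestronglyMeasurable_comp_div hdp
      (LocallyIntegrableOn.aestronglyMeasurable hb))
  · have := (gevreyOn_scaledSeries hx₀ hdp haG).const_mul ζ
    rwa [← hζ] at this
  · have := (gevreyOn_scaledSeries hx₀ hdp hbG).const_mul (ζ ^ 2)
    rwa [← hζ] at this
  · rw [← mul_sub, norm_mul, hn1, ← hd, inv_mul_cancel₀ hdp.ne']
  · rw [h0]; linear_combination ζ * hsum
  · rw [h0, h0]; linear_combination ζ ^ 2 * hl₂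
  · rw [h1, h1]; field_simp; linear_combination e1
  · rw [h1, h1]; field_simp; linear_combination e2

end OptimalAsymptotics

end

/-! ### The correspondence between formal and true solutions. -/

open OptimalAsymptotics in
theorem mainTheorem1 (θ x₀ : ℝ) (hx₀ : 0 < x₀) (a b : ℂ → ℂ)
    (ha : LocIntegrableOnRay a θ x₀) (hb : LocIntegrableOnRay b θ x₀)
    (ac bc : ℕ → ℂ) (κ : ℝ) (hκ : 0 < κ) (hκ' : κ < (√‖ac 0 ^ 2 - 4 * bc 0‖)⁻¹)
    (haG : HasGevreySeries a ac (ray θ x₀) κ) (hbG : HasGevreySeries b bc (ray θ x₀) κ)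
    (l₁ l₂ : ℂ) (hl₁ : l₁ ^ 2 + ac 0 * l₁ + bc 0 = 0) (hl₂ : l₂ ^ 2 + ac 0 * l₂ + bc 0 = 0)
    (hl : l₁ ≠ l₂)
    (r₁ r₂ : ℂ) (hr₁ : r₁ = charExponent ac bc l₁) (hr₂ : r₂ = charExponent ac bc l₂) :
    ∃ S₁ S₂ : PowerSeries ℂ,
      -- the normalized formal series, and the general formal solution
      (PowerSeries.coeff 0 S₁ = 1 ∧
        ∀ F : PowerSeries ℂ, IsFormalSolution ac bc l₁ r₁ F ↔ ∃ C : ℂ, F = C • S₁) ∧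
      (PowerSeries.coeff 0 S₂ = 1 ∧
        ∀ F : PowerSeries ℂ, IsFormalSolution ac bc l₂ r₂ F ↔ ∃ C : ℂ, F = C • S₂) ∧
      ∃ R₁ R₂ : ℂ,
        -- the leading constants in the large order behavior of the coefficients
        Tendsto (fun n : ℕ => PowerSeries.coeff n S₁ /
          (Complex.Gamma ((n : ℂ) + r₂ - r₁) / (l₁ - l₂) ^ n)) atTop (𝓝 R₁) ∧
        Tendsto (fun n : ℕ => PowerSeries.coeff n S₂ /
          (Complex.Gamma ((n : ℂ) + r₁ - r₂) / (l₂ - l₁) ^ n)) atTop (𝓝 R₂) ∧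
        ∃ B₀ : ℝ, 0 < B₀ ∧ ∀ B : ℝ, B₀ ≤ B →
          -- each formal solution is represented by exactly one true solution
          (∀ C₁ C₂ : ℂ,
            (∃ y : ℂ → ℂ, IsSolutionOnRay a b θ x₀ y ∧
              UniformlyAsymptotic (ray θ x₀) y C₁ C₂ l₁ l₂ r₁ r₂ S₁ S₂
                (weight C₁ (stokesConst θ l₁ l₂ R₁) B (r₂ - r₁).re (l₂ - l₁))
                (weight C₂ (stokesConst θ l₂ l₁ R₂) B (-(r₂ - r₁).re) (l₂ - l₁))) ∧
            ∀ y z : ℂ → ℂ,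
              IsSolutionOnRay a b θ x₀ y →
              UniformlyAsymptotic (ray θ x₀) y C₁ C₂ l₁ l₂ r₁ r₂ S₁ S₂
                (weight C₁ (stokesConst θ l₁ l₂ R₁) B (r₂ - r₁).re (l₂ - l₁))
                (weight C₂ (stokesConst θ l₂ l₁ R₂) B (-(r₂ - r₁).re) (l₂ - l₁)) →
              IsSolutionOnRay a b θ x₀ z →
              UniformlyAsymptotic (ray θ x₀) z C₁ C₂ l₁ l₂ r₁ r₂ S₁ S₂
                (weight C₁ (stokesConst θ l₁ l₂ R₁) B (r₂ - r₁).re (l₂ - l₁))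
                (weight C₂ (stokesConst θ l₂ l₁ R₂) B (-(r₂ - r₁).re) (l₂ - l₁)) →
              Set.EqOn y z (ray θ x₀)) ∧
          -- each true solution represents exactly one formal solution
          (∀ y : ℂ → ℂ, IsSolutionOnRay a b θ x₀ y →
            ∃! C : ℂ × ℂ,
              UniformlyAsymptotic (ray θ x₀) y C.1 C.2 l₁ l₂ r₁ r₂ S₁ S₂
                (weight C.1 (stokesConst θ l₁ l₂ R₁) B (r₂ - r₁).re (l₂ - l₁))
                (weight C.2 (stokesConst θ l₂ l₁ R₂) B (-(r₂ - r₁).re) (l₂ - l₁))) := by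
  set d : ℝ := ‖l₁ - l₂‖ with hd
  have hl0 : l₁ - l₂ ≠ 0 := sub_ne_zero.mpr hl
  have hdp : 0 < d := norm_pos_iff.mpr hl0
  set ζ : ℂ := rayScale θ d with hζd
  have hζ : ζ ≠ 0 := rayScale_ne_zero hdp
  have hr : ∀ r : ℂ, ζ ^ r ≠ 0 := fun r => by simp [Complex.cpow_eq_zero_iff, hζ]
  have hP := realProblem_of_ray hx₀ ha hb hκ hκ' haG hbG hl₁ hl₂ hl hr₁ hr₂ hd hζd
  obtain ⟨D, hα, hβ⟩ := hP.exists_bound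
  obtain ⟨s, s', R, R', Y₁, Z₁, Y₂, Z₂, B₀, ⟨hs0, hs⟩, ⟨hs0', hs'⟩, hR, hR', hY₁, hY₂, hB₀, hiff,
    hsol⟩ := hP.exists_fundamentalSystem
  have hUA := fun B y C₁ C₂ => uniformlyAsymptotic_iff (θ := θ) hx₀ hdp hd.symm r₁ r₂ s s' R R' B y C₁ C₂
  have hlim : ∀ (s : ℕ → ℂ) (l l' r r' R : ℂ),
      Tendsto (fun n : ℕ => s n * (ζ * l - ζ * l') ^ n / Complex.Gamma (n + (r' - r))) atTop (𝓝 R) →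
      Tendsto (fun n : ℕ => PowerSeries.coeff n (PowerSeries.rescale ζ (PowerSeries.mk s)) /
        (Complex.Gamma ((n : ℂ) + r' - r) / (l - l') ^ n)) atTop (𝓝 R) := fun s l l' r r' R h =>
    h.congr fun n => by
      rw [PowerSeries.coeff_rescale, PowerSeries.coeff_mk, ← mul_sub, mul_pow, div_div_eq_mul_div,
        add_sub_assoc]
      ring
  refine ⟨PowerSeries.rescale ζ (PowerSeries.mk s), PowerSeries.rescale ζ (PowerSeries.mk s'),
    ⟨by simp [hs0], fun F => ?_⟩, ⟨by simp [hs0'], fun F => ?_⟩, R, R', hlim _ _ _ _ _ _ hR,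
    hlim _ _ _ _ _ _ hR', B₀, hB₀, fun B hB => ⟨fun C₁ C₂ => ⟨?_, fun y z hy hyU hz hzU => ?_⟩,
    fun y hy => ?_⟩⟩
  · rw [← isFormalSolution_rescale hζ, hs]
    exact exists_congr fun c => rescale_eq_smul_iff hζ s F c
  · rw [← isFormalSolution_rescale hζ, hs']
    exact exists_congr fun c => rescale_eq_smul_iff hζ s' F c
  -- The true solution takes the coefficients `C_i ζ^{r_i}` because the formal solutions in `x` and
  -- in `X` differ by the factors `ζ^{r_i}`.
  · have hY := hY₁.linearCombination hP.α_meas hP.β_meas hα hβ hY₂ (C₁ * ζ ^ r₁) (C₂ * ζ ^ r₂)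
    refine ⟨_, isSolutionOnRay_of_isRealSolution hx₀ hdp hY, (hUA B _ C₁ C₂).mpr
      (((hiff B hB _ _ _ _).mpr ⟨rfl, rfl⟩).congr fun X hX => ?_)⟩
    have hX0 : 0 < X := lt_trans (by positivity) hX
    rw [norm_rayPoint (by positivity), mul_div_cancel₀ _ hdp.ne']
  · have key : ∀ y : ℂ → ℂ, IsSolutionOnRay a b θ x₀ y → UniformlyAsymptotic (ray θ x₀) y C₁ C₂ l₁ l₂
        r₁ r₂ (PowerSeries.rescale ζ (PowerSeries.mk s)) (PowerSeries.rescale ζ (PowerSeries.mk s'))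
        (weight C₁ (stokesConst θ l₁ l₂ R) B (r₂ - r₁).re (l₂ - l₁))
        (weight C₂ (stokesConst θ l₂ l₁ R') B (-(r₂ - r₁).re) (l₂ - l₁)) → ∀ X, d * x₀ < X →
        y (rayPoint θ (X / d)) = C₁ * ζ ^ r₁ * Y₁ X + C₂ * ζ ^ r₂ * Y₂ X := fun y hy hyU X hX => by
      obtain ⟨Z, hZ⟩ := hy.exists_isRealSolution hdp
      obtain ⟨c, c', hc⟩ := hsol _ Z hZ
      obtain ⟨rfl, rfl⟩ := (hiff B hB _ _ _ _).mp (((hUA B y C₁ C₂).mp hyU).congr hc)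
      exact hc X hX
    refine (forall_mem_ray hdp).mpr fun X hX => ?_
    rw [key y hy hyU X hX, key z hz hzU X hX]
  · obtain ⟨Z, hZ⟩ := hy.exists_isRealSolution hdp
    obtain ⟨c, c', hc⟩ := hsol _ Z hZ
    refine ⟨(c / ζ ^ r₁, c' / ζ ^ r₂), (hUA B y _ _).mpr ?_, fun C hC => ?_⟩
    · refine UniformExpansion.congr ((hiff B hB c c' _ _).mpr
        ⟨(div_mul_cancel₀ c (hr r₁)).symm, (div_mul_cancel₀ c' (hr r₂)).symm⟩) fun X hX => (hc X hX).symm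
    · obtain ⟨h1, h2⟩ := (hiff B hB c c' _ _).mp (((hUA B y _ _).mp hC).congr hc)
      rw [h1, h2, mul_div_cancel_right₀ _ (hr r₁), mul_div_cancel_right₀ _ (hr r₂)]
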